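/- **Setting.** Let $u=\{u_i\mid i\in\omega\}$ be a countable transitive set with $0,1\in u$ and a fixed enumeration, let $\mathbb L_\gamma=\mathbb L^u_\gamma$ be the constructible hierarchy with $\mathbb L_0=u$, and for $a\in\bigcup_\gamma\mathbb L_\gamma$ put $|a|=\min\{\gamma\mid a\in\mathbb L_{\gamma+1}\}$. Fix compatible well-orderings of the stages $\mathbb L_\gamma$ and an enumeration $\langle\theta_k\rangle_{k\in\omega}$ of the axioms of Kripke–Platek set theory with infinity and without foundation, where $\Delta_0$-separation and $\Delta_0$-collection have at most $C_0$ parameters and the $\Delta_0$-formula in a collection axiom is a disjunction. Formulas are in negation normal form with sets as parameters; an $\mathbb L_\gamma$-formula is a closed formula with parameters in $\mathbb L_\gamma$. The *search tree* $S_\gamma$ consists of finite sequences from $\mathbb L_\gamma$ and is labelled by sequents (finite sequences of formulas), the root by the empty sequent. A node of length $2k$ has one successor, $0$, at which $\neg\theta_k$ is appended. A node of odd length is a leaf if its sequent contains a true $\Delta_0$-formula; otherwise, if its sequent consists of (negated) prime formulas, it is repeated at the only successor $0$; otherwise the first formula that is not (negated) prime is moved to the end and decomposed: $\psi_0\wedge\psi_1$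 has successors $i\in\{0,1\}$, where $\psi_i$ is appended; $\psi_0\vee\psi_1$ has the successor $0$, where $\psi_0$ is appended if it does not occur yet, and $\psi_1$ otherwise; $\forall_x\psi$ has successors $a\in\mathbb L_\gamma$, where $\psi(a)$ is appended; $\exists_x\psi$ has the successor $0$, where $\psi(b)$ is appended for the first $b$ in the list $u_0,\sigma_0,\dots,u_{n-1},\sigma_{n-1},u_n,u_{n+1},\dots$ such that $\psi(b)$ does not occur yet ($\sigma=\langle\sigma_0,\dots,\sigma_{n-1}\rangle$ being the node; $b=u_0$ if there is no such $b$). $S_\gamma$ carries the Kleene–Brouwer ordering, and $|\sigma|$ is the maximum of $0$ and the ranks of the entries of $\sigma$. The ordered set of terms $\varepsilon(S_{\omega^\alpha})$ consists of $0$, the symbols $\varepsilon_\sigma$ for $\sigma\in S_{\omega^\alpha}$ (ordered like the $\sigma$, behaving like $\varepsilon$-numbers above $\Omega$), and the Cantor-style normal forms $\Omega^{s_0}\cdot\beta_0+\dots+\Omega^{s_n}\cdot\beta_n$ with terms $s_0>\dots>s_n$ and $0<\beta_i<\omega^\alpha$ (excluding $\Omega^{\varepsilon_\sigma}\cdot1$),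 compared lexicographically, with the usual operations $s+t$ and $\Omega^s$. Ordinals $\beta<\omega^\alpha$ are identified with the terms $0$, $\Omega^0\cdot\beta$, i.e. with the terms below $\Omega=\Omega^1\cdot1$, and $s^*=\min\{\gamma\mid s\in\varepsilon(S_{\omega^{\gamma+1}})\}$. A *Bachmann–Howard collapse* $\vartheta:\varepsilon(S_{\omega^\alpha})\Rightarrow\alpha$ is a function $\vartheta:\varepsilon(S_{\omega^\alpha})\to\alpha$ such that $s^*<\vartheta(s)$ for all $s$, and $\vartheta(s)<\vartheta(t)$ whenever $s<t$ and $s^*<\vartheta(t)$. For $\Omega\le t$ and $X\subseteq\omega^\alpha$ let $\mathcal H_t[X]$ be the least set $C\supseteq X\cup\{0\}$ of terms such that $s\in C$ whenever $s^*\in C$; $\vartheta(s)\in C$ whenever $s\in C$ and $s<t+1$; and $s\in C$ whenever $s<s'$ for some $s'\in C$ with $s'<\Omega$. Put $\mathcal H_t=\mathcal H_t[\emptyset]$. *Rules* are $\mathrm{Ax}$, $(\wedge,\psi_0,\psi_1)$, $(\vee_i,\psi_0,\psi_1)$, $(\forall_x,\psi)$, $(\exists_x,b,\psi)$, $(\mathrm{Cut},\psi)$,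 $(\mathrm{Ref},\exists_z\forall_{x\in a}\exists_{y\in z}\theta)$ ($\theta$ a bounded disjunction without free $z$) and $(\mathrm{Rep},b)$, with index sets $\iota(r)$ of premises, respectively, $\emptyset$, $\{0,1\}$, $\{0\}$, $\mathbb L_{\omega^\alpha}$, $\{0\}$, $\{0,1\}$, $\{0\}$, $\{b\}$. $\mathbf L_{\omega^\alpha}$-*codes* $P$ are terms denoting infinitary derivations; each has an end-sequent $l(P)$ (a finite set of $\mathbb L_{\omega^\alpha}$-formulas), a last rule $r(P)$, a height $o(P)\in\varepsilon(S_{\omega^\alpha})$, subcodes $n(P,a)$ for $a\in\mathbb L_{\omega^\alpha}$, a cut rank $d(P)\in\omega$, and a controlling operator given by $\Omega\le h_0(P)\in\varepsilon(S_{\omega^\alpha})$ and $h_1(P)<\omega^\alpha$. They are built from the basic codes $P\sigma$ (the subderivation at $\sigma$ of the derivation of the empty sequent that arises from $S_{\omega^\alpha}$ when the nodes of length $2k$ become cuts over $\neg\theta_k$ and cut-free derivations of $\theta_k$ are attached; nodes $\sigma\in S_{\omega^\alpha}$ have height $\varepsilon_\sigma$; $d(P\sigma)=C_0+6$, $h_0(P\sigma)=\Omega$,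 $h_1(P\sigma)=|\sigma|$) by the operators for inversion ($\mathcal I_{\forall_x\psi,b}$, $\mathcal I_{\psi_0\wedge\psi_1,i}$), cut reduction ($\mathcal R_{\exists_x\psi}$, $\mathcal R_{\psi_0\vee\psi_1}$ for formulas of height $>1$), cut elimination ($\mathcal E$), derivations of true $\Delta_0$-formulas, introduction of $\wedge$ and of $\vee$, and boundedness ($\mathcal B^\beta_{\exists,\varphi}$ for $\Sigma$-formulas $\varphi$ and $\mathcal B^\beta_{\forall,\psi}$ for unbounded $\Pi_1$-formulas $\psi$, $\beta<\omega^\alpha$), with their standard recursive clauses for $l,r,o,n,d,h_0,h_1$. A system of codes is *locally correct* if every code $P$ satisfies: * (L): if $r(P)=\mathrm{Ax}$ then $l(P)$ contains a true $\Delta_0$-formula. For every other rule the formula introduced by the rule (if any) is in $l(P)$, and for $a\in\iota(r(P))$ the set $l(n(P,a))$ is contained in $l(P)$ together with the corresponding premise formula of the rule, and $o(n(P,a))<o(P)$; for $(\forall_x,\psi)$ and $(\exists_x,b,\psi)$ even $o(n(P,a))+\omega\le o(P)$; for $(\exists_x,b,\psi)$ also $|b|<o(P)$; for reflection also $\Omega\le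 o(P)$. * (C1), (C2): if $r(P)=(\mathrm{Cut},\varphi)$ then $\mathrm{ht}(\varphi)<d(P)$; and $d(n(P,a))\le d(P)$ for $a\in\iota(r(P))$. Here $\mathrm{ht}$ counts logical symbols above $\Delta_0$-formulas. * (H1)–(H3): $\max\{o(P)^*,k(l(P)),k(r(P))\}\in\mathcal H_{h_0(P)}[h_1(P)]$, where $k(l(P))$ is the maximal rank of the parameters in $l(P)$, and $k(r(P))$ is $|b|$ for $(\exists_x,b,\psi)$ and $(\mathrm{Rep},b)$, the maximal rank of the parameters of $\psi$ for $(\mathrm{Cut},\psi)$, and $0$ otherwise; and for $a\in\iota(r(P))$ we have $h_0(n(P,a))\le h_0(P)$ and $\{h_1(n(P,a)),o(n(P,a))\}\subseteq\mathcal H_{h_0(P)}[h_1(P),|a|]$. **Theorem.** Assume $\vartheta:\varepsilon(S_{\omega^\alpha})\Rightarrow\alpha$ is a Bachmann–Howard collapse. Then the system of $\mathbf L_{\omega^\alpha}$-codes can be extended by a unary function symbol $\mathcal C_t$ for each $t\in\varepsilon(S_{\omega^\alpha})$ with $\Omega\le t$ (that is, $l,r,o,n,d,h_0,h_1$ can be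 given values on the codes $\mathcal C_tP$, keeping the recursive clauses of all other operators) in such a way that the extended system is locally correct and that $$l(\mathcal C_tP)=l(P),\quad o(\mathcal C_tP)=\vartheta(t+\Omega^{o(P)})<\Omega,\quad d(\mathcal C_tP)=1,\quad \langle h_0(\mathcal C_tP),h_1(\mathcal C_tP)\rangle=\langle t+\Omega^{o(P)},0\rangle$$ holds for every code $P$ of the extended system that satisfies (i) $l(P)$ contains only $\Sigma$-formulas (no unbounded universal quantifier) and $d(P)\le 2$, and (ii) $h_0(P)\le t$ and $\{t,h_1(P)\}\subseteq\mathcal H_t$. -/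

import Mathlib

namespace Collapsing

universe v

/-! ## Set-theoretic formulas in negation normal form, with sets as parameters -/

/-- Terms of the object language: parameters (arbitrary sets) and variables. -/
inductive Trm : Type (v + 1)
  | par (a : ZFSet.{v})
  | var (n : ℕ)

/-- Formulas in negation normal form, with relation symbols for membership and equality. -/
inductive Fml : Type (v + 1)
  | mem (s t : Trm.{v})
  | nmem (s t : Trm.{v})
  | eq (s t : Trm.{v})
  | neq (s t : Trm.{v})
  | and (φ ψ : Fml)
  | or (φ ψ : Fml)
  | all (x : ℕ) (φ : Fml)
  | ex (x : ℕ) (φ : Fml)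

noncomputable instance : DecidableEq Fml.{v} := Classical.decEq _

/-- Substitution of the parameter `a` for the variable `x`. -/
def Trm.subst (x : ℕ) (a : ZFSet.{v}) : Trm.{v} → Trm.{v}
  | .par b => .par b
  | .var n => if n = x then .par a else .var n

def Trm.fv : Trm.{v} → Finset ℕ
  | .par _ => ∅
  | .var n => {n}

/-- The set of parameters. -/
def Trm.pars : Trm.{v} → Set ZFSet.{v}
  | .par a => {a}
  | .var _ => ∅

def Trm.val (e : ℕ → ZFSet.{v}) : Trm.{v} → ZFSet.{v}
  | .par a => a
  | .var n => e n

namespace Fml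

/-- Negation, pushed down to prime formulas. -/
def neg : Fml.{v} → Fml.{v}
  | mem s t => nmem s t
  | nmem s t => mem s t
  | eq s t => neq s t
  | neq s t => eq s t
  | and φ ψ => or φ.neg ψ.neg
  | or φ ψ => and φ.neg ψ.neg
  | all x φ => ex x φ.neg
  | ex x φ => all x φ.neg

/-- `φ.subst x a` replaces the free occurrences of the variable `x` in `φ` by the parameter `a`. -/
def subst (x : ℕ) (a : ZFSet.{v}) : Fml.{v} → Fml.{v}
  | mem s t => mem (s.subst x a) (t.subst x a)
  | nmem s t => nmem (s.subst x a) (t.subst x a)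
  | eq s t => eq (s.subst x a) (t.subst x a)
  | neq s t => neq (s.subst x a) (t.subst x a)
  | and φ ψ => and (φ.subst x a) (ψ.subst x a)
  | or φ ψ => or (φ.subst x a) (ψ.subst x a)
  | all y φ => if y = x then all y φ else all y (φ.subst x a)
  | ex y φ => if y = x then ex y φ else ex y (φ.subst x a)

/-- Free variables. -/
def fv : Fml.{v} → Finset ℕ
  | mem s t => s.fv ∪ t.fv
  | nmem s t => s.fv ∪ t.fv
  | eq s t => s.fv ∪ t.fv
  | neq s t => s.fv ∪ t.fv
  | and φ ψ => φ.fv ∪ ψ.fv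
  | or φ ψ => φ.fv ∪ ψ.fv
  | all x φ => φ.fv.erase x
  | ex x φ => φ.fv.erase x

/-- The set of parameters. -/
def pars : Fml.{v} → Set ZFSet.{v}
  | mem s t => s.pars ∪ t.pars
  | nmem s t => s.pars ∪ t.pars
  | eq s t => s.pars ∪ t.pars
  | neq s t => s.pars ∪ t.pars
  | and φ ψ => φ.pars ∪ ψ.pars
  | or φ ψ => φ.pars ∪ ψ.pars
  | all _ φ => φ.pars
  | ex _ φ => φ.pars

/-- Satisfaction in the structure `(M, ∈)` under the assignment `e`. -/
def Sat (M : Set ZFSet.{v}) : Fml.{v} → (ℕ → ZFSet.{v}) → Prop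
  | mem s t, e => s.val e ∈ t.val e
  | nmem s t, e => s.val e ∉ t.val e
  | eq s t, e => s.val e = t.val e
  | neq s t, e => s.val e ≠ t.val e
  | and φ ψ, e => φ.Sat M e ∧ ψ.Sat M e
  | or φ ψ, e => φ.Sat M e ∨ ψ.Sat M e
  | all x φ, e => ∀ a ∈ M, φ.Sat M (Function.update e x a)
  | ex x φ, e => ∃ a ∈ M, φ.Sat M (Function.update e x a)

/-- The quantifier in `∀ x, φ` is bounded, i.e. `φ` is `x ∉ t ∨ ψ` and `t` is not `x`. -/
def BddAll (x : ℕ) (φ : Fml.{v}) : Prop :=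
  ∃ (t : Trm.{v}) (ψ : Fml.{v}), t ≠ .var x ∧ φ = or (nmem (.var x) t) ψ

/-- The quantifier in `∃ x, φ` is bounded, i.e. `φ` is `x ∈ t ∧ ψ` and `t` is not `x`. -/
def BddEx (x : ℕ) (φ : Fml.{v}) : Prop :=
  ∃ (t : Trm.{v}) (ψ : Fml.{v}), t ≠ .var x ∧ φ = and (mem (.var x) t) ψ

/-- `Δ₀`-formulas: all quantifiers are bounded. -/
def IsD0 : Fml.{v} → Prop
  | and φ ψ => φ.IsD0 ∧ ψ.IsD0
  | or φ ψ => φ.IsD0 ∧ ψ.IsD0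
  | all x φ => BddAll x φ ∧ φ.IsD0
  | ex x φ => BddEx x φ ∧ φ.IsD0
  | _ => True

/-- `Σ`-formulas: no unbounded universal quantifier. -/
def IsSigma : Fml.{v} → Prop
  | and φ ψ => φ.IsSigma ∧ ψ.IsSigma
  | or φ ψ => φ.IsSigma ∧ ψ.IsSigma
  | all x φ => BddAll x φ ∧ φ.IsSigma
  | ex _ φ => φ.IsSigma
  | _ => True

/-- Prime formulas and negated prime formulas. -/
def IsPrime : Fml.{v} → Prop
  | and _ _ => False
  | or _ _ => False
  | all _ _ => False
  | ex _ _ => False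
  | _ => True

/-- A true (closed) `Δ₀`-formula. -/
def TrueD0 (φ : Fml.{v}) : Prop :=
  φ.IsD0 ∧ φ.fv = ∅ ∧ φ.Sat Set.univ (fun _ => ∅)

open Classical in
/-- The height of a formula; it counts the logical symbols above `Δ₀`-formulas. -/
noncomputable def ht : Fml.{v} → ℕ
  | and φ ψ => if (and φ ψ).IsD0 then 0 else max φ.ht ψ.ht + 1
  | or φ ψ => if (or φ ψ).IsD0 then 0 else max φ.ht ψ.ht + 1
  | all x φ => if (all x φ).IsD0 then 0 else φ.ht + 1
  | ex x φ => if (ex x φ).IsD0 then 0 else φ.ht + 1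
  | _ => 0

open Classical in
/-- Restriction of all unbounded quantifiers to the set `c`. -/
noncomputable def rel (c : ZFSet.{v}) : Fml.{v} → Fml.{v}
  | and φ ψ => and (φ.rel c) (ψ.rel c)
  | or φ ψ => or (φ.rel c) (ψ.rel c)
  | all x φ =>
      if BddAll x φ then all x (φ.rel c) else all x (or (nmem (.var x) (.par c)) (φ.rel c))
  | ex x φ =>
      if BddEx x φ then ex x (φ.rel c) else ex x (and (mem (.var x) (.par c)) (φ.rel c))
  | φ => φ

/-- Implication, as an abbreviation. -/
def imp (φ ψ : Fml.{v}) : Fml.{v} := or φ.neg ψ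

/-- The bounded quantifier `∀ x ∈ t, φ`. -/
def ball (x : ℕ) (t : Trm.{v}) (φ : Fml.{v}) : Fml.{v} := all x (or (nmem (.var x) t) φ)

/-- The bounded quantifier `∃ x ∈ t, φ`. -/
def bex (x : ℕ) (t : Trm.{v}) (φ : Fml.{v}) : Fml.{v} := ex x (and (mem (.var x) t) φ)

def IsOr (φ : Fml.{v}) : Prop := ∃ ψ₀ ψ₁, φ = or ψ₀ ψ₁

/-- `allFrom j n φ` is `∀ j, ∀ (j+1), …, ∀ (j+n-1), φ`. -/
def allFrom : ℕ → ℕ → Fml.{v} → Fml.{v}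
  | _, 0, φ => φ
  | j, n + 1, φ => all j (allFrom (j + 1) n φ)

/-- `inst j [c₀, c₁, …] φ` substitutes `c₀` for `j`, then `c₁` for `j+1`, and so on. -/
def inst : ℕ → List ZFSet.{v} → Fml.{v} → Fml.{v}
  | _, [], φ => φ
  | j, a :: c, φ => inst (j + 1) c (φ.subst j a)

end Fml

/-! ## Axioms of Kripke-Platek set theory with infinity, without foundation -/

/-- Names for the axioms; the instances of separation and collection carry the number `k` of
additional parameters and the formula `θ`. -/
inductive KPAx : Type (v + 1)
  | equality
  | extensionality
  | pairing
  | union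
  | infinity
  | separation (k : ℕ) (θ : Fml.{v})
  | collection (k : ℕ) (θ : Fml.{v})

namespace KPAx

open Fml

/-- The number of leading universal quantifiers. -/
def m : KPAx.{v} → ℕ
  | equality => 4
  | extensionality => 2
  | pairing => 2
  | union => 1
  | infinity => 0
  | separation k _ => k + 1
  | collection k _ => k + 1

/-- The variable `0` is a limit ordinal: non-empty, transitive, with transitive elements,
and without maximal element. -/
def limitOrd : Fml.{v} :=
  and (bex 1 (.var 0) (eq (.var 1) (.var 1)))
    (and (ball 1 (.var 0) (ball 2 (.var 1) (mem (.var 2) (.var 0))))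
      (and (ball 1 (.var 0) (ball 2 (.var 1) (ball 3 (.var 2) (mem (.var 3) (.var 1)))))
        (ball 1 (.var 0) (bex 2 (.var 0) (mem (.var 1) (.var 2))))))

/-- Antecedent of collection: `∀ y ∈ x, ∃ z, θ` with `x = k`, `y = k+1`, `z = k+2`; here the
bound `x` may be a variable or a parameter. -/
def collHyp (k : ℕ) (x : Trm.{v}) (θ : Fml.{v}) : Fml.{v} := ball (k + 1) x (ex (k + 2) θ)

/-- Succedent of collection: `∃ w, ∀ y ∈ x, ∃ z ∈ w, θ` with `w = k+3`. -/
def collConcl (k : ℕ) (x : Trm.{v}) (θ : Fml.{v}) : Fml.{v} :=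
  ex (k + 3) (ball (k + 1) x (bex (k + 2) (.var (k + 3)) θ))

/-- The formula below the leading universal quantifiers, which bind the variables `0, …, m-1`. -/
def matrix : KPAx.{v} → Fml.{v}
  | equality =>
      imp (and (and (eq (.var 0) (.var 1)) (eq (.var 2) (.var 3))) (mem (.var 0) (.var 2)))
        (mem (.var 1) (.var 3))
  | extensionality =>
      imp (and (ball 2 (.var 0) (mem (.var 2) (.var 1))) (ball 2 (.var 1) (mem (.var 2) (.var 0))))
        (eq (.var 0) (.var 1))
  | pairing => ex 2 (and (mem (.var 0) (.var 2)) (mem (.var 1) (.var 2)))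
  | union => ex 1 (ball 2 (.var 0) (ball 3 (.var 2) (mem (.var 3) (.var 1))))
  | infinity => ex 0 limitOrd
  | separation k θ =>
      ex (k + 2) (and
        (ball (k + 1) (.var k) (imp θ (mem (.var (k + 1)) (.var (k + 2)))))
        (ball (k + 1) (.var (k + 2)) (and (mem (.var (k + 1)) (.var k)) θ)))
  | collection k θ => imp (collHyp k (.var k) θ) (collConcl k (.var k) θ)

/-- The axiom as a sentence. -/
def formula (A : KPAx.{v}) : Fml.{v} := allFrom 0 A.m A.matrix

/-- The admitted instances: at most `C` additional parameters, and `θ` is a `Δ₀`-formula without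
set parameters in the appropriate variables; in collection `θ` is a disjunction. -/
def Valid (C : ℕ) : KPAx.{v} → Prop
  | separation k θ => k ≤ C ∧ θ.IsD0 ∧ θ.pars = ∅ ∧ θ.fv ⊆ Finset.range (k + 2)
  | collection k θ => k ≤ C ∧ θ.IsD0 ∧ θ.pars = ∅ ∧ θ.fv ⊆ Finset.range (k + 3) ∧ θ.IsOr
  | _ => True

end KPAx

/-! ## The constructible hierarchy over a transitive set -/

/-- The set of subsets of `X` that are first-order definable over `(X, ∈)` with parameters. -/
noncomputable def defSets (X : ZFSet.{v}) : ZFSet.{v} :=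
  ZFSet.sep (fun y => ∃ φ : Fml.{v}, φ.pars ⊆ {a | a ∈ X} ∧ φ.fv ⊆ {0} ∧
    y = ZFSet.sep (fun z => φ.Sat {a | a ∈ X} (fun _ => z)) X) (ZFSet.powerset X)

/-- The stages of the constructible hierarchy over `u`. -/
noncomputable def stage (u : ZFSet.{v}) (γ : Ordinal.{v}) : ZFSet.{v} :=
  Ordinal.limitRecOn γ u (fun _ X => defSets X)
    (fun γ _ f => ZFSet.iUnion (fun β : Set.Iio γ => f β.1 β.2))

/-- The fixed data: a countable transitive set `u` containing `0` and `1`, with an enumeration; a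
compatible family of well-orderings of the stages of the constructible hierarchy over `u`; an
enumeration of the axioms of Kripke-Platek set theory, with a bound on the number of parameters
in separation and collection. -/
structure Base where
  u : ZFSet.{v}
  enum : ℕ → ZFSet.{v}
  mem_u_iff : ∀ x, x ∈ u ↔ ∃ i, enum i = x
  trans_u : u.IsTransitive
  zero_mem : ∅ ∈ u
  one_mem : {∅} ∈ u
  lt : ZFSet.{v} → ZFSet.{v} → Prop
  lt_wo : ∀ γ : Ordinal.{v}, IsWellOrder {a : ZFSet.{v} // a ∈ stage u γ} (fun a b => lt a.1 b.1)
  C₀ : ℕ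
  kp : ℕ → KPAx.{v}
  kp_iff : ∀ A : KPAx.{v}, A.Valid C₀ ↔ ∃ k, kp k = A

namespace Base

variable (B : Base.{v})

/-- The stage `L γ` of the constructible hierarchy over `u`. -/
noncomputable def L (γ : Ordinal.{v}) : ZFSet.{v} := stage B.u γ

/-- The rank `|a|` of a constructible set. -/
noncomputable def rk (a : ZFSet.{v}) : Ordinal.{v} := sInf {β | a ∈ B.L (Order.succ β)}

/-- `L γ`-formulas: closed formulas with parameters from `L γ`. -/
def IsF (γ : Ordinal.{v}) (φ : Fml.{v}) : Prop := φ.fv = ∅ ∧ ∀ a ∈ φ.pars, a ∈ B.L γ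

/-- Maximal rank of the parameters of a term of the object language. -/
noncomputable def kTrm : Trm.{v} → Ordinal.{v}
  | .par a => B.rk a
  | .var _ => 0

/-- The maximal rank `k(φ)` of the parameters of `φ`. -/
noncomputable def kF : Fml.{v} → Ordinal.{v}
  | .mem s t => max (B.kTrm s) (B.kTrm t)
  | .nmem s t => max (B.kTrm s) (B.kTrm t)
  | .eq s t => max (B.kTrm s) (B.kTrm t)
  | .neq s t => max (B.kTrm s) (B.kTrm t)
  | .and φ ψ => max (kF φ) (kF ψ)
  | .or φ ψ => max (kF φ) (kF ψ)
  | .all _ φ => kF φ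
  | .ex _ φ => kF φ

/-- The maximal rank of the parameters of a sequent. -/
noncomputable def kS (Γ : Finset Fml.{v}) : Ordinal.{v} := Γ.sup B.kF

/-! ## Search trees

A finite sequence `⟨a₀, …, aₙ⟩` is represented by the list `[aₙ, …, a₀]`, so that `a :: σ` is the
extension of `σ` by the entry `a`. -/

open Classical in
/-- Splits a sequent at its first formula that is not a (negated) prime formula. -/
noncomputable def redex : List Fml.{v} → Option (List Fml.{v} × Fml.{v} × List Fml.{v})
  | [] => none
  | φ :: Γ =>
      if φ.IsPrime then (redex Γ).map (fun p => (φ :: p.1, p.2.1, p.2.2)) else some ([], φ, Γ)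

/-- The list `u₀, σ₀, …, u_{n-1}, σ_{n-1}, u_n, u_{n+1}, …` where `n` is the length of `σ`. -/
noncomputable def cand (σ : List ZFSet.{v}) (i : ℕ) : ZFSet.{v} :=
  if i < 2 * σ.length then
    (if i % 2 = 0 then B.enum (i / 2) else σ.reverse.getD (i / 2) ∅)
  else B.enum (i - σ.length)

open Classical in
/-- The first entry `b` of this list such that `ψ(b)` does not occur in the sequent `Γ`. If there
is no such entry then `u₀` is taken. -/
noncomputable def witness (σ : List ZFSet.{v}) (Γ : List Fml.{v}) (x : ℕ) (ψ : Fml.{v}) :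
    ZFSet.{v} :=
  if h : ∃ i, ψ.subst x (B.cand σ i) ∉ Γ then B.cand σ (Nat.find h) else B.enum 0

open Classical in
/-- For a node `σ` of the search tree with sequent `Γ`, the sequent at `a :: σ`; the value is
`none` if `a :: σ` is not a node. -/
noncomputable def searchStep (γ : Ordinal.{v}) (σ : List ZFSet.{v}) (Γ : List Fml.{v})
    (a : ZFSet.{v}) : Option (List Fml.{v}) :=
  if Even σ.length then
    if a = ∅ then some (Γ ++ [(B.kp (σ.length / 2)).formula.neg]) else none
  else if ∃ φ ∈ Γ, φ.TrueD0 then none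
  else match redex Γ with
    | none => if a = ∅ then some Γ else none
    | some (Γ₀, .and ψ₀ ψ₁, Γ₁) =>
        if a = ∅ then some (Γ₀ ++ Γ₁ ++ [.and ψ₀ ψ₁, ψ₀])
        else if a = {∅} then some (Γ₀ ++ Γ₁ ++ [.and ψ₀ ψ₁, ψ₁])
        else none
    | some (Γ₀, .or ψ₀ ψ₁, Γ₁) =>
        if a = ∅ then some (Γ₀ ++ Γ₁ ++ [.or ψ₀ ψ₁, if ψ₀ ∈ Γ then ψ₁ else ψ₀]) else none
    | some (Γ₀, .all x ψ, Γ₁) =>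
        if a ∈ B.L γ then some (Γ₀ ++ Γ₁ ++ [.all x ψ, ψ.subst x a]) else none
    | some (Γ₀, .ex x ψ, Γ₁) =>
        if a = ∅ then some (Γ₀ ++ Γ₁ ++ [.ex x ψ, ψ.subst x (B.witness σ Γ x ψ)]) else none
    | some _ => none

/-- The labelling of the search tree `S γ`; it has value `none` outside of the tree. -/
noncomputable def searchLab (γ : Ordinal.{v}) : List ZFSet.{v} → Option (List Fml.{v})
  | [] => some []
  | a :: σ => (searchLab γ σ).bind (fun Γ => B.searchStep γ σ Γ a)

/-- `σ` is a node of the search tree `S γ`. -/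
def InS (γ : Ordinal.{v}) (σ : List ZFSet.{v}) : Prop := ∃ Γ, B.searchLab γ σ = some Γ

/-- The Kleene-Brouwer ordering (on reversed lists). -/
def KB (σ τ : List ZFSet.{v}) : Prop :=
  (τ <:+ σ ∧ τ ≠ σ) ∨ ∃ ρ a b, (a :: ρ) <:+ σ ∧ (b :: ρ) <:+ τ ∧ B.lt a b

/-- The rank `|σ|` of a sequence, i.e. the maximal rank of its entries. -/
noncomputable def rkS (σ : List ZFSet.{v}) : Ordinal.{v} := σ.foldr (fun a β => max (B.rk a) β) 0

end Base

/-! ## The term system `ε(S)` -/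

/-- Raw terms. `oadd s β r` stands for `Ω^s · β + r`. -/
inductive Tm : Type (v + 1)
  | zero
  | eps (σ : List ZFSet.{v})
  | oadd (s : Tm) (β : Ordinal.{v}) (r : Tm)

namespace Tm

open Classical in
/-- The ordinal `β` as a term: `0` or `Ω^0 · β`. -/
noncomputable def hat (β : Ordinal.{v}) : Tm.{v} := if β = 0 then zero else oadd zero β zero

noncomputable def one : Tm.{v} := hat 1

/-- The term `Ω = Ω^1 · 1`. -/
noncomputable def Om : Tm.{v} := oadd one 1 zero

/-- Exponentiation `Ω^s`. -/
noncomputable def exp : Tm.{v} → Tm.{v}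
  | eps σ => eps σ
  | s => oadd s 1 zero

/-- Writes `ε_σ` as the one-element sum `Ω^(ε_σ) · 1`. -/
noncomputable def toSum : Tm.{v} → Tm.{v}
  | eps σ => oadd (eps σ) 1 zero
  | s => s

open Classical in
/-- Inverse of `toSum`. -/
noncomputable def ofSum : Tm.{v} → Tm.{v}
  | oadd (eps σ) β r => if β = 1 ∧ r = zero then eps σ else oadd (eps σ) β r
  | s => s

end Tm

namespace Base

variable (B : Base.{v})

/-- The ordering of terms. Sums are compared lexicographically. -/
inductive Lt : Tm.{v} → Tm.{v} → Prop
  | zero_eps (σ) : Lt .zero (.eps σ)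
  | zero_oadd (t γ q) : Lt .zero (.oadd t γ q)
  | eps_eps (σ τ) : B.KB σ τ → Lt (.eps σ) (.eps τ)
  | eps_oadd (σ t γ q) : Lt (.eps σ) t → Lt (.eps σ) (.oadd t γ q)
  | eps_oadd_self (σ γ q) : Lt (.eps σ) (.oadd (.eps σ) γ q)
  | oadd_eps (s β r τ) : Lt s (.eps τ) → Lt (.oadd s β r) (.eps τ)
  | oadd_exp (s β r t γ q) : Lt s t → Lt (.oadd s β r) (.oadd t γ q)
  | oadd_coeff (s β r γ q) : β < γ → Lt (.oadd s β r) (.oadd s γ q)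
  | oadd_tail (s β r q) : Lt r q → Lt (.oadd s β r) (.oadd s β q)

def Le (s t : Tm.{v}) : Prop := B.Lt s t ∨ s = t

/-- Membership in the term system over `S (ω ^ γ)`. With `top = false` this describes the terms that
may stand as (possibly empty) remaining part of a sum. -/
def WfTm (γ : Ordinal.{v}) : Bool → Tm.{v} → Prop
  | _, .zero => True
  | top, .eps σ => top = true ∧ B.InS (Ordinal.omega0.{v} ^ γ) σ
  | top, .oadd s β r =>
      WfTm γ true s ∧ 0 < β ∧ β < Ordinal.omega0.{v} ^ γ ∧ WfTm γ false r ∧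
      (∀ s' β' r', r = .oadd s' β' r' → B.Lt s' s) ∧
      (top = true → r = .zero → β = 1 → ∀ σ, s ≠ .eps σ)

/-- The set of terms `ε(S (ω ^ γ))`. -/
def Eps (γ : Ordinal.{v}) : Set Tm.{v} := {s | B.WfTm γ true s}

/-- The rank `s*` of a term. -/
noncomputable def star (s : Tm.{v}) : Ordinal.{v} := sInf {γ | s ∈ B.Eps (Order.succ γ)}

open Classical in
/-- Addition of sums. -/
noncomputable def addSum : Tm.{v} → Tm.{v} → Tm.{v}
  | .oadd s β r, .oadd t γ q =>
      if B.Lt s t then .oadd t γ q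
      else if s = t then .oadd s (β + γ) q
      else .oadd s β (addSum r (.oadd t γ q))
  | .oadd s β r, _ => .oadd s β r
  | _, t => t

/-- Addition of terms. -/
noncomputable def add (s t : Tm.{v}) : Tm.{v} := (B.addSum s.toSum t.toSum).ofSum

open Classical in
/-- The maximum of two terms. -/
noncomputable def tmax (s t : Tm.{v}) : Tm.{v} := if B.Lt s t then t else s

/-! ## Bachmann-Howard collapse and the operators `H` -/

/-- `ϑ` is a Bachmann-Howard collapse from `ε(S (ω ^ α))` to `α`. -/
structure IsBH (α : Ordinal.{v}) (ϑ : Tm.{v} → Ordinal.{v}) : Prop where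
  lt_alpha : ∀ s ∈ B.Eps α, ϑ s < α
  star_lt : ∀ s ∈ B.Eps α, B.star s < ϑ s
  mono : ∀ s ∈ B.Eps α, ∀ t ∈ B.Eps α, B.Lt s t → B.star s < ϑ t → ϑ s < ϑ t

/-- The sets `Cₙ(t, X)`. -/
noncomputable def Cn (α : Ordinal.{v}) (ϑ : Tm.{v} → Ordinal.{v}) (t : Tm.{v})
    (X : Set Ordinal.{v}) : ℕ → Set Tm.{v}
  | 0 => Tm.hat '' X ∪ {.zero}
  | n + 1 => Cn α ϑ t X n
      ∪ {s | s ∈ B.Eps α ∧ Tm.hat (B.star s) ∈ Cn α ϑ t X n}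
      ∪ {r | ∃ s ∈ Cn α ϑ t X n, B.Lt s t ∧ r = Tm.hat (ϑ s)}
      ∪ {s | s ∈ B.Eps α ∧ ∃ s' ∈ Cn α ϑ t X n, B.Lt s' Tm.Om ∧ B.Lt s s'}

/-- The operator `H_t[X] = C(t + 1, X)`. -/
noncomputable def H (α : Ordinal.{v}) (ϑ : Tm.{v} → Ordinal.{v}) (t : Tm.{v})
    (X : Set Ordinal.{v}) : Set Tm.{v} := ⋃ n, B.Cn α ϑ (B.add t Tm.one) X n

end Base

/-! ## Rules of infinitary logic -/

/-- Rules; `or false` and `or true` stand for the rules that introduce the left and the right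
disjunct, and `ref z x a y θ` is the reflection rule with formula `∃ z, ∀ x ∈ a, ∃ y ∈ z, θ`. -/
inductive Rule : Type (v + 1)
  | ax
  | and (ψ₀ ψ₁ : Fml.{v})
  | or (i : Bool) (ψ₀ ψ₁ : Fml.{v})
  | all (x : ℕ) (ψ : Fml.{v})
  | ex (x : ℕ) (b : ZFSet.{v}) (ψ : Fml.{v})
  | cut (ψ : Fml.{v})
  | ref (z x : ℕ) (a : ZFSet.{v}) (y : ℕ) (θ : Fml.{v})
  | rep (b : ZFSet.{v})

/-- Selects one of two immediate subformulas. -/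
def pick (i : Bool) (ψ₀ ψ₁ : Fml.{v}) : Fml.{v} := if i = true then ψ₁ else ψ₀

/-- The formula `∃ z, ∀ x ∈ a, ∃ y ∈ z, θ`. -/
def refConcl (z x : ℕ) (a : ZFSet.{v}) (y : ℕ) (θ : Fml.{v}) : Fml.{v} :=
  .ex z (.ball x (.par a) (.bex y (.var z) θ))

/-- The formula `∀ x ∈ a, ∃ y, θ`. -/
def refPrem (x : ℕ) (a : ZFSet.{v}) (y : ℕ) (θ : Fml.{v}) : Fml.{v} :=
  .ball x (.par a) (.ex y θ)

namespace Base

variable (B : Base.{v})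

/-- Rules over `L γ`. -/
def IsRule (γ : Ordinal.{v}) : Rule.{v} → Prop
  | .ax => True
  | .and ψ₀ ψ₁ => B.IsF γ ψ₀ ∧ B.IsF γ ψ₁
  | .or _ ψ₀ ψ₁ => B.IsF γ ψ₀ ∧ B.IsF γ ψ₁
  | .all x ψ => B.IsF γ (.all x ψ)
  | .ex x b ψ => B.IsF γ (.ex x ψ) ∧ b ∈ B.L γ
  | .cut ψ => B.IsF γ ψ
  | .ref z x a y θ => B.IsF γ (refConcl z x a y θ) ∧ θ.IsD0 ∧ θ.IsOr ∧
      z ≠ x ∧ z ≠ y ∧ x ≠ y ∧ z ∉ θ.fv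
  | .rep b => b ∈ B.L γ

/-- The relevant premises `ι(r)` of a rule `r` over `L γ`. -/
def premises (γ : Ordinal.{v}) : Rule.{v} → Set ZFSet.{v}
  | .ax => ∅
  | .and _ _ => {∅, {∅}}
  | .or _ _ _ => {∅}
  | .all _ _ => {a | a ∈ B.L γ}
  | .ex _ _ _ => {∅}
  | .cut _ => {∅, {∅}}
  | .ref _ _ _ _ _ => {∅}
  | .rep b => {b}

/-- The parameter bound `k(r)` of a rule. -/
noncomputable def kR : Rule.{v} → Ordinal.{v}
  | .ex _ b _ => B.rk b
  | .rep b => B.rk b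
  | .cut ψ => B.kF ψ
  | _ => 0

end Base

/-! ## The basic preproof: the search tree together with proofs of the axioms -/

/-- The labels of a node: sequent, rule, and ordinal label. -/
structure Lab where
  seq : Finset Fml.{v}
  rule : Rule.{v}
  ord : Tm.{v}

/-- The nodes in the proofs of the axioms. `pre A c` means that the first universal quantifiers of
`A` have been instantiated by `c`; `wit A c` is the premise of the rule that introduces the
existential quantifier in pairing, union, infinity and separation; the remaining nodes occur above
`pre (collection k θ) c` where `c` has length `k + 1`. -/
inductive KPNode : Type (v + 1)
  | pre (A : KPAx.{v}) (c : List ZFSet.{v})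
  | wit (A : KPAx.{v}) (c : List ZFSet.{v})
  | coll₁ (k : ℕ) (θ : Fml.{v}) (c : List ZFSet.{v})
  | coll₂ (k : ℕ) (θ : Fml.{v}) (c : List ZFSet.{v})
  | coll₃ (k : ℕ) (θ : Fml.{v}) (c : List ZFSet.{v})
  | coll₄ (k : ℕ) (θ : Fml.{v}) (c : List ZFSet.{v}) (a : ZFSet.{v})
  | coll₅ (k : ℕ) (θ : Fml.{v}) (c : List ZFSet.{v}) (a : ZFSet.{v})
  | coll₆ (k : ℕ) (θ : Fml.{v}) (c : List ZFSet.{v}) (a : ZFSet.{v})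
  | coll₇ (k : ℕ) (θ : Fml.{v}) (c : List ZFSet.{v}) (a : ZFSet.{v})
  | collMem (k : ℕ) (θ : Fml.{v}) (c : List ZFSet.{v}) (a : ZFSet.{v})
  | coll₈ (k : ℕ) (θ : Fml.{v}) (c : List ZFSet.{v}) (a : ZFSet.{v})
  | coll₉ (k : ℕ) (θ : Fml.{v}) (c : List ZFSet.{v}) (a b : ZFSet.{v})
  | collLeaf (k : ℕ) (θ : Fml.{v}) (c : List ZFSet.{v}) (a b : ZFSet.{v})

namespace KPNode

/-- The term `Ω + ω · n + j`. -/
noncomputable def omPlus (n j : ℕ) : Tm.{v} :=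
  .oadd .one 1 (.hat (Ordinal.omega0.{v} * (n : Ordinal.{v}) + (j : Ordinal.{v})))

/-- The witness for the existential quantifier in pairing, union, infinity and separation. -/
noncomputable def witness : KPAx.{v} → List ZFSet.{v} → ZFSet.{v}
  | .pairing, c => {c.getD 0 ∅, c.getD 1 ∅}
  | .union, c => ZFSet.sUnion (c.getD 0 ∅)
  | .infinity, _ => ZFSet.omega
  | .separation k θ, c =>
      ZFSet.sep (fun z => ((Fml.inst 0 c θ).subst (k + 1) z).Sat Set.univ (fun _ => ∅))
        (c.getD k ∅)
  | _, _ => ∅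

/-- Labels of `pre A c` when all leading universal quantifiers of `A` have been instantiated. The
argument `φ` is the formula that remains. -/
noncomputable def preLab (A : KPAx.{v}) (c : List ZFSet.{v}) (φ : Fml.{v}) : Lab.{v} :=
  match A, φ with
  | .collection _ _, .or ψ₀ ψ₁ => ⟨{.or ψ₀ ψ₁}, .or false ψ₀ ψ₁, omPlus 3 3⟩
  | _, .ex y δ => ⟨{.ex y δ}, .ex y (witness A c) δ, .Om⟩
  | _, φ => ⟨{φ}, .ax, .zero⟩

/-- The ordinal label of `pre A c` when `n > 0` universal quantifiers remain. -/
noncomputable def preOrd (A : KPAx.{v}) (n : ℕ) : Tm.{v} :=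
  match A with
  | .collection _ _ => omPlus (3 + n) 0
  | _ => omPlus n 0

/-- The formula in the premise of the rule for the existential quantifier. -/
noncomputable def witFml (A : KPAx.{v}) (c : List ZFSet.{v}) : Fml.{v} → Fml.{v}
  | .ex y δ => δ.subst y (witness A c)
  | φ => φ

open Fml in
/-- The labels. In the case of collection, with `d` the last entry of `c` and with the entries of
`c` substituted in `θ`, we write `N` for `∃ y ∈ d, ∀ z, ¬θ` and `E` for `∃ w, ∀ y ∈ d, ∃ z ∈ w, θ`.
-/
noncomputable def lab : KPNode.{v} → Lab.{v}
  | pre A c =>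
      if c.length < A.m then
        ⟨{inst 0 c (allFrom c.length (A.m - c.length) A.matrix)},
          .all c.length (inst 0 c (allFrom (c.length + 1) (A.m - c.length - 1) A.matrix)),
          preOrd A (A.m - c.length)⟩
      else preLab A c (inst 0 c A.matrix)
  | wit A c => ⟨{witFml A c (inst 0 c A.matrix)}, .ax, .zero⟩
  | coll₁ k θ c =>
      let d := Trm.par (c.getD k ∅)
      let θ' := inst 0 c θ
      let N := (KPAx.collHyp k d θ').neg
      let E := KPAx.collConcl k d θ'
      ⟨{or N E, N}, .or true N E, omPlus 3 2⟩
  | coll₂ k θ c =>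
      let d := Trm.par (c.getD k ∅)
      let θ' := inst 0 c θ
      let N := (KPAx.collHyp k d θ').neg
      let E := KPAx.collConcl k d θ'
      ⟨{N, E}, .ref (k + 3) (k + 1) (c.getD k ∅) (k + 2) θ', omPlus 3 1⟩
  | coll₃ k θ c =>
      let d := Trm.par (c.getD k ∅)
      let θ' := inst 0 c θ
      let N := (KPAx.collHyp k d θ').neg
      ⟨{N, KPAx.collHyp k d θ'},
        .all (k + 1) (or (nmem (.var (k + 1)) d) (ex (k + 2) θ')), omPlus 3 0⟩
  | coll₄ k θ c a =>
      let d := Trm.par (c.getD k ∅)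
      let θ' := inst 0 c θ
      let N := (KPAx.collHyp k d θ').neg
      let θa := θ'.subst (k + 1) a
      ⟨{N, or (nmem (.par a) d) (ex (k + 2) θa)},
        .or false (nmem (.par a) d) (ex (k + 2) θa), omPlus 2 2⟩
  | coll₅ k θ c a =>
      let d := Trm.par (c.getD k ∅)
      let θ' := inst 0 c θ
      let N := (KPAx.collHyp k d θ').neg
      let θa := θ'.subst (k + 1) a
      ⟨{N, or (nmem (.par a) d) (ex (k + 2) θa), nmem (.par a) d},
        .or true (nmem (.par a) d) (ex (k + 2) θa), omPlus 2 1⟩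
  | coll₆ k θ c a =>
      let d := Trm.par (c.getD k ∅)
      let θ' := inst 0 c θ
      let N := (KPAx.collHyp k d θ').neg
      let θa := θ'.subst (k + 1) a
      ⟨{N, nmem (.par a) d, ex (k + 2) θa},
        .ex (k + 1) a (and (mem (.var (k + 1)) d) (all (k + 2) θ'.neg)), omPlus 2 0⟩
  | coll₇ k θ c a =>
      let d := Trm.par (c.getD k ∅)
      let θa := (inst 0 c θ).subst (k + 1) a
      ⟨{and (mem (.par a) d) (all (k + 2) θa.neg), nmem (.par a) d, ex (k + 2) θa},
        .and (mem (.par a) d) (all (k + 2) θa.neg), omPlus 1 1⟩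
  | collMem k _ c a =>
      let d := Trm.par (c.getD k ∅)
      ⟨{mem (.par a) d, nmem (.par a) d}, .ax, .zero⟩
  | coll₈ k θ c a =>
      let θa := (inst 0 c θ).subst (k + 1) a
      ⟨{all (k + 2) θa.neg, ex (k + 2) θa}, .all (k + 2) θa.neg, omPlus 1 0⟩
  | coll₉ k θ c a b =>
      let θa := (inst 0 c θ).subst (k + 1) a
      ⟨{(θa.subst (k + 2) b).neg, ex (k + 2) θa}, .ex (k + 2) b θa, .Om⟩
  | collLeaf k θ c a b =>
      let θb := ((inst 0 c θ).subst (k + 1) a).subst (k + 2) b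
      ⟨{θb.neg, θb}, .ax, .zero⟩

open Classical in
/-- The node above the premise with index `a`. -/
noncomputable def next : KPNode.{v} → ZFSet.{v} → KPNode.{v}
  | pre A c, a =>
      if c.length < A.m then pre A (c ++ [a])
      else match A with
        | .collection k θ => coll₁ k θ c
        | A => wit A c
  | wit A c, _ => wit A c
  | coll₁ k θ c, _ => coll₂ k θ c
  | coll₂ k θ c, _ => coll₃ k θ c
  | coll₃ k θ c, a => coll₄ k θ c a
  | coll₄ k θ c a, _ => coll₅ k θ c a
  | coll₅ k θ c a, _ => coll₆ k θ c a
  | coll₆ k θ c a, _ => coll₇ k θ c a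
  | coll₇ k θ c a, i => if i = ∅ then collMem k θ c a else coll₈ k θ c a
  | collMem k θ c a, _ => collMem k θ c a
  | coll₈ k θ c a, b => coll₉ k θ c a b
  | coll₉ k θ c a b, _ => collLeaf k θ c a b
  | collLeaf k θ c a b, _ => collLeaf k θ c a b

end KPNode

/-- Nodes of the basic preproof: nodes `σ` of the search tree (with their sequent), and nodes in the
attached proofs of the axioms. -/
inductive PNode : Type (v + 1)
  | search (σ : List ZFSet.{v}) (Γ : List Fml.{v})
  | kp (N : KPNode.{v})

namespace Base

variable (B : Base.{v})

open Classical in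
/-- The rule at a node of the search tree. -/
noncomputable def searchRule (σ : List ZFSet.{v}) (Γ : List Fml.{v}) : Rule.{v} :=
  if Even σ.length then .cut (B.kp (σ.length / 2)).formula.neg
  else if ∃ φ ∈ Γ, φ.TrueD0 then .ax
  else match redex Γ with
    | none => .rep ∅
    | some (_, .and ψ₀ ψ₁, _) => .and ψ₀ ψ₁
    | some (_, .or ψ₀ ψ₁, _) => .or (decide (ψ₀ ∈ Γ)) ψ₀ ψ₁
    | some (_, .all x ψ, _) => .all x ψ
    | some (_, .ex x ψ, _) => .ex x (B.witness σ Γ x ψ) ψ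
    | some _ => .ax

noncomputable def pLab : PNode.{v} → Lab.{v}
  | .search σ Γ => ⟨Γ.toFinset, B.searchRule σ Γ, .eps σ⟩
  | .kp N => N.lab

open Classical in
/-- The node above the premise with index `a`; above the second premise of a cut with a negated
axiom we attach the proof of this axiom. -/
noncomputable def pNext (γ : Ordinal.{v}) : PNode.{v} → ZFSet.{v} → Option PNode.{v}
  | .search σ Γ, a =>
      if Even σ.length ∧ a = {∅} then some (.kp (.pre (B.kp (σ.length / 2)) []))
      else (B.searchStep γ σ Γ a).map (fun Γ' => .search (a :: σ) Γ')
  | .kp N, a => some (.kp (N.next a))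

open Classical in
/-- The node with address `σ` in the basic preproof over `L γ`; it is `none` if there is no such
node. -/
noncomputable def pNode (γ : Ordinal.{v}) : List ZFSet.{v} → Option PNode.{v}
  | [] => some (.search [] [])
  | a :: σ => (pNode γ σ).bind (fun p =>
      if a ∈ B.premises γ (B.pLab p).rule then B.pNext γ p a else none)

/-- The labels of the basic preproof, extended to all finite sequences. -/
noncomputable def basicLab (γ : Ordinal.{v}) (σ : List ZFSet.{v}) : Lab.{v} :=
  match B.pNode γ σ with
  | some p => B.pLab p
  | none => ⟨{.eq (.par ∅) (.par ∅)}, .ax, .zero⟩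

end Base

/-! ## Codes -/

/-- Raw codes. `basic σ` stands for the part of the basic preproof above the node `σ`; `invAll` and
`invAnd` are inversion, `redEx` and `redOr` are cut reduction, `cutElim` is cut elimination, `axm`,
`conj` and `disj` are derivations of true `Δ₀`-formulas and the introduction of conjunctions and
disjunctions, `bddEx` and `bddAll` are boundedness for `Σ`-formulas and for the `Π₁`-formula
`∀ x, θ`, and `coll t` is the collapsing operator `C_t`. -/
inductive Code : Type (v + 1)
  | basic (σ : List ZFSet.{v})
  | invAll (x : ℕ) (ψ : Fml.{v}) (b : ZFSet.{v}) (P : Code)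
  | invAnd (ψ₀ ψ₁ : Fml.{v}) (i : Bool) (P : Code)
  | redEx (x : ℕ) (ψ : Fml.{v}) (P₀ P₁ : Code)
  | redOr (ψ₀ ψ₁ : Fml.{v}) (P₀ P₁ : Code)
  | cutElim (P : Code)
  | axm (θ : Fml.{v})
  | conj (ψ₀ ψ₁ : Fml.{v}) (P₀ P₁ : Code)
  | disj (i : Bool) (ψ₀ ψ₁ : Fml.{v}) (P : Code)
  | bddEx (φ : Fml.{v}) (β : Ordinal.{v}) (P : Code)
  | bddAll (x : ℕ) (θ : Fml.{v}) (β : Ordinal.{v}) (P : Code)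
  | coll (t : Tm.{v}) (P : Code)

/-- A choice of values of the functions `l`, `r`, `o`, `n`, `d`, `h₀`, `h₁` on the codes
`coll t P`. -/
structure CollVal where
  l : Tm.{v} → Code.{v} → Finset Fml.{v}
  r : Tm.{v} → Code.{v} → Rule.{v}
  o : Tm.{v} → Code.{v} → Tm.{v}
  n : Tm.{v} → Code.{v} → ZFSet.{v} → Code.{v}
  d : Tm.{v} → Code.{v} → ℕ
  h₀ : Tm.{v} → Code.{v} → Tm.{v}
  h₁ : Tm.{v} → Code.{v} → Ordinal.{v}

namespace Base

variable (B : Base.{v})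

/-- The codes of the system over `L (ω ^ α)`. -/
def IsCode (α : Ordinal.{v}) : Code.{v} → Prop
  | .basic σ => ∀ a ∈ σ, a ∈ B.L (Ordinal.omega0.{v} ^ α)
  | .invAll x ψ b P =>
      B.IsF (Ordinal.omega0.{v} ^ α) (.all x ψ) ∧ b ∈ B.L (Ordinal.omega0.{v} ^ α) ∧ IsCode α P
  | .invAnd ψ₀ ψ₁ _ P => B.IsF (Ordinal.omega0.{v} ^ α) (.and ψ₀ ψ₁) ∧ IsCode α P
  | .redEx x ψ P₀ P₁ =>
      B.IsF (Ordinal.omega0.{v} ^ α) (.ex x ψ) ∧ 1 < (Fml.ex x ψ).ht ∧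
      IsCode α P₀ ∧ IsCode α P₁
  | .redOr ψ₀ ψ₁ P₀ P₁ =>
      B.IsF (Ordinal.omega0.{v} ^ α) (.or ψ₀ ψ₁) ∧ 1 < (Fml.or ψ₀ ψ₁).ht ∧
      IsCode α P₀ ∧ IsCode α P₁
  | .cutElim P => IsCode α P
  | .axm θ => B.IsF (Ordinal.omega0.{v} ^ α) θ ∧ θ.TrueD0
  | .conj ψ₀ ψ₁ P₀ P₁ =>
      B.IsF (Ordinal.omega0.{v} ^ α) (.and ψ₀ ψ₁) ∧ IsCode α P₀ ∧ IsCode α P₁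
  | .disj _ ψ₀ ψ₁ P => B.IsF (Ordinal.omega0.{v} ^ α) (.or ψ₀ ψ₁) ∧ IsCode α P
  | .bddEx φ β P =>
      B.IsF (Ordinal.omega0.{v} ^ α) φ ∧ φ.IsSigma ∧ β < Ordinal.omega0.{v} ^ α ∧ IsCode α P
  | .bddAll x θ β P =>
      B.IsF (Ordinal.omega0.{v} ^ α) (.all x θ) ∧ θ.IsD0 ∧ ¬ Fml.BddAll x θ ∧
      β < Ordinal.omega0.{v} ^ α ∧ IsCode α P
  | .coll t P => t ∈ B.Eps α ∧ B.Le .Om t ∧ IsCode α P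

variable (α : Ordinal.{v}) (K : CollVal.{v})

/-- The height `o(P)`. -/
noncomputable def o : Code.{v} → Tm.{v}
  | .basic σ => (B.basicLab (Ordinal.omega0.{v} ^ α) σ).ord
  | .invAll _ _ _ P => o P
  | .invAnd _ _ _ P => o P
  | .redEx _ _ P₀ P₁ => B.add (o P₁) (o P₀)
  | .redOr _ _ P₀ P₁ => B.add (o P₁) (o P₀)
  | .cutElim P => (o P).exp
  | .axm _ => .zero
  | .conj _ _ P₀ P₁ => B.add (B.tmax (o P₀) (o P₁)) .one
  | .disj _ _ _ P => B.add (o P) .one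
  | .bddEx _ _ P => o P
  | .bddAll _ _ _ P => o P
  | .coll t P => K.o t P

open Classical in
/-- The end-sequent `l(P)`. -/
noncomputable def l : Code.{v} → Finset Fml.{v}
  | .basic σ => (B.basicLab (Ordinal.omega0.{v} ^ α) σ).seq
  | .invAll x ψ b P => (l P \ {.all x ψ}) ∪ {ψ.subst x b}
  | .invAnd ψ₀ ψ₁ i P => (l P \ {.and ψ₀ ψ₁}) ∪ {pick i ψ₀ ψ₁}
  | .redEx x ψ P₀ P₁ => (l P₀ \ {.ex x ψ}) ∪ (l P₁ \ {.all x ψ.neg})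
  | .redOr ψ₀ ψ₁ P₀ P₁ => (l P₀ \ {.or ψ₀ ψ₁}) ∪ (l P₁ \ {.and ψ₀.neg ψ₁.neg})
  | .cutElim P => l P
  | .axm θ => {θ}
  | .conj ψ₀ ψ₁ P₀ P₁ => (l P₀ \ {ψ₀}) ∪ (l P₁ \ {ψ₁}) ∪ {.and ψ₀ ψ₁}
  | .disj i ψ₀ ψ₁ P => (l P \ {pick i ψ₀ ψ₁}) ∪ {.or ψ₀ ψ₁}
  | .bddEx φ β P =>
      if B.Le (B.o α K P) (.hat β) then (l P \ {φ}) ∪ {φ.rel (B.L β)} else l P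
  | .bddAll x θ β P => (l P \ {.all x θ}) ∪ {(Fml.all x θ).rel (B.L β)}
  | .coll t P => K.l t P

open Classical in
/-- The last rule of a `bddEx`-code, in terms of the last rule of its immediate subcode. -/
noncomputable def bddExRule (φ : Fml.{v}) (c : ZFSet.{v}) : Rule.{v} → Rule.{v}
  | .and ψ₀ ψ₁ => if Fml.and ψ₀ ψ₁ = φ then .and (ψ₀.rel c) (ψ₁.rel c) else .and ψ₀ ψ₁
  | .or i ψ₀ ψ₁ => if Fml.or ψ₀ ψ₁ = φ then .or i (ψ₀.rel c) (ψ₁.rel c) else .or i ψ₀ ψ₁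
  | .all x ψ => if Fml.all x ψ = φ then .all x (ψ.rel c) else .all x ψ
  | .ex x b θ =>
      if Fml.ex x θ = φ then
        (if Fml.BddEx x θ then .ex x b (θ.rel c)
          else .ex x b (.and (.mem (.var x) (.par c)) (θ.rel c)))
      else .ex x b θ
  | r => r

open Classical in
/-- The last rule `r(P)`. -/
noncomputable def r : Code.{v} → Rule.{v}
  | .basic σ => (B.basicLab (Ordinal.omega0.{v} ^ α) σ).rule
  | .invAll x ψ b P => if r P = .all x ψ then .rep b else r P
  | .invAnd ψ₀ ψ₁ i P =>
      if r P = .and ψ₀ ψ₁ then .rep (if i = true then {∅} else ∅) else r P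
  | .redEx x ψ P₀ _ =>
      match r P₀ with
      | .ex y b χ => if Fml.ex y χ = .ex x ψ then .cut (ψ.subst x b) else .ex y b χ
      | q => q
  | .redOr ψ₀ ψ₁ P₀ _ =>
      match r P₀ with
      | .or i χ₀ χ₁ => if Fml.or χ₀ χ₁ = .or ψ₀ ψ₁ then .cut (pick i ψ₀ ψ₁) else .or i χ₀ χ₁
      | q => q
  | .cutElim P =>
      match r P with
      | .cut ψ => if 1 < ψ.ht then .rep ∅ else .cut ψ
      | q => q
  | .axm _ => .ax
  | .conj ψ₀ ψ₁ _ _ => .and ψ₀ ψ₁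
  | .disj i ψ₀ ψ₁ _ => .or i ψ₀ ψ₁
  | .bddEx φ β P => if B.Le (B.o α K P) (.hat β) then bddExRule φ (B.L β) (r P) else r P
  | .bddAll x θ β P =>
      if r P = .all x θ then .all x (.or (.nmem (.var x) (.par (B.L β))) θ) else r P
  | .coll t P => K.r t P

open Classical in
/-- The immediate subproofs of a `bddEx`-code, where `q` is the last rule of the immediate subcode
`P` and where `Q` is the subcode of `P` at the relevant index `a`. -/
noncomputable def bddExNext (φ : Fml.{v}) (β : Ordinal.{v}) (a : ZFSet.{v}) (Q : Code.{v}) :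
    Rule.{v} → Code.{v}
  | .and ψ₀ ψ₁ =>
      if Fml.and ψ₀ ψ₁ = φ then .bddEx (if a = ∅ then ψ₀ else ψ₁) β (.bddEx φ β Q)
      else .bddEx φ β Q
  | .or i ψ₀ ψ₁ =>
      if Fml.or ψ₀ ψ₁ = φ then .bddEx (pick i ψ₀ ψ₁) β (.bddEx φ β Q) else .bddEx φ β Q
  | .all x ψ =>
      if Fml.all x ψ = φ then .bddEx (ψ.subst x a) β (.bddEx φ β Q) else .bddEx φ β Q
  | .ex x b θ =>
      if Fml.ex x θ = φ then
        (if Fml.BddEx x θ then .bddEx (θ.subst x b) β (.bddEx φ β Q)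
          else .conj (.mem (.par b) (.par (B.L β))) ((θ.subst x b).rel (B.L β))
            (.axm (.mem (.par b) (.par (B.L β)))) (.bddEx (θ.subst x b) β (.bddEx φ β Q)))
      else .bddEx φ β Q
  | _ => .bddEx φ β Q

/-- The reduced proof that replaces a cut over `ψ` with premises `Q₀` and `Q₁`. -/
def cutReduce (Q₀ Q₁ : Code.{v}) : Fml.{v} → Code.{v}
  | .ex x χ => .redEx x χ Q₀ Q₁
  | .all x χ => .redEx x χ.neg Q₁ Q₀
  | .or ψ₀ ψ₁ => .redOr ψ₀ ψ₁ Q₀ Q₁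
  | .and ψ₀ ψ₁ => .redOr ψ₀.neg ψ₁.neg Q₁ Q₀
  | _ => Q₀

open Classical in
/-- The immediate subproof `n(P, a)`. -/
noncomputable def n : Code.{v} → ZFSet.{v} → Code.{v}
  | .basic σ, a => .basic (a :: σ)
  | .invAll x ψ b P, a => .invAll x ψ b (n P a)
  | .invAnd ψ₀ ψ₁ i P, a => .invAnd ψ₀ ψ₁ i (n P a)
  | .redEx x ψ P₀ P₁, a =>
      match B.r α K P₀ with
      | .ex y b χ =>
          if Fml.ex y χ = .ex x ψ ∧ a = {∅} then .invAll x ψ.neg b P₁ else .redEx x ψ (n P₀ a) P₁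
      | _ => .redEx x ψ (n P₀ a) P₁
  | .redOr ψ₀ ψ₁ P₀ P₁, a =>
      match B.r α K P₀ with
      | .or i χ₀ χ₁ =>
          if Fml.or χ₀ χ₁ = .or ψ₀ ψ₁ ∧ a = {∅} then .invAnd ψ₀.neg ψ₁.neg i P₁
          else .redOr ψ₀ ψ₁ (n P₀ a) P₁
      | _ => .redOr ψ₀ ψ₁ (n P₀ a) P₁
  | .cutElim P, a =>
      match B.r α K P with
      | .cut ψ =>
          if 1 < ψ.ht then cutReduce (.cutElim (n P ∅)) (.cutElim (n P {∅})) ψ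
          else .cutElim (n P a)
      | _ => .cutElim (n P a)
  | .axm θ, _ => .axm θ
  | .conj _ _ P₀ P₁, a => if a = ∅ then P₀ else P₁
  | .disj _ _ _ P, _ => P
  | .bddEx φ β P, a =>
      if B.Le (B.o α K P) (.hat β) then
        B.bddExNext φ β a
          (n P (match B.r α K P with
            | .ex _ _ _ => ∅
            | _ => a))
          (B.r α K P)
      else n P a
  | .bddAll x θ β P, a =>
      if B.r α K P = .all x θ then
        .disj true (.nmem (.par a) (.par (B.L β))) (θ.subst x a) (.bddAll x θ β (n P a))
      else .bddAll x θ β (n P a)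
  | .coll t P, a => K.n t P a

/-- The cut rank `d(P)`. -/
noncomputable def d : Code.{v} → ℕ
  | .basic _ => B.C₀ + 6
  | .invAll _ _ _ P => d P
  | .invAnd _ _ _ P => d P
  | .redEx x ψ P₀ P₁ => max (max (d P₀) (d P₁)) (Fml.ex x ψ).ht
  | .redOr ψ₀ ψ₁ P₀ P₁ => max (max (d P₀) (d P₁)) (Fml.or ψ₀ ψ₁).ht
  | .cutElim P => max 2 (d P - 1)
  | .axm _ => 0
  | .conj _ _ P₀ P₁ => max (d P₀) (d P₁)
  | .disj _ _ _ P => d P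
  | .bddEx _ _ P => d P
  | .bddAll _ _ _ P => d P
  | .coll t P => K.d t P

/-- The first component of the controlling operator. -/
noncomputable def h₀ : Code.{v} → Tm.{v}
  | .basic _ => .Om
  | .invAll _ _ _ P => h₀ P
  | .invAnd _ _ _ P => h₀ P
  | .redEx _ _ P₀ P₁ => B.tmax (h₀ P₀) (h₀ P₁)
  | .redOr _ _ P₀ P₁ => B.tmax (h₀ P₀) (h₀ P₁)
  | .cutElim P => h₀ P
  | .axm _ => .Om
  | .conj _ _ P₀ P₁ => B.tmax (h₀ P₀) (h₀ P₁)
  | .disj _ _ _ P => h₀ P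
  | .bddEx _ _ P => h₀ P
  | .bddAll _ _ _ P => h₀ P
  | .coll t P => K.h₀ t P

open Classical in
/-- The second component of the controlling operator. -/
noncomputable def h₁ : Code.{v} → Ordinal.{v}
  | .basic σ => B.rkS σ
  | .invAll x ψ b P => max (max (h₁ P) (B.kF (.all x ψ))) (B.rk b)
  | .invAnd ψ₀ ψ₁ i P => max (h₁ P) (B.kF (pick i ψ₀ ψ₁))
  | .redEx _ _ P₀ P₁ => max (h₁ P₀) (h₁ P₁)
  | .redOr _ _ P₀ P₁ => max (h₁ P₀) (h₁ P₁)
  | .cutElim P => h₁ P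
  | .axm θ => B.kF θ
  | .conj ψ₀ ψ₁ P₀ P₁ => max (max (h₁ P₀) (h₁ P₁)) (B.kF (.and ψ₀ ψ₁))
  | .disj _ ψ₀ ψ₁ P => max (h₁ P) (B.kF (.or ψ₀ ψ₁))
  | .bddEx φ β P =>
      if B.Le (B.o α K P) (.hat β) then max (h₁ P) (B.kF (φ.rel (B.L β))) else h₁ P
  | .bddAll x θ β P => max (h₁ P) (B.kF ((Fml.all x θ).rel (B.L β)))
  | .coll t P => K.h₁ t P

/-! ## Local correctness -/

/-- The functions have values in the sets of sequents, rules, terms, codes and operators over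
`L (ω ^ α)`. -/
structure WellTyped (P : Code.{v}) : Prop where
  l_mem : ∀ φ ∈ B.l α K P, B.IsF (Ordinal.omega0.{v} ^ α) φ
  r_mem : B.IsRule (Ordinal.omega0.{v} ^ α) (B.r α K P)
  o_mem : B.o α K P ∈ B.Eps α
  n_mem : ∀ a ∈ B.L (Ordinal.omega0.{v} ^ α), B.IsCode α (B.n α K P a)
  h₀_mem : B.h₀ K P ∈ B.Eps α
  Om_le_h₀ : B.Le .Om (B.h₀ K P)
  h₁_lt : B.h₁ α K P < Ordinal.omega0.{v} ^ α

/-- Condition (L). -/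
def CondL (P : Code.{v}) : Prop :=
  match B.r α K P with
  | .ax => ∃ φ ∈ B.l α K P, φ.TrueD0
  | .and ψ₀ ψ₁ =>
      Fml.and ψ₀ ψ₁ ∈ B.l α K P ∧
      B.Lt (B.o α K (B.n α K P ∅)) (B.o α K P) ∧
      B.Lt (B.o α K (B.n α K P {∅})) (B.o α K P) ∧
      B.l α K (B.n α K P ∅) ⊆ B.l α K P ∪ {ψ₀} ∧
      B.l α K (B.n α K P {∅}) ⊆ B.l α K P ∪ {ψ₁}
  | .or i ψ₀ ψ₁ =>
      Fml.or ψ₀ ψ₁ ∈ B.l α K P ∧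
      B.Lt (B.o α K (B.n α K P ∅)) (B.o α K P) ∧
      B.l α K (B.n α K P ∅) ⊆ B.l α K P ∪ {pick i ψ₀ ψ₁}
  | .all x ψ =>
      Fml.all x ψ ∈ B.l α K P ∧
      ∀ a ∈ B.L (Ordinal.omega0.{v} ^ α),
        B.Le (B.add (B.o α K (B.n α K P a)) (.hat Ordinal.omega0.{v})) (B.o α K P) ∧
        B.l α K (B.n α K P a) ⊆ B.l α K P ∪ {ψ.subst x a}
  | .ex x b ψ =>
      Fml.ex x ψ ∈ B.l α K P ∧
      B.Le (B.add (B.o α K (B.n α K P ∅)) (.hat Ordinal.omega0.{v})) (B.o α K P) ∧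
      B.Lt (.hat (B.rk b)) (B.o α K P) ∧
      B.l α K (B.n α K P ∅) ⊆ B.l α K P ∪ {ψ.subst x b}
  | .cut ψ =>
      B.Lt (B.o α K (B.n α K P ∅)) (B.o α K P) ∧
      B.Lt (B.o α K (B.n α K P {∅})) (B.o α K P) ∧
      B.l α K (B.n α K P ∅) ⊆ B.l α K P ∪ {ψ} ∧
      B.l α K (B.n α K P {∅}) ⊆ B.l α K P ∪ {ψ.neg}
  | .ref z x a y θ =>
      refConcl z x a y θ ∈ B.l α K P ∧
      B.Lt (B.o α K (B.n α K P ∅)) (B.o α K P) ∧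
      B.Le .Om (B.o α K P) ∧
      B.l α K (B.n α K P ∅) ⊆ B.l α K P ∪ {refPrem x a y θ}
  | .rep b =>
      B.Lt (B.o α K (B.n α K P b)) (B.o α K P) ∧
      B.l α K (B.n α K P b) ⊆ B.l α K P

/-- Conditions (C1) and (C2). -/
structure CondC (P : Code.{v}) : Prop where
  c1 : ∀ φ, B.r α K P = .cut φ → φ.ht < B.d K P
  c2 : ∀ a ∈ B.premises (Ordinal.omega0.{v} ^ α) (B.r α K P),
    B.d K (B.n α K P a) ≤ B.d K P

/-- The parameter bound of a code. -/
noncomputable def kP (P : Code.{v}) : Ordinal.{v} :=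
  max (max (B.star (B.o α K P)) (B.kS (B.l α K P))) (B.kR (B.r α K P))

/-- Conditions (H1), (H2) and (H3). -/
structure CondH (ϑ : Tm.{v} → Ordinal.{v}) (P : Code.{v}) : Prop where
  h1 : .hat (B.kP α K P) ∈ B.H α ϑ (B.h₀ K P) {B.h₁ α K P}
  h2 : ∀ a ∈ B.premises (Ordinal.omega0.{v} ^ α) (B.r α K P),
    B.Le (B.h₀ K (B.n α K P a)) (B.h₀ K P)
  h3 : ∀ a ∈ B.premises (Ordinal.omega0.{v} ^ α) (B.r α K P),
    .hat (B.h₁ α K (B.n α K P a)) ∈ B.H α ϑ (B.h₀ K P) {B.h₁ α K P, B.rk a} ∧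
    B.o α K (B.n α K P a) ∈ B.H α ϑ (B.h₀ K P) {B.h₁ α K P, B.rk a}

/-- All conditions hold for all codes, i.e. we have a locally correct system of codes. -/
def LocallyCorrect (ϑ : Tm.{v} → Ordinal.{v}) : Prop :=
  ∀ P, B.IsCode α P →
    B.WellTyped α K P ∧ B.CondL α K P ∧ B.CondC α K P ∧ B.CondH α K ϑ P

end Base

end Collapsing

/-!
The values on the codes `C_t P` are defined by recursion on codes. If `P` satisfies the assumptions
of the theorem (`Collapsible`), the end-sequent, height, cut rank and operator of `C_t P` are as
prescribed, and the last rule of `C_t P` is obtained from the last rule of `P` (`collRule`,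
`collNext`). Otherwise `C_t P` is the axiom `0 = 0`. Rules and subcodes of `C_t P` refer to heights
of subcodes of `P`, which may be longer than `P`; so the recursion has two stages, in the first of
which all values except rules and subcodes are fixed (`exists_isColl`).

Local correctness of all codes is then proved by induction on their build-up (`lc`), simultaneously
for the collapse and for all other operators. Two reformulations make this uniform. The conditions
on the single rules are expressed by `Step`, in terms of the formulas that a rule introduces and the
formulas that it adds in its premises. The conditions on operators are expressed by the ordinals
`J` in `H_t[X]`: they form an initial segment (`IsBH.J_down`), and a term belongs to `H_t[X]` as soon
as its rank does, so that membership amounts to inequalities between ordinals (`CondJ`). Most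
operators pass on the last rule, while heights are changed monotonically (`lc_passive`), or turn the
last rule into a variant of it (`lc_of_premises`, `IsRed.lc_cut`). For the basic codes one checks
the proofs of the axioms, where the witnesses for the axioms are definable over a stage that
contains the parameters and hence remain under control (`witness_mem_ctl`), and the search tree.

For the collapse, let `t₁ = t + Ω ^ o` where `o` is the height of `P`. The collapsing property of `ϑ`
shows that the ordinals in `H_t` lie below `ϑ(t₁)` (`IsBH.lt_theta_of_mem_J`), and that
`ϑ(t + Ω ^ u) < ϑ(t₁)` for each `u < o` with rank in `H_t` (`CollCtx.add_exp`, `CollCtx.theta`). By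
local correctness of `P`, the heights of the premises of `P` are such terms `u`, as long as the
index of the premise is itself controlled by `H_t`. This holds for all relevant premises: as the
end-sequent consists of `Σ`-formulas, a universal quantifier is bounded by a parameter `b` of the
sequent, where premises with index outside of `b` are trivial. Now most rules can be kept. There are
two exceptions.

* A reflection with premise `∀ x ∈ a, ∃ y, θ` is replaced by the introduction of an existential
  quantifier with witness `L_β`, where `β` is the height of the collapsed premise. By boundedness
  (`lc_bddEx`), the premise derives `∀ x ∈ a, ∃ y ∈ L_β, θ`.
* A cut over a formula that is not bounded has height one, so it is a cut over some `∃ x, θ` with `θ`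
  bounded. The premise with this formula is collapsed, and boundedness turns the formula into
  `∃ x ∈ L_β, θ`. In the other premise, `∀ x, ¬θ` is first restricted to `L_β` (`lc_bddAll`). The
  result consists of `Σ`-formulas, but is controlled only by the larger operator for
  `t + Ω ^ u`, where `u` is the height of the first premise and `β = ϑ(t + Ω ^ u)`. It is
  collapsed with respect to this larger term, and `(t + Ω ^ u) + Ω ^ u' < t + Ω ^ o` keeps the new
  height below `ϑ(t₁)` (`CollCtx.step`, `CollCtx.prem_bddAll`).
-/

namespace Collapsing

universe v

/-! ### Formulas: negation, substitution, relativization -/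

namespace Fml

@[simp] theorem neg_neg (φ : Fml.{v}) : φ.neg.neg = φ := by
  induction φ <;> simp_all [neg]

@[simp] theorem fv_neg (φ : Fml.{v}) : φ.neg.fv = φ.fv := by
  induction φ <;> simp_all [neg, fv]

@[simp] theorem pars_neg (φ : Fml.{v}) : φ.neg.pars = φ.pars := by
  induction φ <;> simp_all [neg, pars]

theorem neg_subst (x : ℕ) (a : ZFSet.{v}) (φ : Fml.{v}) :
    (φ.subst x a).neg = φ.neg.subst x a := by
  induction φ <;> simp_all [neg, subst] <;> split_ifs <;> simp_all [neg]

theorem bddEx_neg {x : ℕ} {φ : Fml.{v}} : BddEx x φ.neg ↔ BddAll x φ := by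
  constructor
  · rintro ⟨t, ψ, ht, h⟩
    have := congrArg neg h
    rw [neg_neg] at this
    exact ⟨t, ψ.neg, ht, this⟩
  · rintro ⟨t, ψ, ht, rfl⟩
    exact ⟨t, ψ.neg, ht, rfl⟩

theorem bddAll_neg {x : ℕ} {φ : Fml.{v}} : BddAll x φ.neg ↔ BddEx x φ := by
  rw [← bddEx_neg, neg_neg]

@[simp] theorem isD0_neg (φ : Fml.{v}) : φ.neg.IsD0 ↔ φ.IsD0 := by
  induction φ <;> simp_all [neg, IsD0, bddEx_neg, bddAll_neg]

@[simp] theorem ht_neg (φ : Fml.{v}) : φ.neg.ht = φ.ht := by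
  induction φ with
  | and φ ψ h₁ h₂ =>
    simp only [neg, ht, h₁, h₂]
    split_ifs <;> simp_all [IsD0]
  | or φ ψ h₁ h₂ =>
    simp only [neg, ht, h₁, h₂]
    split_ifs <;> simp_all [IsD0]
  | all x φ h =>
    simp only [neg, ht, h]
    split_ifs <;> simp_all [IsD0, bddEx_neg]
  | ex x φ h =>
    simp only [neg, ht, h]
    split_ifs <;> simp_all [IsD0, bddAll_neg]
  | _ => simp [neg, ht]

theorem ht_of_isD0 {φ : Fml.{v}} (h : φ.IsD0) : φ.ht = 0 := by
  cases φ <;> simp [ht, h]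

theorem isD0_of_ht {φ : Fml.{v}} (h : φ.ht = 0) : φ.IsD0 := by
  cases φ <;> simp_all [ht] <;> simp [IsD0]

theorem ht_ex {x : ℕ} {φ : Fml.{v}} (h : 1 < (ex x φ).ht) : (ex x φ).ht = φ.ht + 1 := by
  have hD : ¬ (ex x φ).IsD0 := fun hD => by rw [ht_of_isD0 hD] at h; omega
  simp only [ht, hD, if_false]

theorem ht_or {φ ψ : Fml.{v}} (h : 1 < (or φ ψ).ht) : (or φ ψ).ht = max φ.ht ψ.ht + 1 := by
  have hD : ¬ (or φ ψ).IsD0 := fun hD => by rw [ht_of_isD0 hD] at h; omega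
  simp only [ht, hD, if_false]

/-- A formula of height one is an unbounded quantifier in front of a bounded formula. -/
theorem ht_le_one {φ : Fml.{v}} (h : φ.ht ≤ 1) : φ.IsD0 ∨
    ∃ x θ, θ.IsD0 ∧ ((φ = all x θ ∧ ¬ BddAll x θ) ∨ (φ = ex x θ ∧ ¬ BddEx x θ)) := by
  by_cases hD : φ.IsD0
  · exact .inl hD
  right
  cases φ with
  | and φ ψ =>
    simp only [ht, hD, if_false] at h
    exact absurd ⟨isD0_of_ht (by omega), isD0_of_ht (by omega)⟩ hD
  | or φ ψ =>
    simp only [ht, hD, if_false] at h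
    exact absurd ⟨isD0_of_ht (by omega), isD0_of_ht (by omega)⟩ hD
  | all x φ =>
    simp only [ht, hD, if_false] at h
    have h0 := isD0_of_ht (φ := φ) (by omega)
    exact ⟨x, φ, h0, .inl ⟨rfl, fun hb => hD ⟨hb, h0⟩⟩⟩
  | ex x φ =>
    simp only [ht, hD, if_false] at h
    have h0 := isD0_of_ht (φ := φ) (by omega)
    exact ⟨x, φ, h0, .inr ⟨rfl, fun hb => hD ⟨hb, h0⟩⟩⟩
  | _ => exact absurd trivial hD

theorem IsD0.isSigma {φ : Fml.{v}} (h : φ.IsD0) : φ.IsSigma := by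
  induction φ <;> simp_all [IsD0, IsSigma]

end Fml

theorem Trm.subst_eq_var {s : Trm.{v}} {x y : ℕ} {a : ZFSet.{v}} (hxy : y ≠ x) :
    s.subst x a = .var y ↔ s = .var y := by
  cases s with
  | par b => simp [Trm.subst]
  | var n =>
    simp only [Trm.subst]
    split_ifs with h
    · subst h; simp [Ne.symm hxy]
    · rfl

theorem Trm.fv_subst (x : ℕ) (a : ZFSet.{v}) (s : Trm.{v}) : (s.subst x a).fv = s.fv.erase x := by
  cases s with
  | par b => simp [Trm.subst, Trm.fv]
  | var n =>
    simp only [Trm.subst]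
    split_ifs with h
    · subst h; simp [Trm.fv]
    · simp [Trm.fv, Ne.symm h]

theorem Trm.pars_subst (x : ℕ) (a : ZFSet.{v}) (s : Trm.{v}) :
    (s.subst x a).pars ⊆ insert a s.pars := by
  cases s with
  | par b => simp [Trm.subst, Trm.pars]
  | var n =>
    simp only [Trm.subst]
    split_ifs with h <;> simp [Trm.pars]

theorem Trm.subst_of_notMem {x : ℕ} {a : ZFSet.{v}} {s : Trm.{v}} (h : x ∉ s.fv) :
    s.subst x a = s := by
  cases s with
  | par b => rfl
  | var n => simp [Trm.fv] at h; simp [Trm.subst, Ne.symm h]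

theorem Trm.val_subst (x : ℕ) (a : ZFSet.{v}) (s : Trm.{v}) (e : ℕ → ZFSet.{v}) :
    (s.subst x a).val e = s.val (Function.update e x a) := by
  cases s with
  | par b => rfl
  | var n =>
    simp only [Trm.subst, Trm.val]
    split_ifs with h
    · subst h; simp
    · simp [h]

theorem Trm.val_congr {s : Trm.{v}} {e e' : ℕ → ZFSet.{v}} (h : ∀ n ∈ s.fv, e n = e' n) :
    s.val e = s.val e' := by
  cases s with
  | par b => rfl
  | var n => exact h n (by simp [Trm.fv])

namespace Fml

theorem bddAll_subst {x y : ℕ} (hxy : y ≠ x) {a : ZFSet.{v}} {φ : Fml.{v}} :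
    BddAll y (φ.subst x a) ↔ BddAll y φ := by
  constructor
  · rintro ⟨t, ψ, ht, h⟩
    cases φ with
    | or φ₀ φ₁ =>
      cases φ₀ with
      | nmem s t' =>
        simp only [subst, or.injEq, nmem.injEq, Trm.subst_eq_var hxy] at h
        obtain ⟨⟨rfl, rfl⟩, rfl⟩ := h
        exact ⟨t', φ₁, fun e => ht ((Trm.subst_eq_var hxy).2 e), rfl⟩
      | all z φ => simp only [subst] at h; split_ifs at h <;> simp at h
      | ex z φ => simp only [subst] at h; split_ifs at h <;> simp at h
      | _ => simp [subst] at h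
    | all z φ => simp only [subst] at h; split_ifs at h
    | ex z φ => simp only [subst] at h; split_ifs at h
    | _ => simp [subst] at h
  · rintro ⟨t, ψ, ht, rfl⟩
    exact ⟨t.subst x a, ψ.subst x a, fun e => ht ((Trm.subst_eq_var hxy).1 e),
      by simp [subst, Trm.subst, hxy]⟩

theorem bddEx_subst {x y : ℕ} (hxy : y ≠ x) {a : ZFSet.{v}} {φ : Fml.{v}} :
    BddEx y (φ.subst x a) ↔ BddEx y φ := by
  rw [← bddAll_neg, neg_subst, bddAll_subst hxy, bddAll_neg]

theorem IsD0.subst {φ : Fml.{v}} (h : φ.IsD0) (x : ℕ) (a : ZFSet.{v}) : (φ.subst x a).IsD0 := by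
  induction φ with
  | all y φ ih =>
    simp only [Fml.subst]
    split_ifs with e
    · exact h
    · exact ⟨(bddAll_subst e).2 h.1, ih h.2⟩
  | ex y φ ih =>
    simp only [Fml.subst]
    split_ifs with e
    · exact h
    · exact ⟨(bddEx_subst e).2 h.1, ih h.2⟩
  | _ => simp_all [Fml.subst, IsD0]

theorem IsSigma.subst {φ : Fml.{v}} (h : φ.IsSigma) (x : ℕ) (a : ZFSet.{v}) :
    (φ.subst x a).IsSigma := by
  induction φ with
  | all y φ ih =>
    simp only [Fml.subst]
    split_ifs with e
    · exact h
    · exact ⟨(bddAll_subst e).2 h.1, ih h.2⟩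
  | ex y φ ih =>
    simp only [Fml.subst]
    split_ifs with e
    · exact h
    · exact ih h
  | _ => simp_all [Fml.subst, IsSigma]

theorem ht_subst_le (φ : Fml.{v}) (x : ℕ) (a : ZFSet.{v}) : (φ.subst x a).ht ≤ φ.ht := by
  by_cases hD : φ.IsD0
  · rw [ht_of_isD0 (hD.subst x a)]; exact Nat.zero_le _
  induction φ with
  | and φ ψ h₁ h₂ =>
    have h₁ : (φ.subst x a).ht ≤ φ.ht := by
      by_cases h : φ.IsD0
      · rw [ht_of_isD0 (h.subst x a)]; exact Nat.zero_le _
      · exact h₁ h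
    have h₂ : (ψ.subst x a).ht ≤ ψ.ht := by
      by_cases h : ψ.IsD0
      · rw [ht_of_isD0 (h.subst x a)]; exact Nat.zero_le _
      · exact h₂ h
    simp only [ht, subst, hD, if_false]
    split_ifs <;> omega
  | or φ ψ h₁ h₂ =>
    have h₁ : (φ.subst x a).ht ≤ φ.ht := by
      by_cases h : φ.IsD0
      · rw [ht_of_isD0 (h.subst x a)]; exact Nat.zero_le _
      · exact h₁ h
    have h₂ : (ψ.subst x a).ht ≤ ψ.ht := by
      by_cases h : ψ.IsD0
      · rw [ht_of_isD0 (h.subst x a)]; exact Nat.zero_le _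
      · exact h₂ h
    simp only [ht, subst, hD, if_false]
    split_ifs <;> omega
  | all y φ h =>
    have h : (φ.subst x a).ht ≤ φ.ht := by
      by_cases h0 : φ.IsD0
      · rw [ht_of_isD0 (h0.subst x a)]; exact Nat.zero_le _
      · exact h h0
    simp only [subst]
    split_ifs with e
    · exact le_rfl
    · simp only [ht, hD, if_false]
      split_ifs <;> omega
  | ex y φ h =>
    have h : (φ.subst x a).ht ≤ φ.ht := by
      by_cases h0 : φ.IsD0
      · rw [ht_of_isD0 (h0.subst x a)]; exact Nat.zero_le _
      · exact h h0
    simp only [subst]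
    split_ifs with e
    · exact le_rfl
    · simp only [ht, hD, if_false]
      split_ifs <;> omega
  | _ => exact absurd trivial hD

@[simp] theorem fv_subst (φ : Fml.{v}) (x : ℕ) (a : ZFSet.{v}) :
    (φ.subst x a).fv = φ.fv.erase x := by
  induction φ with
  | all y φ ih =>
    simp only [subst]
    split_ifs with e
    · subst e; simp [fv]
    · simp only [fv, ih]; exact Finset.erase_right_comm
  | ex y φ ih =>
    simp only [subst]
    split_ifs with e
    · subst e; simp [fv]
    · simp only [fv, ih]; exact Finset.erase_right_comm
  | _ => simp_all [subst, fv, Trm.fv_subst, Finset.erase_union_distrib]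

theorem pars_subst (φ : Fml.{v}) (x : ℕ) (a : ZFSet.{v}) :
    (φ.subst x a).pars ⊆ insert a φ.pars := by
  have key : ∀ {A B C D : Set ZFSet.{v}}, A ⊆ insert a C → B ⊆ insert a D →
      A ∪ B ⊆ insert a (C ∪ D) := by
    intro A B C D h₁ h₂ y hy
    rcases hy with hy | hy
    · rcases h₁ hy with h | h
      · exact .inl h
      · exact .inr (.inl h)
    · rcases h₂ hy with h | h
      · exact .inl h
      · exact .inr (.inr h)
  induction φ with
  | mem s t => exact key (s.pars_subst x a) (t.pars_subst x a)
  | nmem s t => exact key (s.pars_subst x a) (t.pars_subst x a)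
  | eq s t => exact key (s.pars_subst x a) (t.pars_subst x a)
  | neq s t => exact key (s.pars_subst x a) (t.pars_subst x a)
  | and φ ψ h₁ h₂ => exact key h₁ h₂
  | or φ ψ h₁ h₂ => exact key h₁ h₂
  | all y φ ih =>
    simp only [subst]
    split_ifs with e
    · exact Set.subset_insert _ _
    · exact ih
  | ex y φ ih =>
    simp only [subst]
    split_ifs with e
    · exact Set.subset_insert _ _
    · exact ih

theorem subst_of_notMem {φ : Fml.{v}} {x : ℕ} {a : ZFSet.{v}} (h : x ∉ φ.fv) :
    φ.subst x a = φ := by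
  induction φ with
  | all y φ ih =>
    simp only [subst]
    split_ifs with e
    · rfl
    · rw [ih]; simp only [fv, Finset.mem_erase, not_and, ne_eq] at h; exact h (Ne.symm e)
  | ex y φ ih =>
    simp only [subst]
    split_ifs with e
    · rfl
    · rw [ih]; simp only [fv, Finset.mem_erase, not_and, ne_eq] at h; exact h (Ne.symm e)
  | _ => simp_all [subst, fv, Trm.subst_of_notMem]

theorem rel_of_isD0 {φ : Fml.{v}} (h : φ.IsD0) (c : ZFSet.{v}) : φ.rel c = φ := by
  induction φ <;> simp_all [IsD0, rel]

@[simp] theorem fv_rel (φ : Fml.{v}) (c : ZFSet.{v}) : (φ.rel c).fv = φ.fv := by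
  induction φ with
  | all y φ ih =>
    simp only [rel]
    split_ifs with e
    · simp [fv, ih]
    · simp only [fv, ih, Trm.fv, Finset.union_empty]; ext; simp
  | ex y φ ih =>
    simp only [rel]
    split_ifs with e
    · simp [fv, ih]
    · simp only [fv, ih, Trm.fv, Finset.union_empty]; ext; simp
  | _ => simp_all [rel, fv]

theorem pars_rel (φ : Fml.{v}) (c : ZFSet.{v}) : (φ.rel c).pars ⊆ insert c φ.pars := by
  induction φ with
  | and φ ψ h₁ h₂ =>
    simp only [rel, pars]
    refine Set.union_subset (h₁.trans ?_) (h₂.trans ?_) <;> apply Set.insert_subset_insert <;> simp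
  | or φ ψ h₁ h₂ =>
    simp only [rel, pars]
    refine Set.union_subset (h₁.trans ?_) (h₂.trans ?_) <;> apply Set.insert_subset_insert <;> simp
  | all y φ ih =>
    simp only [rel]
    split_ifs with e
    · exact ih
    · simp only [pars, Trm.pars, Set.empty_union]
      exact Set.union_subset (by simp) ih
  | ex y φ ih =>
    simp only [rel]
    split_ifs with e
    · exact ih
    · simp only [pars, Trm.pars, Set.empty_union]
      exact Set.union_subset (by simp) ih
  | _ => simp [rel]

theorem rel_subst (φ : Fml.{v}) (x : ℕ) (a c : ZFSet.{v}) :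
    (φ.subst x a).rel c = (φ.rel c).subst x a := by
  induction φ with
  | all y φ ih =>
    by_cases e : y = x
    · subst e
      simp only [subst, if_true, rel]
      by_cases hb : BddAll y φ <;> simp [hb, subst]
    · simp only [subst, rel, e, if_false, ih]
      split_ifs <;> simp_all [subst, Trm.subst, bddAll_subst e]
  | ex y φ ih =>
    by_cases e : y = x
    · subst e
      simp only [subst, if_true, rel]
      by_cases hb : BddEx y φ <;> simp [hb, subst]
    · simp only [subst, rel, e, if_false, ih]
      split_ifs <;> simp_all [subst, Trm.subst, bddEx_subst e]
  | _ => simp_all [subst, rel]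

theorem neg_rel (φ : Fml.{v}) (c : ZFSet.{v}) : (φ.rel c).neg = φ.neg.rel c := by
  induction φ with
  | all y φ ih => simp only [rel, neg]; split_ifs <;> simp_all [neg, bddEx_neg]
  | ex y φ ih => simp only [rel, neg]; split_ifs <;> simp_all [neg, bddAll_neg]
  | _ => simp_all [rel, neg]

theorem IsD0.rel_all {x : ℕ} {θ : Fml.{v}} (h : θ.IsD0) (c : ZFSet.{v}) :
    ((all x θ).rel c).IsD0 := by
  simp only [rel]
  split_ifs with e
  · rw [rel_of_isD0 h]; exact ⟨e, h⟩
  · rw [rel_of_isD0 h]; exact ⟨⟨.par c, θ, by simp, rfl⟩, trivial, h⟩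

theorem IsD0.rel_ex {x : ℕ} {θ : Fml.{v}} (h : θ.IsD0) (c : ZFSet.{v}) :
    ((ex x θ).rel c).IsD0 := by
  have := IsD0.rel_all (x := x) (θ := θ.neg) (by simpa using h) c
  rw [show all x θ.neg = (ex x θ).neg from rfl, ← neg_rel, isD0_neg] at this
  exact this

/-! ### Satisfaction -/

theorem sat_congr {M : Set ZFSet.{v}} {φ : Fml.{v}} {e e' : ℕ → ZFSet.{v}}
    (h : ∀ n ∈ φ.fv, e n = e' n) : φ.Sat M e ↔ φ.Sat M e' := by
  have key : ∀ {s t : Trm.{v}}, (∀ n ∈ s.fv ∪ t.fv, e n = e' n) →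
      s.val e = s.val e' ∧ t.val e = t.val e' := fun h =>
    ⟨Trm.val_congr fun n hn => h n (Finset.mem_union_left _ hn),
      Trm.val_congr fun n hn => h n (Finset.mem_union_right _ hn)⟩
  induction φ generalizing e e' with
  | mem s t => simp only [Sat, (key h).1, (key h).2]
  | nmem s t => simp only [Sat, (key h).1, (key h).2]
  | eq s t => simp only [Sat, (key h).1, (key h).2]
  | neq s t => simp only [Sat, (key h).1, (key h).2]
  | and φ ψ h₁ h₂ =>
    exact and_congr (h₁ (fun n hn => h n (Finset.mem_union_left _ hn)) key)
      (h₂ (fun n hn => h n (Finset.mem_union_right _ hn)) key)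
  | or φ ψ h₁ h₂ =>
    exact or_congr (h₁ (fun n hn => h n (Finset.mem_union_left _ hn)) key)
      (h₂ (fun n hn => h n (Finset.mem_union_right _ hn)) key)
  | all x φ ih =>
    refine forall₂_congr fun a _ => ih (fun n hn => ?_) ?_
    · by_cases e : n = x
      · subst e; simp
      · simp [e]; exact h n (Finset.mem_erase.2 ⟨e, hn⟩)
    · exact fun h => ⟨Trm.val_congr fun n hn => h n (Finset.mem_union_left _ hn),
        Trm.val_congr fun n hn => h n (Finset.mem_union_right _ hn)⟩
  | ex x φ ih =>
    refine exists_congr fun a => and_congr_right fun _ => ih (fun n hn => ?_) ?_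
    · by_cases e : n = x
      · subst e; simp
      · simp [e]; exact h n (Finset.mem_erase.2 ⟨e, hn⟩)
    · exact fun h => ⟨Trm.val_congr fun n hn => h n (Finset.mem_union_left _ hn),
        Trm.val_congr fun n hn => h n (Finset.mem_union_right _ hn)⟩

theorem sat_subst {M : Set ZFSet.{v}} {φ : Fml.{v}} {x : ℕ} {a : ZFSet.{v}} {e : ℕ → ZFSet.{v}} :
    (φ.subst x a).Sat M e ↔ φ.Sat M (Function.update e x a) := by
  induction φ generalizing e with
  | all y φ ih =>
    simp only [subst]
    split_ifs with h
    · subst h; simp [Sat]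
    · simp only [Sat, ih]
      refine forall₂_congr fun b _ => ?_
      rw [Function.update_comm h]
  | ex y φ ih =>
    simp only [subst]
    split_ifs with h
    · subst h; simp [Sat]
    · simp only [Sat, ih]
      refine exists_congr fun b => ?_
      rw [Function.update_comm h]
  | _ => simp_all [subst, Sat, Trm.val_subst]

theorem sat_neg {M : Set ZFSet.{v}} {φ : Fml.{v}} {e : ℕ → ZFSet.{v}} :
    φ.neg.Sat M e ↔ ¬ φ.Sat M e := by
  induction φ generalizing e <;> simp_all [neg, Sat, imp_iff_not_or]

/-- Absoluteness of bounded formulas between a transitive set and the universe. -/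
theorem sat_absolute {X : ZFSet.{v}} (hX : X.IsTransitive) {φ : Fml.{v}} (hφ : φ.IsD0)
    (hp : ∀ a ∈ φ.pars, a ∈ X) {e : ℕ → ZFSet.{v}} (he : ∀ n ∈ φ.fv, e n ∈ X) :
    φ.Sat {a | a ∈ X} e ↔ φ.Sat Set.univ e := by
  induction φ generalizing e with
  | and φ ψ h₁ h₂ =>
    exact and_congr
      (h₁ hφ.1 (fun a ha => hp a (.inl ha)) fun n hn => he n (Finset.mem_union_left _ hn))
      (h₂ hφ.2 (fun a ha => hp a (.inr ha)) fun n hn => he n (Finset.mem_union_right _ hn))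
  | or φ ψ h₁ h₂ =>
    exact or_congr
      (h₁ hφ.1 (fun a ha => hp a (.inl ha)) fun n hn => he n (Finset.mem_union_left _ hn))
      (h₂ hφ.2 (fun a ha => hp a (.inr ha)) fun n hn => he n (Finset.mem_union_right _ hn))
  | all x φ ih =>
    obtain ⟨⟨t, ψ, ht, rfl⟩, hD⟩ := hφ
    have hval : ∀ b, t.val (Function.update e x b) ∈ X := by
      intro b
      cases t with
      | par c => exact hp c (.inl (.inr rfl))
      | var n =>
        have hn : n ≠ x := fun h => ht (by rw [h])
        simp only [Trm.val, Function.update_of_ne hn]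
        exact he n (by simp [fv, Trm.fv, hn])
    have step : ∀ b ∈ X, _ := fun b hb => ih hD hp (e := Function.update e x b) (by
      intro n hn
      by_cases h : n = x
      · subst h; simpa using hb
      · simp only [Function.update_of_ne h]
        exact he n (by simp only [fv, Finset.mem_erase] at hn ⊢; exact ⟨h, hn⟩))
    constructor
    · intro h b _
      by_cases hb : b ∈ X
      · exact (step b hb).1 (h b hb)
      · refine .inl fun hm => hb (hX.mem_trans ?_ (hval b))
        simpa [Trm.val] using hm
    · intro h b hb
      exact (step b hb).2 (h b trivial)
  | ex x φ ih =>
    obtain ⟨⟨t, ψ, ht, rfl⟩, hD⟩ := hφ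
    have hval : ∀ b, t.val (Function.update e x b) ∈ X := by
      intro b
      cases t with
      | par c => exact hp c (.inl (.inr rfl))
      | var n =>
        have hn : n ≠ x := fun h => ht (by rw [h])
        simp only [Trm.val, Function.update_of_ne hn]
        exact he n (by simp [fv, Trm.fv, hn])
    have step : ∀ b ∈ X, _ := fun b hb => ih hD hp (e := Function.update e x b) (by
      intro n hn
      by_cases h : n = x
      · subst h; simpa using hb
      · simp only [Function.update_of_ne h]
        exact he n (by simp only [fv, Finset.mem_erase] at hn ⊢; exact ⟨h, hn⟩))
    constructor
    · rintro ⟨b, hb, h⟩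
      exact ⟨b, trivial, (step b hb).1 h⟩
    · rintro ⟨b, -, h⟩
      have hb : b ∈ X := by
        refine hX.mem_trans ?_ (hval b)
        have h1 : (Trm.var x).val (Function.update e x b) ∈ t.val (Function.update e x b) := h.1
        have h2 : (Trm.var x).val (Function.update e x b) = b := by simp [Trm.val]
        rwa [h2] at h1
      exact ⟨b, hb, (step b hb).2 h⟩
  | _ => rfl

/-! ### True bounded formulas -/

theorem TrueD0.and {φ ψ : Fml.{v}} (h : (φ.and ψ).TrueD0) : φ.TrueD0 ∧ ψ.TrueD0 := by
  obtain ⟨⟨h₁, h₂⟩, h₃, h₄, h₅⟩ := h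
  simp only [fv, Finset.union_eq_empty] at h₃
  exact ⟨⟨h₁, h₃.1, h₄⟩, ⟨h₂, h₃.2, h₅⟩⟩

theorem TrueD0.instance {x : ℕ} {φ : Fml.{v}} (h : (all x φ).TrueD0) (a : ZFSet.{v}) :
    (φ.subst x a).TrueD0 :=
  ⟨h.1.2.subst x a, by rw [fv_subst]; exact h.2.1, sat_subst.2 (h.2.2 a trivial)⟩

theorem trueD0_mem {a b : ZFSet.{v}} (h : a ∈ b) : (mem (.par a) (.par b)).TrueD0 :=
  ⟨trivial, by simp [fv, Trm.fv], h⟩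

theorem trueD0_nmem {a b : ZFSet.{v}} (h : a ∉ b) : (nmem (.par a) (.par b)).TrueD0 :=
  ⟨trivial, by simp [fv, Trm.fv], h⟩

/-- One of two complementary closed bounded formulas is true. -/
theorem trueD0_or_neg {φ : Fml.{v}} (hD : φ.IsD0) (hv : φ.fv = ∅) :
    φ.TrueD0 ∨ φ.neg.TrueD0 := by
  by_cases h : φ.Sat Set.univ (fun _ => ∅)
  · exact .inl ⟨hD, hv, h⟩
  · exact .inr ⟨by simpa using hD, by simpa using hv, sat_neg.2 h⟩

end Fml

end Collapsing

namespace Collapsing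

universe v

/-! ### The constructible hierarchy -/

theorem mem_defSets {X y : ZFSet.{v}} : y ∈ defSets X ↔ y ⊆ X ∧ ∃ φ : Fml.{v},
    φ.pars ⊆ {a | a ∈ X} ∧ φ.fv ⊆ {0} ∧
    y = ZFSet.sep (fun z => φ.Sat {a | a ∈ X} (fun _ => z)) X := by
  simp [defSets]

/-- A subset of `X` that is defined over `X` by a formula with parameters in `X`. -/
theorem mem_defSets_of_sat {X y : ZFSet.{v}} (φ : Fml.{v}) (hp : φ.pars ⊆ {a | a ∈ X})
    (hv : φ.fv ⊆ {0}) (hy : ∀ z, z ∈ y ↔ z ∈ X ∧ φ.Sat {a | a ∈ X} (fun _ => z)) :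
    y ∈ defSets X :=
  mem_defSets.2 ⟨fun z hz => ((hy z).1 hz).1, φ, hp, hv, by ext z; simp [hy]⟩

theorem subset_defSets {X : ZFSet.{v}} (hX : X.IsTransitive) {a : ZFSet.{v}} (ha : a ∈ X) :
    a ∈ defSets X :=
  mem_defSets_of_sat (.mem (.var 0) (.par a))
    (by simp [Fml.pars, Trm.pars, ha]) (by simp [Fml.fv, Trm.fv])
    (fun z => ⟨fun hz => ⟨hX.mem_trans hz ha, hz⟩, fun hz => hz.2⟩)

theorem isTransitive_defSets {X : ZFSet.{v}} (hX : X.IsTransitive) :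
    (defSets X).IsTransitive :=
  fun _ hy _ hz => subset_defSets hX ((mem_defSets.1 hy).1 hz)

theorem self_mem_defSets (X : ZFSet.{v}) : X ∈ defSets X :=
  mem_defSets_of_sat (.eq (.var 0) (.var 0)) (by simp [Fml.pars, Trm.pars])
    (by simp [Fml.fv, Trm.fv]) (fun z => by simp [Fml.Sat])

theorem pair_mem_defSets {X a b : ZFSet.{v}} (ha : a ∈ X) (hb : b ∈ X) :
    ({a, b} : ZFSet.{v}) ∈ defSets X := by
  refine mem_defSets_of_sat (.or (.eq (.var 0) (.par a)) (.eq (.var 0) (.par b)))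
    ?_ (by simp [Fml.fv, Trm.fv]) (fun z => ?_)
  · intro c hc
    simp [Fml.pars, Trm.pars] at hc
    rcases hc with rfl | rfl <;> assumption
  · simp only [ZFSet.mem_pair, Fml.Sat, Trm.val]
    constructor
    · rintro (rfl | rfl) <;> simp_all
    · exact fun h => h.2

theorem insert_self_mem_defSets {X a : ZFSet.{v}} (hX : X.IsTransitive) (ha : a ∈ X) :
    insert a a ∈ defSets X := by
  refine mem_defSets_of_sat (.or (.eq (.var 0) (.par a)) (.mem (.var 0) (.par a)))
    (by simp [Fml.pars, Trm.pars, ha]) (by simp [Fml.fv, Trm.fv]) (fun z => ?_)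
  simp only [ZFSet.mem_insert_iff, Fml.Sat, Trm.val]
  constructor
  · rintro (rfl | h)
    · simp_all
    · exact ⟨hX.mem_trans h ha, .inr h⟩
  · exact fun h => h.2

theorem sUnion_mem_defSets {X a : ZFSet.{v}} (hX : X.IsTransitive) (ha : a ∈ X) :
    ZFSet.sUnion a ∈ defSets X := by
  refine mem_defSets_of_sat
    (.ex 1 (.and (.mem (.var 1) (.par a)) (.mem (.var 0) (.var 1))))
    (by simp [Fml.pars, Trm.pars, ha]) (by simp [Fml.fv, Trm.fv]; decide) (fun z => ?_)
  simp only [ZFSet.mem_sUnion, Fml.Sat, Trm.val]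
  constructor
  · rintro ⟨y, hy, hz⟩
    have hyX := hX.mem_trans hy ha
    exact ⟨hX.mem_trans hz hyX, y, hyX, by simpa using hy, by simpa using hz⟩
  · rintro ⟨_, y, _, hy, hz⟩
    exact ⟨y, by simpa using hy, by simpa using hz⟩

/-- Bounded separation. The equation `x = z` reduces the case of an arbitrary free variable `x`
to that of the variable `0`, without any renaming of bound variables. -/
theorem sep_mem_defSets {X d : ZFSet.{v}} (hX : X.IsTransitive) (hd : d ∈ X) {θ : Fml.{v}}
    (hD : θ.IsD0) (hp : ∀ a ∈ θ.pars, a ∈ X) {x : ℕ} (hx : x ≠ 0) (hv : θ.fv ⊆ {x}) :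
    ZFSet.sep (fun z => (θ.subst x z).Sat Set.univ (fun _ => ∅)) d ∈ defSets X := by
  refine mem_defSets_of_sat
    (.and (.mem (.var 0) (.par d)) (.ex x (.and (.eq (.var x) (.var 0)) θ))) ?_ ?_ (fun z => ?_)
  · intro a ha
    simp [Fml.pars, Trm.pars] at ha
    rcases ha with rfl | h
    exacts [hd, hp a h]
  · intro n hn
    simp [Fml.fv, Trm.fv] at hn
    rcases hn with rfl | ⟨h, h'⟩
    · simp
    · rcases h' with rfl | h'
      · simp
      · exact absurd (by simpa using hv h') h
  · simp only [ZFSet.mem_sep, Fml.Sat, Trm.val, Function.update_self]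
    have key : z ∈ X → ((θ.subst x z).Sat Set.univ (fun _ => ∅) ↔
        θ.Sat {a | a ∈ X} (Function.update (fun _ => z) x z)) := by
      intro hz
      rw [Fml.sat_absolute hX hD hp (by intro n _; by_cases e : n = x <;> simp [e, hz]),
        Fml.sat_subst]
      refine Fml.sat_congr fun n hn => ?_
      have := hv hn
      simp only [Finset.mem_singleton] at this
      simp [this]
    constructor
    · rintro ⟨hz, h⟩
      have hzX := hX.mem_trans hz hd
      exact ⟨hzX, hz, z, hzX, by simp [Function.update_of_ne hx.symm], (key hzX).1 h⟩
    · rintro ⟨hzX, hz, w, _, hw, h⟩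
      rw [Function.update_of_ne hx.symm] at hw
      subst hw
      exact ⟨hz, (key hzX).2 h⟩

theorem mem_omega_induction {p : ZFSet.{v} → Prop} (h0 : p ∅) (hs : ∀ n, p n → p (insert n n)) :
    ∀ x ∈ ZFSet.omega, p x := by
  intro x
  refine Quotient.inductionOn x fun y hy => ?_
  obtain ⟨⟨n⟩, hn⟩ : ∃ n : ULift ℕ, PSet.Equiv y (PSet.ofNat n.down) := hy
  have : (⟦y⟧ : ZFSet.{v}) = ZFSet.mk (PSet.ofNat n) := Quotient.sound hn
  rw [this]
  clear this hn
  induction n with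
  | zero => exact h0
  | succ n ih => exact hs _ ih

/-- The variable `n` is empty or a successor `m ∪ {m}`; the variables `n + 1` and `n + 2` are used
as bound variables. -/
def zeroOrSucc (n : ℕ) : Fml.{v} :=
  .or (.ball (n + 1) (.var n) (.neq (.var n) (.var n)))
    (.bex (n + 1) (.var n) (.and
      (.ball (n + 2) (.var n) (.or (.mem (.var (n + 2)) (.var (n + 1)))
        (.eq (.var (n + 2)) (.var (n + 1)))))
      (.ball (n + 2) (.var (n + 1)) (.mem (.var (n + 2)) (.var n)))))

theorem sat_zeroOrSucc (n : ℕ) (e : ℕ → ZFSet.{v}) :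
    (zeroOrSucc n).Sat Set.univ e ↔ e n = ∅ ∨ ∃ m ∈ e n, e n = insert m m := by
  simp only [zeroOrSucc, Fml.Sat, Fml.ball, Fml.bex, Trm.val, Set.mem_univ, true_and, true_imp_iff]
  have h1 : n ≠ n + 1 := by omega
  have h2 : n ≠ n + 2 := by omega
  have h3 : n + 1 ≠ n + 2 := by omega
  simp only [Function.update_self, Function.update_of_ne h1, Function.update_of_ne h2,
    Function.update_of_ne h3, ne_eq, not_true, or_false]
  refine or_congr (ZFSet.eq_empty _).symm (exists_congr fun m => and_congr_right fun hm => ?_)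
  rw [ZFSet.ext_iff]
  simp only [ZFSet.mem_insert_iff]
  constructor
  · rintro ⟨h, h'⟩ z
    refine ⟨fun hz => ((h z).resolve_left (not_not.2 hz)).symm, ?_⟩
    rintro (rfl | hz)
    · exact hm
    · exact (h' z).resolve_left (not_not.2 hz)
  · intro h
    refine ⟨fun z => ?_, fun z => ?_⟩
    · by_cases hz : z ∈ e n
      · exact .inr ((h z).1 hz).symm
      · exact .inl hz
    · by_cases hz : z ∈ m
      · exact .inr ((h z).2 (.inr hz))
      · exact .inl hz

/-- A bounded formula that defines the natural numbers. -/
def isNat : Fml.{v} := .and (zeroOrSucc 0) (.ball 1 (.var 0) (zeroOrSucc 1))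

theorem sat_isNat (z : ZFSet.{v}) :
    isNat.Sat Set.univ (fun _ => z) ↔ z ∈ ZFSet.omega := by
  have hsat : isNat.Sat Set.univ (fun _ => z) ↔
      (z = ∅ ∨ ∃ m ∈ z, z = insert m m) ∧ ∀ y ∈ z, y = ∅ ∨ ∃ m ∈ y, y = insert m m := by
    simp only [isNat, Fml.Sat, Fml.ball, sat_zeroOrSucc, Set.mem_univ, forall_const, Trm.val,
      Function.update_self, imp_iff_not_or,
      Function.update_of_ne (show (0 : ℕ) ≠ 1 by decide)]
  rw [hsat]
  clear hsat
  constructor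
  · induction z using ZFSet.inductionOn with
    | _ z ih =>
      rintro ⟨rfl | ⟨m, hm, rfl⟩, h⟩
      · exact ZFSet.omega_zero
      · exact ZFSet.omega_succ (ih m hm ⟨h m hm, fun y hy => h y (by simp [hy])⟩)
  · intro h
    refine mem_omega_induction (p := fun z => (z = ∅ ∨ ∃ m ∈ z, z = insert m m) ∧
      ∀ y ∈ z, y = ∅ ∨ ∃ m ∈ y, y = insert m m) (by simp) (fun n hn => ?_) z h
    refine ⟨.inr ⟨n, by simp, rfl⟩, fun y hy => ?_⟩
    rw [ZFSet.mem_insert_iff] at hy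
    rcases hy with rfl | hy
    · exact hn.1
    · exact hn.2 y hy

theorem omega_mem_defSets {X : ZFSet.{v}} (hX : X.IsTransitive)
    (h : ∀ n ∈ ZFSet.omega, n ∈ X) : ZFSet.omega ∈ defSets X := by
  refine mem_defSets_of_sat isNat ?_ ?_ (fun z => ?_)
  · simp [isNat, zeroOrSucc, Fml.pars, Fml.ball, Fml.bex, Trm.pars]
  · simp [isNat, zeroOrSucc, Fml.fv, Fml.ball, Fml.bex, Trm.fv]; decide
  · have hp : ∀ a ∈ (isNat.{v}).pars, a ∈ X := by
      simp [isNat, zeroOrSucc, Fml.pars, Fml.ball, Fml.bex, Trm.pars]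
    have hD : (isNat.{v}).IsD0 := by
      simp [isNat, zeroOrSucc, Fml.IsD0, Fml.ball, Fml.bex, Fml.BddAll, Fml.BddEx]
    constructor
    · intro hz
      exact ⟨h z hz, (Fml.sat_absolute hX hD hp fun _ _ => h z hz).2 ((sat_isNat z).2 hz)⟩
    · rintro ⟨hz, hs⟩
      exact (sat_isNat z).1 ((Fml.sat_absolute hX hD hp fun _ _ => hz).1 hs)

namespace Base

variable (B : Base.{v})

@[simp] theorem L_zero : B.L 0 = B.u := by simp [L, stage]

theorem L_succ (γ : Ordinal.{v}) : B.L (Order.succ γ) = defSets (B.L γ) := by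
  simp [L, stage]

theorem mem_L_limit {γ : Ordinal.{v}} (hγ : Order.IsSuccLimit γ) {a : ZFSet.{v}} :
    a ∈ B.L γ ↔ ∃ β < γ, a ∈ B.L β := by
  simp only [L, stage]
  rw [Ordinal.limitRecOn_limit _ _ _ _ hγ]
  simp [ZFSet.mem_iUnion]

theorem isTransitive_L (γ : Ordinal.{v}) : (B.L γ).IsTransitive := by
  induction γ using Ordinal.limitRecOn with
  | zero => simpa using B.trans_u
  | add_one γ ih => rw [← Order.succ_eq_add_one, L_succ]; exact isTransitive_defSets ih
  | limit γ hγ ih =>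
    intro y hy z hz
    obtain ⟨β, hβ, h⟩ := (B.mem_L_limit hγ).1 hy
    exact (B.mem_L_limit hγ).2 ⟨β, hβ, ih β hβ y h hz⟩

theorem L_mono {β γ : Ordinal.{v}} (h : β ≤ γ) {a : ZFSet.{v}} (ha : a ∈ B.L β) : a ∈ B.L γ := by
  induction γ using Ordinal.limitRecOn with
  | zero => rwa [← le_antisymm h (zero_le)]
  | add_one γ ih =>
    rw [← Order.succ_eq_add_one] at h ⊢
    rcases h.eq_or_lt with rfl | h
    · exact ha
    · rw [L_succ]
      exact subset_defSets (B.isTransitive_L γ) (ih (Order.lt_succ_iff.1 h))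
  | limit γ hγ ih =>
    rcases h.eq_or_lt with rfl | h
    · exact ha
    · exact (B.mem_L_limit hγ).2 ⟨β, h, ha⟩

theorem L_mem_succ (γ : Ordinal.{v}) : B.L γ ∈ B.L (Order.succ γ) := by
  rw [L_succ]; exact self_mem_defSets _

theorem L_mem_L {β γ : Ordinal.{v}} (h : β < γ) : B.L β ∈ B.L γ :=
  B.L_mono (Order.succ_le_of_lt h) (B.L_mem_succ β)

variable {B}

theorem rk_le {β : Ordinal.{v}} {a : ZFSet.{v}} (h : a ∈ B.L (Order.succ β)) : B.rk a ≤ β :=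
  csInf_le' h

theorem rk_le' {β : Ordinal.{v}} {a : ZFSet.{v}} (h : a ∈ B.L β) : B.rk a ≤ β :=
  rk_le (B.L_mono (Order.le_succ β) h)

theorem mem_L_succ_rk {β : Ordinal.{v}} {a : ZFSet.{v}} (h : a ∈ B.L β) :
    a ∈ B.L (Order.succ (B.rk a)) :=
  csInf_mem (s := {β | a ∈ B.L (Order.succ β)}) ⟨β, B.L_mono (Order.le_succ β) h⟩

theorem mem_L_of_rk_lt {β γ : Ordinal.{v}} {a : ZFSet.{v}} (h : a ∈ B.L β) (hr : B.rk a < γ) :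
    a ∈ B.L γ :=
  B.L_mono (Order.succ_le_of_lt hr) (mem_L_succ_rk h)

theorem rk_lt {γ : Ordinal.{v}} (hγ : 0 < γ) {a : ZFSet.{v}} (h : a ∈ B.L γ) : B.rk a < γ := by
  induction γ using Ordinal.limitRecOn with
  | zero => exact absurd hγ (lt_irrefl _)
  | add_one γ _ => exact Order.lt_succ_iff.2 (rk_le h)
  | limit γ hlim _ =>
    obtain ⟨β, hβ, h⟩ := (B.mem_L_limit hlim).1 h
    exact (rk_le' h).trans_lt hβ

theorem rk_L_le (β : Ordinal.{v}) : B.rk (B.L β) ≤ β := rk_le (B.L_mem_succ β)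

theorem rk_of_mem_u {a : ZFSet.{v}} (h : a ∈ B.u) : B.rk a = 0 :=
  le_antisymm (rk_le' (by simpa using h)) (zero_le)

@[simp] theorem rk_empty : B.rk ∅ = 0 := rk_of_mem_u B.zero_mem

@[simp] theorem rk_one : B.rk {∅} = 0 := rk_of_mem_u B.one_mem

theorem enum_mem (i : ℕ) : B.enum i ∈ B.u := (B.mem_u_iff _).2 ⟨i, rfl⟩

theorem u_mem_L {a : ZFSet.{v}} (h : a ∈ B.u) (γ : Ordinal.{v}) : a ∈ B.L γ :=
  B.L_mono (zero_le) (by simpa using h)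

@[simp] theorem empty_mem_L (γ : Ordinal.{v}) : ∅ ∈ B.L γ := u_mem_L B.zero_mem γ

@[simp] theorem one_mem_L (γ : Ordinal.{v}) : {∅} ∈ B.L γ := u_mem_L B.one_mem γ

theorem rk_mem_le {a b : ZFSet.{v}} {γ : Ordinal.{v}} (hb : b ∈ B.L γ) (h : a ∈ b) :
    B.rk a ≤ B.rk b := by
  have := mem_L_succ_rk hb
  rw [L_succ, mem_defSets] at this
  exact rk_le' (this.1 h)

theorem omega_mem_L : ZFSet.omega ∈ B.L (Order.succ Ordinal.omega0) := by
  rw [L_succ]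
  refine omega_mem_defSets (B.isTransitive_L _) ?_
  intro x hx
  have : ∃ n : ℕ, x ∈ B.L n := by
    refine mem_omega_induction (p := fun x => ∃ n : ℕ, x ∈ B.L n) ⟨0, by simp [B.zero_mem]⟩ ?_ x hx
    rintro y ⟨n, hn⟩
    refine ⟨n + 1, ?_⟩
    rw [Nat.cast_add_one, ← Order.succ_eq_add_one, L_succ]
    exact insert_self_mem_defSets (B.isTransitive_L _) hn
  obtain ⟨n, hn⟩ := this
  exact B.L_mono (Ordinal.natCast_lt_omega0 n).le hn

/-! ### Ranks of formulas -/

theorem kTrm_le {s : Trm.{v}} {β : Ordinal.{v}} :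
    B.kTrm s ≤ β ↔ ∀ a ∈ s.pars, B.rk a ≤ β := by
  cases s <;> simp [kTrm, Trm.pars]

theorem kF_le {φ : Fml.{v}} {β : Ordinal.{v}} : B.kF φ ≤ β ↔ ∀ a ∈ φ.pars, B.rk a ≤ β := by
  induction φ <;> simp_all [kF, Fml.pars, kTrm_le, or_imp, forall_and]

theorem rk_le_kF {φ : Fml.{v}} {a : ZFSet.{v}} (h : a ∈ φ.pars) : B.rk a ≤ B.kF φ :=
  kF_le.1 le_rfl a h

@[simp] theorem kF_neg (φ : Fml.{v}) : B.kF φ.neg = B.kF φ := by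
  refine le_antisymm (kF_le.2 fun a ha => rk_le_kF (by simpa using ha))
    (kF_le.2 fun a ha => rk_le_kF (by simpa using ha))

theorem kF_subst_le (φ : Fml.{v}) (x : ℕ) (a : ZFSet.{v}) :
    B.kF (φ.subst x a) ≤ max (B.kF φ) (B.rk a) := by
  refine kF_le.2 fun b hb => ?_
  rcases φ.pars_subst x a hb with rfl | h
  · exact le_max_right _ _
  · exact (rk_le_kF h).trans (le_max_left _ _)

theorem kF_rel_le (φ : Fml.{v}) (c : ZFSet.{v}) :
    B.kF (φ.rel c) ≤ max (B.kF φ) (B.rk c) := by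
  refine kF_le.2 fun b hb => ?_
  rcases φ.pars_rel c hb with rfl | h
  · exact le_max_right _ _
  · exact (rk_le_kF h).trans (le_max_left _ _)

theorem kF_rel_all (x : ℕ) (φ : Fml.{v}) (c : ZFSet.{v}) :
    B.kF (φ.rel c) ≤ B.kF ((Fml.all x φ).rel c) := by
  simp only [Fml.rel]; split_ifs <;> simp [kF]

theorem kF_rel_ex (x : ℕ) (φ : Fml.{v}) (c : ZFSet.{v}) :
    B.kF (φ.rel c) ≤ B.kF ((Fml.ex x φ).rel c) := by
  simp only [Fml.rel]; split_ifs <;> simp [kF]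

/-! ### Closed formulas -/

namespace IsF

variable {γ : Ordinal.{v}} {φ ψ : Fml.{v}} {x : ℕ}

theorem neg (h : B.IsF γ φ) : B.IsF γ φ.neg := by simpa [IsF] using h

theorem and : B.IsF γ (.and φ ψ) ↔ B.IsF γ φ ∧ B.IsF γ ψ := by
  simp only [IsF, Fml.fv, Fml.pars, Finset.union_eq_empty, Set.mem_union]
  constructor
  · exact fun h => ⟨⟨h.1.1, fun a ha => h.2 a (.inl ha)⟩, h.1.2, fun a ha => h.2 a (.inr ha)⟩
  · exact fun h => ⟨⟨h.1.1, h.2.1⟩, fun a ha => ha.elim (h.1.2 a) (h.2.2 a)⟩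

theorem or : B.IsF γ (.or φ ψ) ↔ B.IsF γ φ ∧ B.IsF γ ψ := IsF.and

theorem all_subst (h : B.IsF γ (.all x φ)) {a : ZFSet.{v}} (ha : a ∈ B.L γ) :
    B.IsF γ (φ.subst x a) := by
  refine ⟨by rw [Fml.fv_subst]; exact h.1, fun b hb => ?_⟩
  rcases φ.pars_subst x a hb with rfl | hb
  · exact ha
  · exact h.2 b hb

theorem ex_subst (h : B.IsF γ (.ex x φ)) {a : ZFSet.{v}} (ha : a ∈ B.L γ) :
    B.IsF γ (φ.subst x a) := all_subst (x := x) h ha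

theorem rel (h : B.IsF γ φ) {c : ZFSet.{v}} (hc : c ∈ B.L γ) : B.IsF γ (φ.rel c) := by
  refine ⟨by simpa using h.1, fun b hb => ?_⟩
  rcases φ.pars_rel c hb with rfl | hb
  · exact hc
  · exact h.2 b hb

theorem mem_par {a b : ZFSet.{v}} (ha : a ∈ B.L γ) (hb : b ∈ B.L γ) :
    B.IsF γ (.mem (.par a) (.par b)) := by
  simp [IsF, Fml.fv, Fml.pars, Trm.fv, Trm.pars, ha, hb]

theorem nmem_par {a b : ZFSet.{v}} (ha : a ∈ B.L γ) (hb : b ∈ B.L γ) :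
    B.IsF γ (.nmem (.par a) (.par b)) := mem_par ha hb

theorem kF_lt (h : B.IsF γ φ) (hγ : 0 < γ) : B.kF φ < γ := by
  replace h := h.2
  induction φ with
  | mem s t => cases s <;> cases t <;> simp_all [kF, kTrm, Fml.pars, Trm.pars] <;>
      simp [rk_lt hγ, h]
  | nmem s t => cases s <;> cases t <;> simp_all [kF, kTrm, Fml.pars, Trm.pars] <;>
      simp [rk_lt hγ, h]
  | eq s t => cases s <;> cases t <;> simp_all [kF, kTrm, Fml.pars, Trm.pars] <;>
      simp [rk_lt hγ, h]
  | neq s t => cases s <;> cases t <;> simp_all [kF, kTrm, Fml.pars, Trm.pars] <;>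
      simp [rk_lt hγ, h]
  | and φ ψ h₁ h₂ =>
    exact max_lt (h₁ fun a ha => h a (.inl ha)) (h₂ fun a ha => h a (.inr ha))
  | or φ ψ h₁ h₂ =>
    exact max_lt (h₁ fun a ha => h a (.inl ha)) (h₂ fun a ha => h a (.inr ha))
  | all x φ ih => exact ih h
  | ex x φ ih => exact ih h

end IsF

end Base

end Collapsing

namespace Collapsing

universe v

namespace Base

variable {B : Base.{v}}

/-! ### The Kleene-Brouwer ordering -/

theorem lt_irrefl' {γ : Ordinal.{v}} {a : ZFSet.{v}} (ha : a ∈ B.L γ) : ¬ B.lt a a := by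
  have := B.lt_wo γ
  exact irrefl_of (fun a b : {a : ZFSet.{v} // a ∈ stage B.u γ} => B.lt a.1 b.1) ⟨a, ha⟩

theorem lt_trans' {γ : Ordinal.{v}} {a b c : ZFSet.{v}} (ha : a ∈ B.L γ) (hb : b ∈ B.L γ)
    (hc : c ∈ B.L γ) : B.lt a b → B.lt b c → B.lt a c := by
  have := B.lt_wo γ
  exact trans_of (fun a b : {a : ZFSet.{v} // a ∈ stage B.u γ} => B.lt a.1 b.1)
    (a := ⟨a, ha⟩) (b := ⟨b, hb⟩) (c := ⟨c, hc⟩)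

theorem lt_trichotomy' {γ : Ordinal.{v}} {a b : ZFSet.{v}} (ha : a ∈ B.L γ) (hb : b ∈ B.L γ) :
    B.lt a b ∨ a = b ∨ B.lt b a := by
  have := B.lt_wo γ
  have h := trichotomous_of (fun a b : {a : ZFSet.{v} // a ∈ stage B.u γ} => B.lt a.1 b.1)
    ⟨a, ha⟩ ⟨b, hb⟩
  rcases h with h | h | h
  · exact .inl h
  · exact .inr (.inl (congrArg Subtype.val h))
  · exact .inr (.inr h)

theorem cons_suffix_inj {a b : ZFSet.{v}} {ρ ρ' σ : List ZFSet.{v}} (h : (a :: ρ) <:+ σ)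
    (h' : (b :: ρ') <:+ σ) (hl : ρ.length = ρ'.length) : a = b ∧ ρ = ρ' := by
  have := (List.suffix_of_suffix_length_le h h' (by simp [hl])).eq_of_length (by simp [hl])
  simpa using this

theorem KB_irrefl {γ : Ordinal.{v}} {σ : List ZFSet.{v}} (hσ : ∀ a ∈ σ, a ∈ B.L γ) :
    ¬ B.KB σ σ := by
  rintro (⟨_, h⟩ | ⟨ρ, a, b, ha, hb, h⟩)
  · exact h rfl
  · obtain ⟨rfl, -⟩ := cons_suffix_inj ha hb rfl
    exact lt_irrefl' (hσ a (ha.subset (by simp))) h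

theorem KB_trans {γ : Ordinal.{v}} {σ τ υ : List ZFSet.{v}} (hσ : ∀ a ∈ σ, a ∈ B.L γ)
    (hτ : ∀ a ∈ τ, a ∈ B.L γ) (hυ : ∀ a ∈ υ, a ∈ B.L γ) (h₁ : B.KB σ τ) (h₂ : B.KB τ υ) :
    B.KB σ υ := by
  have hne : ∀ {x y : List ZFSet.{v}}, x.length < y.length → x ≠ y := fun h e => by
    rw [e] at h; exact lt_irrefl _ h
  rcases h₁ with ⟨h₁, n₁⟩ | ⟨ρ, a, b, ha, hb, hab⟩ <;>
    rcases h₂ with ⟨h₂, n₂⟩ | ⟨ρ', c, d, hc, hd, hcd⟩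
  · refine .inl ⟨h₂.trans h₁, hne ?_⟩
    exact h₂.length_le.trans_lt (h₁.length_le.lt_of_ne fun e => n₁ (h₁.eq_of_length e))
  · exact .inr ⟨ρ', c, d, hc.trans h₁, hd, hcd⟩
  · by_cases hl : (b :: ρ).length ≤ υ.length
    · exact .inr ⟨ρ, a, b, ha, List.suffix_of_suffix_length_le hb h₂ hl, hab⟩
    · have hυρ : υ <:+ ρ := List.suffix_of_suffix_length_le h₂ ((List.suffix_cons b ρ).trans hb)
        (by simp at hl; omega)
      refine .inl ⟨(hυρ.trans (List.suffix_cons a ρ)).trans ha, hne ?_⟩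
      have := ha.length_le
      simp at hl this
      omega
  · rcases lt_trichotomy ρ.length ρ'.length with hl | hl | hl
    · have : (b :: ρ) <:+ ρ' := List.suffix_of_suffix_length_le hb
        ((List.suffix_cons c ρ').trans hc) (by simpa using hl)
      exact .inr ⟨ρ, a, b, ha, (this.trans (List.suffix_cons d ρ')).trans hd, hab⟩
    · obtain ⟨rfl, rfl⟩ := cons_suffix_inj hb hc hl
      exact .inr ⟨ρ, a, d, ha, hd, lt_trans' (hσ a (ha.subset (by simp)))
        (hτ b (hb.subset (by simp))) (hυ d (hd.subset (by simp))) hab hcd⟩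
    · have : (c :: ρ') <:+ ρ := List.suffix_of_suffix_length_le hc
        ((List.suffix_cons b ρ).trans hb) (by simpa using hl)
      exact .inr ⟨ρ', c, d, (this.trans (List.suffix_cons a ρ)).trans ha, hd, hcd⟩

theorem suffix_or_split (σ τ : List ZFSet.{v}) : σ <:+ τ ∨ τ <:+ σ ∨
    ∃ ρ a b, a ≠ b ∧ (a :: ρ) <:+ σ ∧ (b :: ρ) <:+ τ := by
  induction σ with
  | nil => exact .inl τ.nil_suffix
  | cons x σ ih =>
    rcases ih with ⟨p, rfl⟩ | h | ⟨ρ, a, b, hab, ha, hb⟩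
    · rcases List.eq_nil_or_concat p with rfl | ⟨p, y, rfl⟩
      · exact .inr (.inl (List.suffix_cons x _))
      · by_cases hxy : x = y
        · subst hxy; exact .inl ⟨p, by simp⟩
        · exact .inr (.inr ⟨σ, x, y, hxy, List.suffix_rfl, ⟨p, by simp⟩⟩)
    · exact .inr (.inl (h.trans (List.suffix_cons x σ)))
    · exact .inr (.inr ⟨ρ, a, b, hab, ha.trans (List.suffix_cons x σ), hb⟩)

theorem KB_trichotomy {γ : Ordinal.{v}} {σ τ : List ZFSet.{v}} (hσ : ∀ a ∈ σ, a ∈ B.L γ)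
    (hτ : ∀ a ∈ τ, a ∈ B.L γ) : B.KB σ τ ∨ σ = τ ∨ B.KB τ σ := by
  by_cases e : σ = τ
  · exact .inr (.inl e)
  rcases suffix_or_split σ τ with h | h | ⟨ρ, a, b, hab, ha, hb⟩
  · exact .inr (.inr (.inl ⟨h, e⟩))
  · exact .inl (.inl ⟨h, Ne.symm e⟩)
  · rcases lt_trichotomy' (hσ a (ha.subset (by simp))) (hτ b (hb.subset (by simp)))
      with h | h | h
    · exact .inl (.inr ⟨ρ, a, b, ha, hb, h⟩)
    · exact absurd h hab
    · exact .inr (.inr (.inr ⟨ρ, b, a, hb, ha, h⟩))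

theorem KB_cons (a : ZFSet.{v}) (σ : List ZFSet.{v}) : B.KB (a :: σ) σ :=
  .inl ⟨List.suffix_cons a σ, by simp⟩

/-! ### Nodes of the search tree -/

theorem searchStep_mem_L {γ : Ordinal.{v}} {σ : List ZFSet.{v}} {Γ Γ' : List Fml.{v}}
    {a : ZFSet.{v}} (h : B.searchStep γ σ Γ a = some Γ') : a ∈ B.L γ := by
  by_contra ha
  have h0 : a ≠ ∅ := fun e => ha (by simp [e])
  have h1 : a ≠ {∅} := fun e => ha (by simp [e])
  unfold searchStep at h
  split_ifs at h
  rcases hr : redex Γ with _ | ⟨Γ₀, φ, Γ₁⟩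
  · simp [hr] at h
  · cases φ <;> simp_all

theorem searchStep_congr {γ γ' : Ordinal.{v}} {σ : List ZFSet.{v}} {Γ Γ' : List Fml.{v}}
    {a : ZFSet.{v}} (h : B.searchStep γ σ Γ a = some Γ') (ha : a ∈ B.L γ') :
    B.searchStep γ' σ Γ a = some Γ' := by
  have ha' := searchStep_mem_L h
  rw [← h]
  simp only [searchStep, ha, ha']

theorem searchLab_mem_L {γ : Ordinal.{v}} {σ : List ZFSet.{v}} {Γ : List Fml.{v}}
    (h : B.searchLab γ σ = some Γ) : ∀ a ∈ σ, a ∈ B.L γ := by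
  induction σ generalizing Γ with
  | nil => simp
  | cons b σ ih =>
    obtain ⟨Δ, h₁, h₂⟩ := Option.bind_eq_some_iff.1 h
    intro a ha
    rcases List.mem_cons.1 ha with rfl | ha
    · exact searchStep_mem_L h₂
    · exact ih h₁ a ha

theorem searchLab_congr {γ γ' : Ordinal.{v}} {σ : List ZFSet.{v}} {Γ : List Fml.{v}}
    (h : B.searchLab γ σ = some Γ) (hσ : ∀ a ∈ σ, a ∈ B.L γ') : B.searchLab γ' σ = some Γ := by
  induction σ generalizing Γ with
  | nil => exact h
  | cons b σ ih =>
    obtain ⟨Δ, h₁, h₂⟩ := Option.bind_eq_some_iff.1 h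
    exact Option.bind_eq_some_iff.2 ⟨Δ, ih h₁ fun a ha => hσ a (by simp [ha]),
      searchStep_congr h₂ (hσ b (by simp))⟩

theorem rk_le_rkS {σ : List ZFSet.{v}} {a : ZFSet.{v}} (h : a ∈ σ) : B.rk a ≤ B.rkS σ := by
  induction σ with
  | nil => simp at h
  | cons b σ ih =>
    simp only [rkS, List.foldr]
    rcases List.mem_cons.1 h with rfl | h
    · exact le_max_left _ _
    · exact (ih h).trans (le_max_right _ _)

theorem rkS_cons (a : ZFSet.{v}) (σ : List ZFSet.{v}) :
    B.rkS (a :: σ) = max (B.rk a) (B.rkS σ) := rfl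

/-! ### The ordering of terms -/

@[simp] theorem not_lt_zero (s : Tm.{v}) : ¬ B.Lt s .zero := nofun

@[simp] theorem zero_lt_iff {s : Tm.{v}} : B.Lt .zero s ↔ s ≠ .zero := by
  constructor
  · rintro h rfl; exact not_lt_zero _ h
  · cases s with
    | zero => exact fun h => absurd rfl h
    | eps σ => exact fun _ => .zero_eps σ
    | oadd s β r => exact fun _ => .zero_oadd s β r

@[simp] theorem eps_lt_eps {σ τ : List ZFSet.{v}} : B.Lt (.eps σ) (.eps τ) ↔ B.KB σ τ :=
  ⟨fun h => by cases h; assumption, .eps_eps σ τ⟩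

@[simp] theorem eps_lt_oadd {σ : List ZFSet.{v}} {t q : Tm.{v}} {γ : Ordinal.{v}} :
    B.Lt (.eps σ) (.oadd t γ q) ↔ B.Lt (.eps σ) t ∨ t = .eps σ := by
  constructor
  · intro h
    cases h with
    | eps_oadd _ _ _ _ h => exact .inl h
    | eps_oadd_self => exact .inr rfl
  · rintro (h | rfl)
    · exact .eps_oadd _ _ _ _ h
    · exact .eps_oadd_self _ _ _

@[simp] theorem oadd_lt_eps {τ : List ZFSet.{v}} {s r : Tm.{v}} {β : Ordinal.{v}} :
    B.Lt (.oadd s β r) (.eps τ) ↔ B.Lt s (.eps τ) :=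
  ⟨fun h => by cases h; assumption, .oadd_eps _ _ _ _⟩

theorem oadd_lt_oadd {s r t q : Tm.{v}} {β γ : Ordinal.{v}} :
    B.Lt (.oadd s β r) (.oadd t γ q) ↔ B.Lt s t ∨ s = t ∧ (β < γ ∨ β = γ ∧ B.Lt r q) := by
  constructor
  · intro h
    cases h with
    | oadd_exp _ _ _ _ _ _ h => exact .inl h
    | oadd_coeff _ _ _ _ _ h => exact .inr ⟨rfl, .inl h⟩
    | oadd_tail _ _ _ _ h => exact .inr ⟨rfl, .inr ⟨rfl, h⟩⟩
  · rintro (h | ⟨rfl, h | ⟨rfl, h⟩⟩)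
    · exact .oadd_exp _ _ _ _ _ _ h
    · exact .oadd_coeff _ _ _ _ _ h
    · exact .oadd_tail _ _ _ _ h

/-- All sequences that occur in a term have their entries in `L δ`. On such terms the ordering is
linear, whether or not they are in normal form. -/
def Ent (B : Base.{v}) (δ : Ordinal.{v}) : Tm.{v} → Prop
  | .zero => True
  | .eps σ => ∀ a ∈ σ, a ∈ B.L δ
  | .oadd s _ r => Ent B δ s ∧ Ent B δ r

/-- The number of symbols of a term. -/
def _root_.Collapsing.Tm.size : Tm.{v} → ℕ
  | .zero => 0
  | .eps _ => 0
  | .oadd s _ r => s.size + r.size + 1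

theorem tm_lt_irrefl {δ : Ordinal.{v}} {s : Tm.{v}} (hs : B.Ent δ s) : ¬ B.Lt s s := by
  induction s with
  | zero => simp
  | eps σ => rw [eps_lt_eps]; exact KB_irrefl hs
  | oadd s β r h₁ h₂ => rw [oadd_lt_oadd]; have := h₁ hs.1; have := h₂ hs.2; simp_all

theorem tm_lt_trans {δ : Ordinal.{v}} {s t u : Tm.{v}} (hs : B.Ent δ s) (ht : B.Ent δ t)
    (hu : B.Ent δ u) (h₁ : B.Lt s t) (h₂ : B.Lt t u) : B.Lt s u := by
  induction hn : s.size + t.size + u.size using Nat.strong_induction_on generalizing s t u with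
  | _ n ih =>
  subst hn
  cases u with
  | zero => exact absurd h₂ (not_lt_zero _)
  | eps υ =>
    cases t with
    | zero => exact absurd h₁ (not_lt_zero _)
    | eps τ =>
      cases s with
      | zero => simp
      | eps σ => rw [eps_lt_eps] at *; exact KB_trans hs ht hu h₁ h₂
      | oadd s β r =>
        rw [oadd_lt_eps] at *
        exact ih _ (by simp only [Tm.size]; omega) hs.1 ht hu h₁ h₂ rfl
    | oadd t γ q =>
      cases s with
      | zero => simp
      | eps σ =>
        rw [oadd_lt_eps] at h₂
        rw [eps_lt_oadd] at h₁
        rcases h₁ with h₁ | rfl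
        · exact ih _ (by simp only [Tm.size]; omega) hs ht.1 hu h₁ h₂ rfl
        · exact h₂
      | oadd s β r =>
        rw [oadd_lt_eps] at *
        rcases oadd_lt_oadd.1 h₁ with h₁ | ⟨rfl, -⟩
        · exact ih _ (by simp only [Tm.size]; omega) hs.1 ht.1 hu h₁ h₂ rfl
        · exact h₂
  | oadd u ε p =>
    cases t with
    | zero => exact absurd h₁ (not_lt_zero _)
    | eps τ =>
      rw [eps_lt_oadd] at h₂
      cases s with
      | zero => simp
      | eps σ =>
        rw [eps_lt_oadd]
        rcases h₂ with h₂ | rfl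
        · exact .inl (ih _ (by simp only [Tm.size]; omega) hs ht hu.1 h₁ h₂ rfl)
        · exact .inl h₁
      | oadd s β r =>
        rw [oadd_lt_eps] at h₁
        rw [oadd_lt_oadd]
        rcases h₂ with h₂ | rfl
        · exact .inl (ih _ (by simp only [Tm.size]; omega) hs.1 ht hu.1 h₁ h₂ rfl)
        · exact .inl h₁
    | oadd t γ q =>
      rw [oadd_lt_oadd] at h₂
      cases s with
      | zero => simp
      | eps σ =>
        rw [eps_lt_oadd] at h₁ ⊢
        rcases h₂ with h₂ | ⟨rfl, -⟩
        · rcases h₁ with h₁ | rfl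
          · exact .inl (ih _ (by simp only [Tm.size]; omega) hs ht.1 hu.1 h₁ h₂ rfl)
          · exact .inl h₂
        · exact h₁
      | oadd s β r =>
        rw [oadd_lt_oadd] at h₁ ⊢
        rcases h₁ with h₁ | ⟨rfl, h₁⟩ <;> rcases h₂ with h₂ | ⟨rfl, h₂⟩
        · exact .inl (ih _ (by simp only [Tm.size]; omega) hs.1 ht.1 hu.1 h₁ h₂ rfl)
        · exact .inl h₁
        · exact .inl h₂
        · refine .inr ⟨rfl, ?_⟩
          rcases h₁ with h₁ | ⟨rfl, h₁⟩ <;> rcases h₂ with h₂ | ⟨rfl, h₂⟩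
          · exact .inl (h₁.trans h₂)
          · exact .inl h₁
          · exact .inl h₂
          · exact .inr ⟨rfl, ih _ (by simp only [Tm.size]; omega) hs.2 ht.2 hu.2 h₁ h₂ rfl⟩

theorem tm_trichotomy {δ : Ordinal.{v}} {s t : Tm.{v}} (hs : B.Ent δ s) (ht : B.Ent δ t) :
    B.Lt s t ∨ s = t ∨ B.Lt t s := by
  induction s generalizing t with
  | zero => cases t <;> simp
  | eps σ =>
    induction t with
    | zero => simp
    | eps τ => simpa using KB_trichotomy hs ht
    | oadd t γ q ih _ =>
      simp only [eps_lt_oadd, oadd_lt_eps]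
      rcases ih ht.1 with h | h | h
      · exact .inl (.inl h)
      · exact .inl (.inr h.symm)
      · exact .inr (.inr h)
  | oadd s β r ih₁ ih₂ =>
    cases t with
    | zero => simp
    | eps τ =>
      simp only [eps_lt_oadd, oadd_lt_eps]
      rcases ih₁ (t := .eps τ) hs.1 ht with h | h | h
      · exact .inl h
      · exact .inr (.inr (.inr h))
      · exact .inr (.inr (.inl h))
    | oadd t γ q =>
      simp only [oadd_lt_oadd, Tm.oadd.injEq]
      rcases ih₁ hs.1 ht.1 with h | rfl | h
      · exact .inl (.inl h)
      · rcases lt_trichotomy β γ with h | rfl | h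
        · exact .inl (.inr ⟨rfl, .inl h⟩)
        · rcases ih₂ hs.2 ht.2 with h | rfl | h
          · exact .inl (.inr ⟨rfl, .inr ⟨rfl, h⟩⟩)
          · exact .inr (.inl ⟨rfl, rfl, rfl⟩)
          · exact .inr (.inr (.inr ⟨rfl, .inr ⟨rfl, h⟩⟩))
        · exact .inr (.inr (.inr ⟨rfl, .inl h⟩))
      · exact .inr (.inr (.inl h))

theorem exponent_lt (s : Tm.{v}) (β : Ordinal.{v}) (r : Tm.{v}) : B.Lt s (.oadd s β r) := by
  induction s generalizing β r with
  | zero => simp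
  | eps σ => simp
  | oadd s β' r' ih _ => exact .oadd_exp _ _ _ _ _ _ (ih _ _)

theorem InS.mem_L {γ : Ordinal.{v}} {σ : List ZFSet.{v}} (h : B.InS γ σ) :
    ∀ a ∈ σ, a ∈ B.L γ := by
  obtain ⟨Γ, h⟩ := h
  exact searchLab_mem_L h

theorem WfTm.ent {γ : Ordinal.{v}} {b : Bool} {s : Tm.{v}} (h : B.WfTm γ b s) :
    B.Ent (Ordinal.omega0 ^ γ) s := by
  induction s generalizing b with
  | zero => trivial
  | eps σ => simp only [WfTm] at h; exact h.2.mem_L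
  | oadd s β r h₁ h₂ => simp only [WfTm] at h; exact ⟨h₁ h.1, h₂ h.2.2.2.1⟩

theorem ent_of_mem {γ : Ordinal.{v}} {s : Tm.{v}} (h : s ∈ B.Eps γ) :
    B.Ent (Ordinal.omega0 ^ γ) s := WfTm.ent h

theorem WfTm.mono {γ γ' : Ordinal.{v}} (hγ : γ ≤ γ') {b : Bool} {s : Tm.{v}}
    (h : B.WfTm γ b s) : B.WfTm γ' b s := by
  have hle : Ordinal.omega0.{v} ^ γ ≤ Ordinal.omega0 ^ γ' :=
    Ordinal.opow_le_opow_right Ordinal.omega0_pos hγ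
  induction s generalizing b with
  | zero => trivial
  | eps σ =>
    simp only [WfTm] at h ⊢
    obtain ⟨h₁, Γ, h₂⟩ := h
    exact ⟨h₁, Γ, searchLab_congr h₂ fun a ha => B.L_mono hle (searchLab_mem_L h₂ a ha)⟩
  | oadd s β r h₁ h₂ =>
    simp only [WfTm] at h ⊢
    exact ⟨h₁ h.1, h.2.1, h.2.2.1.trans_le hle, h₂ h.2.2.2.1, h.2.2.2.2⟩

theorem Eps_mono {γ γ' : Ordinal.{v}} (hγ : γ ≤ γ') {s : Tm.{v}} (h : s ∈ B.Eps γ) :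
    s ∈ B.Eps γ' := WfTm.mono hγ h

section Order

variable {γ : Ordinal.{v}} {s t u : Tm.{v}}

theorem Lt.irrefl (hs : s ∈ B.Eps γ) : ¬ B.Lt s s := tm_lt_irrefl (ent_of_mem hs)

theorem Lt.trans (hs : s ∈ B.Eps γ) (ht : t ∈ B.Eps γ) (hu : u ∈ B.Eps γ) (h₁ : B.Lt s t)
    (h₂ : B.Lt t u) : B.Lt s u :=
  tm_lt_trans (ent_of_mem hs) (ent_of_mem ht) (ent_of_mem hu) h₁ h₂

theorem lt_or_le (hs : s ∈ B.Eps γ) (ht : t ∈ B.Eps γ) : B.Lt s t ∨ B.Le t s := by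
  rcases tm_trichotomy (ent_of_mem hs) (ent_of_mem ht) with h | h | h
  · exact .inl h
  · exact .inr (.inr h.symm)
  · exact .inr (.inl h)

theorem Le.refl (s : Tm.{v}) : B.Le s s := .inr rfl

theorem Lt.le (h : B.Lt s t) : B.Le s t := .inl h

theorem Lt.trans_le (hs : s ∈ B.Eps γ) (ht : t ∈ B.Eps γ) (hu : u ∈ B.Eps γ) (h₁ : B.Lt s t)
    (h₂ : B.Le t u) : B.Lt s u := by
  rcases h₂ with h₂ | rfl
  · exact h₁.trans hs ht hu h₂
  · exact h₁

theorem Le.trans_lt (hs : s ∈ B.Eps γ) (ht : t ∈ B.Eps γ) (hu : u ∈ B.Eps γ) (h₁ : B.Le s t)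
    (h₂ : B.Lt t u) : B.Lt s u := by
  rcases h₁ with h₁ | rfl
  · exact h₁.trans hs ht hu h₂
  · exact h₂

theorem Le.trans (hs : s ∈ B.Eps γ) (ht : t ∈ B.Eps γ) (hu : u ∈ B.Eps γ) (h₁ : B.Le s t)
    (h₂ : B.Le t u) : B.Le s u := by
  rcases h₁ with h₁ | rfl
  · exact .inl (h₁.trans_le hs ht hu h₂)
  · exact h₂

theorem Lt.not_le (hs : s ∈ B.Eps γ) (ht : t ∈ B.Eps γ) (h : B.Lt s t) : ¬ B.Le t s :=
  fun h' => Lt.irrefl hs (h.trans_le hs ht hs h')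

theorem zero_le (s : Tm.{v}) : B.Le .zero s := by
  by_cases h : s = .zero
  · exact .inr h.symm
  · exact .inl (zero_lt_iff.2 h)

theorem tmax_cases (s t : Tm.{v}) : B.tmax s t = s ∨ B.tmax s t = t := by
  unfold tmax; split_ifs <;> simp

theorem tmax_mem (hs : s ∈ B.Eps γ) (ht : t ∈ B.Eps γ) : B.tmax s t ∈ B.Eps γ := by
  rcases tmax_cases (B := B) s t with h | h <;> rwa [h]

theorem le_tmax_left (s t : Tm.{v}) : B.Le s (B.tmax s t) := by
  unfold tmax; split_ifs with h
  · exact h.le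
  · exact .refl _

theorem le_tmax_right (hs : s ∈ B.Eps γ) (ht : t ∈ B.Eps γ) : B.Le t (B.tmax s t) := by
  unfold tmax; split_ifs with h
  · exact .refl _
  · exact (lt_or_le hs ht).resolve_left h

theorem tmax_le (h₁ : B.Le s u) (h₂ : B.Le t u) : B.Le (B.tmax s t) u := by
  rcases tmax_cases (B := B) s t with h | h <;> rwa [h]

end Order

/-! ### Sums -/

/-- The leading exponent of a sum is smaller than `s`. -/
def HeadLt (B : Base.{v}) (x s : Tm.{v}) : Prop := ∀ s' β' r', x = .oadd s' β' r' → B.Lt s' s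

theorem headLt_zero (s : Tm.{v}) : B.HeadLt .zero s := nofun

theorem headLt_oadd {s t r : Tm.{v}} {β : Ordinal.{v}} :
    B.HeadLt (.oadd s β r) t ↔ B.Lt s t := by
  constructor
  · exact fun h => h _ _ _ rfl
  · rintro h _ _ _ ⟨⟩; exact h

/-- Normal forms of sums, in which `ε_σ` is written as `Ω^(ε_σ) · 1`. -/
def Sums (B : Base.{v}) (γ : Ordinal.{v}) : Set Tm.{v} := {x | B.WfTm γ false x}

theorem zero_mem_sums (γ : Ordinal.{v}) : Tm.zero ∈ B.Sums γ := by
  simp [Sums, WfTm]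

theorem eps_notMem_sums {γ : Ordinal.{v}} {σ : List ZFSet.{v}} : Tm.eps σ ∉ B.Sums γ := by
  simp [Sums, WfTm]

theorem oadd_mem_sums {γ β : Ordinal.{v}} {s r : Tm.{v}} : Tm.oadd s β r ∈ B.Sums γ ↔
    s ∈ B.Eps γ ∧ 0 < β ∧ β < Ordinal.omega0 ^ γ ∧ r ∈ B.Sums γ ∧ B.HeadLt r s := by
  simp [Sums, WfTm, Eps, HeadLt]

theorem oadd_mem_Eps {γ β : Ordinal.{v}} {s r : Tm.{v}} : Tm.oadd s β r ∈ B.Eps γ ↔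
    Tm.oadd s β r ∈ B.Sums γ ∧ (r = .zero → β = 1 → ∀ σ, s ≠ .eps σ) := by
  simp only [Sums, Eps, Set.mem_ofPred_eq, WfTm]
  tauto

@[simp] theorem zero_addSum (y : Tm.{v}) : B.addSum .zero y = y := by
  simp [addSum]

@[simp] theorem oadd_addSum_zero (s r : Tm.{v}) (β : Ordinal.{v}) :
    B.addSum (.oadd s β r) .zero = .oadd s β r := by
  simp [addSum]

theorem addSum_zero {γ : Ordinal.{v}} {x : Tm.{v}} (hx : x ∈ B.Sums γ) : B.addSum x .zero = x := by
  cases x with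
  | zero => simp
  | eps σ => exact absurd hx eps_notMem_sums
  | oadd s β r => simp

theorem addSum_of_lt {s t r q : Tm.{v}} {β γ : Ordinal.{v}} (h : B.Lt s t) :
    B.addSum (.oadd s β r) (.oadd t γ q) = .oadd t γ q := by
  simp [addSum, h]

theorem addSum_of_eq {δ : Ordinal.{v}} {s r q : Tm.{v}} {β γ : Ordinal.{v}} (hs : s ∈ B.Eps δ) :
    B.addSum (.oadd s β r) (.oadd s γ q) = .oadd s (β + γ) q := by
  simp [addSum, Lt.irrefl hs]

theorem addSum_of_gt {δ : Ordinal.{v}} {s t r q : Tm.{v}} {β γ : Ordinal.{v}}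
    (hs : s ∈ B.Eps δ) (ht : t ∈ B.Eps δ) (h : B.Lt t s) :
    B.addSum (.oadd s β r) (.oadd t γ q) = .oadd s β (B.addSum r (.oadd t γ q)) := by
  have h1 : ¬ B.Lt s t := fun h' => Lt.irrefl hs (h'.trans hs ht hs h)
  have h2 : s ≠ t := fun e => Lt.irrefl hs (by rw [← e] at h; exact h)
  simp [addSum, h1, h2]

theorem lt_trich {δ : Ordinal.{v}} {s t : Tm.{v}} (hs : s ∈ B.Eps δ) (ht : t ∈ B.Eps δ) :
    B.Lt s t ∨ s = t ∨ B.Lt t s := tm_trichotomy (ent_of_mem hs) (ent_of_mem ht)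

theorem HeadLt.addSum {x y s : Tm.{v}} (hx : B.HeadLt x s) (hy : B.HeadLt y s) :
    B.HeadLt (B.addSum x y) s := by
  unfold Base.addSum
  split
  · split_ifs
    · exact hy
    · exact headLt_oadd.2 (headLt_oadd.1 hx)
    · exact headLt_oadd.2 (headLt_oadd.1 hx)
  · exact hx
  · exact hy

theorem addSum_mem {δ : Ordinal.{v}} {x y : Tm.{v}} (hx : x ∈ B.Sums δ) (hy : y ∈ B.Sums δ) :
    B.addSum x y ∈ B.Sums δ := by
  induction x with
  | zero => simpa using hy
  | eps σ => exact absurd hx eps_notMem_sums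
  | oadd s β r _ ih =>
    cases y with
    | zero => simpa using hx
    | eps σ => exact absurd hy eps_notMem_sums
    | oadd t γ q =>
      obtain ⟨hs, h0, hβ, hr, hsr⟩ := oadd_mem_sums.1 hx
      obtain ⟨ht, h0', hγ, hq, htq⟩ := oadd_mem_sums.1 hy
      rcases lt_trich hs ht with h | rfl | h
      · rwa [addSum_of_lt h]
      · rw [addSum_of_eq hs]
        exact oadd_mem_sums.2 ⟨hs, add_pos_of_pos_of_nonneg h0 (_root_.zero_le),
          Ordinal.isPrincipal_add_omega0_opow δ hβ hγ, hq, htq⟩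
      · rw [addSum_of_gt hs ht h]
        exact oadd_mem_sums.2 ⟨hs, h0, hβ, ih hr, hsr.addSum (headLt_oadd.2 h)⟩

theorem addSum_lt_addSum {δ : Ordinal.{v}} {x y z : Tm.{v}} (hx : x ∈ B.Sums δ)
    (hy : y ∈ B.Sums δ) (hz : z ∈ B.Sums δ) (h : B.Lt y z) :
    B.Lt (B.addSum x y) (B.addSum x z) := by
  induction x with
  | zero => simpa using h
  | eps σ => exact absurd hx eps_notMem_sums
  | oadd s β r _ ih =>
    obtain ⟨hs, h0, hβ, hr, hsr⟩ := oadd_mem_sums.1 hx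
    cases z with
    | zero => exact absurd h (not_lt_zero _)
    | eps σ => exact absurd hz eps_notMem_sums
    | oadd u ε p =>
      obtain ⟨hu, h0u, -, -, -⟩ := oadd_mem_sums.1 hz
      cases y with
      | zero =>
        rw [oadd_addSum_zero]
        rcases lt_trich hs hu with h' | rfl | h'
        · rw [addSum_of_lt h']; exact .oadd_exp _ _ _ _ _ _ h'
        · rw [addSum_of_eq hs]
          exact .oadd_coeff _ _ _ _ _ (lt_add_of_pos_right _ h0u)
        · rw [addSum_of_gt hs hu h']
          refine .oadd_tail _ _ _ _ ?_
          simpa [addSum_zero hr] using ih hr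
      | eps σ => exact absurd hy eps_notMem_sums
      | oadd t γ q =>
        obtain ⟨ht, -, -, -, -⟩ := oadd_mem_sums.1 hy
        rcases lt_trich hs ht with h1 | rfl | h1 <;> rcases lt_trich hs hu with h2 | rfl | h2
        · rwa [addSum_of_lt h1, addSum_of_lt h2]
        · rcases oadd_lt_oadd.1 h with h | ⟨rfl, h⟩
          · exact absurd (h1.trans hs ht hs h) (Lt.irrefl hs)
          · exact absurd h1 (Lt.irrefl hs)
        · rcases oadd_lt_oadd.1 h with h | ⟨rfl, h⟩
          · exact absurd ((h2.trans hu hs ht h1).trans hu ht hu h) (Lt.irrefl hu)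
          · exact absurd (h1.trans hs ht hs h2) (Lt.irrefl hs)
        · rw [addSum_of_eq hs, addSum_of_lt h2]; exact .oadd_exp _ _ _ _ _ _ h2
        · rw [addSum_of_eq hs, addSum_of_eq hs, oadd_lt_oadd]
          rcases oadd_lt_oadd.1 h with h' | ⟨-, h' | ⟨rfl, h'⟩⟩
          · exact absurd h' (Lt.irrefl hs)
          · exact .inr ⟨rfl, .inl (by simpa using h')⟩
          · exact .inr ⟨rfl, .inr ⟨rfl, h'⟩⟩
        · rcases oadd_lt_oadd.1 h with h | ⟨rfl, h⟩
          · exact absurd (h.trans hs hu hs h2) (Lt.irrefl hs)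
          · exact absurd h2 (Lt.irrefl hs)
        · rw [addSum_of_gt hs ht h1, addSum_of_lt h2]; exact .oadd_exp _ _ _ _ _ _ h2
        · rw [addSum_of_gt hs ht h1, addSum_of_eq hs]
          exact .oadd_coeff _ _ _ _ _ (lt_add_of_pos_right _ h0u)
        · rw [addSum_of_gt hs ht h1, addSum_of_gt hs hu h2]
          exact .oadd_tail _ _ _ _ (ih hr)

theorem le_addSum {δ : Ordinal.{v}} {x y : Tm.{v}} (hx : x ∈ B.Sums δ) (hy : y ∈ B.Sums δ) :
    B.Le y (B.addSum x y) := by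
  induction x with
  | zero => exact .inr (by simp)
  | eps σ => exact absurd hx eps_notMem_sums
  | oadd s β r _ ih =>
    obtain ⟨hs, h0, hβ, hr, hsr⟩ := oadd_mem_sums.1 hx
    cases y with
    | zero => exact .inl (by simp)
    | eps σ => exact absurd hy eps_notMem_sums
    | oadd t γ q =>
      obtain ⟨ht, -, -, -, -⟩ := oadd_mem_sums.1 hy
      rcases lt_trich hs ht with h | rfl | h
      · exact .inr (addSum_of_lt h).symm
      · rw [addSum_of_eq hs]
        rcases (le_add_self : γ ≤ β + γ).lt_or_eq with h | h
        · exact .inl (.oadd_coeff _ _ _ _ _ h)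
        · rw [← h]; exact .refl _
      · rw [addSum_of_gt hs ht h]; exact .inl (.oadd_exp _ _ _ _ _ _ h)

theorem addSum_assoc {δ : Ordinal.{v}} {x y z : Tm.{v}} (hx : x ∈ B.Sums δ) (hy : y ∈ B.Sums δ)
    (hz : z ∈ B.Sums δ) : B.addSum (B.addSum x y) z = B.addSum x (B.addSum y z) := by
  induction x with
  | zero => simp
  | eps σ => exact absurd hx eps_notMem_sums
  | oadd s β r _ ih =>
    obtain ⟨hs, h0, hβ, hr, hsr⟩ := oadd_mem_sums.1 hx
    cases y with
    | zero => simp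
    | eps σ => exact absurd hy eps_notMem_sums
    | oadd t γ q =>
      obtain ⟨ht, -, -, hq, -⟩ := oadd_mem_sums.1 hy
      cases z with
      | zero => rw [addSum_zero hy, addSum_zero (addSum_mem hx hy)]
      | eps σ => exact absurd hz eps_notMem_sums
      | oadd u ε p =>
        obtain ⟨hu, -, -, -, -⟩ := oadd_mem_sums.1 hz
        rcases lt_trich hs ht with h1 | rfl | h1 <;> rcases lt_trich ht hu with h2 | h2 | h2
        · rw [addSum_of_lt h1, addSum_of_lt h2, addSum_of_lt (h1.trans hs ht hu h2)]
        · subst h2; rw [addSum_of_lt h1, addSum_of_eq ht, addSum_of_lt h1]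
        · rw [addSum_of_lt h1, addSum_of_gt ht hu h2, addSum_of_lt h1]
        · rw [addSum_of_eq hs, addSum_of_lt h2, addSum_of_lt h2, addSum_of_lt h2]
        · subst h2
          rw [addSum_of_eq hs, addSum_of_eq hs, addSum_of_eq hs, addSum_of_eq hs, add_assoc]
        · rw [addSum_of_eq hs, addSum_of_gt hs hu h2, addSum_of_gt hs hu h2, addSum_of_eq hs]
        · rw [addSum_of_gt hs ht h1, addSum_of_lt h2]
          rcases lt_trich hs hu with h3 | h3 | h3
          · rw [addSum_of_lt h3, addSum_of_lt h3]
          · subst h3; rw [addSum_of_eq hs, addSum_of_eq hs]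
          · rw [addSum_of_gt hs hu h3, addSum_of_gt hs hu h3, ih hr, addSum_of_lt h2]
        · subst h2
          rw [addSum_of_gt hs ht h1, addSum_of_gt hs ht h1, ih hr, addSum_of_eq ht,
            addSum_of_gt hs ht h1]
        · rw [addSum_of_gt hs ht h1, addSum_of_gt hs hu (h2.trans hu ht hs h1), ih hr,
            addSum_of_gt ht hu h2, addSum_of_gt hs ht h1]

/-! ### Addition and exponentiation of terms -/

section Arith

variable {γ : Ordinal.{v}} {s t u : Tm.{v}}

theorem succ_pos' (γ : Ordinal.{v}) : 0 < Order.succ γ :=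
  _root_.zero_le.trans_lt (Order.lt_succ γ)

theorem one_lt_opow (hγ : 0 < γ) : (1 : Ordinal.{v}) < Ordinal.omega0 ^ γ :=
  Ordinal.one_lt_omega0.trans_le (Ordinal.left_le_opow _ hγ)

theorem toSum_mem (hγ : 0 < γ) (hs : s ∈ B.Eps γ) : s.toSum ∈ B.Sums γ := by
  cases s with
  | zero => exact zero_mem_sums γ
  | eps σ => exact oadd_mem_sums.2 ⟨hs, one_pos, one_lt_opow hγ, zero_mem_sums γ, headLt_zero _⟩
  | oadd s β r => exact (oadd_mem_Eps.1 hs).1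

theorem ofSum_mem {x : Tm.{v}} (hx : x ∈ B.Sums γ) : x.ofSum ∈ B.Eps γ := by
  cases x with
  | zero => simp [Tm.ofSum, Eps, WfTm]
  | eps σ => exact absurd hx eps_notMem_sums
  | oadd s β r =>
    cases s with
    | zero => exact oadd_mem_Eps.2 ⟨hx, by simp⟩
    | eps σ =>
      simp only [Tm.ofSum]
      split_ifs with h
      · exact (oadd_mem_sums.1 hx).1
      · exact oadd_mem_Eps.2 ⟨hx, fun h1 h2 => absurd ⟨h2, h1⟩ h⟩
    | oadd _ _ _ => exact oadd_mem_Eps.2 ⟨hx, by simp⟩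

theorem toSum_ofSum {x : Tm.{v}} (hx : x ∈ B.Sums γ) : x.ofSum.toSum = x := by
  cases x with
  | zero => rfl
  | eps σ => exact absurd hx eps_notMem_sums
  | oadd s β r =>
    cases s with
    | eps σ =>
      simp only [Tm.ofSum]
      split_ifs with h
      · rw [h.1, h.2]; rfl
      · rfl
    | _ => rfl

theorem ofSum_toSum (hs : s ∈ B.Eps γ) : s.toSum.ofSum = s := by
  cases s with
  | zero => rfl
  | eps σ => simp [Tm.toSum, Tm.ofSum]
  | oadd s β r =>
    cases s with
    | eps σ =>
      have := (oadd_mem_Eps.1 hs).2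
      simp only [Tm.toSum, Tm.ofSum]
      split_ifs with h
      · exact absurd rfl (this h.2 h.1 σ)
      · rfl
    | _ => rfl

theorem toSum_lt_toSum (hs : s ∈ B.Eps γ) (ht : t ∈ B.Eps γ) :
    B.Lt s.toSum t.toSum ↔ B.Lt s t := by
  cases s with
  | zero => cases t <;> simp [Tm.toSum]
  | eps σ =>
    cases t with
    | zero => simp [Tm.toSum]
    | eps τ =>
      simp only [Tm.toSum, oadd_lt_oadd, eps_lt_eps]
      simp
    | oadd t β q =>
      simp only [Tm.toSum, oadd_lt_oadd, eps_lt_oadd]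
      refine or_congr_right ⟨fun h => h.1.symm, ?_⟩
      rintro rfl
      refine ⟨rfl, ?_⟩
      obtain ⟨h₁, h₂⟩ := oadd_mem_Eps.1 ht
      obtain ⟨-, h0, -⟩ := oadd_mem_sums.1 h₁
      rcases (Order.one_le_iff_pos.2 h0).lt_or_eq with h | h
      · exact .inl h
      · refine .inr ⟨h, zero_lt_iff.2 fun hq => h₂ hq h.symm σ rfl⟩
  | oadd s β r =>
    cases t with
    | zero => simp [Tm.toSum]
    | eps τ =>
      simp only [Tm.toSum, oadd_lt_oadd, oadd_lt_eps, not_lt_zero, and_false, or_false]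
      refine or_iff_left ?_
      rintro ⟨rfl, h⟩
      obtain ⟨-, h0, -⟩ := oadd_mem_sums.1 (oadd_mem_Eps.1 hs).1
      exact absurd h (not_lt.2 (Order.one_le_iff_pos.2 h0))
    | oadd t γ q => rfl

theorem lt_of_toSum (hs : s ∈ B.Eps γ) (ht : t ∈ B.Eps γ) (h : B.Le s.toSum t.toSum) :
    B.Le s t := by
  rcases h with h | h
  · exact .inl ((toSum_lt_toSum hs ht).1 h)
  · exact .inr (by rw [← ofSum_toSum hs, h, ofSum_toSum ht])

theorem zero_mem_Eps (γ : Ordinal.{v}) : Tm.zero ∈ B.Eps γ := by simp [Eps, WfTm]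

theorem add_mem (hγ : 0 < γ) (hs : s ∈ B.Eps γ) (ht : t ∈ B.Eps γ) : B.add s t ∈ B.Eps γ :=
  ofSum_mem (addSum_mem (toSum_mem hγ hs) (toSum_mem hγ ht))

theorem toSum_add (hγ : 0 < γ) (hs : s ∈ B.Eps γ) (ht : t ∈ B.Eps γ) :
    (B.add s t).toSum = B.addSum s.toSum t.toSum :=
  toSum_ofSum (addSum_mem (toSum_mem hγ hs) (toSum_mem hγ ht))

theorem add_assoc' (hγ : 0 < γ) (hs : s ∈ B.Eps γ) (ht : t ∈ B.Eps γ) (hu : u ∈ B.Eps γ) :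
    B.add (B.add s t) u = B.add s (B.add t u) := by
  unfold add
  rw [toSum_ofSum (addSum_mem (toSum_mem hγ hs) (toSum_mem hγ ht)),
    toSum_ofSum (addSum_mem (toSum_mem hγ ht) (toSum_mem hγ hu)),
    addSum_assoc (toSum_mem hγ hs) (toSum_mem hγ ht) (toSum_mem hγ hu)]

theorem zero_add' (hs : s ∈ B.Eps γ) : B.add .zero s = s := by
  simp only [add, Tm.toSum, zero_addSum]
  exact ofSum_toSum hs

theorem add_zero' (hγ : 0 < γ) (hs : s ∈ B.Eps γ) : B.add s .zero = s := by
  unfold add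
  rw [show (Tm.zero.{v}).toSum = .zero from rfl, addSum_zero (toSum_mem hγ hs), ofSum_toSum hs]

theorem add_lt_add' (hγ : 0 < γ) (hs : s ∈ B.Eps γ) (ht : t ∈ B.Eps γ) (hu : u ∈ B.Eps γ)
    (h : B.Lt t u) : B.Lt (B.add s t) (B.add s u) := by
  rw [← toSum_lt_toSum (add_mem hγ hs ht) (add_mem hγ hs hu), toSum_add hγ hs ht,
    toSum_add hγ hs hu]
  exact addSum_lt_addSum (toSum_mem hγ hs) (toSum_mem hγ ht) (toSum_mem hγ hu)
    ((toSum_lt_toSum ht hu).2 h)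

theorem add_le_add' (hγ : 0 < γ) (hs : s ∈ B.Eps γ) (ht : t ∈ B.Eps γ) (hu : u ∈ B.Eps γ)
    (h : B.Le t u) : B.Le (B.add s t) (B.add s u) := by
  rcases h with h | rfl
  · exact .inl (add_lt_add' hγ hs ht hu h)
  · exact .refl _

theorem le_add_right' (hγ : 0 < γ) (hs : s ∈ B.Eps γ) (ht : t ∈ B.Eps γ) :
    B.Le t (B.add s t) := by
  refine lt_of_toSum ht (add_mem hγ hs ht) ?_
  rw [toSum_add hγ hs ht]
  exact le_addSum (toSum_mem hγ hs) (toSum_mem hγ ht)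

theorem le_add_left' (hγ : 0 < γ) (hs : s ∈ B.Eps γ) (ht : t ∈ B.Eps γ) :
    B.Le s (B.add s t) := by
  have := add_le_add' hγ hs (zero_mem_Eps γ) ht (zero_le t)
  rwa [add_zero' hγ hs] at this

theorem lt_add_of_pos (hγ : 0 < γ) (hs : s ∈ B.Eps γ) (ht : t ∈ B.Eps γ) (h : B.Lt .zero t) :
    B.Lt s (B.add s t) := by
  have := add_lt_add' hγ hs (zero_mem_Eps γ) ht h
  rwa [add_zero' hγ hs] at this

@[simp] theorem toSum_exp (s : Tm.{v}) : s.exp.toSum = .oadd s 1 .zero := by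
  cases s <;> rfl

theorem exp_mem (hγ : 0 < γ) (hs : s ∈ B.Eps γ) : s.exp ∈ B.Eps γ := by
  cases s with
  | eps σ => exact hs
  | _ => exact oadd_mem_Eps.2 ⟨oadd_mem_sums.2 ⟨hs, one_pos, one_lt_opow hγ, zero_mem_sums γ,
      headLt_zero _⟩, by simp⟩

theorem lt_exp_of_headLt {x : Tm.{v}} (hx : x ∈ B.Sums γ) (h : B.HeadLt x s) :
    B.Lt x (.oadd s 1 .zero) := by
  cases x with
  | zero => simp
  | eps σ => exact absurd hx eps_notMem_sums
  | oadd t β r => exact .oadd_exp _ _ _ _ _ _ (headLt_oadd.1 h)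

theorem exp_lt_exp (hγ : 0 < γ) (hs : s ∈ B.Eps γ) (ht : t ∈ B.Eps γ) (h : B.Lt s t) :
    B.Lt s.exp t.exp := by
  rw [← toSum_lt_toSum (exp_mem hγ hs) (exp_mem hγ ht), toSum_exp, toSum_exp]
  exact .oadd_exp _ _ _ _ _ _ h

theorem exp_add_exp_lt (hγ : 0 < γ) (hs : s ∈ B.Eps γ) (ht : t ∈ B.Eps γ) (hu : u ∈ B.Eps γ)
    (h₁ : B.Lt s u) (h₂ : B.Lt t u) : B.Lt (B.add s.exp t.exp) u.exp := by
  have h1 := exp_mem hγ hs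
  have h2 := exp_mem hγ ht
  rw [← toSum_lt_toSum (add_mem hγ h1 h2) (exp_mem hγ hu), toSum_add hγ h1 h2, toSum_exp u]
  refine lt_exp_of_headLt (addSum_mem (toSum_mem hγ h1) (toSum_mem hγ h2)) (HeadLt.addSum ?_ ?_)
  · rw [toSum_exp]; exact headLt_oadd.2 h₁
  · rw [toSum_exp]; exact headLt_oadd.2 h₂

theorem le_exp (s : Tm.{v}) : B.Le s s.exp := by
  cases s with
  | zero => exact zero_le _
  | eps σ => exact .refl _
  | oadd s β r => exact .inl (.oadd_exp _ _ _ _ _ _ (exponent_lt _ _ _))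

theorem exp_pos (s : Tm.{v}) : B.Lt .zero s.exp := by
  cases s <;> simp [Tm.exp]

/-! ### Ordinals as terms -/

theorem hat_of_ne {β : Ordinal.{v}} (h : β ≠ 0) : Tm.hat β = .oadd .zero β .zero := by
  simp [Tm.hat, h]

@[simp] theorem hat_zero : Tm.hat (0 : Ordinal.{v}) = .zero := by simp [Tm.hat]

theorem one_def : Tm.one.{v} = .oadd .zero 1 .zero := by simp [Tm.one, hat_of_ne]

@[simp] theorem toSum_hat (β : Ordinal.{v}) : (Tm.hat β).toSum = Tm.hat β := by
  unfold Tm.hat; split_ifs <;> rfl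

theorem hat_mem {β : Ordinal.{v}} (h : β < Ordinal.omega0 ^ γ) : Tm.hat β ∈ B.Eps γ := by
  by_cases e : β = 0
  · subst e; rw [hat_zero]; exact zero_mem_Eps γ
  · rw [hat_of_ne e]
    exact oadd_mem_Eps.2 ⟨oadd_mem_sums.2 ⟨zero_mem_Eps γ, pos_iff_ne_zero.2 e, h, zero_mem_sums γ,
      headLt_zero _⟩, by simp⟩

theorem lt_of_hat_mem {β : Ordinal.{v}} (h : Tm.hat β ∈ B.Eps γ) : β < Ordinal.omega0 ^ γ := by
  by_cases e : β = 0
  · subst e; exact Ordinal.opow_pos _ Ordinal.omega0_pos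
  · rw [hat_of_ne e] at h
    exact (oadd_mem_sums.1 (oadd_mem_Eps.1 h).1).2.2.1

@[simp] theorem hat_lt_hat {β δ : Ordinal.{v}} : B.Lt (.hat β) (.hat δ) ↔ β < δ := by
  by_cases e : β = 0 <;> by_cases e' : δ = 0
  · simp [e, e']
  · simp [e, e', hat_of_ne e', pos_iff_ne_zero]
  · simp [e', hat_of_ne e]
  · simp [hat_of_ne e, hat_of_ne e', oadd_lt_oadd]

theorem hat_injective {β δ : Ordinal.{v}} (h : Tm.hat β = Tm.hat δ) : β = δ := by
  by_cases e : β = 0 <;> by_cases e' : δ = 0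
  · rw [e, e']
  · simp [e, hat_of_ne e'] at h
  · simp [e', hat_of_ne e] at h
  · simpa [hat_of_ne e, hat_of_ne e'] using h

@[simp] theorem hat_le_hat {β δ : Ordinal.{v}} : B.Le (.hat β) (.hat δ) ↔ β ≤ δ := by
  rw [le_iff_lt_or_eq]
  exact or_congr hat_lt_hat ⟨hat_injective, fun h => h ▸ rfl⟩

@[simp] theorem hat_lt_Om (β : Ordinal.{v}) : B.Lt (.hat β) .Om := by
  by_cases e : β = 0
  · simp [e, Tm.Om]
  · rw [hat_of_ne e]
    refine .oadd_exp _ _ _ _ _ _ ?_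
    simp [one_def]

theorem add_hat (β δ : Ordinal.{v}) : B.add (.hat β) (.hat δ) = .hat (β + δ) := by
  unfold add
  rw [toSum_hat, toSum_hat]
  by_cases e : β = 0 <;> by_cases e' : δ = 0
  · simp [e, e', Tm.ofSum]
  · simp [e, Tm.ofSum, hat_of_ne e']
  · simp [e', Tm.ofSum, hat_of_ne e]
  · have : β + δ ≠ 0 := by simp [e]
    rw [hat_of_ne e, hat_of_ne e', hat_of_ne this, addSum_of_eq (zero_mem_Eps 0)]
    rfl

theorem Om_mem (hγ : 0 < γ) : Tm.Om ∈ B.Eps γ := by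
  have h1 : Tm.one ∈ B.Eps γ := hat_mem (one_lt_opow hγ)
  exact oadd_mem_Eps.2 ⟨oadd_mem_sums.2 ⟨h1, one_pos, one_lt_opow hγ, zero_mem_sums γ,
    headLt_zero _⟩, by simp [one_def]⟩

theorem lt_one (hs : s ∈ B.Eps γ) (h : B.Lt s .one) : s = .zero := by
  rw [one_def] at h
  cases s with
  | zero => rfl
  | eps σ => simp at h
  | oadd s β r =>
    obtain ⟨-, h0, -⟩ := oadd_mem_sums.1 (oadd_mem_Eps.1 hs).1
    rcases oadd_lt_oadd.1 h with h | ⟨-, h | ⟨-, h⟩⟩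
    · exact absurd h (not_lt_zero _)
    · exact absurd h (not_lt.2 (Order.one_le_iff_pos.2 h0))
    · exact absurd h (not_lt_zero _)

theorem eq_zero_of_headLt_zero {x : Tm.{v}} (hx : x ∈ B.Sums γ) (h : B.HeadLt x .zero) :
    x = .zero := by
  cases x with
  | zero => rfl
  | eps σ => exact absurd hx eps_notMem_sums
  | oadd s β r => exact absurd (headLt_oadd.1 h) (not_lt_zero _)

/-- The terms below `Ω` are the ordinals. -/
theorem exists_hat_of_lt_Om (hs : s ∈ B.Eps γ) (h : B.Lt s .Om) : ∃ β, s = .hat β := by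
  unfold Tm.Om at h
  cases s with
  | zero => exact ⟨0, by simp⟩
  | eps σ => simp [one_def] at h
  | oadd s β r =>
    obtain ⟨hs', h0, -, hr, hsr⟩ := oadd_mem_sums.1 (oadd_mem_Eps.1 hs).1
    rcases oadd_lt_oadd.1 h with h | ⟨-, h | ⟨-, h⟩⟩
    · obtain rfl := lt_one hs' h
      obtain rfl := eq_zero_of_headLt_zero hr hsr
      exact ⟨β, by rw [hat_of_ne h0.ne']⟩
    · exact absurd h (not_lt.2 (Order.one_le_iff_pos.2 h0))
    · exact absurd h (not_lt_zero _)

theorem one_mem_Eps (hγ : 0 < γ) : Tm.one ∈ B.Eps γ := hat_mem (one_lt_opow hγ)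

theorem addSum_one_le {x y : Tm.{v}} (hx : x ∈ B.Sums γ) (hy : y ∈ B.Sums γ) (h : B.Lt x y) :
    B.Le (B.addSum x .one) y := by
  rw [one_def]
  induction x generalizing y with
  | zero =>
    rw [zero_addSum]
    cases y with
    | zero => exact absurd h (not_lt_zero _)
    | eps σ => exact absurd hy eps_notMem_sums
    | oadd t β q =>
      obtain ⟨ht, h0, -, hq, hqt⟩ := oadd_mem_sums.1 hy
      by_cases e : t = .zero
      · subst e
        obtain rfl := eq_zero_of_headLt_zero hq hqt
        rcases (Order.one_le_iff_pos.2 h0).lt_or_eq with h | rfl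
        · exact .inl (.oadd_coeff _ _ _ _ _ h)
        · exact .refl _
      · exact .inl (.oadd_exp _ _ _ _ _ _ (zero_lt_iff.2 e))
  | eps σ => exact absurd hx eps_notMem_sums
  | oadd s β r _ ih =>
    obtain ⟨hs, h0, -, hr, hrs⟩ := oadd_mem_sums.1 hx
    cases y with
    | zero => exact absurd h (not_lt_zero _)
    | eps σ => exact absurd hy eps_notMem_sums
    | oadd t δ q =>
      obtain ⟨ht, -, -, hq, hqt⟩ := oadd_mem_sums.1 hy
      by_cases e : s = .zero
      · subst e
        rw [addSum_of_eq (zero_mem_Eps 0)]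
        obtain rfl := eq_zero_of_headLt_zero hr hrs
        rcases oadd_lt_oadd.1 h with h' | ⟨rfl, h' | ⟨rfl, h'⟩⟩
        · exact .inl (.oadd_exp _ _ _ _ _ _ h')
        · obtain rfl := eq_zero_of_headLt_zero hq hqt
          rcases (Order.add_one_le_of_lt h').lt_or_eq with h1 | rfl
          · exact .inl (.oadd_coeff _ _ _ _ _ h1)
          · exact .refl _
        · obtain rfl := eq_zero_of_headLt_zero hq hqt
          exact absurd h' (not_lt_zero _)
      · rw [addSum_of_gt hs (zero_mem_Eps γ) (zero_lt_iff.2 e)]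
        rcases oadd_lt_oadd.1 h with h' | ⟨rfl, h' | ⟨rfl, h'⟩⟩
        · exact .inl (.oadd_exp _ _ _ _ _ _ h')
        · exact .inl (.oadd_coeff _ _ _ _ _ h')
        · rcases ih hr hq h' with h1 | h1
          · exact .inl (.oadd_tail _ _ _ _ h1)
          · rw [h1]; exact .refl _

/-- `t + 1` is the successor of `t`. -/
theorem le_of_lt_add_one (hγ : 0 < γ) (hs : s ∈ B.Eps γ) (ht : t ∈ B.Eps γ)
    (h : B.Lt s (B.add t .one)) : B.Le s t := by
  rcases lt_or_le ht hs with h' | h'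
  · exfalso
    have h1 := one_mem_Eps (B := B) hγ
    refine (h.not_le hs (add_mem hγ ht h1)) (lt_of_toSum (add_mem hγ ht h1) hs ?_)
    rw [toSum_add hγ ht h1, show (Tm.one.{v}).toSum = .one from toSum_hat 1]
    exact addSum_one_le (toSum_mem hγ ht) (toSum_mem hγ hs) ((toSum_lt_toSum ht hs).2 h')
  · exact h'

theorem lt_add_one (hγ : 0 < γ) (ht : t ∈ B.Eps γ) : B.Lt t (B.add t .one) :=
  lt_add_of_pos hγ ht (one_mem_Eps hγ) (by simp [one_def])

theorem exp_add_hat_le (hγ : 0 < γ) (hs : s ∈ B.Eps γ) (ht : t ∈ B.Eps γ) (h : B.Lt s t)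
    {β : Ordinal.{v}} (hβ : β < Ordinal.omega0 ^ γ) : B.Lt (B.add s.exp (.hat β)) t.exp := by
  have h1 := exp_mem hγ hs
  have h2 := hat_mem (B := B) hβ
  rw [← toSum_lt_toSum (add_mem hγ h1 h2) (exp_mem hγ ht), toSum_add hγ h1 h2, toSum_exp t]
  refine lt_exp_of_headLt (addSum_mem (toSum_mem hγ h1) (toSum_mem hγ h2)) (HeadLt.addSum ?_ ?_)
  · rw [toSum_exp]; exact headLt_oadd.2 h
  · rw [toSum_hat]
    by_cases e : β = 0
    · rw [e, hat_zero]; exact headLt_zero _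
    · rw [hat_of_ne e]
      refine headLt_oadd.2 (zero_lt_iff.2 ?_)
      rintro rfl
      exact not_lt_zero _ h

/-! ### The rank of a term -/

theorem star_le (h : s ∈ B.Eps (Order.succ γ)) : B.star s ≤ γ := csInf_le' h

theorem mem_Eps_star (h : s ∈ B.Eps γ) : s ∈ B.Eps (Order.succ (B.star s)) :=
  csInf_mem (s := {γ | s ∈ B.Eps (Order.succ γ)}) ⟨γ, Eps_mono (Order.le_succ γ) h⟩

theorem star_hat_le {β : Ordinal.{v}} (h : β < Ordinal.omega0 ^ Order.succ γ) :
    B.star (.hat β) ≤ γ := star_le (hat_mem h)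

theorem lt_opow_succ (β : Ordinal.{v}) : β < Ordinal.omega0 ^ Order.succ β :=
  (Ordinal.right_le_opow _ Ordinal.one_lt_omega0).trans_lt
    ((Ordinal.opow_lt_opow_iff_right Ordinal.one_lt_omega0).2 (Order.lt_succ β))

theorem star_hat_le_self (β : Ordinal.{v}) : B.star (.hat β) ≤ β := star_hat_le (lt_opow_succ β)

theorem lt_opow_star_hat (β : Ordinal.{v}) :
    β < Ordinal.omega0 ^ Order.succ (B.star (.hat β)) :=
  lt_of_hat_mem (mem_Eps_star (hat_mem (lt_opow_succ β)))

theorem star_hat_mono {β δ : Ordinal.{v}} (h : β ≤ δ) : B.star (.hat β) ≤ B.star (.hat δ) :=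
  star_hat_le (h.trans_lt (lt_opow_star_hat δ))

@[simp] theorem star_zero : B.star .zero = 0 :=
  le_antisymm (star_le (zero_mem_Eps _)) (_root_.zero_le)

theorem star_add_le (hs : s ∈ B.Eps γ) (ht : t ∈ B.Eps γ) :
    B.star (B.add s t) ≤ max (B.star s) (B.star t) :=
  star_le (add_mem (succ_pos' _)
    (Eps_mono (Order.succ_le_succ (le_max_left _ _)) (mem_Eps_star hs))
    (Eps_mono (Order.succ_le_succ (le_max_right _ _)) (mem_Eps_star ht)))

theorem star_exp_le (hs : s ∈ B.Eps γ) : B.star s.exp ≤ B.star s :=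
  star_le (exp_mem (succ_pos' _) (mem_Eps_star hs))

theorem star_tmax_le : B.star (B.tmax s t) ≤ max (B.star s) (B.star t) := by
  rcases tmax_cases (B := B) s t with h | h <;> simp [h]

@[simp] theorem star_Om : B.star .Om = 0 :=
  le_antisymm (star_le (Om_mem (succ_pos' _))) (_root_.zero_le)

@[simp] theorem star_one : B.star .one = 0 :=
  le_antisymm (star_le (one_mem_Eps (succ_pos' _))) (_root_.zero_le)

theorem star_eps_le {σ : List ZFSet.{v}} (h : B.InS γ σ) : B.star (.eps σ) ≤ B.rkS σ := by
  obtain ⟨Γ, h⟩ := h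
  refine star_le ?_
  have : ∀ a ∈ σ, a ∈ B.L (Ordinal.omega0 ^ Order.succ (B.rkS σ)) := fun a ha =>
    mem_L_of_rk_lt (searchLab_mem_L h a ha) ((rk_le_rkS ha).trans_lt (lt_opow_succ _))
  exact ⟨rfl, Γ, searchLab_congr h this⟩

end Arith

end Base

end Collapsing

namespace Collapsing

universe v

namespace Base

variable {B : Base.{v}} {α : Ordinal.{v}} {ϑ : Tm.{v} → Ordinal.{v}}

/-! ### Bachmann-Howard collapses -/

theorem le_opow (α : Ordinal.{v}) : α ≤ Ordinal.omega0 ^ α :=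
  Ordinal.right_le_opow _ Ordinal.one_lt_omega0

theorem star_hat_omega_le : B.star (.hat Ordinal.omega0) ≤ 1 := by
  refine star_hat_le ?_
  have := (Ordinal.opow_lt_opow_iff_right Ordinal.one_lt_omega0).2 (Order.lt_succ (1 : Ordinal.{v}))
  rwa [Ordinal.opow_one] at this

namespace IsBH

variable (hϑ : B.IsBH α ϑ)

include hϑ

theorem pos : 0 < α := _root_.zero_le.trans_lt (hϑ.lt_alpha _ (zero_mem_Eps α))

theorem hat_mem {s : Tm.{v}} (hs : s ∈ B.Eps α) : Tm.hat (ϑ s) ∈ B.Eps α :=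
  Base.hat_mem ((hϑ.lt_alpha s hs).trans_le (le_opow α))

theorem star_lt_opow {s : Tm.{v}} (hs : s ∈ B.Eps α) : B.star s < Ordinal.omega0 ^ α :=
  ((hϑ.star_lt s hs).trans (hϑ.lt_alpha s hs)).trans_le (le_opow α)

theorem hat_star_mem {s : Tm.{v}} (hs : s ∈ B.Eps α) : Tm.hat (B.star s) ∈ B.Eps α :=
  Base.hat_mem (hϑ.star_lt_opow hs)

/-- On ordinals the collapse is strictly increasing, and hence inflationary. -/
theorem le_hat {γ : Ordinal.{v}} (hγ : γ < Ordinal.omega0 ^ α) : γ ≤ ϑ (.hat γ) := by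
  induction γ using WellFoundedLT.induction with
  | _ γ ih =>
    by_contra! h
    have h1 : ϑ (.hat γ) < Ordinal.omega0 ^ α := h.trans hγ
    refine (ih _ h h1).not_gt (hϑ.mono _ (Base.hat_mem h1) _ (Base.hat_mem hγ) (by simpa) ?_)
    exact (star_hat_mono h.le).trans_lt (hϑ.star_lt _ (Base.hat_mem hγ))

/-- Values `ϑ(t)` with `Ω ≤ t` are closed under the inverse of the rank function on ordinals. -/
theorem lt_of_star_lt {t : Tm.{v}} (ht : t ∈ B.Eps α) (hΩ : B.Le .Om t) {γ : Ordinal.{v}}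
    (hγ : γ < Ordinal.omega0 ^ α) (h : B.star (.hat γ) < ϑ t) : γ < ϑ t :=
  (hϑ.le_hat hγ).trans_lt (hϑ.mono _ (Base.hat_mem hγ) _ ht
    ((hat_lt_Om γ).trans_le (Base.hat_mem hγ) (Om_mem hϑ.pos) ht hΩ) h)

theorem one_lt {t : Tm.{v}} (ht : t ∈ B.Eps α) (hΩ : B.Le .Om t) : 1 < ϑ t := by
  refine hϑ.lt_of_star_lt ht hΩ (one_lt_opow hϑ.pos) ?_
  exact (star_hat_le (γ := 0) (one_lt_opow (succ_pos' 0))).trans_lt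
    (_root_.zero_le.trans_lt (hϑ.star_lt t ht))

theorem one_lt_alpha : 1 < α :=
  (hϑ.one_lt (Om_mem hϑ.pos) (.refl _)).trans (hϑ.lt_alpha _ (Om_mem hϑ.pos))

theorem omega_lt_opow : Ordinal.omega0 < Ordinal.omega0 ^ α := by
  have := (Ordinal.opow_lt_opow_iff_right Ordinal.one_lt_omega0).2 hϑ.one_lt_alpha
  rwa [Ordinal.opow_one] at this

theorem add_omega_lt {t : Tm.{v}} (ht : t ∈ B.Eps α) (hΩ : B.Le .Om t) {γ : Ordinal.{v}}
    (h : γ < ϑ t) : γ + Ordinal.omega0 < ϑ t := by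
  have hγ : γ < Ordinal.omega0 ^ α := h.trans ((hϑ.lt_alpha t ht).trans_le (le_opow α))
  refine hϑ.lt_of_star_lt ht hΩ (Ordinal.isPrincipal_add_omega0_opow α hγ hϑ.omega_lt_opow) ?_
  rw [← add_hat (B := B)]
  refine (star_add_le (Base.hat_mem hγ) (Base.hat_mem hϑ.omega_lt_opow)).trans_lt (max_lt ?_ ?_)
  · exact (star_hat_le_self γ).trans_lt h
  · exact star_hat_omega_le.trans_lt (hϑ.one_lt ht hΩ)

end IsBH

/-! ### The operators `H` -/

theorem H_induction {t : Tm.{v}} {X : Set Ordinal.{v}} {p : Tm.{v} → Prop} (zero : p .zero)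
    (base : ∀ γ ∈ X, p (.hat γ)) (star : ∀ s ∈ B.Eps α, p (.hat (B.star s)) → p s)
    (theta : ∀ s, p s → B.Lt s (B.add t .one) → p (.hat (ϑ s)))
    (down : ∀ s ∈ B.Eps α, ∀ s', p s' → B.Lt s' .Om → B.Lt s s' → p s) :
    ∀ s ∈ B.H α ϑ t X, p s := by
  intro s hs
  obtain ⟨n, hn⟩ := Set.mem_iUnion.1 hs
  clear hs
  induction n generalizing s with
  | zero =>
    rcases hn with ⟨γ, hγ, rfl⟩ | rfl
    · exact base γ hγ
    · exact zero
  | succ n ih =>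
    rcases hn with ((hn | ⟨h₁, h₂⟩) | ⟨s', h₁, h₂, rfl⟩) | ⟨h₁, s', h₂, h₃, h₄⟩
    · exact ih s hn
    · exact star s h₁ (ih _ h₂)
    · exact theta s' (ih _ h₁) h₂
    · exact down s h₁ s' (ih _ h₂) h₃ h₄

theorem zero_mem_H {t : Tm.{v}} {X : Set Ordinal.{v}} : Tm.zero ∈ B.H α ϑ t X :=
  Set.mem_iUnion.2 ⟨0, .inr rfl⟩

theorem base_mem_H {t : Tm.{v}} {X : Set Ordinal.{v}} {γ : Ordinal.{v}} (h : γ ∈ X) :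
    Tm.hat γ ∈ B.H α ϑ t X :=
  Set.mem_iUnion.2 ⟨0, .inl ⟨γ, h, rfl⟩⟩

theorem mem_H_of_star {t s : Tm.{v}} {X : Set Ordinal.{v}} (hs : s ∈ B.Eps α)
    (h : Tm.hat (B.star s) ∈ B.H α ϑ t X) : s ∈ B.H α ϑ t X := by
  obtain ⟨n, hn⟩ := Set.mem_iUnion.1 h
  exact Set.mem_iUnion.2 ⟨n + 1, .inl (.inl (.inr ⟨hs, hn⟩))⟩

theorem theta_mem_H' {t s : Tm.{v}} {X : Set Ordinal.{v}} (hs : s ∈ B.H α ϑ t X)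
    (h : B.Lt s (B.add t .one)) : Tm.hat (ϑ s) ∈ B.H α ϑ t X := by
  obtain ⟨n, hn⟩ := Set.mem_iUnion.1 hs
  exact Set.mem_iUnion.2 ⟨n + 1, .inl (.inr ⟨s, hn, h, rfl⟩)⟩

theorem mem_H_of_lt {t s s' : Tm.{v}} {X : Set Ordinal.{v}} (hs : s ∈ B.Eps α)
    (h : s' ∈ B.H α ϑ t X) (hΩ : B.Lt s' .Om) (hlt : B.Lt s s') : s ∈ B.H α ϑ t X := by
  obtain ⟨n, hn⟩ := Set.mem_iUnion.1 h
  exact Set.mem_iUnion.2 ⟨n + 1, .inr ⟨hs, s', hn, hΩ, hlt⟩⟩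

/-- The ordinals in `H t X`. They form an initial segment, and they determine `H t X`. -/
def J (B : Base.{v}) (α : Ordinal.{v}) (ϑ : Tm.{v} → Ordinal.{v}) (t : Tm.{v})
    (X : Set Ordinal.{v}) : Set Ordinal.{v} := {γ | Tm.hat γ ∈ B.H α ϑ t X}

theorem mem_J {t : Tm.{v}} {X : Set Ordinal.{v}} {γ : Ordinal.{v}} :
    γ ∈ B.J α ϑ t X ↔ Tm.hat γ ∈ B.H α ϑ t X := Iff.rfl

theorem base_mem_J {t : Tm.{v}} {X : Set Ordinal.{v}} {γ : Ordinal.{v}} (h : γ ∈ X) :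
    γ ∈ B.J α ϑ t X := base_mem_H h

theorem zero_mem_J {t : Tm.{v}} {X : Set Ordinal.{v}} : 0 ∈ B.J α ϑ t X := by
  rw [mem_J, hat_zero]; exact zero_mem_H

namespace IsBH

variable (hϑ : B.IsBH α ϑ)

include hϑ

theorem J_Iio {t : Tm.{v}} {X : Set Ordinal.{v}} (hX : ∀ γ ∈ X, γ < Ordinal.omega0 ^ α) :
    ∀ s ∈ B.H α ϑ t X, s ∈ B.Eps α ∧ B.star s ∈ B.J α ϑ t X := by
  refine H_induction (α := α) (ϑ := ϑ) (B := B) ⟨zero_mem_Eps α, by simpa using zero_mem_J⟩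
    ?_ ?_ ?_ ?_
  all_goals
    have down : ∀ γ β, γ ≤ β → β ∈ B.J α ϑ t X → γ < Ordinal.omega0 ^ α → γ ∈ B.J α ϑ t X := by
      intro γ β h hβ hγ
      rcases h.lt_or_eq with h | rfl
      · exact mem_H_of_lt (Base.hat_mem hγ) hβ (hat_lt_Om β) (by simpa)
      · exact hβ
  · intro γ hγ
    have h1 := Base.hat_mem (B := B) (hX γ hγ)
    exact ⟨h1, down _ γ (star_hat_le_self γ) (base_mem_J hγ) (hϑ.star_lt_opow h1)⟩
  · rintro s hs ⟨h1, h2⟩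
    exact ⟨hs, mem_H_of_star (B := B) (hϑ.hat_star_mem hs) h2⟩
  · rintro s ⟨hs, h1⟩ h2
    have h3 := hϑ.hat_mem hs
    exact ⟨h3, down _ _ (star_hat_le_self _) (theta_mem_H' (mem_H_of_star hs h1) h2)
      (hϑ.star_lt_opow h3)⟩
  · rintro s hs s' ⟨h1, h2⟩ h3 h4
    obtain ⟨β, rfl⟩ := exists_hat_of_lt_Om h1 h3
    have hβ : β ∈ B.J α ϑ t X := mem_H_of_star (B := B) h1 h2
    have hs' : s ∈ B.H α ϑ t X := mem_H_of_lt hs hβ h3 h4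
    obtain ⟨γ, rfl⟩ := exists_hat_of_lt_Om hs (h4.trans hs h1 (Om_mem hϑ.pos) h3)
    exact ⟨hs, down _ _ (star_hat_le_self _) hs' (hϑ.star_lt_opow hs)⟩

theorem J_down {t : Tm.{v}} {X : Set Ordinal.{v}}
    {γ β : Ordinal.{v}} (hβα : β < Ordinal.omega0 ^ α) (hβ : β ∈ B.J α ϑ t X) (h : γ ≤ β) :
    γ ∈ B.J α ϑ t X := by
  have := hϑ.pos
  rcases h.lt_or_eq with h | rfl
  · exact mem_H_of_lt (Base.hat_mem (h.trans hβα)) hβ (hat_lt_Om β) (by simpa)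
  · exact hβ

theorem lt_of_mem_J {t : Tm.{v}} {X : Set Ordinal.{v}} (hX : ∀ γ ∈ X, γ < Ordinal.omega0 ^ α)
    {γ : Ordinal.{v}} (hγ : γ ∈ B.J α ϑ t X) : γ < Ordinal.omega0 ^ α :=
  lt_of_hat_mem (hϑ.J_Iio hX _ hγ).1

theorem theta_mem_J {t s : Tm.{v}} {X : Set Ordinal.{v}} (hs : s ∈ B.Eps α) (ht : t ∈ B.Eps α)
    (h : B.Le s t) (hJ : B.star s ∈ B.J α ϑ t X) : ϑ s ∈ B.J α ϑ t X :=
  theta_mem_H' (mem_H_of_star hs hJ) (h.trans_lt hs ht (add_mem hϑ.pos ht (one_mem_Eps hϑ.pos))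
    (lt_add_one hϑ.pos ht))

theorem H_mono {t t' : Tm.{v}} {X X' : Set Ordinal.{v}} (ht : t ∈ B.Eps α) (ht' : t' ∈ B.Eps α)
    (hX : ∀ γ ∈ X, γ < Ordinal.omega0 ^ α) (h : B.Le t t') (hXX' : X ⊆ B.J α ϑ t' X') :
    B.H α ϑ t X ⊆ B.H α ϑ t' X' := by
  have key : ∀ s ∈ B.H α ϑ t X, s ∈ B.Eps α ∧ s ∈ B.H α ϑ t' X' := by
    refine H_induction (α := α) (ϑ := ϑ) (B := B) ⟨zero_mem_Eps α, zero_mem_H⟩ ?_ ?_ ?_ ?_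
    · exact fun γ hγ => ⟨Base.hat_mem (hX γ hγ), hXX' hγ⟩
    · exact fun s hs h => ⟨hs, mem_H_of_star hs h.2⟩
    · rintro s ⟨hs, h1⟩ h2
      refine ⟨hϑ.hat_mem hs, theta_mem_H' h1 ?_⟩
      have h3 := le_of_lt_add_one hϑ.pos hs ht h2
      exact (h3.trans hs ht ht' h).trans_lt hs ht' (add_mem hϑ.pos ht' (one_mem_Eps hϑ.pos))
        (lt_add_one hϑ.pos ht')
    · exact fun s hs s' h h1 h2 => ⟨hs, mem_H_of_lt hs h.2 h1 h2⟩
  exact fun s hs => (key s hs).2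

theorem J_mono {t t' : Tm.{v}} {X X' : Set Ordinal.{v}} (ht : t ∈ B.Eps α) (ht' : t' ∈ B.Eps α)
    (hX : ∀ γ ∈ X, γ < Ordinal.omega0 ^ α) (h : B.Le t t') (hXX' : X ⊆ B.J α ϑ t' X') :
    B.J α ϑ t X ⊆ B.J α ϑ t' X' := fun _ hγ => hϑ.H_mono ht ht' hX h hXX' hγ

/-- The ordinals controlled by `H t` lie below `ϑ(t')` for any `t' > t`. -/
theorem lt_theta_of_mem_J {t t' : Tm.{v}} (ht : t ∈ B.Eps α) (ht' : t' ∈ B.Eps α)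
    (hΩ : B.Le .Om t) (h : B.Lt t t') {γ : Ordinal.{v}} (hγ : γ ∈ B.J α ϑ t ∅) : γ < ϑ t' := by
  have hΩ' : B.Le .Om t' := hΩ.trans (Om_mem hϑ.pos) ht ht' h.le
  have key : ∀ s ∈ B.H α ϑ t ∅, s ∈ B.Eps α ∧ B.star s < ϑ t' := by
    refine H_induction (α := α) (ϑ := ϑ) (B := B) ⟨zero_mem_Eps α, ?_⟩ ?_ ?_ ?_ ?_
    · rw [star_zero]; exact zero_lt_one.trans (hϑ.one_lt ht' hΩ')
    · exact fun γ hγ => absurd hγ (Set.notMem_empty γ)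
    · exact fun s hs h => ⟨hs, hϑ.lt_of_star_lt ht' hΩ' (hϑ.star_lt_opow hs) h.2⟩
    · rintro s ⟨hs, h1⟩ h2
      have h3 := (le_of_lt_add_one hϑ.pos hs ht h2).trans_lt hs ht ht' h
      exact ⟨hϑ.hat_mem hs, (star_hat_le_self _).trans_lt (hϑ.mono s hs t' ht' h3 h1)⟩
    · rintro s hs s' ⟨hs', h1⟩ h2 h3
      obtain ⟨β, rfl⟩ := exists_hat_of_lt_Om hs' h2
      obtain ⟨γ, rfl⟩ := exists_hat_of_lt_Om hs (h3.trans hs hs' (Om_mem hϑ.pos) h2)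
      exact ⟨hs, (star_hat_mono (by simpa using h3.le)).trans_lt h1⟩
  obtain ⟨h1, h2⟩ := key _ hγ
  exact hϑ.lt_of_star_lt ht' hΩ' (lt_of_hat_mem h1) h2

/-- Any operator controls some ordinals beyond `ω`. -/
theorem omega_add_mem_J {t : Tm.{v}} {X : Set Ordinal.{v}} (ht : t ∈ B.Eps α) (hΩ : B.Le .Om t) :
    Ordinal.omega0 + 1 ∈ B.J α ϑ t X ∧ Ordinal.omega0 + 1 < Ordinal.omega0 ^ α := by
  have h0 : ϑ t ≤ Ordinal.omega0 ^ α := (hϑ.lt_alpha t ht).le.trans (le_opow α)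
  have hΩ' := Om_mem (B := B) hϑ.pos
  have h1 : ϑ .Om ∈ B.J α ϑ t X := hϑ.theta_mem_J hΩ' ht hΩ (by simpa using zero_mem_J)
  have h2 := hϑ.add_omega_lt hΩ' (.refl _) (hϑ.add_omega_lt hΩ' (.refl _) (hϑ.one_lt hΩ' (.refl _)))
  have h3 : Ordinal.omega0 + 1 ≤ ϑ .Om := by
    refine le_trans ?_ h2.le
    exact add_le_add le_add_self Ordinal.one_lt_omega0.le
  have h4 : ϑ .Om < Ordinal.omega0 ^ α := (hϑ.lt_alpha _ hΩ').trans_le (le_opow α)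
  exact ⟨hϑ.J_down h4 h1 h3, h3.trans_lt h4⟩

end IsBH

end Base

end Collapsing

namespace Collapsing

universe v

/-! ### Rules and local correctness, uniformly -/

/-- The formulas that a rule introduces. -/
def Rule.prin : Rule.{v} → Set Fml.{v}
  | .ax => ∅
  | .and ψ₀ ψ₁ => {.and ψ₀ ψ₁}
  | .or _ ψ₀ ψ₁ => {.or ψ₀ ψ₁}
  | .all x ψ => {.all x ψ}
  | .ex x _ ψ => {.ex x ψ}
  | .cut _ => ∅
  | .ref z x a y θ => {refConcl z x a y θ}
  | .rep _ => ∅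

/-- The formulas that a rule adds in the premise with index `a`. -/
def Rule.prem : Rule.{v} → ZFSet.{v} → Set Fml.{v}
  | .ax, _ => ∅
  | .and ψ₀ ψ₁, a => {φ | (a = ∅ ∧ φ = ψ₀) ∨ (a ≠ ∅ ∧ φ = ψ₁)}
  | .or i ψ₀ ψ₁, _ => {pick i ψ₀ ψ₁}
  | .all x ψ, a => {ψ.subst x a}
  | .ex x b ψ, _ => {ψ.subst x b}
  | .cut ψ, a => {φ | (a = ∅ ∧ φ = ψ) ∨ (a ≠ ∅ ∧ φ = ψ.neg)}
  | .ref _ x a y θ, _ => {refPrem x a y θ}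
  | .rep _, _ => ∅

/-- The rules for which heights have to drop by at least `ω`. -/
def Rule.Big : Rule.{v} → Prop
  | .all _ _ => True
  | .ex _ _ _ => True
  | _ => False

namespace Base

variable {B : Base.{v}}

/-- A rule over `L γ` leads to the sequent `Γ` of height `o`, from the sequents `Γ' a` of
heights `o' a`. -/
structure Step (B : Base.{v}) (γ : Ordinal.{v}) (q : Rule.{v}) (Γ : Finset Fml.{v}) (o : Tm.{v})
    (Γ' : ZFSet.{v} → Finset Fml.{v}) (o' : ZFSet.{v} → Tm.{v}) : Prop where
  ax : q = .ax → ∃ φ ∈ Γ, φ.TrueD0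
  prin : ∀ φ ∈ q.prin, φ ∈ Γ
  sub : ∀ a ∈ B.premises γ q, ∀ φ ∈ Γ' a, φ ∈ Γ ∨ φ ∈ q.prem a
  lt : ¬ q.Big → ∀ a ∈ B.premises γ q, B.Lt (o' a) o
  big : q.Big → ∀ a ∈ B.premises γ q, B.Le (B.add (o' a) (.hat Ordinal.omega0)) o
  ex : ∀ x b ψ, q = .ex x b ψ → B.Lt (.hat (B.rk b)) o
  ref : ∀ z x a y θ, q = .ref z x a y θ → B.Le .Om o

/-- Conditions (H1), (H2) and (H3), expressed in terms of the ordinals that the operator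
controls. -/
structure CondJ (B : Base.{v}) (α : Ordinal.{v}) (K : CollVal.{v}) (ϑ : Tm.{v} → Ordinal.{v})
    (P : Code.{v}) : Prop where
  star : B.star (B.o α K P) ∈ B.J α ϑ (B.h₀ K P) {B.h₁ α K P}
  seq : ∀ φ ∈ B.l α K P, B.kF φ ∈ B.J α ϑ (B.h₀ K P) {B.h₁ α K P}
  rule : B.kR (B.r α K P) ∈ B.J α ϑ (B.h₀ K P) {B.h₁ α K P}
  h₀_le : ∀ a ∈ B.premises (Ordinal.omega0 ^ α) (B.r α K P), B.Le (B.h₀ K (B.n α K P a)) (B.h₀ K P)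
  h₁_mem : ∀ a ∈ B.premises (Ordinal.omega0 ^ α) (B.r α K P),
    B.h₁ α K (B.n α K P a) ∈ B.J α ϑ (B.h₀ K P) {B.h₁ α K P, B.rk a}
  star_mem : ∀ a ∈ B.premises (Ordinal.omega0 ^ α) (B.r α K P),
    B.star (B.o α K (B.n α K P a)) ∈ B.J α ϑ (B.h₀ K P) {B.h₁ α K P, B.rk a}

/-- The part of well-typedness that does not refer to the last rule. -/
structure Typed (B : Base.{v}) (α : Ordinal.{v}) (K : CollVal.{v}) (P : Code.{v}) : Prop where
  l_mem : ∀ φ ∈ B.l α K P, B.IsF (Ordinal.omega0 ^ α) φ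
  o_mem : B.o α K P ∈ B.Eps α
  h₀_mem : B.h₀ K P ∈ B.Eps α
  Om_le_h₀ : B.Le .Om (B.h₀ K P)
  h₁_lt : B.h₁ α K P < Ordinal.omega0 ^ α

/-- Local correctness of a single code. -/
structure LC (B : Base.{v}) (α : Ordinal.{v}) (K : CollVal.{v}) (ϑ : Tm.{v} → Ordinal.{v})
    (P : Code.{v}) : Prop where
  r_mem : B.IsRule (Ordinal.omega0 ^ α) (B.r α K P)
  n_mem : ∀ a ∈ B.L (Ordinal.omega0 ^ α), B.IsCode α (B.n α K P a)
  step : B.Step (Ordinal.omega0 ^ α) (B.r α K P) (B.l α K P) (B.o α K P)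
    (fun a => B.l α K (B.n α K P a)) (fun a => B.o α K (B.n α K P a))
  condC : B.CondC α K P
  condJ : B.CondJ α K ϑ P

theorem Step.condL {α : Ordinal.{v}} {K : CollVal.{v}} {P : Code.{v}}
    (h : B.Step (Ordinal.omega0 ^ α) (B.r α K P) (B.l α K P) (B.o α K P)
      (fun a => B.l α K (B.n α K P a)) (fun a => B.o α K (B.n α K P a))) : B.CondL α K P := by
  have hsub := h.sub
  have hlt := h.lt
  have hbig := h.big
  have hprin := h.prin
  have hne : ({∅} : ZFSet.{v}) ≠ ∅ := fun e => by
    have : (∅ : ZFSet.{v}) ∈ ({∅} : ZFSet.{v}) := by simp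
    rw [e] at this
    exact ZFSet.notMem_empty _ this
  unfold CondL
  rcases hr : B.r α K P with
      _ | ⟨ψ₀, ψ₁⟩ | ⟨i, ψ₀, ψ₁⟩ | ⟨x, ψ⟩ | ⟨x, b, ψ⟩ | ψ | ⟨z, x, a, y, θ⟩ | b
  all_goals
    rw [hr] at hsub hlt hbig hprin
    simp only [premises, Rule.prem, Rule.Big, Rule.prin, Finset.subset_iff, Finset.mem_union,
      Finset.mem_singleton, Set.mem_singleton_iff, Set.mem_insert_iff, forall_eq_or_imp, forall_eq,
      not_true_eq_false, not_false_eq_true, forall_true_left, false_imp_iff, Set.mem_ofPred_eq,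
      hne, false_and, true_and, or_false, false_or, ne_eq, Set.mem_empty_iff_false]
      at hsub hlt hbig hprin ⊢
  · exact h.ax hr
  · exact ⟨hprin, hlt.1, hlt.2, fun φ hφ => hsub.1 φ hφ, fun φ hφ => hsub.2 φ hφ⟩
  · exact ⟨hprin, hlt, fun φ hφ => hsub φ hφ⟩
  · exact ⟨hprin, fun a ha => ⟨hbig a ha, fun φ hφ => hsub a ha φ hφ⟩⟩
  · exact ⟨hprin, hbig, h.ex _ _ _ hr, fun φ hφ => hsub φ hφ⟩
  · exact ⟨hlt.1, hlt.2, fun φ hφ => hsub.1 φ hφ, fun φ hφ => hsub.2 φ hφ⟩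
  · exact ⟨hprin, hlt, h.ref _ _ _ _ _ hr, fun φ hφ => hsub φ hφ⟩
  · exact ⟨hlt, fun φ hφ => hsub φ hφ⟩

theorem kS_mem_J {α : Ordinal.{v}} {ϑ : Tm.{v} → Ordinal.{v}} {t : Tm.{v}} {X : Set Ordinal.{v}}
    {Γ : Finset Fml.{v}} (h : ∀ φ ∈ Γ, B.kF φ ∈ B.J α ϑ t X) : B.kS Γ ∈ B.J α ϑ t X := by
  rcases Γ.eq_empty_or_nonempty with rfl | hΓ
  · exact zero_mem_J
  · obtain ⟨φ, hφ, e⟩ := Finset.exists_mem_eq_sup Γ hΓ B.kF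
    rw [kS, e]
    exact h φ hφ

theorem max_mem_J {α : Ordinal.{v}} {ϑ : Tm.{v} → Ordinal.{v}} {t : Tm.{v}} {X : Set Ordinal.{v}}
    {β γ : Ordinal.{v}} (hβ : β ∈ B.J α ϑ t X) (hγ : γ ∈ B.J α ϑ t X) :
    max β γ ∈ B.J α ϑ t X := by
  rcases max_choice β γ with h | h <;> rwa [h]

theorem premises_mem_L {γ : Ordinal.{v}} {q : Rule.{v}} (hq : B.IsRule γ q) :
    ∀ a ∈ B.premises γ q, a ∈ B.L γ := by
  intro a ha
  cases q <;> simp only [premises, Set.mem_singleton_iff, Set.mem_insert_iff,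
    Set.mem_empty_iff_false] at ha
  case and => rcases ha with rfl | rfl <;> simp
  case or => subst ha; simp
  case all => exact ha
  case ex => subst ha; simp
  case cut => rcases ha with rfl | rfl <;> simp
  case ref => subst ha; simp
  case rep => subst ha; exact hq

theorem locallyCorrect_of_LC {α : Ordinal.{v}} {K : CollVal.{v}} {ϑ : Tm.{v} → Ordinal.{v}}
    (hT : ∀ P, B.IsCode α P → B.Typed α K P) (h : ∀ P, B.IsCode α P → B.LC α K ϑ P) :
    B.LocallyCorrect α K ϑ := by
  intro P hP
  obtain ⟨h1, h2, h3, h4, h5⟩ := hT P hP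
  have hP' := h P hP
  refine ⟨⟨h1, hP'.r_mem, h2, hP'.n_mem, h3, h4, h5⟩, hP'.step.condL, hP'.condC, ?_⟩
  have hJ := hP'.condJ
  refine ⟨max_mem_J (max_mem_J hJ.star (kS_mem_J hJ.seq)) hJ.rule, hJ.h₀_le, fun a ha => ?_⟩
  exact ⟨hJ.h₁_mem a ha, mem_H_of_star
    (hT _ (hP'.n_mem a (premises_mem_L hP'.r_mem a ha))).o_mem (hJ.star_mem a ha)⟩

end Base

/-! ### Values on collapsed codes -/

/-- The number of symbols of a code. -/
def Code.size : Code.{v} → ℕ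
  | .basic _ => 0
  | .invAll _ _ _ P => P.size + 1
  | .invAnd _ _ _ P => P.size + 1
  | .redEx _ _ P₀ P₁ => P₀.size + P₁.size + 1
  | .redOr _ _ P₀ P₁ => P₀.size + P₁.size + 1
  | .cutElim P => P.size + 1
  | .axm _ => 0
  | .conj _ _ P₀ P₁ => P₀.size + P₁.size + 1
  | .disj _ _ _ P => P.size + 1
  | .bddEx _ _ P => P.size + 1
  | .bddAll _ _ _ P => P.size + 1
  | .coll _ P => P.size + 1

namespace CollVal

/-- Agreement of the values that do not involve rules, on codes of size below `m`. -/
def Agree₀ (m : ℕ) (K K' : CollVal.{v}) : Prop :=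
  ∀ t P, P.size < m → K.l t P = K'.l t P ∧ K.o t P = K'.o t P ∧ K.d t P = K'.d t P ∧
    K.h₀ t P = K'.h₀ t P ∧ K.h₁ t P = K'.h₁ t P

/-- Agreement of all values, on codes of size below `m`. -/
def Agree (m : ℕ) (K K' : CollVal.{v}) : Prop :=
  Agree₀ m K K' ∧ ∀ t P, P.size < m → K.r t P = K'.r t P ∧ K.n t P = K'.n t P

theorem Agree.mono {m m' : ℕ} {K K' : CollVal.{v}} (h : Agree m K K') (hm : m' ≤ m) :
    Agree m' K K' :=
  ⟨fun t P hP => h.1 t P (hP.trans_le hm), fun t P hP => h.2 t P (hP.trans_le hm)⟩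

theorem Agree.symm {m : ℕ} {K K' : CollVal.{v}} (h : Agree m K K') : Agree m K' K :=
  ⟨fun t P hP => by simp only [h.1 t P hP, and_self], fun t P hP => by
    simp only [h.2 t P hP, and_self]⟩

theorem Agree.trans {m : ℕ} {K K' K'' : CollVal.{v}} (h : Agree m K K') (h' : Agree m K' K'') :
    Agree m K K'' :=
  ⟨fun t P hP => by simp only [h.1 t P hP, h'.1 t P hP, and_self], fun t P hP => by
    simp only [h.2 t P hP, h'.2 t P hP, and_self]⟩

theorem eq_of_agree {K K' : CollVal.{v}} (h : ∀ m, Agree m K K') : K = K' := by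
  have h0 := fun t P => (h (P.size + 1)).1 t P (Nat.lt_succ_self _)
  have h1 := fun t P => (h (P.size + 1)).2 t P (Nat.lt_succ_self _)
  cases K
  cases K'
  congr
  · funext t P; exact (h0 t P).1
  · funext t P; exact (h1 t P).1
  · funext t P; exact (h0 t P).2.1
  · funext t P; exact (h1 t P).2
  · funext t P; exact (h0 t P).2.2.1
  · funext t P; exact (h0 t P).2.2.2.1
  · funext t P; exact (h0 t P).2.2.2.2

/-- Recursion over codes, as a fixed point theorem: a map that depends only on the values on smaller
codes has a fixed point. -/
theorem exists_fixedPoint (F : CollVal.{v} → CollVal.{v})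
    (hF : ∀ m K K', Agree m K K' → Agree (m + 1) (F K) (F K')) : ∃ K, F K = K := by
  let K₀ : CollVal.{v} := ⟨fun _ _ => ∅, fun _ _ => .ax, fun _ _ => .zero,
    fun _ _ _ => .axm (.eq (.par ∅) (.par ∅)), fun _ _ => 0, fun _ _ => .zero, fun _ _ => 0⟩
  have h1 : ∀ m j, Agree m (F^[m] K₀) (F^[m + j] K₀) := by
    intro m
    induction m with
    | zero => exact fun j => ⟨fun _ _ h => absurd h (Nat.not_lt_zero _),
        fun _ _ h => absurd h (Nat.not_lt_zero _)⟩
    | succ m ih =>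
      intro j
      rw [Nat.add_right_comm, Function.iterate_succ_apply', Function.iterate_succ_apply']
      exact hF _ _ _ (ih j)
  let K : CollVal.{v} := ⟨fun t P => (F^[P.size + 1] K₀).l t P,
    fun t P => (F^[P.size + 1] K₀).r t P,
    fun t P => (F^[P.size + 1] K₀).o t P, fun t P => (F^[P.size + 1] K₀).n t P,
    fun t P => (F^[P.size + 1] K₀).d t P, fun t P => (F^[P.size + 1] K₀).h₀ t P,
    fun t P => (F^[P.size + 1] K₀).h₁ t P⟩
  have h2 : ∀ m, Agree m K (F^[m] K₀) := by
    intro m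
    have : ∀ P : Code.{v}, P.size < m → Agree (P.size + 1) (F^[P.size + 1] K₀) (F^[m] K₀) := by
      intro P hP
      have := h1 (P.size + 1) (m - (P.size + 1))
      rwa [Nat.add_sub_cancel' hP] at this
    exact ⟨fun t P hP => (this P hP).1 t P (Nat.lt_succ_self _),
      fun t P hP => (this P hP).2 t P (Nat.lt_succ_self _)⟩
  refine ⟨K, eq_of_agree fun m => ?_⟩
  have h3 := hF _ _ _ (h2 m)
  rw [← Function.iterate_succ_apply' F] at h3
  exact (h3.trans (h2 (m + 1)).symm).mono (Nat.le_succ m)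

end CollVal

namespace Base

variable {B : Base.{v}} {α : Ordinal.{v}}

open CollVal

theorem static_congr {m : ℕ} {K K' : CollVal.{v}} (h : Agree₀ m K K') {P : Code.{v}}
    (hP : P.size ≤ m) : B.o α K P = B.o α K' P ∧ B.l α K P = B.l α K' P ∧
      B.d K P = B.d K' P ∧ B.h₀ K P = B.h₀ K' P ∧ B.h₁ α K P = B.h₁ α K' P := by
  induction P with
  | basic σ => exact ⟨rfl, rfl, rfl, rfl, rfl⟩
  | axm θ => exact ⟨rfl, rfl, rfl, rfl, rfl⟩
  | coll t P _ =>
    simp only [o, l, d, h₀, h₁]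
    simp only [Code.size] at hP
    obtain ⟨h1, h2, h3, h4, h5⟩ := h t P hP
    exact ⟨h2, h1, h3, h4, h5⟩
  | redEx x ψ P₀ P₁ h₀ h₁ | redOr x ψ P₀ P₁ h₀ h₁ | conj x ψ P₀ P₁ h₀ h₁ =>
    simp only [Code.size] at hP
    obtain ⟨h1, h2, h3, h4, h5⟩ := h₀ (by omega)
    obtain ⟨h1', h2', h3', h4', h5'⟩ := h₁ (by omega)
    simp only [o, l, d, Base.h₀, Base.h₁, h1, h2, h3, h4, h5, h1', h2', h3', h4', h5', and_self]
  | _ =>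
    rename_i ih
    simp only [Code.size] at hP
    obtain ⟨h1, h2, h3, h4, h5⟩ := ih (by omega)
    refine ⟨?_, ?_, ?_, ?_, ?_⟩
    all_goals
      simp only [o, l, d, h₀, h₁, h1, h2, h3, h4, h5]
      try rw [h1]

theorem dynamic_congr {m : ℕ} {K K' : CollVal.{v}} (h : Agree m K K') {P : Code.{v}}
    (hP : P.size ≤ m) : B.r α K P = B.r α K' P ∧ B.n α K P = B.n α K' P := by
  induction P with
  | basic σ => exact ⟨rfl, by funext a; rfl⟩
  | axm θ => exact ⟨rfl, by funext a; rfl⟩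
  | coll t P _ =>
    simp only [Code.size] at hP
    exact ⟨(h.2 t P hP).1, by funext a; simp only [n, (h.2 t P hP).2]⟩
  | redEx x ψ P₀ P₁ h₀ h₁ | redOr x ψ P₀ P₁ h₀ h₁ | conj x ψ P₀ P₁ h₀ h₁ =>
    simp only [Code.size] at hP
    obtain ⟨h1, h2⟩ := h₀ (by omega)
    exact ⟨by simp only [r, h1], by funext a; simp only [n, h1, h2]⟩
  | bddEx φ β P ih =>
    simp only [Code.size] at hP
    obtain ⟨h1, h2⟩ := ih (by omega)
    have h3 := (static_congr (B := B) (α := α) h.1 (P := P) (by omega)).1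
    exact ⟨by simp only [r, h1]; rw [h3], by funext a; simp only [n, h1, h2]; rw [h3]⟩
  | _ =>
    rename_i ih
    simp only [Code.size] at hP
    obtain ⟨h1, h2⟩ := ih (by omega)
    refine ⟨?_, ?_⟩
    · simp only [r, h1]
      try rw [h1]
    · funext a
      simp only [n, h1, h2]
      try rw [h1]

/-- The assumptions under which the collapse `C_t P` is defined as in the theorem. -/
structure Collapsible (B : Base.{v}) (α : Ordinal.{v}) (K : CollVal.{v})
    (ϑ : Tm.{v} → Ordinal.{v}) (t : Tm.{v}) (P : Code.{v}) : Prop where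
  sigma : ∀ φ ∈ B.l α K P, φ.IsSigma
  d_le : B.d K P ≤ 2
  h₀_le : B.Le (B.h₀ K P) t
  t_mem : t ∈ B.H α ϑ t ∅
  h₁_mem : .hat (B.h₁ α K P) ∈ B.H α ϑ t ∅

/-- The formula `0 = 0`, which is the end-sequent where the collapse is not defined. -/
def triv : Fml.{v} := .eq (.par ∅) (.par ∅)

open Classical in
/-- The last rule of `C_t P`, where `q` is the last rule of `P` and where `N a` are the immediate
subcodes of `P`, with heights given by `o'`. Reflection becomes an existential quantifier, with
the stage `L β` as witness; a cut over a formula of height one is bounded to such a stage. -/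
noncomputable def collRule (B : Base.{v}) (ϑ : Tm.{v} → Ordinal.{v}) (o' : Code.{v} → Tm.{v})
    (t : Tm.{v}) (N : ZFSet.{v} → Code.{v}) : Rule.{v} → Rule.{v}
  | .ref z x a y θ =>
      .ex z (B.L (ϑ (B.add t (o' (N ∅)).exp))) (.ball x (.par a) (.bex y (.var z) θ))
  | .cut (.ex x θ) =>
      if θ.IsD0 ∧ ¬ Fml.BddEx x θ then
        .cut ((Fml.ex x θ).rel (B.L (ϑ (B.add t (o' (N ∅)).exp))))
      else .cut (.ex x θ)
  | .cut (.all x θ) =>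
      if θ.IsD0 ∧ ¬ Fml.BddAll x θ then
        .cut ((Fml.all x θ).rel (B.L (ϑ (B.add t (o' (N {∅})).exp))))
      else .cut (.all x θ)
  | q => q

open Classical in
/-- The immediate subcodes of `C_t P`. For a bounded universal quantifier over `b`, the premises
with index `a ∉ b` are derived from the true formula `a ∉ b`, since their operators need not be
below `H_t`. In a cut over a formula of height one, the existential premise is bounded first; the
collapse of the other premise uses the larger term `t + Ω^o`, so that the bound is controlled. -/
noncomputable def collNext (ϑ : Tm.{v} → Ordinal.{v}) (B : Base.{v}) (o' : Code.{v} → Tm.{v})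
    (t : Tm.{v}) (N : ZFSet.{v} → Code.{v}) : Rule.{v} → ZFSet.{v} → Code.{v}
  | .ref _ x a y θ, _ =>
      .bddEx (refPrem x a y θ) (ϑ (B.add t (o' (N ∅)).exp)) (.coll t (N ∅))
  | .all x (.or (.nmem (.var y) (.par b)) χ), a =>
      if y = x ∧ a ∉ b then
        .disj false (.nmem (.par a) (.par b)) (χ.subst x a) (.axm (.nmem (.par a) (.par b)))
      else .coll t (N a)
  | .cut (.ex x θ), a =>
      if θ.IsD0 ∧ ¬ Fml.BddEx x θ then
        if a = ∅ then .bddEx (.ex x θ) (ϑ (B.add t (o' (N ∅)).exp)) (.coll t (N ∅))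
        else .coll (B.add t (o' (N ∅)).exp)
          (.bddAll x θ.neg (ϑ (B.add t (o' (N ∅)).exp)) (N {∅}))
      else .coll t (N a)
  | .cut (.all x θ), a =>
      if θ.IsD0 ∧ ¬ Fml.BddAll x θ then
        if a = ∅ then .coll (B.add t (o' (N {∅})).exp)
          (.bddAll x θ (ϑ (B.add t (o' (N {∅})).exp)) (N ∅))
        else .bddEx (.ex x θ.neg) (ϑ (B.add t (o' (N {∅})).exp)) (.coll t (N {∅}))
      else .coll t (N a)
  | _, a => .coll t (N a)

/-- The recursive clauses for the collapsed codes. -/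
structure IsColl (B : Base.{v}) (α : Ordinal.{v}) (ϑ : Tm.{v} → Ordinal.{v}) (K : CollVal.{v}) :
    Prop where
  pos : ∀ t P, B.Collapsible α K ϑ t P →
    K.l t P = B.l α K P ∧ K.o t P = .hat (ϑ (B.add t (B.o α K P).exp)) ∧ K.d t P = 1 ∧
    K.h₀ t P = B.add t (B.o α K P).exp ∧ K.h₁ t P = 0 ∧
    K.r t P = B.collRule ϑ (B.o α K) t (B.n α K P) (B.r α K P) ∧
    K.n t P = collNext ϑ B (B.o α K) t (B.n α K P) (B.r α K P)
  neg : ∀ t P, ¬ B.Collapsible α K ϑ t P →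
    K.l t P = {triv} ∧ K.o t P = .zero ∧ K.d t P = 0 ∧ K.h₀ t P = .Om ∧ K.h₁ t P = 0 ∧
    K.r t P = .ax ∧ K.n t P = fun _ => .axm triv

theorem collapsible_congr {m : ℕ} {K K' : CollVal.{v}} (h : Agree₀ m K K') {P : Code.{v}}
    (hP : P.size ≤ m) {ϑ : Tm.{v} → Ordinal.{v}} {t : Tm.{v}} :
    B.Collapsible α K ϑ t P ↔ B.Collapsible α K' ϑ t P := by
  obtain ⟨-, h2, h3, h4, h5⟩ := static_congr (B := B) (α := α) h hP
  constructor
  · rintro ⟨a1, a2, a3, a4, a5⟩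
    exact ⟨h2 ▸ a1, h3 ▸ a2, h4 ▸ a3, a4, h5 ▸ a5⟩
  · rintro ⟨a1, a2, a3, a4, a5⟩
    exact ⟨h2 ▸ a1, h3 ▸ a2, h4 ▸ a3, a4, h5 ▸ a5⟩

open Classical in
/-- The values can be defined in two stages, because the rules and subcodes of `C_t P` depend on
the heights of subcodes of `P`, which need not be smaller than `P`. -/
theorem exists_isColl (B : Base.{v}) (α : Ordinal.{v}) (ϑ : Tm.{v} → Ordinal.{v}) :
    ∃ K, B.IsColl α ϑ K := by
  let F₁ : CollVal.{v} → CollVal.{v} := fun K =>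
    { l := fun t P => if B.Collapsible α K ϑ t P then B.l α K P else {triv}
      r := fun _ _ => .ax
      o := fun t P => if B.Collapsible α K ϑ t P then .hat (ϑ (B.add t (B.o α K P).exp)) else .zero
      n := fun _ _ _ => .axm triv
      d := fun t P => if B.Collapsible α K ϑ t P then 1 else 0
      h₀ := fun t P => if B.Collapsible α K ϑ t P then B.add t (B.o α K P).exp else .Om
      h₁ := fun _ _ => 0 }
  obtain ⟨K₁, hK₁⟩ := exists_fixedPoint F₁ (by
    intro m K K' h
    refine ⟨fun t P hP => ?_, fun t P hP => ⟨rfl, rfl⟩⟩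
    have hP' := Nat.lt_succ_iff.1 hP
    obtain ⟨h1, h2, -, -, -⟩ := static_congr (B := B) (α := α) h.1 hP'
    have h3 := collapsible_congr (B := B) (α := α) h.1 hP' (ϑ := ϑ) (t := t)
    by_cases hc : B.Collapsible α K ϑ t P
    · have hc' := h3.1 hc
      simp only [F₁, if_pos hc, if_pos hc', h1, h2, and_self]
    · have hc' := fun x => hc (h3.2 x)
      simp only [F₁, if_neg hc, if_neg hc', and_self])
  let F₂ : CollVal.{v} → CollVal.{v} := fun K =>
    { l := K₁.l
      r := fun t P => if B.Collapsible α K₁ ϑ t P then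
        B.collRule ϑ (B.o α K₁) t (B.n α K P) (B.r α K P) else .ax
      o := K₁.o
      n := fun t P => if B.Collapsible α K₁ ϑ t P then
        collNext ϑ B (B.o α K₁) t (B.n α K P) (B.r α K P) else fun _ => .axm triv
      d := K₁.d
      h₀ := K₁.h₀
      h₁ := K₁.h₁ }
  obtain ⟨K, hK⟩ := exists_fixedPoint F₂ (by
    intro m K K' h
    refine ⟨fun t P hP => ⟨rfl, rfl, rfl, rfl, rfl⟩, fun t P hP => ?_⟩
    obtain ⟨h1, h2⟩ := dynamic_congr (B := B) (α := α) h (Nat.lt_succ_iff.1 hP)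
    simp only [F₂, h1, h2, and_self])
  have hag : ∀ m, Agree₀ m K₁ K := by
    intro m t P _
    rw [← hK]
    exact ⟨rfl, rfl, rfl, rfl, rfl⟩
  have hst := fun P : Code.{v} => static_congr (B := B) (α := α) (hag _) (le_refl P.size)
  have hco := fun (P : Code.{v}) t =>
    collapsible_congr (B := B) (α := α) (hag _) (le_refl P.size) (ϑ := ϑ) (t := t)
  have ho : B.o α K₁ = B.o α K := funext fun P => (hst P).1
  refine ⟨K, fun t P hc => ?_, fun t P hc => ?_⟩
  · have hc₁ := (hco P t).2 hc
    rw [← ho, ← (hst P).2.1]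
    have h1 : K.r t P = (F₂ K).r t P := by rw [hK]
    have h2 : K.n t P = (F₂ K).n t P := by rw [hK]
    have h3 := (hag (P.size + 1)) t P (Nat.lt_succ_self _)
    rw [← h3.1, ← h3.2.1, ← h3.2.2.1, ← h3.2.2.2.1, ← h3.2.2.2.2, h1, h2, ← hK₁]
    simp only [F₁, F₂, hK₁, if_pos hc₁]
    exact ⟨trivial, trivial, trivial, trivial, trivial, trivial, trivial⟩
  · have hc₁ := fun x => hc ((hco P t).1 x)
    have h1 : K.r t P = (F₂ K).r t P := by rw [hK]
    have h2 : K.n t P = (F₂ K).n t P := by rw [hK]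
    have h3 := (hag (P.size + 1)) t P (Nat.lt_succ_self _)
    rw [← h3.1, ← h3.2.1, ← h3.2.2.1, ← h3.2.2.2.1, ← h3.2.2.2.2, h1, h2, ← hK₁]
    simp only [F₁, F₂, if_neg hc₁]
    exact ⟨trivial, trivial, trivial, trivial, trivial, trivial, trivial⟩

end Base

end Collapsing

namespace Collapsing

universe v

/-! ### Simultaneous instantiation -/

/-- `Trm.inst j [c₀, c₁, …] s` substitutes `c₀` for `j`, then `c₁` for `j+1`, and so on. -/
def Trm.inst : ℕ → List ZFSet.{v} → Trm.{v} → Trm.{v}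
  | _, [], s => s
  | j, a :: c, s => Trm.inst (j + 1) c (s.subst j a)

@[simp] theorem Trm.inst_par (j : ℕ) (c : List ZFSet.{v}) (a : ZFSet.{v}) :
    Trm.inst j c (.par a) = .par a := by
  induction c generalizing j with
  | nil => rfl
  | cons b c ih => exact ih (j + 1)

theorem Trm.inst_var_of_notMem {j n : ℕ} {c : List ZFSet.{v}} (h : n < j ∨ j + c.length ≤ n) :
    Trm.inst j c (.var n) = .var n := by
  induction c generalizing j with
  | nil => rfl
  | cons b c ih =>
    simp only [List.length_cons] at h
    have hn : n ≠ j := by omega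
    simp only [Trm.inst, Trm.subst, hn, if_false]
    exact ih (by omega)

theorem Trm.inst_var_of_mem {j n : ℕ} {c : List ZFSet.{v}} (h : j ≤ n) (h' : n < j + c.length) :
    Trm.inst j c (.var n) = .par (c.getD (n - j) ∅) := by
  induction c generalizing j with
  | nil => simp at h'; omega
  | cons b c ih =>
    simp only [List.length_cons] at h'
    by_cases hn : n = j
    · subst hn; simp [Trm.inst, Trm.subst]
    · simp only [Trm.inst, Trm.subst, hn, if_false]
      rw [ih (by omega) (by omega), show n - j = (n - (j + 1)) + 1 by omega, List.getD_cons_succ]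

namespace Fml

@[simp] theorem inst_mem (j : ℕ) (c : List ZFSet.{v}) (s t : Trm.{v}) :
    inst j c (mem s t) = mem (Trm.inst j c s) (Trm.inst j c t) := by
  induction c generalizing j s t with
  | nil => rfl
  | cons a c ih => exact ih _ _ _

@[simp] theorem inst_nmem (j : ℕ) (c : List ZFSet.{v}) (s t : Trm.{v}) :
    inst j c (nmem s t) = nmem (Trm.inst j c s) (Trm.inst j c t) := by
  induction c generalizing j s t with
  | nil => rfl
  | cons a c ih => exact ih _ _ _

@[simp] theorem inst_or (j : ℕ) (c : List ZFSet.{v}) (φ ψ : Fml.{v}) :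
    inst j c (or φ ψ) = or (inst j c φ) (inst j c ψ) := by
  induction c generalizing j φ ψ with
  | nil => rfl
  | cons a c ih => exact ih _ _ _

@[simp] theorem inst_and (j : ℕ) (c : List ZFSet.{v}) (φ ψ : Fml.{v}) :
    inst j c (and φ ψ) = and (inst j c φ) (inst j c ψ) := by
  induction c generalizing j φ ψ with
  | nil => rfl
  | cons a c ih => exact ih _ _ _

theorem inst_all {j x : ℕ} {c : List ZFSet.{v}} (h : x < j ∨ j + c.length ≤ x) (φ : Fml.{v}) :
    inst j c (all x φ) = all x (inst j c φ) := by
  induction c generalizing j φ with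
  | nil => rfl
  | cons a c ih =>
    simp only [List.length_cons] at h
    have hx : x ≠ j := by omega
    simp only [inst, subst, hx, if_false]
    exact ih (by omega) _

theorem inst_ex {j x : ℕ} {c : List ZFSet.{v}} (h : x < j ∨ j + c.length ≤ x) (φ : Fml.{v}) :
    inst j c (ex x φ) = ex x (inst j c φ) := by
  induction c generalizing j φ with
  | nil => rfl
  | cons a c ih =>
    simp only [List.length_cons] at h
    have hx : x ≠ j := by omega
    simp only [inst, subst, hx, if_false]
    exact ih (by omega) _

theorem inst_neg (j : ℕ) (c : List ZFSet.{v}) (φ : Fml.{v}) :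
    inst j c φ.neg = (inst j c φ).neg := by
  induction c generalizing j φ with
  | nil => rfl
  | cons a c ih => simp only [inst]; rw [← neg_subst]; exact ih _ _

theorem inst_append_singleton (j : ℕ) (c : List ZFSet.{v}) (a : ZFSet.{v}) (φ : Fml.{v}) :
    inst j (c ++ [a]) φ = (inst j c φ).subst (j + c.length) a := by
  induction c generalizing j φ with
  | nil => rfl
  | cons b c ih =>
    simp only [List.cons_append, inst, ih, List.length_cons]
    congr 1
    omega

theorem mem_fv_inst {j n : ℕ} {c : List ZFSet.{v}} {φ : Fml.{v}} (h : n ∈ (inst j c φ).fv) :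
    n ∈ φ.fv ∧ (n < j ∨ j + c.length ≤ n) := by
  induction c generalizing j φ with
  | nil => exact ⟨h, by simp; omega⟩
  | cons a c ih =>
    obtain ⟨h1, h2⟩ := ih h
    rw [fv_subst, Finset.mem_erase] at h1
    refine ⟨h1.2, ?_⟩
    simp only [List.length_cons]
    omega

theorem pars_inst {j : ℕ} {c : List ZFSet.{v}} {φ : Fml.{v}} {a : ZFSet.{v}}
    (h : a ∈ (inst j c φ).pars) : a ∈ φ.pars ∨ a ∈ c := by
  induction c generalizing j φ with
  | nil => exact .inl h
  | cons b c ih =>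
    rcases ih h with h | h
    · rcases pars_subst _ _ _ h with rfl | h
      · exact .inr (by simp)
      · exact .inl h
    · exact .inr (by simp [h])

theorem IsD0.inst {φ : Fml.{v}} (h : φ.IsD0) (j : ℕ) (c : List ZFSet.{v}) : (inst j c φ).IsD0 := by
  induction c generalizing j φ with
  | nil => exact h
  | cons a c ih => exact ih (h.subst j a) _

theorem IsOr.inst {φ : Fml.{v}} (h : φ.IsOr) (j : ℕ) (c : List ZFSet.{v}) : (inst j c φ).IsOr := by
  obtain ⟨ψ₀, ψ₁, rfl⟩ := h
  exact ⟨_, _, inst_or j c ψ₀ ψ₁⟩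

theorem fv_allFrom (j n : ℕ) (φ : Fml.{v}) {i : ℕ} :
    i ∈ (allFrom j n φ).fv ↔ i ∈ φ.fv ∧ (i < j ∨ j + n ≤ i) := by
  induction n generalizing j with
  | zero => simp only [allFrom]; exact ⟨fun h => ⟨h, by omega⟩, fun h => h.1⟩
  | succ n ih =>
    simp only [allFrom, fv, Finset.mem_erase, ih, ne_eq]
    constructor
    · rintro ⟨h1, h2, h3⟩; exact ⟨h2, by omega⟩
    · rintro ⟨h1, h2⟩; exact ⟨by omega, h1, by omega⟩

theorem pars_allFrom (j n : ℕ) (φ : Fml.{v}) : (allFrom j n φ).pars = φ.pars := by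
  induction n generalizing j with
  | zero => rfl
  | succ n ih => exact ih _

theorem ht_all_le (x : ℕ) (φ : Fml.{v}) : (all x φ).ht ≤ φ.ht + 1 := by
  by_cases h : (all x φ).IsD0
  · rw [ht_of_isD0 h]; omega
  · simp only [ht, h, if_false]; exact le_rfl

theorem ht_ex_le (x : ℕ) (φ : Fml.{v}) : (ex x φ).ht ≤ φ.ht + 1 := by
  have := ht_all_le x φ.neg
  rwa [show all x φ.neg = (ex x φ).neg from rfl, ht_neg, ht_neg] at this

theorem ht_or_le (φ ψ : Fml.{v}) : (or φ ψ).ht ≤ max φ.ht ψ.ht + 1 := by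
  by_cases h : (or φ ψ).IsD0
  · rw [ht_of_isD0 h]; omega
  · simp only [ht, h, if_false]; exact le_rfl

theorem ht_allFrom_le (j n : ℕ) (φ : Fml.{v}) : (allFrom j n φ).ht ≤ n + φ.ht := by
  induction n generalizing j with
  | zero => simp [allFrom]
  | succ n ih =>
    have := ih (j + 1)
    have := ht_all_le j (allFrom (j + 1) n φ)
    simp only [allFrom]
    omega

/-- Closed formulas with parameters in `D`. -/
def ClosedIn (D : Set ZFSet.{v}) (φ : Fml.{v}) : Prop := φ.fv = ∅ ∧ ∀ a ∈ φ.pars, a ∈ D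

namespace ClosedIn

variable {D : Set ZFSet.{v}} {φ ψ : Fml.{v}} {x : ℕ} {a : ZFSet.{v}}

theorem mono {D' : Set ZFSet.{v}} (h : ClosedIn D φ) (hD : D ⊆ D') : ClosedIn D' φ :=
  ⟨h.1, fun a ha => hD (h.2 a ha)⟩

@[simp] theorem neg : ClosedIn D φ.neg ↔ ClosedIn D φ := by simp [ClosedIn]

@[simp] theorem and : ClosedIn D (.and φ ψ) ↔ ClosedIn D φ ∧ ClosedIn D ψ := by
  simp only [ClosedIn, fv, pars, Finset.union_eq_empty, Set.mem_union, or_imp, forall_and]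
  tauto

@[simp] theorem or : ClosedIn D (.or φ ψ) ↔ ClosedIn D φ ∧ ClosedIn D ψ := and

theorem subst (h : ClosedIn D (.all x φ)) (ha : a ∈ D) : ClosedIn D (φ.subst x a) := by
  refine ⟨by rw [fv_subst]; exact h.1, fun b hb => ?_⟩
  rcases pars_subst _ _ _ hb with rfl | hb
  · exact ha
  · exact h.2 b hb

theorem subst' (h : ClosedIn D (.ex x φ)) (ha : a ∈ D) : ClosedIn D (φ.subst x a) :=
  subst (x := x) h ha

end ClosedIn

end Fml

open Fml

/-! ### The axioms -/

namespace KPAx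

theorem collHyp_isD0_aux {k : ℕ} {x : Trm.{v}} {θ : Fml.{v}} (h : θ.IsD0) :
    (collHyp k x θ).ht ≤ 3 := by
  have h1 := ht_all_le (k + 1) (.or (.nmem (.var (k + 1)) x) (.ex (k + 2) θ))
  have h2 := ht_or_le (.nmem (.var (k + 1)) x) (.ex (k + 2) θ)
  have h3 := ht_ex_le (k + 2) θ
  have h4 := ht_of_isD0 h
  have h5 : (Fml.nmem (.var (k + 1)) x).ht = 0 := by simp [ht]
  unfold collHyp ball
  omega

theorem ht_matrix {C : ℕ} {A : KPAx.{v}} (h : A.Valid C) : A.m + A.matrix.ht < C + 6 := by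
  cases A with
  | equality =>
    have : (matrix.{v} equality).ht = 0 := ht_of_isD0 (by simp [matrix, imp, neg, IsD0])
    simp only [this, m]; omega
  | extensionality =>
    have : (matrix.{v} extensionality).ht = 0 := ht_of_isD0
      (by simp [matrix, imp, neg, IsD0, ball, BddEx])
    simp only [this, m]; omega
  | pairing =>
    have h1 := ht_ex_le 2 (Fml.and (.mem (.var 0) (.var 2)) (.mem (.var 1) (.var 2)) : Fml.{v})
    have h2 : (Fml.and (.mem (.var 0) (.var 2)) (.mem (.var 1) (.var 2)) : Fml.{v}).ht = 0 :=
      ht_of_isD0 (by simp [IsD0])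
    simp only [m, matrix]; omega
  | union =>
    have h1 := ht_ex_le 1 (ball 2 (.var 0) (ball 3 (.var 2) (.mem (.var 3) (.var 1))) : Fml.{v})
    have h2 : (ball 2 (.var 0) (ball 3 (.var 2) (.mem (.var 3) (.var 1))) : Fml.{v}).ht = 0 :=
      ht_of_isD0 (by simp [IsD0, ball, BddAll])
    simp only [m, matrix]; omega
  | infinity =>
    have h1 := ht_ex_le 0 (limitOrd.{v})
    have h2 : (limitOrd.{v}).ht = 0 :=
      ht_of_isD0 (by simp [limitOrd, IsD0, ball, bex, BddAll, BddEx])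
    simp only [m, matrix]; omega
  | separation k θ =>
    obtain ⟨hk, hD, -, -⟩ := h
    simp only [m, matrix]
    refine lt_of_le_of_lt (Nat.add_le_add_left (ht_ex_le _ _) _) ?_
    rw [ht_of_isD0]
    · omega
    · simp [IsD0, ball, BddAll, imp, hD]
  | collection k θ =>
    obtain ⟨hk, hD, -, -, -⟩ := h
    have h1 := ht_or_le (collHyp k (.var k) θ).neg (collConcl k (.var k) θ)
    have h2 := collHyp_isD0_aux (k := k) (x := .var k) hD
    have h3 := ht_ex_le (k + 3) (ball (k + 1) (.var k) (bex (k + 2) (.var (k + 3)) θ))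
    have h4 : (ball (k + 1) (.var k) (bex (k + 2) (.var (k + 3)) θ)).ht = 0 :=
      ht_of_isD0 (by simp [IsD0, ball, bex, BddAll, BddEx, hD])
    have h5 : (collConcl k (.var k) θ).ht ≤ 1 := by unfold collConcl; omega
    rw [ht_neg] at h1
    simp only [m, matrix, imp]
    omega

theorem ht_formula {C : ℕ} {A : KPAx.{v}} (h : A.Valid C) : A.formula.ht < C + 6 :=
  (ht_allFrom_le _ _ _).trans_lt (ht_matrix h)

theorem pars_matrix {C : ℕ} {A : KPAx.{v}} (h : A.Valid C) : A.matrix.pars = ∅ := by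
  cases A <;> simp only [matrix, imp, neg, ball, bex, limitOrd, collHyp, collConcl, pars, Trm.pars,
    Set.union_empty, pars_neg]
  case separation => rw [h.2.2.1]; simp
  case collection => rw [h.2.2.1]; simp

theorem fv_matrix {C : ℕ} {A : KPAx.{v}} (h : A.Valid C) {i : ℕ} (hi : i ∈ A.matrix.fv) :
    i < A.m := by
  cases A <;> simp [matrix, imp, neg, ball, bex, limitOrd, collHyp, collConcl, fv,
    Trm.fv, m] at hi ⊢
  case separation k θ =>
    have := h.2.2.2
    by_cases hm : i ∈ θ.fv
    · have h1 := Finset.mem_range.1 (this hm)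
      simp only [hm, or_true, and_true] at hi
      omega
    · simp only [hm, or_false] at hi
      omega
  case collection k θ =>
    have := h.2.2.2.1
    by_cases hm : i ∈ θ.fv
    · have h1 := Finset.mem_range.1 (this hm)
      simp only [hm, or_true, and_true] at hi
      omega
    · simp only [hm, or_false, and_false] at hi
      omega
  all_goals omega

theorem closedIn_inst {C : ℕ} {A : KPAx.{v}} (h : A.Valid C) {c : List ZFSet.{v}}
    (hc : c.length ≤ A.m) {D : Set ZFSet.{v}} (hD : ∀ a ∈ c, a ∈ D) :
    ClosedIn D (inst 0 c (allFrom c.length (A.m - c.length) A.matrix)) := by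
  refine ⟨Finset.eq_empty_iff_forall_notMem.2 fun i hi => ?_, fun a ha => ?_⟩
  · obtain ⟨h1, h2⟩ := mem_fv_inst hi
    obtain ⟨h3, h4⟩ := (fv_allFrom _ _ _).1 h1
    have := fv_matrix h h3
    omega
  · rcases pars_inst ha with ha | ha
    · rw [pars_allFrom, pars_matrix h] at ha
      exact absurd ha (Set.notMem_empty a)
    · exact hD a ha

theorem closedIn_formula {C : ℕ} {A : KPAx.{v}} (h : A.Valid C) (D : Set ZFSet.{v}) :
    ClosedIn D A.formula := closedIn_inst h (c := []) (Nat.zero_le _) (by simp)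

end KPAx

/-! ### Heights in the proofs of the axioms -/

namespace Base

variable {B : Base.{v}}

open KPNode

theorem Om_eq_omPlus : Tm.Om.{v} = omPlus 0 0 := by simp [Tm.Om, omPlus]

theorem omPlus_mem {α : Ordinal.{v}} (hα : 1 < α) (n j : ℕ) : omPlus.{v} n j ∈ B.Eps α := by
  have hα0 : 0 < α := zero_lt_one.trans hα
  have h1 : Ordinal.omega0 * (n : Ordinal.{v}) + j < Ordinal.omega0 ^ α := by
    have h2 : Ordinal.omega0 ^ (2 : Ordinal.{v}) ≤ Ordinal.omega0 ^ α :=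
      Ordinal.opow_le_opow_right Ordinal.omega0_pos (by
        rw [← one_add_one_eq_two]; exact Order.add_one_le_of_lt hα)
    refine lt_of_lt_of_le ?_ h2
    have h3 : Ordinal.omega0 ^ (2 : Ordinal.{v}) = Ordinal.omega0 * Ordinal.omega0 := by
      rw [← one_add_one_eq_two, Ordinal.opow_add, Ordinal.opow_one]
    rw [h3]
    calc Ordinal.omega0 * (n : Ordinal.{v}) + j < Ordinal.omega0 * n + Ordinal.omega0 :=
          add_lt_add_right (Ordinal.natCast_lt_omega0 j) _
      _ = Ordinal.omega0 * (n + 1 : ℕ) := by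
          rw [Nat.cast_add_one, mul_add, mul_one]
      _ ≤ _ := by gcongr; exact (Ordinal.natCast_lt_omega0 _).le
  refine oadd_mem_Eps.2 ⟨oadd_mem_sums.2 ⟨one_mem_Eps hα0, one_pos, one_lt_opow hα0, ?_, ?_⟩,
    by simp [one_def]⟩
  · have := toSum_mem hα0 (hat_mem (B := B) h1)
    rwa [toSum_hat] at this
  · intro s β r h
    by_cases e : Ordinal.omega0 * (n : Ordinal.{v}) + j = 0
    · rw [e, hat_zero] at h; exact absurd h (by simp)
    · rw [hat_of_ne e] at h
      cases h
      simp [one_def]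

theorem star_omPlus (n j : ℕ) : B.star (omPlus n j) ≤ 1 :=
  star_le (omPlus_mem (Order.lt_succ 1) n j)

theorem omPlus_lt {n j j' : ℕ} (h : j < j') : B.Lt (omPlus n j) (omPlus n j') := by
  refine .oadd_tail _ _ _ _ ?_
  rw [hat_lt_hat]
  exact add_lt_add_right (by exact_mod_cast h) _

theorem hat_lt_omPlus (β : Ordinal.{v}) (n j : ℕ) : B.Lt (.hat β) (omPlus n j) := by
  by_cases e : β = 0
  · simp [e, omPlus]
  · rw [hat_of_ne e]
    exact .oadd_exp _ _ _ _ _ _ (by simp [one_def])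

theorem Om_le_omPlus (n j : ℕ) : B.Le .Om (omPlus n j) := by
  unfold Tm.Om omPlus
  by_cases e : Tm.hat (Ordinal.omega0.{v} * n + j) = .zero
  · rw [e]; exact .refl _
  · exact .inl (.oadd_tail _ _ _ _ (zero_lt_iff.2 e))

theorem omPlus_add_omega (n j : ℕ) :
    B.add (omPlus n j) (.hat Ordinal.omega0) = omPlus (n + 1) 0 := by
  have h0 : (Ordinal.omega0.{v}) ≠ 0 := Ordinal.omega0_pos.ne'
  have h1 : Ordinal.omega0.{v} * (n : Ordinal.{v}) + j + Ordinal.omega0 =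
      Ordinal.omega0 * ((n + 1 : ℕ) : Ordinal.{v}) + ((0 : ℕ) : Ordinal.{v}) := by
    rw [add_assoc, Ordinal.natCast_add_omega0, Nat.cast_add_one, mul_add, mul_one, Nat.cast_zero,
      add_zero]
  have h2 := add_hat (B := B) (Ordinal.omega0.{v} * (n : Ordinal.{v}) + j) Ordinal.omega0
  have hs : ∀ β : Ordinal.{v}, (Tm.oadd .one 1 (.hat β)).toSum = .oadd .one 1 (.hat β) :=
    fun _ => rfl
  have ho : ∀ x : Tm.{v}, (Tm.oadd .one 1 x).ofSum = .oadd .one 1 x := by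
    intro x; rw [one_def]; rfl
  have h3 : ∀ β : Ordinal.{v},
      B.addSum (.hat β) (.hat Ordinal.omega0) = .hat (β + Ordinal.omega0) := by
    intro β
    have hm : ∀ δ : Ordinal.{v}, Tm.hat δ ∈
        B.Sums (Order.succ (Order.succ (max β (β + Ordinal.omega0) + δ))) := by
      intro δ
      have := toSum_mem (succ_pos' _) (hat_mem (B := B)
        (γ := Order.succ (Order.succ (max β (β + Ordinal.omega0) + δ))) (β := δ)
        (lt_of_le_of_lt (le_add_self.trans (Order.le_succ _)) (lt_opow_succ _)))
      rwa [toSum_hat] at this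
    rw [hat_of_ne h0, hat_of_ne (β := β + Ordinal.omega0) (by simp)]
    by_cases e : β = 0
    · simp [e]
    · rw [hat_of_ne e, addSum_of_eq (zero_mem_Eps 0)]
  unfold add omPlus
  rw [hs, toSum_hat, hat_of_ne h0, addSum_of_gt (one_mem_Eps one_pos) (zero_mem_Eps 1)
    (by simp [one_def]), ← hat_of_ne h0, h3, h1, ho]

theorem zero_add_omega : B.add .zero (.hat Ordinal.omega0) = .hat Ordinal.omega0 := by
  have := add_hat (B := B) 0 Ordinal.omega0
  simpa using this

/-! ### Steps for the single rules -/

namespace Step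

variable {γ : Ordinal.{v}} {Γ : Finset Fml.{v}} {o : Tm.{v}}
  {Γ' : ZFSet.{v} → Finset Fml.{v}} {o' : ZFSet.{v} → Tm.{v}}

theorem mk_ax {φ : Fml.{v}} (h : φ ∈ Γ) (hT : φ.TrueD0) : B.Step γ .ax Γ o Γ' o' where
  ax _ := ⟨φ, h, hT⟩
  prin := nofun
  sub := nofun
  lt _ := nofun
  big := nofun
  ex := nofun
  ref := nofun

theorem one_ne_empty : ({∅} : ZFSet.{v}) ≠ ∅ := fun e => by
  have : (∅ : ZFSet.{v}) ∈ ({∅} : ZFSet.{v}) := by simp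
  rw [e] at this
  exact ZFSet.notMem_empty _ this

theorem mk_and {ψ₀ ψ₁ : Fml.{v}} (h : .and ψ₀ ψ₁ ∈ Γ) (h₀ : B.Lt (o' ∅) o) (h₁ : B.Lt (o' {∅}) o)
    (s₀ : ∀ φ ∈ Γ' ∅, φ ∈ Γ ∨ φ = ψ₀) (s₁ : ∀ φ ∈ Γ' {∅}, φ ∈ Γ ∨ φ = ψ₁) :
    B.Step γ (.and ψ₀ ψ₁) Γ o Γ' o' where
  ax := nofun
  prin φ hφ := by obtain rfl : φ = _ := hφ; exact h
  sub := by
    rintro a (rfl | rfl) φ hφ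
    · exact (s₀ φ hφ).imp_right fun h => .inl ⟨rfl, h⟩
    · exact (s₁ φ hφ).imp_right fun h => .inr ⟨one_ne_empty, h⟩
  lt _ := by rintro a (rfl | rfl) <;> assumption
  big := nofun
  ex := nofun
  ref := nofun

theorem mk_cut {ψ : Fml.{v}} (h₀ : B.Lt (o' ∅) o) (h₁ : B.Lt (o' {∅}) o)
    (s₀ : ∀ φ ∈ Γ' ∅, φ ∈ Γ ∨ φ = ψ) (s₁ : ∀ φ ∈ Γ' {∅}, φ ∈ Γ ∨ φ = ψ.neg) :
    B.Step γ (.cut ψ) Γ o Γ' o' where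
  ax := nofun
  prin := nofun
  sub := by
    rintro a (rfl | rfl) φ hφ
    · exact (s₀ φ hφ).imp_right fun h => .inl ⟨rfl, h⟩
    · exact (s₁ φ hφ).imp_right fun h => .inr ⟨one_ne_empty, h⟩
  lt _ := by rintro a (rfl | rfl) <;> assumption
  big := nofun
  ex := nofun
  ref := nofun

theorem mk_or {i : Bool} {ψ₀ ψ₁ : Fml.{v}} (h : .or ψ₀ ψ₁ ∈ Γ) (h₀ : B.Lt (o' ∅) o)
    (s₀ : ∀ φ ∈ Γ' ∅, φ ∈ Γ ∨ φ = pick i ψ₀ ψ₁) : B.Step γ (.or i ψ₀ ψ₁) Γ o Γ' o' where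
  ax := nofun
  prin φ hφ := by obtain rfl : φ = _ := hφ; exact h
  sub := by rintro a rfl φ hφ; exact s₀ φ hφ
  lt _ := by rintro a rfl; exact h₀
  big := nofun
  ex := nofun
  ref := nofun

theorem mk_all {x : ℕ} {ψ : Fml.{v}} (h : .all x ψ ∈ Γ)
    (h₀ : ∀ a ∈ B.L γ, B.Le (B.add (o' a) (.hat Ordinal.omega0)) o)
    (s₀ : ∀ a ∈ B.L γ, ∀ φ ∈ Γ' a, φ ∈ Γ ∨ φ = ψ.subst x a) : B.Step γ (.all x ψ) Γ o Γ' o' where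
  ax := nofun
  prin φ hφ := by obtain rfl : φ = _ := hφ; exact h
  sub := s₀
  lt h := absurd trivial h
  big _ := h₀
  ex := nofun
  ref := nofun

theorem mk_ex {x : ℕ} {b : ZFSet.{v}} {ψ : Fml.{v}} (h : .ex x ψ ∈ Γ)
    (h₀ : B.Le (B.add (o' ∅) (.hat Ordinal.omega0)) o) (hb : B.Lt (.hat (B.rk b)) o)
    (s₀ : ∀ φ ∈ Γ' ∅, φ ∈ Γ ∨ φ = ψ.subst x b) : B.Step γ (.ex x b ψ) Γ o Γ' o' where
  ax := nofun
  prin φ hφ := by obtain rfl : φ = _ := hφ; exact h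
  sub := by rintro a rfl φ hφ; exact s₀ φ hφ
  lt h := absurd trivial h
  big _ := by rintro a rfl; exact h₀
  ex := by rintro _ _ _ ⟨⟩; exact hb
  ref := nofun

theorem mk_ref {z x y : ℕ} {a : ZFSet.{v}} {θ : Fml.{v}} (h : refConcl z x a y θ ∈ Γ)
    (h₀ : B.Lt (o' ∅) o) (hΩ : B.Le .Om o)
    (s₀ : ∀ φ ∈ Γ' ∅, φ ∈ Γ ∨ φ = refPrem x a y θ) : B.Step γ (.ref z x a y θ) Γ o Γ' o' where
  ax := nofun
  prin φ hφ := by obtain rfl : φ = _ := hφ; exact h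
  sub := by rintro a rfl φ hφ; exact s₀ φ hφ
  lt _ := by rintro a rfl; exact h₀
  big := nofun
  ex := nofun
  ref _ _ _ _ _ _ := hΩ

theorem mk_rep {b : ZFSet.{v}} (h₀ : B.Lt (o' b) o) (s₀ : ∀ φ ∈ Γ' b, φ ∈ Γ) :
    B.Step γ (.rep b) Γ o Γ' o' where
  ax := nofun
  prin := nofun
  sub := by rintro a rfl φ hφ; exact .inl (s₀ φ hφ)
  lt _ := by rintro a rfl; exact h₀
  big := nofun
  ex := nofun
  ref := nofun

end Step

end Base

end Collapsing

namespace Collapsing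

universe v

open Fml

/-! ### The proofs of the axioms -/

namespace KPAx

theorem inst_collHyp {k : ℕ} {c : List ZFSet.{v}} (hc : c.length = k + 1) (θ : Fml.{v}) :
    inst 0 c (collHyp k (.var k) θ) = collHyp k (.par (c.getD k ∅)) (inst 0 c θ) := by
  rw [collHyp, ball, inst_all (by omega), inst_or, inst_nmem, inst_ex (by omega),
    Trm.inst_var_of_notMem (by omega), Trm.inst_var_of_mem (Nat.zero_le _) (by omega)]
  rfl

theorem inst_collConcl {k : ℕ} {c : List ZFSet.{v}} (hc : c.length = k + 1) (θ : Fml.{v}) :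
    inst 0 c (collConcl k (.var k) θ) = collConcl k (.par (c.getD k ∅)) (inst 0 c θ) := by
  rw [collConcl, ball, bex, inst_ex (by omega), inst_all (by omega), inst_or, inst_nmem,
    inst_ex (by omega), inst_and, inst_mem, Trm.inst_var_of_notMem (by omega),
    Trm.inst_var_of_mem (Nat.zero_le _) (by omega), Trm.inst_var_of_notMem (by omega),
    Trm.inst_var_of_notMem (by omega)]
  rfl

end KPAx

namespace KPNode

open KPAx

/-- The nodes that occur in the proofs of the axioms, with parameters from `D`. -/
def Ok (C : ℕ) (D : Set ZFSet.{v}) : KPNode.{v} → Prop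
  | pre A c => A.Valid C ∧ c.length ≤ A.m ∧ ∀ a ∈ c, a ∈ D
  | wit A c => (A.Valid C ∧ c.length = A.m ∧ ∀ a ∈ c, a ∈ D) ∧
      ∃ y δ, A.matrix = .ex y δ ∧ A.m ≤ y
  | coll₁ k θ c | coll₂ k θ c | coll₃ k θ c =>
      (collection k θ).Valid C ∧ c.length = k + 1 ∧ ∀ a ∈ c, a ∈ D
  | coll₄ k θ c a | coll₅ k θ c a | coll₆ k θ c a | coll₇ k θ c a | collMem k θ c a
  | coll₈ k θ c a => ((collection k θ).Valid C ∧ c.length = k + 1 ∧ ∀ a ∈ c, a ∈ D) ∧ a ∈ D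
  | coll₉ k θ c a b | collLeaf k θ c a b =>
      ((collection k θ).Valid C ∧ c.length = k + 1 ∧ ∀ a ∈ c, a ∈ D) ∧ a ∈ D ∧ b ∈ D

/-- The local conditions at a node in the proof of an axiom. -/
structure Good (B : Base.{v}) (γ : Ordinal.{v}) (C : ℕ) (D : Set ZFSet.{v}) (N : KPNode.{v}) :
    Prop where
  closed : ∀ φ ∈ N.lab.seq, ClosedIn D φ
  rule : B.IsRule γ N.lab.rule
  kR : B.kR N.lab.rule = 0 ∨ ∃ b ∈ D, B.kR N.lab.rule = B.rk b
  not_cut : ∀ ψ, N.lab.rule ≠ .cut ψ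
  ord : N.lab.ord = .zero ∨ ∃ n j, N.lab.ord = omPlus n j
  next : ∀ a ∈ B.premises γ N.lab.rule, ∀ D', D ⊆ D' → a ∈ D' → Ok C D' (N.next a)
  step : B.Step γ N.lab.rule N.lab.seq N.lab.ord (fun a => (N.next a).lab.seq)
    (fun a => (N.next a).lab.ord)

variable {B : Base.{v}} {γ : Ordinal.{v}} {C : ℕ} {D : Set ZFSet.{v}}

theorem isF_of_closedIn (hD : ∀ a ∈ D, a ∈ B.L γ) {φ : Fml.{v}} (h : ClosedIn D φ) : B.IsF γ φ :=
  ⟨h.1, fun a ha => hD a (h.2 a ha)⟩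

/-! #### Collection -/

/-- The instances of `θ` and of the bound `d` above a fully instantiated collection axiom. -/
structure CollData (D : Set ZFSet.{v}) (k : ℕ) (θ : Fml.{v}) (d : ZFSet.{v}) : Prop where
  isD0 : θ.IsD0
  isOr : θ.IsOr
  fv : ∀ i ∈ θ.fv, i = k + 1 ∨ i = k + 2
  pars : ∀ a ∈ θ.pars, a ∈ D
  mem : d ∈ D

namespace CollData

variable {k : ℕ} {θ : Fml.{v}} {d : ZFSet.{v}} (h : CollData D k θ d)

include h

theorem hyp : ClosedIn D (collHyp k (.par d) θ) := by
  refine ⟨Finset.eq_empty_iff_forall_notMem.2 fun i hi => ?_, fun a ha => ?_⟩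
  · simp [collHyp, ball, Fml.fv, Trm.fv] at hi
    have := h.fv i hi.2.2
    omega
  · simp [collHyp, ball, Fml.pars, Trm.pars] at ha
    rcases ha with rfl | ha
    exacts [h.mem, h.pars a ha]

theorem concl : ClosedIn D (collConcl k (.par d) θ) := by
  refine ⟨Finset.eq_empty_iff_forall_notMem.2 fun i hi => ?_, fun a ha => ?_⟩
  · simp [collConcl, ball, bex, Fml.fv, Trm.fv] at hi
    have := h.fv i
    grind
  · simp [collConcl, ball, bex, Fml.pars, Trm.pars] at ha
    rcases ha with rfl | ha
    exacts [h.mem, h.pars a ha]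

theorem ex_subst {a : ZFSet.{v}} (ha : a ∈ D) : ClosedIn D (.ex (k + 2) (θ.subst (k + 1) a)) := by
  refine ⟨Finset.eq_empty_iff_forall_notMem.2 fun i hi => ?_, fun b hb => ?_⟩
  · simp [Fml.fv, fv_subst] at hi
    have := h.fv i hi.2.2
    omega
  · rcases pars_subst _ _ _ hb with rfl | hb
    exacts [ha, h.pars b hb]

theorem subst_subst {a b : ZFSet.{v}} (ha : a ∈ D) (hb : b ∈ D) :
    ClosedIn D ((θ.subst (k + 1) a).subst (k + 2) b) := (h.ex_subst ha).subst' hb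

theorem mem_par {a : ZFSet.{v}} (ha : a ∈ D) : ClosedIn D (.mem (.par a) (.par d)) :=
  ⟨rfl, by simp [Fml.pars, Trm.pars, ha, h.mem]⟩

theorem nmem_par {a : ZFSet.{v}} (ha : a ∈ D) : ClosedIn D (.nmem (.par a) (.par d)) :=
  h.mem_par ha

end CollData

theorem collData {k : ℕ} {θ : Fml.{v}} {c : List ZFSet.{v}} (h : (collection k θ).Valid C)
    (hc : c.length = k + 1) (hD : ∀ a ∈ c, a ∈ D) :
    CollData D k (inst 0 c θ) (c.getD k ∅) := by
  obtain ⟨h1, h2, h3, h4, h5⟩ := h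
  refine ⟨h2.inst _ _, h5.inst _ _, fun i hi => ?_, fun a ha => ?_, ?_⟩
  · obtain ⟨h6, h7⟩ := mem_fv_inst hi
    have := Finset.mem_range.1 (h4 h6)
    omega
  · rcases pars_inst ha with ha | ha
    · rw [h3] at ha
      exact absurd ha (Set.notMem_empty a)
    · exact hD a ha
  · rw [List.getD_eq_getElem _ _ (by omega)]
    exact hD _ (List.getElem_mem _)

theorem subst_collBody (k : ℕ) (d a : ZFSet.{v}) (θ : Fml.{v}) :
    (Fml.or (.nmem (.var (k + 1)) (.par d)) (.ex (k + 2) θ)).subst (k + 1) a =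
      .or (.nmem (.par a) (.par d)) (.ex (k + 2) (θ.subst (k + 1) a)) := by
  simp [Fml.subst, Trm.subst]

theorem subst_collBody_neg (k : ℕ) (d a : ZFSet.{v}) (θ : Fml.{v}) :
    (Fml.and (.mem (.var (k + 1)) (.par d)) (.all (k + 2) θ.neg)).subst (k + 1) a =
      .and (.mem (.par a) (.par d)) (.all (k + 2) (θ.subst (k + 1) a).neg) := by
  simp [Fml.subst, Trm.subst, neg_subst]

theorem add_omega_le {n j : ℕ} :
    B.Le (B.add (omPlus n j) (.hat Ordinal.omega0)) (omPlus (n + 1) 0) :=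
  .inr (Base.omPlus_add_omega n j)

open Base in
/-- Nodes below the choice of an element of the bound; the second one is an instance of reflection. -/
theorem good_coll_trunk (hD : ∀ a ∈ D, a ∈ B.L γ) {k : ℕ} {θ : Fml.{v}} {c : List ZFSet.{v}}
    (h : (collection k θ).Valid C) (hc : c.length = k + 1) (hcD : ∀ a ∈ c, a ∈ D) :
    Good B γ C D (coll₁ k θ c) ∧ Good B γ C D (coll₂ k θ c) ∧ Good B γ C D (coll₃ k θ c) := by
  have H := collData h hc hcD
  have h1 := H.hyp
  have h2 := H.concl
  have hL := fun φ => isF_of_closedIn (φ := φ) hD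
  refine ⟨⟨?_, ?_, .inl rfl, nofun, .inr ⟨_, _, rfl⟩, ?_, ?_⟩,
    ⟨?_, ?_, .inl rfl, nofun, .inr ⟨_, _, rfl⟩, ?_, ?_⟩,
    ⟨?_, ?_, .inl rfl, nofun, .inr ⟨_, _, rfl⟩, ?_, ?_⟩⟩
  · simp only [lab, Finset.mem_insert, Finset.mem_singleton]
    rintro φ (rfl | rfl)
    exacts [ClosedIn.or.2 ⟨ClosedIn.neg.2 h1, h2⟩, ClosedIn.neg.2 h1]
  · exact ⟨hL _ (by simpa using h1), hL _ h2⟩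
  · exact fun a _ D' hD' _ => ⟨h, hc, fun a ha => hD' (hcD a ha)⟩
  · refine Step.mk_or (by simp [lab]) (omPlus_lt (by omega)) fun φ hφ => ?_
    simp only [next, lab, pick, Finset.mem_insert, Finset.mem_singleton, if_true] at hφ ⊢
    tauto
  · simp only [lab, Finset.mem_insert, Finset.mem_singleton]
    rintro φ (rfl | rfl)
    exacts [ClosedIn.neg.2 h1, h2]
  · refine ⟨hL _ h2, H.isD0, H.isOr, by omega, by omega, by omega, fun hv => ?_⟩
    have := H.fv _ hv
    omega
  · exact fun a _ D' hD' _ => ⟨h, hc, fun a ha => hD' (hcD a ha)⟩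
  · refine Step.mk_ref (by simp [lab, refConcl, collConcl]) (omPlus_lt (by omega))
      (Om_le_omPlus _ _) fun φ hφ => ?_
    simp only [next, lab, Finset.mem_insert, Finset.mem_singleton] at hφ ⊢
    exact hφ.imp_left .inl
  · simp only [lab, Finset.mem_insert, Finset.mem_singleton]
    rintro φ (rfl | rfl)
    exacts [ClosedIn.neg.2 h1, h1]
  · exact hL _ h1
  · exact fun a _ D' hD' ha => ⟨⟨h, hc, fun a ha => hD' (hcD a ha)⟩, ha⟩
  · refine Step.mk_all (by simp [lab, collHyp, ball]) (fun a _ => add_omega_le) fun a _ φ hφ => ?_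
    simp only [next, lab, Finset.mem_insert, Finset.mem_singleton, subst_collBody] at hφ ⊢
    tauto

open Base in
/-- Nodes above the choice of an element `a` of the bound. -/
theorem good_coll_elem (hD : ∀ a ∈ D, a ∈ B.L γ) {k : ℕ} {θ : Fml.{v}} {c : List ZFSet.{v}}
    (h : (collection k θ).Valid C) (hc : c.length = k + 1) (hcD : ∀ a ∈ c, a ∈ D) {a : ZFSet.{v}}
    (ha : a ∈ D) :
    Good B γ C D (coll₄ k θ c a) ∧ Good B γ C D (coll₅ k θ c a) ∧ Good B γ C D (coll₆ k θ c a) ∧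
    Good B γ C D (coll₇ k θ c a) ∧ Good B γ C D (collMem k θ c a) ∧
    Good B γ C D (coll₈ k θ c a) := by
  have H := collData h hc hcD
  have h1 := H.hyp
  have h2 := H.ex_subst ha
  have h2' : ClosedIn D (.all (k + 2) ((inst 0 c θ).subst (k + 1) a).neg) :=
    ClosedIn.neg.2 h2
  have h3 := H.mem_par ha
  have h4 := H.nmem_par ha
  have hL := fun φ => isF_of_closedIn (φ := φ) hD
  refine ⟨⟨?_, ?_, .inl rfl, nofun, .inr ⟨_, _, rfl⟩, ?_, ?_⟩,
    ⟨?_, ?_, .inl rfl, nofun, .inr ⟨_, _, rfl⟩, ?_, ?_⟩,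
    ⟨?_, ?_, .inr ⟨a, ha, rfl⟩, nofun, .inr ⟨_, _, rfl⟩, ?_, ?_⟩,
    ⟨?_, ?_, .inl rfl, nofun, .inr ⟨_, _, rfl⟩, ?_, ?_⟩,
    ⟨?_, trivial, .inl rfl, nofun, .inl rfl, nofun, ?_⟩,
    ⟨?_, ?_, .inl rfl, nofun, .inr ⟨_, _, rfl⟩, ?_, ?_⟩⟩
  · simp only [lab, Finset.mem_insert, Finset.mem_singleton]
    rintro φ (rfl | rfl)
    exacts [ClosedIn.neg.2 h1, ClosedIn.or.2 ⟨h4, h2⟩]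
  · exact ⟨hL _ h4, hL _ h2⟩
  · exact fun _ _ D' hD' _ => ⟨⟨h, hc, fun a ha => hD' (hcD a ha)⟩, hD' ha⟩
  · refine Step.mk_or (by simp [lab]) (omPlus_lt (by omega)) fun φ hφ => ?_
    simp only [next, lab, pick, Finset.mem_insert, Finset.mem_singleton, Bool.false_eq_true,
      if_false] at hφ ⊢
    tauto
  · simp only [lab, Finset.mem_insert, Finset.mem_singleton]
    rintro φ (rfl | rfl | rfl)
    exacts [ClosedIn.neg.2 h1, ClosedIn.or.2 ⟨h4, h2⟩, h4]
  · exact ⟨hL _ h4, hL _ h2⟩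
  · exact fun _ _ D' hD' _ => ⟨⟨h, hc, fun a ha => hD' (hcD a ha)⟩, hD' ha⟩
  · refine Step.mk_or (by simp [lab]) (omPlus_lt (by omega)) fun φ hφ => ?_
    simp only [next, lab, pick, Finset.mem_insert, Finset.mem_singleton, if_true] at hφ ⊢
    tauto
  · simp only [lab, Finset.mem_insert, Finset.mem_singleton]
    rintro φ (rfl | rfl | rfl)
    exacts [ClosedIn.neg.2 h1, h4, h2]
  · exact ⟨hL _ (ClosedIn.neg.2 h1), hD a ha⟩
  · exact fun _ _ D' hD' _ => ⟨⟨h, hc, fun a ha => hD' (hcD a ha)⟩, hD' ha⟩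
  · refine Step.mk_ex (by simp [lab, collHyp, ball, Fml.neg]) add_omega_le (hat_lt_omPlus _ _ _)
      fun φ hφ => ?_
    simp only [next, lab, Finset.mem_insert, Finset.mem_singleton, subst_collBody_neg] at hφ ⊢
    tauto
  · simp only [lab, Finset.mem_insert, Finset.mem_singleton]
    rintro φ (rfl | rfl | rfl)
    exacts [ClosedIn.and.2 ⟨h3, h2'⟩, h4, h2]
  · exact ⟨hL _ h3, hL _ h2'⟩
  · intro i _ D' hD' _
    simp only [next]
    split_ifs
    all_goals exact ⟨⟨h, hc, fun a ha => hD' (hcD a ha)⟩, hD' ha⟩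
  · refine Step.mk_and (by simp [lab]) ?_ ?_ (fun φ hφ => ?_) fun φ hφ => ?_
    · simp [next, lab, omPlus]
    · simp only [next, Step.one_ne_empty, if_false]
      exact omPlus_lt (by omega)
    · simp only [next, lab, Finset.mem_insert, Finset.mem_singleton, if_true] at hφ ⊢
      tauto
    · simp only [next, lab, Finset.mem_insert, Finset.mem_singleton, Step.one_ne_empty,
        if_false] at hφ ⊢
      tauto
  · simp only [lab, Finset.mem_insert, Finset.mem_singleton]
    rintro φ (rfl | rfl)
    exacts [h3, h4]
  · rcases trueD0_or_neg (φ := .mem (.par a) (.par (c.getD k ∅))) trivial rfl with hT | hT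
    · exact Step.mk_ax (by simp [lab]) hT
    · exact Step.mk_ax (by simp [lab, Fml.neg]) hT
  · simp only [lab, Finset.mem_insert, Finset.mem_singleton]
    rintro φ (rfl | rfl)
    exacts [h2', h2]
  · exact hL _ h2'
  · exact fun b _ D' hD' hb => ⟨⟨h, hc, fun a ha => hD' (hcD a ha)⟩, hD' ha, hb⟩
  · refine Step.mk_all (by simp [lab]) (fun b _ => ?_) fun b _ φ hφ => ?_
    · simp only [next, lab]
      rw [Om_eq_omPlus]
      exact add_omega_le
    · simp only [next, lab, Finset.mem_insert, Finset.mem_singleton, neg_subst] at hφ ⊢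
      tauto

open Base in
/-- Nodes above the choice of an element `a` of the bound and of a witness `b` for `a`. -/
theorem good_coll_wit (hD : ∀ a ∈ D, a ∈ B.L γ) {k : ℕ} {θ : Fml.{v}} {c : List ZFSet.{v}}
    (h : (collection k θ).Valid C) (hc : c.length = k + 1) (hcD : ∀ a ∈ c, a ∈ D)
    {a b : ZFSet.{v}} (ha : a ∈ D) (hb : b ∈ D) :
    Good B γ C D (coll₉ k θ c a b) ∧ Good B γ C D (collLeaf k θ c a b) := by
  have H := collData h hc hcD
  have h2 := H.ex_subst ha
  have h3 := H.subst_subst ha hb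
  have hL := fun φ => isF_of_closedIn (φ := φ) hD
  refine ⟨⟨?_, ?_, .inr ⟨b, hb, rfl⟩, nofun, .inr ⟨0, 0, Om_eq_omPlus⟩, ?_, ?_⟩,
    ⟨?_, trivial, .inl rfl, nofun, .inl rfl, nofun, ?_⟩⟩
  · simp [lab, h2, h3]
  · exact ⟨hL _ h2, hD b hb⟩
  · exact fun _ _ D' hD' _ => ⟨⟨h, hc, fun a ha => hD' (hcD a ha)⟩, hD' ha, hD' hb⟩
  · refine Step.mk_ex (by simp [lab]) (.inl ?_) (hat_lt_Om _) fun φ hφ => ?_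
    · simp only [next, lab, zero_add_omega]
      exact hat_lt_Om _
    · simp only [next, lab, Finset.mem_insert, Finset.mem_singleton] at hφ ⊢
      tauto
  · simp [lab, h3]
  · rcases trueD0_or_neg ((H.isD0.subst (k + 1) a).subst (k + 2) b) h3.1 with hT | hT
    · exact Step.mk_ax (by simp [lab]) hT
    · exact Step.mk_ax (by simp [lab]) hT

end KPNode

end Collapsing

namespace Collapsing

universe v

open Fml

namespace KPNode

open KPAx

variable {B : Base.{v}} {γ : Ordinal.{v}} {C : ℕ} {D : Set ZFSet.{v}}

/-! #### The other axioms -/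

theorem length_eq_one {c : List ZFSet.{v}} (h : c.length = 1) : ∃ a, c = [a] :=
  List.length_eq_one_iff.1 h

theorem mem_omega_props : ∀ x ∈ ZFSet.omega.{v},
    (∀ y ∈ x, y ∈ ZFSet.omega) ∧ ∀ y ∈ x, ∀ z ∈ y, z ∈ x := by
  have key : ∀ x ∈ ZFSet.omega.{v}, x ∈ ZFSet.omega ∧ (∀ y ∈ x, y ∈ ZFSet.omega) ∧
      ∀ y ∈ x, ∀ z ∈ y, z ∈ x := by
    refine mem_omega_induction ?_ ?_
    · simp
    · rintro n ⟨h0, h1, h2⟩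
      simp only [ZFSet.mem_insert_iff]
      refine ⟨ZFSet.omega_succ h0, ?_, ?_⟩
      · rintro y (rfl | hy)
        exacts [h0, h1 y hy]
      · rintro y (rfl | hy) z hz
        exacts [.inr hz, .inr (h2 y hy z hz)]
  exact fun x hx => (key x hx).2

/-- The witnesses for pairing, union, infinity and separation are as required. -/
theorem sat_witness {A : KPAx.{v}} (hA : A.Valid C) {c : List ZFSet.{v}} (hc : c.length = A.m)
    {y : ℕ} {δ : Fml.{v}} (hm : A.matrix = .ex y δ) :
    δ.IsD0 ∧ ((inst 0 c δ).subst y (witness A c)).Sat Set.univ (fun _ => ∅) := by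
  cases A with
  | equality => simp [matrix, imp] at hm
  | extensionality => simp [matrix, imp] at hm
  | collection k θ => simp [matrix, imp] at hm
  | pairing =>
    obtain ⟨a, b, rfl⟩ := List.length_eq_two.1 hc
    simp only [matrix, Fml.ex.injEq] at hm
    obtain ⟨rfl, rfl⟩ := hm
    refine ⟨by simp [IsD0], ?_⟩
    simp [inst, Fml.subst, Trm.subst, Sat, Trm.val, witness]
  | union =>
    obtain ⟨a, rfl⟩ := length_eq_one hc
    simp only [matrix, Fml.ex.injEq] at hm
    obtain ⟨rfl, rfl⟩ := hm
    refine ⟨by simp [ball, IsD0, BddAll], ?_⟩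
    simp [inst, Fml.subst, Trm.subst, Sat, Trm.val, witness, ball]
    intro x
    by_cases hx : x ∈ a
    · refine .inr fun z => ?_
      by_cases hz : z ∈ x
      · exact .inr ⟨x, hx, hz⟩
      · exact .inl hz
    · exact .inl hx
  | infinity =>
    obtain rfl : c = [] := List.length_eq_zero_iff.1 hc
    simp only [matrix, Fml.ex.injEq] at hm
    obtain ⟨rfl, rfl⟩ := hm
    refine ⟨by simp [limitOrd, ball, bex, IsD0, BddAll, BddEx], ?_⟩
    simp [inst, limitOrd, ball, bex, Fml.subst, Trm.subst, Sat, Trm.val, witness]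
    simp only [← imp_iff_not_or]
    have h := mem_omega_props.{v}
    refine ⟨⟨∅, ZFSet.omega_zero⟩, fun a ha => (h a ha).1, fun a ha => (h a ha).2, fun a ha => ?_⟩
    exact ⟨insert a a, ZFSet.omega_succ ha, by simp⟩
  | separation k θ =>
    simp only [matrix, Fml.ex.injEq] at hm
    obtain ⟨rfl, rfl⟩ := hm
    obtain ⟨-, hD, -, hv⟩ := hA
    refine ⟨by simp [ball, imp, IsD0, BddAll, hD], ?_⟩
    have hc' : c.length = k + 1 := hc
    rw [inst_and, ball, ball, inst_all (by omega), inst_all (by omega), inst_or, inst_or, imp,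
      inst_or, inst_and, inst_nmem, inst_nmem, inst_mem, inst_mem, inst_neg,
      Trm.inst_var_of_mem (n := k) (by omega) (by omega),
      Trm.inst_var_of_notMem (n := k + 1) (by omega),
      Trm.inst_var_of_notMem (n := k + 2) (by omega)]
    have hθ : (inst 0 c θ).subst (k + 2) (witness (separation k θ) c) = inst 0 c θ := by
      refine subst_of_notMem fun h => ?_
      have := Finset.mem_range.1 (hv (mem_fv_inst h).1)
      omega
    simp [Fml.subst, Trm.subst, ← neg_subst, hθ]
    simp only [witness, Sat, Trm.val, sat_neg, Function.update_self, Set.mem_univ, true_imp_iff,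
      ← imp_iff_not_or, ZFSet.mem_sep, sat_subst, List.getD_eq_getElem?_getD]
    exact ⟨fun a h1 h2 => ⟨h1, h2⟩, fun a h => h⟩

theorem isD0_matrix {A : KPAx.{v}} (hA : A = equality ∨ A = extensionality) {c : List ZFSet.{v}}
    (hc : c.length = A.m) : A.matrix.IsD0 ∧ (inst 0 c A.matrix).Sat Set.univ (fun _ => ∅) := by
  rcases hA with rfl | rfl
  · refine ⟨by simp [matrix, imp, neg, IsD0], ?_⟩
    obtain ⟨a₀, a₁, a₂, a₃, rfl⟩ : ∃ a₀ a₁ a₂ a₃, c = [a₀, a₁, a₂, a₃] := by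
      rcases c with _ | ⟨a₀, _ | ⟨a₁, _ | ⟨a₂, _ | ⟨a₃, _ | ⟨a₄, c⟩⟩⟩⟩⟩ <;> simp [m] at hc
      exact ⟨_, _, _, _, rfl⟩
    simp [matrix, imp, neg, inst, Fml.subst, Trm.subst, Sat, Trm.val]
    grind
  · refine ⟨by simp [matrix, imp, neg, ball, IsD0, BddEx], ?_⟩
    obtain ⟨a, b, rfl⟩ := List.length_eq_two.1 hc
    simp [matrix, imp, neg, inst, ball, Fml.subst, Trm.subst, Sat, Trm.val]
    by_cases e : a = b
    · exact .inr e
    · refine .inl ?_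
      by_contra! h
      exact e (ZFSet.ext fun z => ⟨h.1 z, h.2 z⟩)

open Base

theorem lab_pre_seq (A : KPAx.{v}) {c : List ZFSet.{v}} (hc : c.length ≤ A.m) :
    (lab (pre A c)).seq = {inst 0 c (allFrom c.length (A.m - c.length) A.matrix)} := by
  simp only [lab]
  split_ifs with h
  · rfl
  · rw [Nat.sub_eq_zero_of_le (not_lt.1 h)]
    simp only [allFrom, preLab]
    split <;> simp_all

/-- The three kinds of labels at a fully instantiated axiom. -/
theorem preLab_cases {A : KPAx.{v}} {c : List ZFSet.{v}} (hc : c.length = A.m) :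
    (A = equality ∨ A = extensionality) ∧ preLab A c (inst 0 c A.matrix) =
        ⟨{inst 0 c A.matrix}, .ax, .zero⟩ ∨
    (∃ y δ, A.matrix = .ex y δ ∧ A.m ≤ y ∧ preLab A c (inst 0 c A.matrix) =
        ⟨{.ex y (inst 0 c δ)}, .ex y (witness A c) (inst 0 c δ), .Om⟩ ∧
        ∀ a, (pre A c).next a = wit A c) ∨
    ∃ k θ, A = collection k θ := by
  have hex : ∀ (A : KPAx.{v}) y δ, A.matrix = .ex y δ → c.length = A.m → A.m ≤ y →
      (∀ k θ, A ≠ collection k θ) → ∃ y δ, A.matrix = .ex y δ ∧ A.m ≤ y ∧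
        preLab A c (inst 0 c A.matrix) =
          ⟨{.ex y (inst 0 c δ)}, .ex y (witness A c) (inst 0 c δ), .Om⟩ ∧
        ∀ a, (pre A c).next a = wit A c := by
    intro A y δ h hc hy hA
    refine ⟨y, δ, h, hy, ?_, fun a => ?_⟩
    · rw [h, inst_ex (by omega)]
      cases A <;> rfl
    · have hlt : ¬ c.length < A.m := by omega
      cases A <;> first | exact absurd rfl (hA _ _) | simp only [next, hlt, if_false]
  cases A with
  | equality => exact .inl ⟨.inl rfl, by simp [matrix, imp, preLab]⟩
  | extensionality => exact .inl ⟨.inr rfl, by simp [matrix, imp, preLab]⟩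
  | pairing => exact .inr (.inl (hex _ _ _ rfl hc le_rfl nofun))
  | union => exact .inr (.inl (hex _ _ _ rfl hc le_rfl nofun))
  | infinity => exact .inr (.inl (hex _ _ _ rfl hc le_rfl nofun))
  | separation k θ => exact .inr (.inl (hex _ _ _ rfl hc (Nat.le_succ _) nofun))
  | collection k θ => exact .inr (.inr ⟨k, θ, rfl⟩)

theorem preOrd_succ_le (A : KPAx.{v}) (n : ℕ) :
    B.Le (B.add (preOrd A n) (.hat Ordinal.omega0)) (preOrd A (n + 1)) := by
  cases A <;> exact add_omega_le

theorem lab_pre_coll {k : ℕ} {θ : Fml.{v}} {c : List ZFSet.{v}} (hc : c.length = k + 1) :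
    lab (pre (collection k θ) c) =
      ⟨{.or (collHyp k (.par (c.getD k ∅)) (inst 0 c θ)).neg
          (collConcl k (.par (c.getD k ∅)) (inst 0 c θ))},
        .or false (collHyp k (.par (c.getD k ∅)) (inst 0 c θ)).neg
          (collConcl k (.par (c.getD k ∅)) (inst 0 c θ)), omPlus 3 3⟩ := by
  have h : ¬ c.length < (collection k θ).m := by simp [m, hc]
  simp only [lab, h, if_false]
  rw [matrix, imp, inst_or, inst_neg, inst_collHyp hc, inst_collConcl hc, preLab]

theorem lab_pre_ord_le (A : KPAx.{v}) {c : List ZFSet.{v}} (hc : c.length ≤ A.m) :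
    B.Le (B.add (lab (pre A c)).ord (.hat Ordinal.omega0)) (preOrd A (A.m - c.length + 1)) := by
  by_cases h : c.length < A.m
  · simp only [lab, if_pos h]
    exact preOrd_succ_le _ _
  · have hc' : c.length = A.m := by omega
    rw [hc', Nat.sub_self]
    rcases preLab_cases hc' with ⟨hA, e⟩ | ⟨y, δ, -, -, e, -⟩ | ⟨k, θ, rfl⟩
    · simp only [lab, if_neg h, e, zero_add_omega]
      rcases hA with rfl | rfl <;> exact .inl (hat_lt_omPlus _ _ _)
    · simp only [lab, if_neg h, e]
      rw [Om_eq_omPlus, omPlus_add_omega]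
      cases A
      case collection => simp [preLab, matrix, imp] at e
      all_goals exact .refl _
    · rw [lab_pre_coll hc']
      exact add_omega_le

theorem good_pre (hD : ∀ a ∈ D, a ∈ B.L γ)
    (hW : ∀ (A : KPAx.{v}) c, A.Valid C → c.length = A.m → (∀ a ∈ c, a ∈ D) → witness A c ∈ D)
    {A : KPAx.{v}} {c : List ZFSet.{v}} (hA : A.Valid C) (hc : c.length ≤ A.m)
    (hcD : ∀ a ∈ c, a ∈ D) : Good B γ C D (pre A c) := by
  have hcl : ∀ φ ∈ (lab (pre A c)).seq, ClosedIn D φ := by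
    rw [lab_pre_seq A hc]
    simpa using closedIn_inst hA hc hcD
  have hL := fun φ hφ => isF_of_closedIn hD (hcl φ hφ)
  by_cases h : c.length < A.m
  · have e : inst 0 c (allFrom c.length (A.m - c.length) A.matrix) =
        .all c.length (inst 0 c (allFrom (c.length + 1) (A.m - c.length - 1) A.matrix)) := by
      rw [show A.m - c.length = (A.m - c.length - 1) + 1 by omega, allFrom, inst_all (by omega)]
      rfl
    have e' : lab (pre A c) = ⟨{.all c.length
        (inst 0 c (allFrom (c.length + 1) (A.m - c.length - 1) A.matrix))},
        .all c.length (inst 0 c (allFrom (c.length + 1) (A.m - c.length - 1) A.matrix)),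
        preOrd A (A.m - c.length)⟩ := by
      simp only [lab, h, if_true, e]
    have hn : ∀ a, (pre A c).next a = pre A (c ++ [a]) := fun a => by simp only [next, h, if_true]
    have hl : ∀ a, (c ++ [a]).length = c.length + 1 := fun a => by simp
    refine ⟨hcl, ?_, .inl ?_, ?_, .inr ?_, ?_, ?_⟩
    · rw [e'] at hL ⊢
      exact hL _ (by simp)
    · rw [e']; rfl
    · rw [e']; nofun
    · rw [e']
      cases A <;> exact ⟨_, _, rfl⟩
    · intro a _ D' hD' ha
      rw [hn]
      refine ⟨hA, by rw [hl]; exact h, fun b hb => ?_⟩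
      rcases List.mem_append.1 hb with hb | hb
      · exact hD' (hcD b hb)
      · rw [List.mem_singleton.1 hb]; exact ha
    · rw [e']
      refine Step.mk_all (by simp) (fun a _ => ?_) fun a _ φ hφ => ?_
      · rw [hn]
        have := lab_pre_ord_le (B := B) A (c := c ++ [a]) (by rw [hl]; exact h)
        rwa [hl, show A.m - (c.length + 1) + 1 = A.m - c.length by omega] at this
      · rw [hn, lab_pre_seq A (by rw [hl]; exact h), inst_append_singleton, hl,
          Nat.zero_add, show A.m - (c.length + 1) = A.m - c.length - 1 by omega] at hφ
        exact .inr (Finset.mem_singleton.1 hφ)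
  · have hc' : c.length = A.m := by omega
    rcases preLab_cases hc' with ⟨hA', e⟩ | ⟨y, δ, hm, hy, e, hn⟩ | ⟨k, θ, rfl⟩
    · have e' : lab (pre A c) = ⟨{inst 0 c A.matrix}, .ax, .zero⟩ := by
        simp only [lab, h, if_false, e]
      obtain ⟨h1, h2⟩ := isD0_matrix hA' hc'
      rw [e'] at hcl
      refine ⟨by rw [e']; exact hcl, by rw [e']; trivial, .inl (by rw [e']; rfl), by rw [e']; nofun,
        .inl (by rw [e']), by rw [e']; nofun, ?_⟩
      rw [e']
      exact Step.mk_ax (Finset.mem_singleton_self _)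
        ⟨h1.inst _ _, (hcl _ (Finset.mem_singleton_self _)).1, h2⟩
    · have e' : lab (pre A c) = ⟨{.ex y (inst 0 c δ)}, .ex y (witness A c) (inst 0 c δ), .Om⟩ := by
        simp only [lab, h, if_false, e]
      have hw := hW A c hA hc' hcD
      rw [e'] at hL
      refine ⟨hcl, ?_, .inr ⟨_, hw, by rw [e']; rfl⟩, by rw [e']; nofun,
        .inr ⟨0, 0, by rw [e', Om_eq_omPlus]⟩, ?_, ?_⟩
      · rw [e']
        exact ⟨hL _ (Finset.mem_singleton_self _), hD _ hw⟩
      · intro a _ D' hD' ha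
        rw [hn]
        exact ⟨⟨hA, hc', fun a ha => hD' (hcD a ha)⟩, y, δ, hm, hy⟩
      · rw [e']
        refine Step.mk_ex (Finset.mem_singleton_self _) ?_ (hat_lt_Om _) fun φ hφ => ?_
        · rw [hn]
          simp only [lab, zero_add_omega]
          exact .inl (hat_lt_Om _)
        · rw [hn] at hφ
          simp only [lab, hm, Finset.mem_singleton] at hφ
          rw [inst_ex (by omega)] at hφ
          exact .inr hφ
    · have e' := lab_pre_coll (θ := θ) hc'
      have hn : ∀ a, (pre (collection k θ) c).next a = coll₁ k θ c := fun a => by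
        simp only [next, h, if_false]
      rw [e'] at hL
      refine ⟨hcl, ?_, .inl (by rw [e']; rfl), by rw [e']; nofun, .inr ⟨3, 3, by rw [e']⟩, ?_, ?_⟩
      · rw [e']
        exact IsF.or.1 (hL _ (Finset.mem_singleton_self _))
      · intro a _ D' hD' ha
        rw [hn]
        exact ⟨hA, hc', fun a ha => hD' (hcD a ha)⟩
      · rw [e']
        refine Step.mk_or (Finset.mem_singleton_self _) ?_ fun φ hφ => ?_
        · rw [hn]
          exact omPlus_lt (by omega)
        · rw [hn] at hφ
          simp only [lab, Finset.mem_insert, Finset.mem_singleton] at hφ ⊢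
          exact hφ

theorem good_wit (hW : ∀ (A : KPAx.{v}) c, A.Valid C → c.length = A.m → (∀ a ∈ c, a ∈ D) →
      witness A c ∈ D)
    {A : KPAx.{v}} {c : List ZFSet.{v}} (hA : A.Valid C) (hc : c.length = A.m)
    (hcD : ∀ a ∈ c, a ∈ D) {y : ℕ} {δ : Fml.{v}} (hm : A.matrix = .ex y δ) (hy : A.m ≤ y) :
    Good B γ C D (wit A c) := by
  have e : lab (wit A c) = ⟨{(inst 0 c δ).subst y (witness A c)}, .ax, .zero⟩ := by
    rw [lab, hm, inst_ex (by omega)]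
    rfl
  have h1 := closedIn_inst hA hc.le hcD
  rw [hc, Nat.sub_self, allFrom, hm, inst_ex (by omega)] at h1
  have h2 := h1.subst' (hW A c hA hc hcD)
  obtain ⟨h3, h4⟩ := sat_witness hA hc hm
  refine ⟨by rw [e]; simpa using h2, by rw [e]; trivial, .inl (by rw [e]; rfl), by rw [e]; nofun,
    .inl (by rw [e]), by rw [e]; nofun, ?_⟩
  rw [e]
  exact Step.mk_ax (Finset.mem_singleton_self _) ⟨(h3.inst _ _).subst _ _, h2.1, h4⟩

theorem Ok.good (hD : ∀ a ∈ D, a ∈ B.L γ)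
    (hW : ∀ (A : KPAx.{v}) c, A.Valid C → c.length = A.m → (∀ a ∈ c, a ∈ D) → witness A c ∈ D)
    {N : KPNode.{v}} (h : N.Ok C D) : Good B γ C D N := by
  cases N with
  | pre A c => exact good_pre hD hW h.1 h.2.1 h.2.2
  | wit A c =>
    obtain ⟨⟨h1, h2, h3⟩, y, δ, h4, h5⟩ := h
    exact good_wit hW h1 h2 h3 h4 h5
  | coll₁ k θ c => exact (good_coll_trunk hD h.1 h.2.1 h.2.2).1
  | coll₂ k θ c => exact (good_coll_trunk hD h.1 h.2.1 h.2.2).2.1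
  | coll₃ k θ c => exact (good_coll_trunk hD h.1 h.2.1 h.2.2).2.2
  | coll₄ k θ c a => exact (good_coll_elem hD h.1.1 h.1.2.1 h.1.2.2 h.2).1
  | coll₅ k θ c a => exact (good_coll_elem hD h.1.1 h.1.2.1 h.1.2.2 h.2).2.1
  | coll₆ k θ c a => exact (good_coll_elem hD h.1.1 h.1.2.1 h.1.2.2 h.2).2.2.1
  | coll₇ k θ c a => exact (good_coll_elem hD h.1.1 h.1.2.1 h.1.2.2 h.2).2.2.2.1
  | collMem k θ c a => exact (good_coll_elem hD h.1.1 h.1.2.1 h.1.2.2 h.2).2.2.2.2.1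
  | coll₈ k θ c a => exact (good_coll_elem hD h.1.1 h.1.2.1 h.1.2.2 h.2).2.2.2.2.2
  | coll₉ k θ c a b => exact (good_coll_wit hD h.1.1 h.1.2.1 h.1.2.2 h.2.1 h.2.2).1
  | collLeaf k θ c a b => exact (good_coll_wit hD h.1.1 h.1.2.1 h.1.2.2 h.2.1 h.2.2).2

end KPNode

end Collapsing

namespace Collapsing

universe v

open Fml

namespace Base

variable {B : Base.{v}} {α : Ordinal.{v}} {ϑ : Tm.{v} → Ordinal.{v}}

/-- The sets over which `H Ω [ρ]` has control. -/
def Ctl (B : Base.{v}) (α : Ordinal.{v}) (ϑ : Tm.{v} → Ordinal.{v}) (ρ : Ordinal.{v}) :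
    Set ZFSet.{v} := {x | x ∈ B.L (Ordinal.omega0 ^ α) ∧ B.rk x ∈ B.J α ϑ .Om {ρ}}

theorem mem_L_of_ctl {ρ : Ordinal.{v}} : ∀ a ∈ B.Ctl α ϑ ρ, a ∈ B.L (Ordinal.omega0 ^ α) :=
  fun _ h => h.1

theorem kF_mem_J {t : Tm.{v}} {X : Set Ordinal.{v}} {φ : Fml.{v}}
    (h : ∀ a ∈ φ.pars, B.rk a ∈ B.J α ϑ t X) : B.kF φ ∈ B.J α ϑ t X := by
  have hT : ∀ s : Trm.{v}, (∀ a ∈ s.pars, B.rk a ∈ B.J α ϑ t X) → B.kTrm s ∈ B.J α ϑ t X := by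
    intro s hs
    cases s with
    | par a => exact hs a rfl
    | var n => exact zero_mem_J
  induction φ with
  | mem s u | nmem s u | eq s u | neq s u =>
    exact max_mem_J (hT s fun a ha => h a (.inl ha)) (hT u fun a ha => h a (.inr ha))
  | and φ ψ h₁ h₂ | or φ ψ h₁ h₂ =>
    exact max_mem_J (h₁ fun a ha => h a (.inl ha)) (h₂ fun a ha => h a (.inr ha))
  | all x φ ih | ex x φ ih => exact ih h

namespace IsBH

variable (hϑ : B.IsBH α ϑ)

include hϑ

theorem succ_mem_J {t : Tm.{v}} {X : Set Ordinal.{v}} {β : Ordinal.{v}}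
    (hβ : β < Ordinal.omega0 ^ α) (h : β ∈ B.J α ϑ t X) :
    Order.succ β < Ordinal.omega0 ^ α ∧ Order.succ β ∈ B.J α ϑ t X := by
  have hlim : ∀ γ : Ordinal.{v}, 0 < γ → ∀ δ, δ < Ordinal.omega0 ^ γ →
      Order.succ δ < Ordinal.omega0 ^ γ := by
    intro γ hγ δ hδ
    rw [Order.succ_eq_add_one]
    exact Ordinal.isPrincipal_add_omega0_opow γ hδ (one_lt_opow hγ)
  have h1 := hlim α hϑ.pos β hβ
  refine ⟨h1, mem_H_of_star (Base.hat_mem h1) ?_⟩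
  exact hϑ.J_down hβ h ((star_hat_le (hlim _ (succ_pos' _) _ (lt_opow_star_hat (B := B) β))).trans
    (star_hat_le_self β))

theorem J_Om_mono {ρ : Ordinal.{v}} {t : Tm.{v}} {X : Set Ordinal.{v}}
    (hρ : ρ < Ordinal.omega0 ^ α) (ht : t ∈ B.Eps α) (hΩ : B.Le .Om t)
    (h : ρ ∈ B.J α ϑ t X) : B.J α ϑ .Om {ρ} ⊆ B.J α ϑ t X :=
  hϑ.J_mono (Om_mem hϑ.pos) ht (by simpa using hρ) hΩ (by simpa using h)

theorem ctl_mono {ρ ρ' : Ordinal.{v}} (hρ' : ρ' < Ordinal.omega0 ^ α) (h : ρ ≤ ρ') :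
    B.Ctl α ϑ ρ ⊆ B.Ctl α ϑ ρ' := fun _ ha =>
  ⟨ha.1, hϑ.J_Om_mono (h.trans_lt hρ') (Om_mem hϑ.pos) (.refl _)
    (hϑ.J_down hρ' (base_mem_J (Set.mem_singleton _)) h) ha.2⟩

theorem mem_ctl {ρ : Ordinal.{v}} {a : ZFSet.{v}} (ha : a ∈ B.L (Ordinal.omega0 ^ α))
    (hρ : ρ < Ordinal.omega0 ^ α) (h : B.rk a ≤ ρ) : a ∈ B.Ctl α ϑ ρ :=
  ⟨ha, hϑ.J_down hρ (base_mem_J rfl) h⟩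

/-- A set that is definable over a stage from parameters in `Ctl` is in `Ctl`. -/
theorem mem_ctl_of_defSets {ρ β : Ordinal.{v}} {a : ZFSet.{v}} (hβ : β < Ordinal.omega0 ^ α)
    (h : β ∈ B.J α ϑ .Om {ρ}) (ha : a ∈ defSets (B.L (Order.succ β))) : a ∈ B.Ctl α ϑ ρ := by
  rw [← L_succ] at ha
  obtain ⟨h1, h2⟩ := hϑ.succ_mem_J hβ h
  obtain ⟨h3, -⟩ := hϑ.succ_mem_J h1 h2
  exact ⟨B.L_mono h3.le ha, hϑ.J_down h1 h2 (rk_le ha)⟩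

/-- The operators are closed under the witnesses for the axioms, which are definable over a stage
that contains the parameters. -/
theorem witness_mem_ctl (ρ : Ordinal.{v}) {C : ℕ} (A : KPAx.{v}) (c : List ZFSet.{v})
    (hA : A.Valid C) (hc : c.length = A.m) (h : ∀ a ∈ c, a ∈ B.Ctl α ϑ ρ) :
    KPNode.witness A c ∈ B.Ctl α ϑ ρ := by
  have h0 : (0 : Ordinal.{v}) < Ordinal.omega0 ^ α := zero_lt_one.trans (one_lt_opow hϑ.pos)
  have hr : ∀ a ∈ B.Ctl α ϑ ρ, B.rk a < Ordinal.omega0 ^ α := fun a ha => rk_lt h0 ha.1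
  have hemp : ∅ ∈ B.Ctl α ϑ ρ := ⟨B.empty_mem_L _, by simpa using zero_mem_J⟩
  cases A with
  | equality => exact hemp
  | extensionality => exact hemp
  | collection k θ => exact hemp
  | pairing =>
    obtain ⟨a, b, rfl⟩ := List.length_eq_two.1 hc
    have ha := h a (by simp)
    have hb := h b (by simp)
    refine hϑ.mem_ctl_of_defSets (max_lt (hr a ha) (hr b hb)) (max_mem_J ha.2 hb.2)
      (pair_mem_defSets ?_ ?_)
    · exact B.L_mono (Order.succ_le_succ (le_max_left _ _)) (mem_L_succ_rk ha.1)
    · exact B.L_mono (Order.succ_le_succ (le_max_right _ _)) (mem_L_succ_rk hb.1)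
  | union =>
    obtain ⟨a, rfl⟩ := KPNode.length_eq_one hc
    have ha := h a (by simp)
    exact hϑ.mem_ctl_of_defSets (hr a ha) ha.2
      (sUnion_mem_defSets (B.isTransitive_L _) (mem_L_succ_rk ha.1))
  | infinity =>
    obtain ⟨h1, h2⟩ := hϑ.omega_add_mem_J (X := {ρ}) (Om_mem hϑ.pos) (.refl _)
    have h3 := omega_mem_L (B := B)
    have h4 : Order.succ Ordinal.omega0 ≤ Ordinal.omega0 ^ α := by
      rw [Order.succ_eq_add_one]; exact h2.le
    exact ⟨B.L_mono h4 h3, hϑ.J_down h2 h1 ((rk_le h3).trans le_self_add)⟩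
  | separation k θ =>
    obtain ⟨-, hD, hp, hv⟩ := hA
    have hc' : c.length = k + 1 := hc
    obtain ⟨β, hβ, hβJ, hcβ⟩ : ∃ β < Ordinal.omega0 ^ α, β ∈ B.J α ϑ .Om {ρ} ∧
        ∀ a ∈ c, a ∈ B.L (Order.succ β) := by
      clear hc hc'
      induction c with
      | nil => exact ⟨0, h0, zero_mem_J, by simp⟩
      | cons a c ih =>
        obtain ⟨β, h1, h2, h3⟩ := ih fun b hb => h b (by simp [hb])
        have ha := h a (by simp)
        refine ⟨max (B.rk a) β, max_lt (hr a ha) h1, max_mem_J ha.2 h2, fun b hb => ?_⟩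
        rcases List.mem_cons.1 hb with rfl | hb
        · exact B.L_mono (Order.succ_le_succ (le_max_left _ _)) (mem_L_succ_rk ha.1)
        · exact B.L_mono (Order.succ_le_succ (le_max_right _ _)) (h3 b hb)
    refine hϑ.mem_ctl_of_defSets hβ hβJ (sep_mem_defSets (B.isTransitive_L _) (hcβ _ ?_)
      (hD.inst _ _) (fun a ha => ?_) (Nat.succ_ne_zero k) fun i hi => ?_)
    · rw [List.getD_eq_getElem _ _ (by omega)]
      exact List.getElem_mem _
    · rcases pars_inst ha with ha | ha
      · rw [hp] at ha
        exact absurd ha (Set.notMem_empty a)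
      · exact hcβ a ha
    · obtain ⟨h1, h2⟩ := mem_fv_inst hi
      have := Finset.mem_range.1 (hv h1)
      rw [Finset.mem_singleton]
      omega

end IsBH

/-! ### Nodes of the basic preproof -/

theorem redex_spec {Γ Γ₀ Γ₁ : List Fml.{v}} {φ : Fml.{v}} (h : redex Γ = some (Γ₀, φ, Γ₁)) :
    Γ = Γ₀ ++ φ :: Γ₁ ∧ ¬ φ.IsPrime := by
  induction Γ generalizing Γ₀ with
  | nil => simp [redex] at h
  | cons ψ Γ ih =>
    simp only [redex] at h
    split_ifs at h with hp
    · rw [Option.map_eq_some_iff] at h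
      obtain ⟨⟨Δ₀, χ, Δ₁⟩, h1, h2⟩ := h
      simp only [Prod.mk.injEq] at h2
      obtain ⟨rfl, rfl, rfl⟩ := h2
      obtain ⟨h3, h4⟩ := ih h1
      exact ⟨by rw [h3]; rfl, h4⟩
    · simp only [Option.some.injEq, Prod.mk.injEq] at h
      obtain ⟨rfl, rfl, rfl⟩ := h
      exact ⟨rfl, hp⟩

theorem mem_of_redex {Γ Γ₀ Γ₁ : List Fml.{v}} {φ : Fml.{v}} (h : redex Γ = some (Γ₀, φ, Γ₁)) :
    ∀ ψ, ψ ∈ Γ ↔ ψ = φ ∨ ψ ∈ Γ₀ ++ Γ₁ := by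
  intro ψ
  rw [(redex_spec h).1]
  simp only [List.mem_append, List.mem_cons]
  tauto

theorem witness_mem (σ : List ZFSet.{v}) (Γ : List Fml.{v}) (x : ℕ) (ψ : Fml.{v}) :
    B.witness σ Γ x ψ ∈ B.u ∨ B.witness σ Γ x ψ ∈ σ := by
  have hc : ∀ i, B.cand σ i ∈ B.u ∨ B.cand σ i ∈ σ := by
    intro i
    unfold cand
    split_ifs with h1 h2
    · exact .inl (enum_mem _)
    · refine .inr ?_
      have h3 : i / 2 < σ.reverse.length := by rw [List.length_reverse]; omega
      rw [List.getD_eq_getElem _ _ h3]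
      exact List.mem_reverse.1 (List.getElem_mem h3)
    · exact .inl (enum_mem _)
  unfold witness
  split_ifs
  · exact hc _
  · exact .inl (enum_mem _)

theorem rkS_lt (hα : 0 < α) {σ : List ZFSet.{v}} (hσ : ∀ a ∈ σ, a ∈ B.L (Ordinal.omega0 ^ α)) :
    B.rkS σ < Ordinal.omega0 ^ α := by
  have h0 : (0 : Ordinal.{v}) < Ordinal.omega0 ^ α := zero_lt_one.trans (one_lt_opow hα)
  induction σ with
  | nil => exact h0
  | cons a σ ih =>
    rw [rkS_cons]
    exact max_lt (rk_lt h0 (hσ a (by simp))) (ih fun b hb => hσ b (by simp [hb]))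

theorem valid_kp (k : ℕ) : (B.kp k).Valid B.C₀ := (B.kp_iff _).2 ⟨k, rfl⟩

theorem eps_add_hat_le {γ : Ordinal.{v}} (hγ : 0 < γ) {σ τ : List ZFSet.{v}}
    (hσ : B.InS (Ordinal.omega0 ^ γ) σ) (hτ : B.InS (Ordinal.omega0 ^ γ) τ) (h : B.KB σ τ)
    {β : Ordinal.{v}} (hβ : β < Ordinal.omega0 ^ γ) :
    B.Le (B.add (.eps σ) (.hat β)) (.eps τ) :=
  .inl (exp_add_hat_le (s := .eps σ) (t := .eps τ) hγ ⟨rfl, hσ⟩ ⟨rfl, hτ⟩ (by simpa using h) hβ)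

theorem hat_lt_eps (β : Ordinal.{v}) (σ : List ZFSet.{v}) : B.Lt (.hat β) (.eps σ) := by
  by_cases e : β = 0
  · simp [e]
  · rw [hat_of_ne e]
    exact .oadd_eps _ _ _ _ (.zero_eps _)

theorem omPlus_lt_eps (n j : ℕ) (σ : List ZFSet.{v}) : B.Lt (KPNode.omPlus n j) (.eps σ) :=
  .oadd_eps _ _ _ _ (hat_lt_eps 1 σ)

/-- The nodes that occur at the address `σ` of the basic preproof. -/
def PNodeOk (B : Base.{v}) (α : Ordinal.{v}) (ϑ : Tm.{v} → Ordinal.{v}) (σ : List ZFSet.{v}) :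
    PNode.{v} → Prop
  | .search τ Γ => τ = σ ∧ B.searchLab (Ordinal.omega0 ^ α) σ = some Γ
  | .kp N => N.Ok B.C₀ (B.Ctl α ϑ (B.rkS σ))

theorem pNode_ok (hϑ : B.IsBH α ϑ) {σ : List ZFSet.{v}}
    (hσ : ∀ a ∈ σ, a ∈ B.L (Ordinal.omega0 ^ α)) {p : PNode.{v}}
    (h : B.pNode (Ordinal.omega0 ^ α) σ = some p) : B.PNodeOk α ϑ σ p := by
  induction σ generalizing p with
  | nil =>
    simp only [pNode, Option.some.injEq] at h
    subst h
    exact ⟨rfl, rfl⟩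
  | cons a σ ih =>
    rw [pNode, Option.bind_eq_some_iff] at h
    obtain ⟨q, hq, h⟩ := h
    have hq' := ih (fun b hb => hσ b (by simp [hb])) hq
    split_ifs at h with ha
    cases q with
    | search τ Γ =>
      obtain ⟨rfl, hΓ⟩ := hq'
      simp only [pNext] at h
      split_ifs at h with hc
      · simp only [Option.some.injEq] at h
        subst h
        exact ⟨valid_kp _, Nat.zero_le _, by simp⟩
      · rw [Option.map_eq_some_iff] at h
        obtain ⟨Γ', h1, rfl⟩ := h
        exact ⟨rfl, Option.bind_eq_some_iff.2 ⟨Γ, hΓ, h1⟩⟩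
    | kp N =>
      simp only [pNext, Option.some.injEq] at h
      subst h
      have hρ := rkS_lt hϑ.pos hσ
      exact (KPNode.Ok.good mem_L_of_ctl (hϑ.witness_mem_ctl _) hq').next a ha _
        (hϑ.ctl_mono hρ (le_max_right _ _)) (hϑ.mem_ctl (hσ a (by simp)) hρ (le_max_left _ _))

/-- Formulas in the search tree have parameters that are controlled by the entries of the node. -/
theorem search_closed (hϑ : B.IsBH α ϑ) {σ : List ZFSet.{v}} {Γ : List Fml.{v}}
    (h : B.searchLab (Ordinal.omega0 ^ α) σ = some Γ) :
    ∀ φ ∈ Γ, ClosedIn (B.Ctl α ϑ (B.rkS σ)) φ := by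
  have hσ := searchLab_mem_L h
  induction σ generalizing Γ with
  | nil =>
    simp only [searchLab, Option.some.injEq] at h
    subst h
    simp
  | cons a σ ih =>
    obtain ⟨Δ, h₁, h₂⟩ := Option.bind_eq_some_iff.1 h
    have hρ := rkS_lt hϑ.pos hσ
    have h₃ : ∀ φ ∈ Δ, ClosedIn (B.Ctl α ϑ (B.rkS (a :: σ))) φ := fun φ hφ =>
      (ih h₁ (fun b hb => hσ b (by simp [hb])) φ hφ).mono (hϑ.ctl_mono hρ (le_max_right _ _))
    have ha := hϑ.mem_ctl (hσ a (by simp)) hρ (le_max_left _ _)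
    have hw : ∀ x ψ, B.witness σ Δ x ψ ∈ B.Ctl α ϑ (B.rkS (a :: σ)) := by
      intro x ψ
      rcases witness_mem (B := B) σ Δ x ψ with h | h
      · exact ⟨B.u_mem_L h _, by rw [B.rk_of_mem_u h]; exact zero_mem_J⟩
      · exact hϑ.mem_ctl (hσ _ (by simp [h])) hρ ((rk_le_rkS h).trans (le_max_right _ _))
    unfold searchStep at h₂
    by_cases c1 : Even σ.length
    · rw [if_pos c1] at h₂
      split_ifs at h₂
      simp only [Option.some.injEq] at h₂
      subst h₂
      simp only [List.mem_append, List.mem_singleton]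
      rintro φ (hφ | rfl)
      exacts [h₃ φ hφ, ClosedIn.neg.2 (KPAx.closedIn_formula (valid_kp _) _)]
    · rw [if_neg c1] at h₂
      by_cases c2 : ∃ φ ∈ Δ, φ.TrueD0
      · simp [c2] at h₂
      rw [if_neg c2] at h₂
      rcases hr : redex Δ with _ | ⟨Γ₀, φ, Γ₁⟩
      · simp only [hr] at h₂
        split_ifs at h₂
        simp only [Option.some.injEq] at h₂
        subst h₂
        exact h₃
      · have hm := mem_of_redex hr
        have hφ := h₃ φ ((hm φ).2 (.inl rfl))
        have key : ∀ χ, ClosedIn (B.Ctl α ϑ (B.rkS (a :: σ))) χ →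
            ∀ ψ ∈ Γ₀ ++ Γ₁ ++ [φ, χ], ClosedIn (B.Ctl α ϑ (B.rkS (a :: σ))) ψ := by
          intro χ hχ ψ hψ
          simp only [List.mem_append, List.mem_cons, List.not_mem_nil, or_false] at hψ
          rcases hψ with hψ | rfl | rfl
          exacts [h₃ ψ ((hm ψ).2 (.inr (List.mem_append.2 hψ))), hφ, hχ]
        cases φ <;> simp only [hr, reduceCtorEq] at h₂ <;> split_ifs at h₂ <;>
          simp only [Option.some.injEq] at h₂ <;> subst h₂ <;> refine key _ ?_
        · exact (ClosedIn.and.1 hφ).1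
        · exact (ClosedIn.and.1 hφ).2
        · exact (ClosedIn.or.1 hφ).2
        · exact (ClosedIn.or.1 hφ).1
        · exact hφ.subst ha
        · exact hφ.subst' (hw _ _)

end Base

end Collapsing

namespace Collapsing

universe v

open Fml

namespace Base

variable {B : Base.{v}} {α : Ordinal.{v}} {ϑ : Tm.{v} → Ordinal.{v}}

theorem basicLab_cons {γ : Ordinal.{v}} {σ : List ZFSet.{v}} {p p' : PNode.{v}} {a : ZFSet.{v}}
    (hp : B.pNode γ σ = some p) (ha : a ∈ B.premises γ (B.pLab p).rule)
    (hn : B.pNext γ p a = some p') : B.basicLab γ (a :: σ) = B.pLab p' := by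
  have : B.pNode γ (a :: σ) = some p' := by
    rw [pNode, hp, Option.bind_some, if_pos ha, hn]
  rw [basicLab, this]

theorem searchRule_cases (σ : List ZFSet.{v}) (Γ : List Fml.{v}) (γ : Ordinal.{v}) :
    (Even σ.length ∧ B.searchRule σ Γ = .cut (B.kp (σ.length / 2)).formula.neg ∧
      B.searchStep γ σ Γ ∅ = some (Γ ++ [(B.kp (σ.length / 2)).formula.neg])) ∨
    (¬ Even σ.length ∧
      ((∃ φ ∈ Γ, φ.TrueD0) ∧ B.searchRule σ Γ = .ax ∨
      B.searchRule σ Γ = .rep ∅ ∧ B.searchStep γ σ Γ ∅ = some Γ ∨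
      ∃ Γ₀ Γ₁, (∃ ψ₀ ψ₁, redex Γ = some (Γ₀, .and ψ₀ ψ₁, Γ₁) ∧ B.searchRule σ Γ = .and ψ₀ ψ₁ ∧
          B.searchStep γ σ Γ ∅ = some (Γ₀ ++ Γ₁ ++ [.and ψ₀ ψ₁, ψ₀]) ∧
          B.searchStep γ σ Γ {∅} = some (Γ₀ ++ Γ₁ ++ [.and ψ₀ ψ₁, ψ₁])) ∨
        (∃ i ψ₀ ψ₁, redex Γ = some (Γ₀, .or ψ₀ ψ₁, Γ₁) ∧ B.searchRule σ Γ = .or i ψ₀ ψ₁ ∧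
          B.searchStep γ σ Γ ∅ = some (Γ₀ ++ Γ₁ ++ [.or ψ₀ ψ₁, pick i ψ₀ ψ₁])) ∨
        (∃ x ψ, redex Γ = some (Γ₀, .all x ψ, Γ₁) ∧ B.searchRule σ Γ = .all x ψ ∧
          ∀ a ∈ B.L γ, B.searchStep γ σ Γ a = some (Γ₀ ++ Γ₁ ++ [.all x ψ, ψ.subst x a])) ∨
        (∃ x ψ, redex Γ = some (Γ₀, .ex x ψ, Γ₁) ∧
          B.searchRule σ Γ = .ex x (B.witness σ Γ x ψ) ψ ∧
          B.searchStep γ σ Γ ∅ =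
            some (Γ₀ ++ Γ₁ ++ [.ex x ψ, ψ.subst x (B.witness σ Γ x ψ)])))) := by
  by_cases c1 : Even σ.length
  · exact .inl ⟨c1, by simp only [searchRule, if_pos c1], by simp [searchStep, if_pos c1]⟩
  refine .inr ⟨c1, ?_⟩
  by_cases c2 : ∃ φ ∈ Γ, φ.TrueD0
  · exact .inl ⟨c2, by simp only [searchRule, if_neg c1, if_pos c2]⟩
  refine .inr ?_
  unfold searchStep searchRule
  simp only [if_neg c1, if_neg c2]
  rcases hr : redex Γ with _ | ⟨Γ₀, φ, Γ₁⟩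
  · exact .inl (by simp)
  refine .inr ⟨Γ₀, Γ₁, ?_⟩
  have hp := (redex_spec hr).2
  cases φ with
  | and ψ₀ ψ₁ => exact .inl ⟨ψ₀, ψ₁, rfl, rfl, by simp, by simp [Step.one_ne_empty]⟩
  | or ψ₀ ψ₁ =>
    refine .inr (.inl ⟨_, ψ₀, ψ₁, rfl, rfl, ?_⟩)
    by_cases h : ψ₀ ∈ Γ <;> simp [h, pick]
  | all x ψ => exact .inr (.inr (.inl ⟨x, ψ, rfl, rfl, fun a ha => by simp [ha]⟩))
  | ex x ψ => exact .inr (.inr (.inr ⟨x, ψ, rfl, rfl, by simp⟩))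
  | _ => exact absurd trivial hp

/-- The local conditions at the address `σ` of the basic preproof. -/
structure BasicOk (B : Base.{v}) (α : Ordinal.{v}) (ϑ : Tm.{v} → Ordinal.{v})
    (σ : List ZFSet.{v}) : Prop where
  rule : B.IsRule (Ordinal.omega0 ^ α) (B.basicLab (Ordinal.omega0 ^ α) σ).rule
  kR : B.kR (B.basicLab (Ordinal.omega0 ^ α) σ).rule ∈ B.J α ϑ .Om {B.rkS σ}
  cut : ∀ ψ, (B.basicLab (Ordinal.omega0 ^ α) σ).rule = .cut ψ → ψ.ht < B.C₀ + 6
  step : B.Step (Ordinal.omega0 ^ α) (B.basicLab (Ordinal.omega0 ^ α) σ).rule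
    (B.basicLab (Ordinal.omega0 ^ α) σ).seq (B.basicLab (Ordinal.omega0 ^ α) σ).ord
    (fun a => (B.basicLab (Ordinal.omega0 ^ α) (a :: σ)).seq)
    (fun a => (B.basicLab (Ordinal.omega0 ^ α) (a :: σ)).ord)

theorem basicOk_search (hϑ : B.IsBH α ϑ) {σ : List ZFSet.{v}} {Γ : List Fml.{v}}
    (hp : B.pNode (Ordinal.omega0 ^ α) σ = some (.search σ Γ))
    (hΓ : B.searchLab (Ordinal.omega0 ^ α) σ = some Γ) : B.BasicOk α ϑ σ := by
  have hb : B.basicLab (Ordinal.omega0 ^ α) σ = ⟨Γ.toFinset, B.searchRule σ Γ, .eps σ⟩ := by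
    rw [basicLab, hp]; rfl
  have hnext : ∀ a Γ', a ∈ B.premises (Ordinal.omega0 ^ α) (B.searchRule σ Γ) →
      ¬ (Even σ.length ∧ a = {∅}) → B.searchStep (Ordinal.omega0 ^ α) σ Γ a = some Γ' →
      B.basicLab (Ordinal.omega0 ^ α) (a :: σ) =
          ⟨Γ'.toFinset, B.searchRule (a :: σ) Γ', .eps (a :: σ)⟩ ∧
        B.InS (Ordinal.omega0 ^ α) (a :: σ) := by
    intro a Γ' h1 h2 h3
    exact ⟨basicLab_cons (p' := .search (a :: σ) Γ') hp h1
      (by simp only [pNext, if_neg h2, h3, Option.map_some]), Γ', Option.bind_eq_some_iff.2 ⟨Γ, hΓ, h3⟩⟩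
  have hin : B.InS (Ordinal.omega0 ^ α) σ := ⟨Γ, hΓ⟩
  have hlt : ∀ a, B.Lt (.eps (a :: σ)) (.eps σ) := fun a => .eps_eps _ _ (B.KB_cons a σ)
  have hbig : ∀ a, B.InS (Ordinal.omega0 ^ α) (a :: σ) →
      B.Le (B.add (.eps (a :: σ)) (.hat Ordinal.omega0)) (.eps σ) := fun a h =>
    eps_add_hat_le hϑ.pos h hin (B.KB_cons a σ) hϑ.omega_lt_opow
  have hcl := search_closed hϑ hΓ
  have hL : ∀ φ ∈ Γ, B.IsF (Ordinal.omega0 ^ α) φ := fun φ hφ =>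
    KPNode.isF_of_closedIn mem_L_of_ctl (hcl φ hφ)
  have hsub : ∀ {Γ₀ Γ₁ φ χ}, redex Γ = some (Γ₀, φ, Γ₁) →
      ∀ ψ ∈ (Γ₀ ++ Γ₁ ++ [φ, χ]).toFinset, ψ ∈ Γ.toFinset ∨ ψ = χ := by
    intro Γ₀ Γ₁ φ χ hr ψ hψ
    have := mem_of_redex hr ψ
    simp only [List.mem_toFinset, List.mem_append, List.mem_cons, List.not_mem_nil,
      or_false] at hψ this ⊢
    tauto
  have hred : ∀ {Γ₀ Γ₁ φ}, redex Γ = some (Γ₀, φ, Γ₁) → φ ∈ Γ := fun hr =>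
    (mem_of_redex hr _).2 (.inl rfl)
  rcases searchRule_cases (B := B) σ Γ (Ordinal.omega0 ^ α) with
    ⟨c1, e, e0⟩ | ⟨c1, ⟨⟨φ, hφ, hT⟩, e⟩ | ⟨e, e0⟩ |
    ⟨Γ₀, Γ₁, ⟨ψ₀, ψ₁, hr, e, e0, e1⟩ | ⟨i, ψ₀, ψ₁, hr, e, e0⟩ | ⟨x, ψ, hr, e, e0⟩ |
      ⟨x, ψ, hr, e, e0⟩⟩⟩
  · rw [e] at hb hnext
    have hcf := KPAx.closedIn_formula (B.valid_kp (σ.length / 2)) (B.Ctl α ϑ (B.rkS σ))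
    obtain ⟨h1, -⟩ := hnext ∅ _ (by simp [premises])
      (fun h => Step.one_ne_empty h.2.symm) e0
    have h2 : B.basicLab (Ordinal.omega0 ^ α) ({∅} :: σ) =
        (KPNode.pre (B.kp (σ.length / 2)) []).lab :=
      basicLab_cons (p' := .kp (.pre (B.kp (σ.length / 2)) [])) hp (by simp [pLab, e, premises])
        (by simp only [pNext, c1, and_self, if_true])
    have h3 := KPNode.good_pre (B := B) mem_L_of_ctl (hϑ.witness_mem_ctl (B.rkS σ))
      (B.valid_kp (σ.length / 2)) (c := []) (Nat.zero_le _) (by simp)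
    refine ⟨?_, ?_, ?_, ?_⟩
    · rw [hb]
      exact (KPNode.isF_of_closedIn mem_L_of_ctl hcf).neg
    · rw [hb]
      exact kF_mem_J fun a ha => ((ClosedIn.neg.2 hcf).2 a ha).2
    · rw [hb]
      rintro _ ⟨⟩
      rw [ht_neg]
      exact KPAx.ht_formula (B.valid_kp _)
    · rw [hb]
      refine Step.mk_cut ?_ ?_ (fun φ hφ => ?_) fun φ hφ => ?_
      · rw [h1]
        exact hlt _
      · rw [h2]
        rcases h3.ord with h | ⟨n, j, h⟩ <;> rw [h]
        exacts [.zero_eps _, omPlus_lt_eps _ _ _]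
      · rw [h1] at hφ
        exact Or.symm (by simpa using hφ)
      · rw [h2, KPNode.lab_pre_seq _ (Nat.zero_le _)] at hφ
        rw [Fml.neg_neg]
        exact .inr (Finset.mem_singleton.1 hφ)
  · rw [e] at hb
    refine ⟨by rw [hb]; trivial, by rw [hb]; exact zero_mem_J, by rw [hb]; nofun, ?_⟩
    rw [hb]
    exact Step.mk_ax (List.mem_toFinset.2 hφ) hT
  · rw [e] at hb hnext
    obtain ⟨h1, -⟩ := hnext ∅ _ rfl (fun h => c1 h.1) e0
    refine ⟨by rw [hb]; exact B.empty_mem_L _, ?_, by rw [hb]; nofun, ?_⟩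
    · rw [hb]
      simpa [Base.kR] using zero_mem_J
    · rw [hb]
      refine Step.mk_rep ?_ fun φ hφ => ?_
      · rw [h1]; exact hlt _
      · rw [h1] at hφ; exact hφ
  · rw [e] at hb hnext
    obtain ⟨h1, -⟩ := hnext ∅ _ (by simp [premises]) (fun h => c1 h.1) e0
    obtain ⟨h2, -⟩ := hnext {∅} _ (by simp [premises]) (fun h => c1 h.1) e1
    refine ⟨by rw [hb]; exact IsF.and.1 (hL _ (hred hr)), by rw [hb]; exact zero_mem_J,
      by rw [hb]; nofun, ?_⟩
    rw [hb]
    refine Step.mk_and (List.mem_toFinset.2 (hred hr)) ?_ ?_ (fun φ hφ => ?_) fun φ hφ => ?_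
    · rw [h1]; exact hlt _
    · rw [h2]; exact hlt _
    · rw [h1] at hφ; exact hsub hr φ hφ
    · rw [h2] at hφ; exact hsub hr φ hφ
  · rw [e] at hb hnext
    obtain ⟨h1, -⟩ := hnext ∅ _ rfl (fun h => c1 h.1) e0
    refine ⟨by rw [hb]; exact IsF.or.1 (hL _ (hred hr)), by rw [hb]; exact zero_mem_J,
      by rw [hb]; nofun, ?_⟩
    rw [hb]
    refine Step.mk_or (List.mem_toFinset.2 (hred hr)) ?_ (fun φ hφ => ?_)
    · rw [h1]; exact hlt _
    · rw [h1] at hφ; exact hsub hr φ hφ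
  · rw [e] at hb hnext
    refine ⟨by rw [hb]; exact hL _ (hred hr), by rw [hb]; exact zero_mem_J,
      by rw [hb]; nofun, ?_⟩
    rw [hb]
    refine Step.mk_all (List.mem_toFinset.2 (hred hr)) (fun a ha => ?_) fun a ha φ hφ => ?_
    all_goals obtain ⟨h1, h2⟩ := hnext a _ ha (fun h => c1 h.1) (e0 a ha)
    · rw [h1]; exact hbig _ h2
    · rw [h1] at hφ; exact hsub hr φ hφ
  · rw [e] at hb hnext
    obtain ⟨h1, h2⟩ := hnext ∅ _ rfl (fun h => c1 h.1) e0
    have hw : B.witness σ Γ x ψ ∈ B.Ctl α ϑ (B.rkS σ) := by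
      rcases witness_mem (B := B) σ Γ x ψ with h | h
      · exact ⟨B.u_mem_L h _, by rw [B.rk_of_mem_u h]; exact zero_mem_J⟩
      · exact hϑ.mem_ctl (searchLab_mem_L hΓ _ h) (rkS_lt hϑ.pos (searchLab_mem_L hΓ)) (rk_le_rkS h)
    refine ⟨by rw [hb]; exact ⟨hL _ (hred hr), hw.1⟩, by rw [hb]; exact hw.2,
      by rw [hb]; nofun, ?_⟩
    rw [hb]
    refine Step.mk_ex (List.mem_toFinset.2 (hred hr)) ?_ (hat_lt_eps _ _) (fun φ hφ => ?_)
    · rw [h1]; exact hbig _ h2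
    · rw [h1] at hφ; exact hsub hr φ hφ

theorem basicLab_none {γ : Ordinal.{v}} {σ : List ZFSet.{v}} (h : B.pNode γ σ = none) :
    B.basicLab γ σ = ⟨{triv}, .ax, .zero⟩ := by
  rw [basicLab, h]; rfl

theorem _root_.Collapsing.triv_trueD0 : TrueD0 triv.{v} := ⟨trivial, rfl, rfl⟩

theorem basicOk (hϑ : B.IsBH α ϑ) {σ : List ZFSet.{v}}
    (hσ : ∀ a ∈ σ, a ∈ B.L (Ordinal.omega0 ^ α)) : B.BasicOk α ϑ σ := by
  rcases hp : B.pNode (Ordinal.omega0 ^ α) σ with _ | p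
  · have hb := basicLab_none hp
    refine ⟨by rw [hb]; trivial, by rw [hb]; exact zero_mem_J, by rw [hb]; nofun, ?_⟩
    rw [hb]
    exact Step.mk_ax (Finset.mem_singleton_self _) triv_trueD0
  · have hok := pNode_ok hϑ hσ hp
    cases p with
    | search τ Γ =>
      obtain ⟨rfl, hΓ⟩ := hok
      exact basicOk_search hϑ hp hΓ
    | kp N =>
      have hg := KPNode.Ok.good (B := B) mem_L_of_ctl (hϑ.witness_mem_ctl _) hok
      have hb : B.basicLab (Ordinal.omega0 ^ α) σ = N.lab := by
        rw [basicLab, hp]; rfl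
      have hn : ∀ a ∈ B.premises (Ordinal.omega0 ^ α) N.lab.rule,
          B.basicLab (Ordinal.omega0 ^ α) (a :: σ) = (N.next a).lab := fun a ha =>
        basicLab_cons (p' := .kp (N.next a)) hp ha rfl
      refine ⟨by rw [hb]; exact hg.rule, ?_, fun ψ h => ?_, ?_⟩
      · rw [hb]
        rcases hg.kR with h | ⟨b, hbD, h⟩ <;> rw [h]
        exacts [zero_mem_J, hbD.2]
      · rw [hb] at h
        exact absurd h (hg.not_cut ψ)
      · rw [hb]
        obtain ⟨s1, s2, s3, s4, s5, s6, s7⟩ := hg.step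
        refine ⟨s1, s2, fun a ha => ?_, fun h a ha => ?_, fun h a ha => ?_, s6, s7⟩
        · rw [hn a ha]; exact s3 a ha
        · rw [hn a ha]; exact s4 h a ha
        · rw [hn a ha]; exact s5 h a ha

/-- The data of a basic code other than its last rule. -/
theorem basic_typed (hϑ : B.IsBH α ϑ) {σ : List ZFSet.{v}}
    (hσ : ∀ a ∈ σ, a ∈ B.L (Ordinal.omega0 ^ α)) :
    (∀ φ ∈ (B.basicLab (Ordinal.omega0 ^ α) σ).seq, ClosedIn (B.Ctl α ϑ (B.rkS σ)) φ) ∧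
    (B.basicLab (Ordinal.omega0 ^ α) σ).ord ∈ B.Eps α ∧
    B.star (B.basicLab (Ordinal.omega0 ^ α) σ).ord ∈ B.J α ϑ .Om {B.rkS σ} := by
  have hρ := rkS_lt hϑ.pos hσ
  rcases hp : B.pNode (Ordinal.omega0 ^ α) σ with _ | p
  · rw [basicLab_none hp]
    refine ⟨?_, zero_mem_Eps α, by rw [star_zero]; exact zero_mem_J⟩
    simp only [Finset.mem_singleton]
    rintro φ rfl
    refine ⟨rfl, ?_⟩
    simpa [triv, Fml.pars, Trm.pars] using
      hϑ.mem_ctl (ρ := B.rkS σ) (B.empty_mem_L _) hρ (by simp)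
  · have hok := pNode_ok hϑ hσ hp
    have hb : B.basicLab (Ordinal.omega0 ^ α) σ = B.pLab p := by rw [basicLab, hp]
    rw [hb]
    cases p with
    | search τ Γ =>
      obtain ⟨rfl, hΓ⟩ := hok
      refine ⟨fun φ hφ => search_closed hϑ hΓ φ (List.mem_toFinset.1 hφ), ⟨rfl, Γ, hΓ⟩, ?_⟩
      exact hϑ.J_down hρ (base_mem_J rfl) (star_eps_le ⟨Γ, hΓ⟩)
    | kp N =>
      have hg := KPNode.Ok.good (B := B) mem_L_of_ctl (hϑ.witness_mem_ctl _) hok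
      refine ⟨hg.closed, ?_⟩
      rw [pLab]
      rcases hg.ord with h | ⟨n, j, h⟩ <;> rw [h]
      · exact ⟨zero_mem_Eps α, by rw [star_zero]; exact zero_mem_J⟩
      · obtain ⟨h1, h2⟩ := hϑ.omega_add_mem_J (X := {B.rkS σ}) (Om_mem hϑ.pos) (.refl _)
        exact ⟨omPlus_mem hϑ.one_lt_alpha _ _, hϑ.J_down h2 h1
          ((star_omPlus n j).trans le_add_self)⟩

variable {K : CollVal.{v}}

theorem typed_basic (hϑ : B.IsBH α ϑ) {σ : List ZFSet.{v}} (h : B.IsCode α (.basic σ)) :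
    B.Typed α K (.basic σ) := by
  obtain ⟨h1, h2, -⟩ := basic_typed hϑ h
  exact ⟨fun φ hφ => KPNode.isF_of_closedIn mem_L_of_ctl (h1 φ hφ), h2, Om_mem hϑ.pos, .refl _,
    rkS_lt hϑ.pos h⟩

theorem lc_basic (hϑ : B.IsBH α ϑ) {σ : List ZFSet.{v}} (h : B.IsCode α (.basic σ)) :
    B.LC α K ϑ (.basic σ) := by
  have hok := basicOk hϑ h
  obtain ⟨h1, h2, h3⟩ := basic_typed hϑ h
  have hpr : ∀ a ∈ B.premises (Ordinal.omega0 ^ α) (B.r α K (.basic σ)),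
      a ∈ B.L (Ordinal.omega0 ^ α) := premises_mem_L hok.rule
  have hcons : ∀ a ∈ B.L (Ordinal.omega0 ^ α), B.IsCode α (.basic (a :: σ)) := by
    intro a ha b hb
    rcases List.mem_cons.1 hb with rfl | hb
    exacts [ha, h b hb]
  have hmax : ∀ a, B.rkS (a :: σ) ∈ B.J α ϑ .Om {B.rkS σ, B.rk a} := fun a => by
    rw [rkS_cons]
    exact max_mem_J (base_mem_J (by simp)) (base_mem_J (by simp))
  refine ⟨hok.rule, hcons, hok.step, ⟨hok.cut, fun _ _ => le_rfl⟩, h3,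
    fun φ hφ => kF_mem_J fun a ha => ((h1 φ hφ).2 a ha).2, hok.kR, fun _ _ => .refl _,
    fun a _ => hmax a, fun a ha => ?_⟩
  have hc := hcons a (hpr a ha)
  exact hϑ.J_Om_mono (rkS_lt hϑ.pos hc) (Om_mem hϑ.pos) (.refl _) (hmax a) (basic_typed hϑ hc).2.2

end Base

end Collapsing

namespace Collapsing

universe v

open Fml

namespace Base

variable {B : Base.{v}} {α : Ordinal.{v}} {ϑ : Tm.{v} → Ordinal.{v}} {K : CollVal.{v}}

/-! ### Codes are well-typed -/

theorem opow_pos' (α : Ordinal.{v}) : (0 : Ordinal.{v}) < Ordinal.omega0 ^ α :=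
  Ordinal.opow_pos _ Ordinal.omega0_pos

theorem pick_mem {γ : Ordinal.{v}} {ψ₀ ψ₁ : Fml.{v}} (i : Bool) (h : B.IsF γ ψ₀ ∧ B.IsF γ ψ₁) :
    B.IsF γ (pick i ψ₀ ψ₁) := by
  unfold pick; split_ifs; exacts [h.2, h.1]

theorem typed_coll (hϑ : B.IsBH α ϑ) (hK : B.IsColl α ϑ K) {t : Tm.{v}} {P : Code.{v}}
    (ht : t ∈ B.Eps α) (hΩ : B.Le .Om t) (hP : B.Typed α K P) : B.Typed α K (.coll t P) := by
  have hΩ' := Om_mem (B := B) hϑ.pos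
  by_cases hc : B.Collapsible α K ϑ t P
  · obtain ⟨h1, h2, h3, h4, h5, -⟩ := hK.pos t P hc
    have he := exp_mem hϑ.pos hP.o_mem
    have hm := add_mem hϑ.pos ht he
    refine ⟨?_, ?_, ?_, ?_, ?_⟩
    · rw [l, h1]; exact hP.l_mem
    · rw [o, h2]; exact hϑ.hat_mem hm
    · rw [h₀, h4]; exact hm
    · rw [h₀, h4]; exact hΩ.trans hΩ' ht hm (le_add_left' hϑ.pos ht he)
    · rw [h₁, h5]; exact opow_pos' α
  · obtain ⟨h1, h2, h3, h4, h5, -⟩ := hK.neg t P hc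
    refine ⟨?_, ?_, ?_, ?_, ?_⟩
    · rw [l, h1]
      simp only [Finset.mem_singleton]
      rintro φ rfl
      exact ⟨rfl, by simp [triv, Fml.pars, Trm.pars]⟩
    · rw [o, h2]; exact zero_mem_Eps α
    · rw [h₀, h4]; exact hΩ'
    · rw [h₀, h4]; exact .refl _
    · rw [h₁, h5]; exact opow_pos' α

/-- The values of a code are well-typed. This does not require local correctness, and it comes first
because rules and heights can only be compared when they are well-typed. -/
theorem typed (hϑ : B.IsBH α ϑ) (hK : B.IsColl α ϑ K) :
    ∀ P, B.IsCode α P → B.Typed α K P := by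
  have hα := hϑ.pos
  have h1 := one_mem_Eps (B := B) hα
  have h0 := opow_pos' α
  intro P
  induction P with
  | basic σ => exact typed_basic hϑ
  | invAll x ψ b P ih =>
    rintro ⟨h, hb, hP⟩
    obtain ⟨a1, a2, a3, a4, a5⟩ := ih hP
    refine ⟨fun φ hφ => ?_, a2, a3, a4, max_lt (max_lt a5 (h.kF_lt h0)) (rk_lt h0 hb)⟩
    simp only [l, Finset.mem_union, Finset.mem_sdiff, Finset.mem_singleton] at hφ
    rcases hφ with ⟨hφ, -⟩ | rfl
    exacts [a1 φ hφ, h.all_subst hb]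
  | invAnd ψ₀ ψ₁ i P ih =>
    rintro ⟨h, hP⟩
    obtain ⟨a1, a2, a3, a4, a5⟩ := ih hP
    have hp := pick_mem i (IsF.and.1 h)
    refine ⟨fun φ hφ => ?_, a2, a3, a4, max_lt a5 (hp.kF_lt h0)⟩
    simp only [l, Finset.mem_union, Finset.mem_sdiff, Finset.mem_singleton] at hφ
    rcases hφ with ⟨hφ, -⟩ | rfl
    exacts [a1 φ hφ, hp]
  | redEx x ψ P₀ P₁ ih₀ ih₁ =>
    rintro ⟨-, -, hP₀, hP₁⟩
    obtain ⟨a1, a2, a3, a4, a5⟩ := ih₀ hP₀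
    obtain ⟨b1, b2, b3, b4, b5⟩ := ih₁ hP₁
    refine ⟨fun φ hφ => ?_, add_mem hα b2 a2, tmax_mem a3 b3, ?_, max_lt a5 b5⟩
    · simp only [l, Finset.mem_union, Finset.mem_sdiff] at hφ
      rcases hφ with ⟨hφ, -⟩ | ⟨hφ, -⟩
      exacts [a1 φ hφ, b1 φ hφ]
    · exact a4.trans (Om_mem hα) a3 (tmax_mem a3 b3) (le_tmax_left _ _)
  | redOr ψ₀ ψ₁ P₀ P₁ ih₀ ih₁ =>
    rintro ⟨-, -, hP₀, hP₁⟩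
    obtain ⟨a1, a2, a3, a4, a5⟩ := ih₀ hP₀
    obtain ⟨b1, b2, b3, b4, b5⟩ := ih₁ hP₁
    refine ⟨fun φ hφ => ?_, add_mem hα b2 a2, tmax_mem a3 b3, ?_, max_lt a5 b5⟩
    · simp only [l, Finset.mem_union, Finset.mem_sdiff] at hφ
      rcases hφ with ⟨hφ, -⟩ | ⟨hφ, -⟩
      exacts [a1 φ hφ, b1 φ hφ]
    · exact a4.trans (Om_mem hα) a3 (tmax_mem a3 b3) (le_tmax_left _ _)
  | cutElim P ih =>
    intro hP
    obtain ⟨a1, a2, a3, a4, a5⟩ := ih hP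
    exact ⟨a1, exp_mem hα a2, a3, a4, a5⟩
  | axm θ =>
    rintro ⟨h, -⟩
    exact ⟨by simpa [l] using h, zero_mem_Eps α, Om_mem hα, .refl _, h.kF_lt h0⟩
  | conj ψ₀ ψ₁ P₀ P₁ ih₀ ih₁ =>
    rintro ⟨h, hP₀, hP₁⟩
    obtain ⟨a1, a2, a3, a4, a5⟩ := ih₀ hP₀
    obtain ⟨b1, b2, b3, b4, b5⟩ := ih₁ hP₁
    refine ⟨fun φ hφ => ?_, add_mem hα (tmax_mem a2 b2) h1, tmax_mem a3 b3, ?_,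
      max_lt (max_lt a5 b5) (h.kF_lt h0)⟩
    · simp only [l, Finset.mem_union, Finset.mem_sdiff, Finset.mem_singleton] at hφ
      rcases hφ with (⟨hφ, -⟩ | ⟨hφ, -⟩) | rfl
      exacts [a1 φ hφ, b1 φ hφ, h]
    · exact a4.trans (Om_mem hα) a3 (tmax_mem a3 b3) (le_tmax_left _ _)
  | disj i ψ₀ ψ₁ P ih =>
    rintro ⟨h, hP⟩
    obtain ⟨a1, a2, a3, a4, a5⟩ := ih hP
    refine ⟨fun φ hφ => ?_, add_mem hα a2 h1, a3, a4, max_lt a5 (h.kF_lt h0)⟩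
    simp only [l, Finset.mem_union, Finset.mem_sdiff, Finset.mem_singleton] at hφ
    rcases hφ with ⟨hφ, -⟩ | rfl
    exacts [a1 φ hφ, h]
  | bddEx φ β P ih =>
    rintro ⟨h, -, hβ, hP⟩
    obtain ⟨a1, a2, a3, a4, a5⟩ := ih hP
    have hr := h.rel (L_mem_L (B := B) hβ)
    refine ⟨fun ψ hψ => ?_, a2, a3, a4, ?_⟩
    · simp only [l] at hψ
      split_ifs at hψ
      · simp only [Finset.mem_union, Finset.mem_sdiff, Finset.mem_singleton] at hψ
        rcases hψ with ⟨hψ, -⟩ | rfl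
        exacts [a1 ψ hψ, hr]
      · exact a1 ψ hψ
    · simp only [h₁]
      split_ifs
      exacts [max_lt a5 (hr.kF_lt h0), a5]
  | bddAll x θ β P ih =>
    rintro ⟨h, -, -, hβ, hP⟩
    obtain ⟨a1, a2, a3, a4, a5⟩ := ih hP
    have hr := h.rel (L_mem_L (B := B) hβ)
    refine ⟨fun ψ hψ => ?_, a2, a3, a4, max_lt a5 (hr.kF_lt h0)⟩
    simp only [l, Finset.mem_union, Finset.mem_sdiff, Finset.mem_singleton] at hψ
    rcases hψ with ⟨hψ, -⟩ | rfl
    exacts [a1 ψ hψ, hr]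
  | coll t P ih =>
    rintro ⟨ht, hΩ, hP⟩
    exact typed_coll hϑ hK ht hΩ (ih hP)

/-! ### Comparison of controlling operators -/

theorem IsBH.J_le (hϑ : B.IsBH α ϑ) {t : Tm.{v}} {X : Set Ordinal.{v}}
    (hX : ∀ γ ∈ X, γ < Ordinal.omega0 ^ α) {β γ : Ordinal.{v}} (hγ : γ ∈ B.J α ϑ t X)
    (h : β ≤ γ) : β ∈ B.J α ϑ t X := hϑ.J_down (hϑ.lt_of_mem_J hX hγ) hγ h

theorem Typed.J_le {P : Code.{v}} (hP : B.Typed α K P) (hϑ : B.IsBH α ϑ) {β γ : Ordinal.{v}}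
    (hγ : γ ∈ B.J α ϑ (B.h₀ K P) {B.h₁ α K P}) (h : β ≤ γ) :
    β ∈ B.J α ϑ (B.h₀ K P) {B.h₁ α K P} := hϑ.J_le (by simpa using hP.h₁_lt) hγ h

theorem Typed.mem_J {P : Code.{v}} (hP : B.Typed α K P) (hϑ : B.IsBH α ϑ) {β : Ordinal.{v}}
    (h : β ≤ B.h₁ α K P) : β ∈ B.J α ϑ (B.h₀ K P) {B.h₁ α K P} :=
  hP.J_le hϑ (base_mem_J rfl) h

theorem Typed.lt_of_mem {P : Code.{v}} (hP : B.Typed α K P) {a : ZFSet.{v}}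
    (ha : a ∈ B.L (Ordinal.omega0 ^ α)) :
    ∀ γ ∈ ({B.h₁ α K P, B.rk a} : Set Ordinal.{v}), γ < Ordinal.omega0 ^ α := by
  rintro γ (rfl | rfl)
  exacts [hP.h₁_lt, rk_lt (opow_pos' α) ha]

theorem Typed.J_le₂ {P : Code.{v}} (hP : B.Typed α K P) (hϑ : B.IsBH α ϑ) {a : ZFSet.{v}}
    (ha : a ∈ B.L (Ordinal.omega0 ^ α)) {β γ : Ordinal.{v}}
    (hγ : γ ∈ B.J α ϑ (B.h₀ K P) {B.h₁ α K P, B.rk a}) (h : β ≤ γ) :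
    β ∈ B.J α ϑ (B.h₀ K P) {B.h₁ α K P, B.rk a} := hϑ.J_le (hP.lt_of_mem ha) hγ h

theorem Typed.J_sub_pair {P : Code.{v}} (hP : B.Typed α K P) (hϑ : B.IsBH α ϑ) (a : ZFSet.{v}) :
    B.J α ϑ (B.h₀ K P) {B.h₁ α K P} ⊆ B.J α ϑ (B.h₀ K P) {B.h₁ α K P, B.rk a} :=
  hϑ.J_mono hP.h₀_mem hP.h₀_mem (by simpa using hP.h₁_lt) (.refl _)
    (by simpa using base_mem_J (by simp))

/-- The operator of `P` lies below the operator of `Q`. -/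
theorem Typed.J_sub {P Q : Code.{v}} (hP : B.Typed α K P) (hQ : B.Typed α K Q)
    (hϑ : B.IsBH α ϑ) (h₀ : B.Le (B.h₀ K P) (B.h₀ K Q))
    (h₁ : B.h₁ α K P ∈ B.J α ϑ (B.h₀ K Q) {B.h₁ α K Q}) :
    B.J α ϑ (B.h₀ K P) {B.h₁ α K P} ⊆ B.J α ϑ (B.h₀ K Q) {B.h₁ α K Q} :=
  hϑ.J_mono hP.h₀_mem hQ.h₀_mem (by simpa using hP.h₁_lt) h₀ (by simpa using h₁)

theorem Typed.J_sub₂ {P Q : Code.{v}} (hP : B.Typed α K P) (hQ : B.Typed α K Q)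
    (hϑ : B.IsBH α ϑ) (h₀ : B.Le (B.h₀ K P) (B.h₀ K Q))
    (h₁ : B.h₁ α K P ∈ B.J α ϑ (B.h₀ K Q) {B.h₁ α K Q}) {a : ZFSet.{v}}
    (ha : a ∈ B.L (Ordinal.omega0 ^ α)) :
    B.J α ϑ (B.h₀ K P) {B.h₁ α K P, B.rk a} ⊆ B.J α ϑ (B.h₀ K Q) {B.h₁ α K Q, B.rk a} := by
  refine hϑ.J_mono hP.h₀_mem hQ.h₀_mem (hP.lt_of_mem ha) h₀ ?_
  rintro γ (rfl | rfl)
  exacts [hQ.J_sub_pair hϑ a h₁, base_mem_J (by simp)]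

theorem Typed.J_pair_eq {P : Code.{v}} (hP : B.Typed α K P) (hϑ : B.IsBH α ϑ) {a : ZFSet.{v}}
    (ha : a ∈ B.L (Ordinal.omega0 ^ α)) (h : B.rk a ∈ B.J α ϑ (B.h₀ K P) {B.h₁ α K P}) :
    B.J α ϑ (B.h₀ K P) {B.h₁ α K P, B.rk a} ⊆ B.J α ϑ (B.h₀ K P) {B.h₁ α K P} := by
  refine hϑ.J_mono hP.h₀_mem hP.h₀_mem (hP.lt_of_mem ha) (.refl _) ?_
  rintro γ (rfl | rfl)
  exacts [base_mem_J rfl, h]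

/-! ### Operators that pass on the last rule -/

/-- Maps on heights that are compatible with local correctness. They raise ranks at most to `ρ`. -/
structure OrdMap (B : Base.{v}) (α : Ordinal.{v}) (ρ : Ordinal.{v}) (F : Tm.{v} → Tm.{v}) :
    Prop where
  lt : ∀ s ∈ B.Eps α, ∀ t ∈ B.Eps α, B.Lt s t → B.Lt (F s) (F t)
  big : ∀ s ∈ B.Eps α, ∀ t ∈ B.Eps α, B.Le (B.add s (.hat Ordinal.omega0)) t →
    B.Le (B.add (F s) (.hat Ordinal.omega0)) (F t)
  mem : ∀ s ∈ B.Eps α, F s ∈ B.Eps α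
  le : ∀ s ∈ B.Eps α, B.Le s (F s)
  star : ∀ s ∈ B.Eps α, B.star (F s) ≤ max (B.star s) ρ

theorem OrdMap.id : B.OrdMap α 0 (fun s => s) where
  lt _ _ _ _ h := h
  big _ _ _ _ h := h
  mem _ h := h
  le _ _ := .refl _
  star _ _ := le_max_left _ _

theorem OrdMap.add (hα : 1 < α) {c : Tm.{v}} (hc : c ∈ B.Eps α) :
    B.OrdMap α (B.star c) (fun s => B.add c s) := by
  have hα0 : 0 < α := zero_lt_one.trans hα
  have hω : Tm.hat Ordinal.omega0 ∈ B.Eps α := hat_mem (by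
    have := (Ordinal.opow_lt_opow_iff_right Ordinal.one_lt_omega0).2 hα
    rwa [Ordinal.opow_one] at this)
  refine ⟨fun s hs t ht h => add_lt_add' hα0 hc hs ht h, fun s hs t ht h => ?_,
    fun s hs => add_mem hα0 hc hs, fun s hs => le_add_right' hα0 hc hs, fun s hs => ?_⟩
  · rw [add_assoc' hα0 hc hs hω]
    exact add_le_add' hα0 hc (add_mem hα0 hs hω) ht h
  · rw [max_comm]
    exact star_add_le hc hs

theorem lt_of_add_omega_le (hα : 1 < α) {s t : Tm.{v}} (hs : s ∈ B.Eps α) (ht : t ∈ B.Eps α)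
    (h : B.Le (B.add s (.hat Ordinal.omega0)) t) : B.Lt s t := by
  have hα0 : 0 < α := zero_lt_one.trans hα
  have hω : Tm.hat Ordinal.omega0 ∈ B.Eps α := hat_mem (by
    have := (Ordinal.opow_lt_opow_iff_right Ordinal.one_lt_omega0).2 hα
    rwa [Ordinal.opow_one] at this)
  refine Lt.trans_le hs (add_mem hα0 hs hω) ht (lt_add_of_pos hα0 hs hω ?_) h
  rw [← hat_zero, hat_lt_hat]
  exact Ordinal.omega0_pos

theorem OrdMap.exp (hα : 1 < α) : B.OrdMap α 0 Tm.exp := by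
  have hα0 : 0 < α := zero_lt_one.trans hα
  refine ⟨fun s hs t ht h => exp_lt_exp hα0 hs ht h, fun s hs t ht h => ?_,
    fun s hs => exp_mem hα0 hs, fun s _ => le_exp s, fun s hs => ?_⟩
  · have h1 := lt_of_add_omega_le hα hs ht h
    refine .inl (exp_add_hat_le hα0 hs ht h1 ?_)
    have := (Ordinal.opow_lt_opow_iff_right Ordinal.one_lt_omega0).2 hα
    rwa [Ordinal.opow_one] at this
  · exact (star_exp_le hs).trans (le_max_left _ _)

/-- A code `Q` with the same last rule as `P` inherits local correctness, provided that formulas in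
`R`, which are the only ones that may disappear, are not introduced by this rule. -/
theorem lc_passive (hϑ : B.IsBH α ϑ) {P Q : Code.{v}} (hT : ∀ P, B.IsCode α P → B.Typed α K P)
    (TP : B.Typed α K P) (TQ : B.Typed α K Q) (hP : B.LC α K ϑ P) (hr : B.r α K Q = B.r α K P)
    (hcode : ∀ a ∈ B.L (Ordinal.omega0 ^ α), B.IsCode α (B.n α K Q a))
    {F : Tm.{v} → Tm.{v}} {ρ : Ordinal.{v}} (hF : B.OrdMap α ρ F)
    (ho : B.o α K Q = F (B.o α K P))
    (hon : ∀ a ∈ B.premises (Ordinal.omega0 ^ α) (B.r α K P),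
      B.o α K (B.n α K Q a) = F (B.o α K (B.n α K P a)))
    {R : Fml.{v} → Prop} (hprin : ∀ φ ∈ (B.r α K P).prin, ¬ R φ)
    (hax : B.r α K P = .ax → ∀ φ ∈ B.l α K P, R φ → φ.TrueD0 → ∃ ψ ∈ B.l α K Q, ψ.TrueD0)
    (hl : ∀ φ ∈ B.l α K P, ¬ R φ → φ ∈ B.l α K Q)
    (hln : ∀ a ∈ B.premises (Ordinal.omega0 ^ α) (B.r α K P), ∀ φ ∈ B.l α K (B.n α K Q a),
      (φ ∈ B.l α K (B.n α K P a) ∧ ¬ R φ) ∨ φ ∈ B.l α K Q)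
    (hc1 : ∀ ψ, B.r α K P = .cut ψ → ψ.ht < B.d K Q)
    (hc2 : ∀ a ∈ B.premises (Ordinal.omega0 ^ α) (B.r α K P), B.d K (B.n α K Q a) ≤ B.d K Q)
    (h0 : B.Le (B.h₀ K P) (B.h₀ K Q)) (h1 : B.h₁ α K P ≤ B.h₁ α K Q)
    (hseq : ∀ φ ∈ B.l α K Q, φ ∈ B.l α K P ∨ B.kF φ ∈ B.J α ϑ (B.h₀ K Q) {B.h₁ α K Q})
    (hρ : ρ ∈ B.J α ϑ (B.h₀ K Q) {B.h₁ α K Q})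
    (hh0 : ∀ a ∈ B.premises (Ordinal.omega0 ^ α) (B.r α K P),
      B.Le (B.h₀ K (B.n α K Q a)) (B.h₀ K Q))
    (hh1 : ∀ a ∈ B.premises (Ordinal.omega0 ^ α) (B.r α K P),
      B.h₁ α K (B.n α K Q a) ≤ max (B.h₁ α K (B.n α K P a)) (B.h₁ α K Q)) :
    B.LC α K ϑ Q := by
  have hpL := premises_mem_L hP.r_mem
  have hTn := fun a ha => hT _ (hP.n_mem a (hpL a ha))
  have hJ := TP.J_sub TQ hϑ h0 (TQ.mem_J hϑ h1)
  have hJ₂ := fun {a} (ha : a ∈ _) => TP.J_sub₂ TQ hϑ h0 (TQ.mem_J hϑ h1) (hpL a ha)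
  have hle := hF.le _ TP.o_mem
  have hFm := hF.mem _ TP.o_mem
  refine ⟨hr ▸ hP.r_mem, hcode, ⟨?_, ?_, ?_, ?_, ?_, ?_, ?_⟩, ⟨?_, ?_⟩, ?_, ?_, ?_, ?_, ?_, ?_⟩
  all_goals try rw [hr]
  · intro h
    obtain ⟨φ, hφ, hφT⟩ := hP.step.ax h
    by_cases hR : R φ
    · exact hax h φ hφ hR hφT
    · exact ⟨φ, hl φ hφ hR, hφT⟩
  · exact fun φ hφ => hl φ (hP.step.prin φ hφ) (hprin φ hφ)
  · intro a ha φ hφ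
    rcases hln a ha φ hφ with ⟨h, hR⟩ | h
    · exact (hP.step.sub a ha φ h).imp_left fun h => hl φ h hR
    · exact .inl h
  · intro hb a ha
    rw [hon a ha, ho]
    exact hF.lt _ (hTn a ha).o_mem _ TP.o_mem (hP.step.lt hb a ha)
  · intro hb a ha
    rw [hon a ha, ho]
    exact hF.big _ (hTn a ha).o_mem _ TP.o_mem (hP.step.big hb a ha)
  · intro x b ψ h
    have hb : b ∈ B.L (Ordinal.omega0 ^ α) := by
      have := hP.r_mem
      rw [h] at this
      exact this.2
    rw [ho]
    exact (hP.step.ex x b ψ h).trans_le (hat_mem (rk_lt (opow_pos' α) hb)) TP.o_mem hFm hle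
  · intro z x a y θ h
    rw [ho]
    exact (hP.step.ref z x a y θ h).trans (Om_mem hϑ.pos) TP.o_mem hFm hle
  · exact hc1
  · exact hc2
  · rw [ho]
    exact TQ.J_le hϑ (max_mem_J (hJ hP.condJ.star) hρ) (hF.star _ TP.o_mem)
  · intro φ hφ
    rcases hseq φ hφ with h | h
    exacts [hJ (hP.condJ.seq φ h), h]
  · exact hJ hP.condJ.rule
  · exact hh0
  · intro a ha
    exact TQ.J_le₂ hϑ (hpL a ha) (max_mem_J (hJ₂ ha (hP.condJ.h₁_mem a ha)) (base_mem_J (by simp)))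
      (hh1 a ha)
  · intro a ha
    rw [hon a ha]
    exact TQ.J_le₂ hϑ (hpL a ha) (max_mem_J (hJ₂ ha (hP.condJ.star_mem a ha))
      (TQ.J_sub_pair hϑ a hρ)) (hF.star _ (hTn a ha).o_mem)

end Base

end Collapsing

namespace Collapsing

universe v

open Fml

theorem prin_all {q : Rule.{v}} {x : ℕ} {ψ : Fml.{v}} (h : .all x ψ ∈ q.prin) : q = .all x ψ := by
  cases q <;> simp [Rule.prin, refConcl] at h
  rw [h.1, h.2]

theorem prin_and {q : Rule.{v}} {ψ₀ ψ₁ : Fml.{v}} (h : .and ψ₀ ψ₁ ∈ q.prin) : q = .and ψ₀ ψ₁ := by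
  cases q <;> simp [Rule.prin, refConcl] at h
  rw [h.1, h.2]

theorem prin_or {q : Rule.{v}} {ψ₀ ψ₁ : Fml.{v}} (h : .or ψ₀ ψ₁ ∈ q.prin) :
    ∃ i, q = .or i ψ₀ ψ₁ := by
  cases q <;> simp [Rule.prin, refConcl] at h
  exact ⟨_, by rw [h.1, h.2]⟩

theorem prin_ex {q : Rule.{v}} {x : ℕ} {ψ : Fml.{v}} (h : .ex x ψ ∈ q.prin) :
    (∃ b, q = .ex x b ψ) ∨ ∃ z y a w θ, q = .ref z y a w θ ∧ .ex x ψ = refConcl z y a w θ := by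
  cases q <;> simp [Rule.prin] at h
  · exact .inl ⟨_, by rw [h.1, h.2]⟩
  · exact .inr ⟨_, _, _, _, _, rfl, h⟩

theorem pick_neg (i : Bool) (ψ₀ ψ₁ : Fml.{v}) : pick i ψ₀.neg ψ₁.neg = (pick i ψ₀ ψ₁).neg := by
  cases i <;> rfl

theorem ht_ex_le_one {x : ℕ} {ψ : Fml.{v}} (h : ψ.IsD0) : (Fml.ex x ψ).ht ≤ 1 := by
  rw [Fml.ht, ht_of_isD0 h]
  split_ifs <;> simp

theorem ht_refConcl_le_one {B : Base.{v}} {γ : Ordinal.{v}} {z x y : ℕ} {a : ZFSet.{v}}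
    {θ : Fml.{v}} (h : B.IsRule γ (.ref z x a y θ)) : (refConcl z x a y θ).ht ≤ 1 := by
  obtain ⟨-, h1, -, -, h2, -, -⟩ := h
  refine ht_ex_le_one ⟨⟨_, _, by simp, rfl⟩, trivial, ⟨_, _, ?_, rfl⟩, trivial, h1⟩
  simpa using h2

namespace Base

variable {B : Base.{v}} {α : Ordinal.{v}} {ϑ : Tm.{v} → Ordinal.{v}} {K : CollVal.{v}}

theorem LC.o_lt (hϑ : B.IsBH α ϑ) (hT : ∀ P, B.IsCode α P → B.Typed α K P) {P : Code.{v}}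
    (TP : B.Typed α K P) (hP : B.LC α K ϑ P) {a : ZFSet.{v}}
    (ha : a ∈ B.premises (Ordinal.omega0 ^ α) (B.r α K P)) :
    B.Lt (B.o α K (B.n α K P a)) (B.o α K P) := by
  by_cases hq : (B.r α K P).Big
  · exact lt_of_add_omega_le hϑ.one_lt_alpha
      (hT _ (hP.n_mem a (premises_mem_L hP.r_mem a ha))).o_mem TP.o_mem (hP.step.big hq a ha)
  · exact hP.step.lt hq a ha

/-! ### Inversion -/

/-- A rule that introduces `∀ x, ψ` becomes a repetition of its premise with index `b`. -/
theorem lc_invAll (hϑ : B.IsBH α ϑ) (hT : ∀ P, B.IsCode α P → B.Typed α K P) {x : ℕ}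
    {ψ : Fml.{v}} {b : ZFSet.{v}} {P : Code.{v}} (hc : B.IsCode α (.invAll x ψ b P))
    (hP : B.LC α K ϑ P) : B.LC α K ϑ (.invAll x ψ b P) := by
  obtain ⟨hF, hb, hcP⟩ := id hc
  have TP := hT _ hcP
  have TQ := hT _ hc
  have h1 : B.h₁ α K P ≤ B.h₁ α K (.invAll x ψ b P) :=
    (le_max_left _ _).trans (le_max_left _ _)
  have hcode : ∀ a ∈ B.L (Ordinal.omega0 ^ α), B.IsCode α (.invAll x ψ b (B.n α K P a)) :=
    fun a ha => ⟨hF, hb, hP.n_mem a ha⟩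
  have hψ : B.kF (ψ.subst x b) ≤ B.h₁ α K (.invAll x ψ b P) :=
    (B.kF_subst_le ψ x b).trans (max_le ((le_max_right _ _).trans (le_max_left _ _))
      (le_max_right _ _))
  have hk : max (B.kF (.all x ψ)) (B.rk b) ≤ B.h₁ α K (.invAll x ψ b P) :=
    max_le_max_right _ (le_max_right _ _)
  have hseq : ∀ φ ∈ B.l α K (.invAll x ψ b P), φ ∈ B.l α K P ∨
      B.kF φ ∈ B.J α ϑ (B.h₀ K (.invAll x ψ b P)) {B.h₁ α K (.invAll x ψ b P)} := by
    intro φ hφ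
    simp only [l, Finset.mem_union, Finset.mem_sdiff, Finset.mem_singleton] at hφ
    rcases hφ with ⟨hφ, -⟩ | rfl
    exacts [.inl hφ, .inr (TQ.mem_J hϑ hψ)]
  have hh1 : ∀ a, B.h₁ α K (.invAll x ψ b (B.n α K P a)) ≤
      max (B.h₁ α K (B.n α K P a)) (B.h₁ α K (.invAll x ψ b P)) := fun a => by
    simp only [Base.h₁] at hk ⊢
    rw [max_assoc]
    exact max_le_max_left _ hk
  by_cases hr : B.r α K P = .all x ψ
  · have hrQ : B.r α K (.invAll x ψ b P) = .rep b := by simp only [r, if_pos hr]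
    have hJ := TP.J_sub TQ hϑ (.refl _) (TQ.mem_J hϑ h1)
    have hJ₂ := TP.J_sub₂ TQ hϑ (.refl _) (TQ.mem_J hϑ h1) hb
    have hb' : b ∈ B.premises (Ordinal.omega0 ^ α) (B.r α K P) := by rw [hr]; exact hb
    refine ⟨by rw [hrQ]; exact hb, hcode, ?_, ⟨?_, ?_⟩, ?_, ?_, ?_, ?_, ?_, ?_⟩
    all_goals try rw [hrQ]
    · refine Step.mk_rep (hP.o_lt hϑ hT TP hb') fun φ hφ => ?_
      simp only [n, l, Finset.mem_union, Finset.mem_sdiff, Finset.mem_singleton] at hφ ⊢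
      rcases hφ with ⟨hφ, hne⟩ | hφ
      · rcases hP.step.sub b hb' φ hφ with h | h
        · exact .inl ⟨h, hne⟩
        · rw [hr] at h
          exact .inr h
      · exact .inr hφ
    · nofun
    · rintro a rfl
      exact hP.condC.c2 a hb'
    · exact hJ hP.condJ.star
    · exact fun φ hφ => (hseq φ hφ).elim (fun h => hJ (hP.condJ.seq φ h)) (fun h => h)
    · exact TQ.mem_J hϑ (le_max_right _ _)
    · rintro a rfl
      exact hP.condJ.h₀_le a hb'
    · rintro a rfl
      exact TQ.J_le₂ hϑ hb (max_mem_J (hJ₂ (hP.condJ.h₁_mem a hb'))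
        (base_mem_J (Set.mem_insert _ _))) (hh1 a)
    · rintro a rfl
      exact hJ₂ (hP.condJ.star_mem a hb')
  · have hrQ : B.r α K (.invAll x ψ b P) = B.r α K P := by simp only [r, if_neg hr]
    refine lc_passive hϑ hT TP TQ hP hrQ hcode OrdMap.id rfl (fun _ _ => rfl)
      (R := fun φ => φ = .all x ψ) ?_ ?_ ?_ ?_ hP.condC.c1 hP.condC.c2 (.refl _) h1 hseq zero_mem_J
      hP.condJ.h₀_le (fun a _ => hh1 a)
    · rintro φ hφ rfl
      exact hr (prin_all hφ)
    · rintro - φ - rfl hφ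
      exact ⟨_, by simp [l], hφ.instance b⟩
    · intro φ hφ hne
      simp only [l, Finset.mem_union, Finset.mem_sdiff, Finset.mem_singleton]
      exact .inl ⟨hφ, hne⟩
    · intro a ha φ hφ
      simp only [n, l, Finset.mem_union, Finset.mem_sdiff, Finset.mem_singleton] at hφ ⊢
      tauto

/-- A rule that introduces the conjunction becomes a repetition of one of its premises. -/
theorem lc_invAnd (hϑ : B.IsBH α ϑ) (hT : ∀ P, B.IsCode α P → B.Typed α K P)
    {ψ₀ ψ₁ : Fml.{v}} {i : Bool} {P : Code.{v}} (hc : B.IsCode α (.invAnd ψ₀ ψ₁ i P))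
    (hP : B.LC α K ϑ P) : B.LC α K ϑ (.invAnd ψ₀ ψ₁ i P) := by
  obtain ⟨hF, hcP⟩ := id hc
  have TP := hT _ hcP
  have TQ := hT _ hc
  have h1 : B.h₁ α K P ≤ B.h₁ α K (.invAnd ψ₀ ψ₁ i P) := le_max_left _ _
  have hcode : ∀ a ∈ B.L (Ordinal.omega0 ^ α), B.IsCode α (.invAnd ψ₀ ψ₁ i (B.n α K P a)) :=
    fun a ha => ⟨hF, hP.n_mem a ha⟩
  have hseq : ∀ φ ∈ B.l α K (.invAnd ψ₀ ψ₁ i P), φ ∈ B.l α K P ∨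
      B.kF φ ∈ B.J α ϑ (B.h₀ K (.invAnd ψ₀ ψ₁ i P)) {B.h₁ α K (.invAnd ψ₀ ψ₁ i P)} := by
    intro φ hφ
    simp only [l, Finset.mem_union, Finset.mem_sdiff, Finset.mem_singleton] at hφ
    rcases hφ with ⟨hφ, -⟩ | rfl
    exacts [.inl hφ, .inr (TQ.mem_J hϑ (le_max_right _ _))]
  have hh1 : ∀ a, B.h₁ α K (.invAnd ψ₀ ψ₁ i (B.n α K P a)) ≤
      max (B.h₁ α K (B.n α K P a)) (B.h₁ α K (.invAnd ψ₀ ψ₁ i P)) := fun a =>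
    max_le_max_left _ (le_max_right _ _)
  by_cases hr : B.r α K P = .and ψ₀ ψ₁
  · have hrQ : B.r α K (.invAnd ψ₀ ψ₁ i P) = .rep (if i = true then {∅} else ∅) := by
      simp only [r, if_pos hr]
    have hJ := TP.J_sub TQ hϑ (.refl _) (TQ.mem_J hϑ h1)
    have hb' : (if i = true then {∅} else ∅) ∈
        B.premises (Ordinal.omega0 ^ α) (B.r α K P) := by
      rw [hr]; cases i <;> simp [premises]
    have hprem : ∀ φ ∈ (B.r α K P).prem (if i = true then {∅} else ∅), φ = pick i ψ₀ ψ₁ := by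
      rw [hr]; cases i <;> simp [Rule.prem, pick, Step.one_ne_empty]
    have hrk : B.rk (if i = true then {∅} else ∅) = 0 := by cases i <;> simp
    generalize (if i = true then ({∅} : ZFSet.{v}) else ∅) = b at *
    have hb := premises_mem_L hP.r_mem b hb'
    have hJ₂ := TP.J_sub₂ TQ hϑ (.refl _) (TQ.mem_J hϑ h1) hb
    refine ⟨by rw [hrQ]; exact hb, hcode, ?_, ⟨?_, ?_⟩, ?_, ?_, ?_, ?_, ?_, ?_⟩
    all_goals try rw [hrQ]
    · refine Step.mk_rep (hP.o_lt hϑ hT TP hb') fun φ hφ => ?_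
      simp only [n, l, Finset.mem_union, Finset.mem_sdiff, Finset.mem_singleton] at hφ ⊢
      rcases hφ with ⟨hφ, hne⟩ | hφ
      · rcases hP.step.sub b hb' φ hφ with h | h
        · exact .inl ⟨h, hne⟩
        · exact .inr (hprem φ h)
      · exact .inr hφ
    · nofun
    · rintro a rfl
      exact hP.condC.c2 a hb'
    · exact hJ hP.condJ.star
    · exact fun φ hφ => (hseq φ hφ).elim (fun h => hJ (hP.condJ.seq φ h)) (fun h => h)
    · rw [kR, hrk]; exact zero_mem_J
    · rintro a rfl
      exact hP.condJ.h₀_le a hb'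
    · rintro a rfl
      exact TQ.J_le₂ hϑ hb (max_mem_J (hJ₂ (hP.condJ.h₁_mem a hb'))
        (base_mem_J (Set.mem_insert _ _))) (hh1 a)
    · rintro a rfl
      exact hJ₂ (hP.condJ.star_mem a hb')
  · have hrQ : B.r α K (.invAnd ψ₀ ψ₁ i P) = B.r α K P := by simp only [r, if_neg hr]
    refine lc_passive hϑ hT TP TQ hP hrQ hcode OrdMap.id rfl (fun _ _ => rfl)
      (R := fun φ => φ = .and ψ₀ ψ₁) ?_ ?_ ?_ ?_ hP.condC.c1 hP.condC.c2 (.refl _) h1 hseq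
      zero_mem_J hP.condJ.h₀_le (fun a _ => hh1 a)
    · rintro φ hφ rfl
      exact hr (prin_and hφ)
    · rintro - φ - rfl hφ
      refine ⟨pick i ψ₀ ψ₁, by simp [l], ?_⟩
      cases i
      exacts [hφ.and.1, hφ.and.2]
    · intro φ hφ hne
      simp only [l, Finset.mem_union, Finset.mem_sdiff, Finset.mem_singleton]
      exact .inl ⟨hφ, hne⟩
    · intro a ha φ hφ
      simp only [n, l, Finset.mem_union, Finset.mem_sdiff, Finset.mem_singleton] at hφ ⊢
      tauto

/-! ### Cut reduction -/

/-- The code `Q` stands for a derivation that results from derivations `P₀` and `P₁` when a cut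
over `χ` is reduced along the occurrences of `χ` in `P₀`. This treats existential quantifiers and
disjunctions uniformly. -/
structure IsRed (B : Base.{v}) (α : Ordinal.{v}) (K : CollVal.{v}) (χ : Fml.{v})
    (Q P₀ P₁ : Code.{v}) : Prop where
  code : B.IsCode α Q
  l_eq : B.l α K Q = (B.l α K P₀ \ {χ}) ∪ (B.l α K P₁ \ {χ.neg})
  o_eq : B.o α K Q = B.add (B.o α K P₁) (B.o α K P₀)
  d_eq : B.d K Q = max (max (B.d K P₀) (B.d K P₁)) χ.ht
  h₀_eq : B.h₀ K Q = B.tmax (B.h₀ K P₀) (B.h₀ K P₁)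
  h₁_eq : B.h₁ α K Q = max (B.h₁ α K P₀) (B.h₁ α K P₁)

theorem isRed_redEx {x : ℕ} {ψ : Fml.{v}} {P₀ P₁ : Code.{v}}
    (hc : B.IsCode α (.redEx x ψ P₀ P₁)) :
    B.IsRed α K (.ex x ψ) (.redEx x ψ P₀ P₁) P₀ P₁ := ⟨hc, rfl, rfl, rfl, rfl, rfl⟩

theorem isRed_redOr {ψ₀ ψ₁ : Fml.{v}} {P₀ P₁ : Code.{v}}
    (hc : B.IsCode α (.redOr ψ₀ ψ₁ P₀ P₁)) :
    B.IsRed α K (.or ψ₀ ψ₁) (.redOr ψ₀ ψ₁ P₀ P₁) P₀ P₁ := ⟨hc, rfl, rfl, rfl, rfl, rfl⟩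

section

variable {χ : Fml.{v}} {Q P₀ P₁ : Code.{v}}

theorem IsRed.J_sub (hϑ : B.IsBH α ϑ) (hT : ∀ P, B.IsCode α P → B.Typed α K P)
    (hR : B.IsRed α K χ Q P₀ P₁) (T₀ : B.Typed α K P₀) (T₁ : B.Typed α K P₁) :
    B.J α ϑ (B.h₀ K P₀) {B.h₁ α K P₀} ⊆ B.J α ϑ (B.h₀ K Q) {B.h₁ α K Q} ∧
    B.J α ϑ (B.h₀ K P₁) {B.h₁ α K P₁} ⊆ B.J α ϑ (B.h₀ K Q) {B.h₁ α K Q} := by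
  have TQ := hT _ hR.code
  refine ⟨T₀.J_sub TQ hϑ ?_ (TQ.mem_J hϑ ?_), T₁.J_sub TQ hϑ ?_ (TQ.mem_J hϑ ?_)⟩
  · rw [hR.h₀_eq]; exact le_tmax_left _ _
  · rw [hR.h₁_eq]; exact le_max_left _ _
  · rw [hR.h₀_eq]; exact le_tmax_right T₀.h₀_mem T₁.h₀_mem
  · rw [hR.h₁_eq]; exact le_max_right _ _

/-- The premises of a rule that does not introduce the cut formula are reduced one by one. -/
theorem IsRed.lc_passive (hϑ : B.IsBH α ϑ) (hT : ∀ P, B.IsCode α P → B.Typed α K P)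
    (hχ : 1 < χ.ht) (hR : B.IsRed α K χ Q P₀ P₁) (hc₀ : B.IsCode α P₀) (hc₁ : B.IsCode α P₁)
    (h₀ : B.LC α K ϑ P₀) (h₁ : B.LC α K ϑ P₁) (hr : B.r α K Q = B.r α K P₀)
    (hn : ∀ a ∈ B.L (Ordinal.omega0 ^ α), B.IsRed α K χ (B.n α K Q a) (B.n α K P₀ a) P₁)
    (hprin : χ ∉ (B.r α K P₀).prin) : B.LC α K ϑ Q := by
  have T₀ := hT _ hc₀
  have T₁ := hT _ hc₁
  have TQ := hT _ hR.code
  have hpL := premises_mem_L h₀.r_mem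
  obtain ⟨hJ₀, hJ₁⟩ := hR.J_sub hϑ hT T₀ T₁ (ϑ := ϑ)
  refine Base.lc_passive hϑ hT T₀ TQ h₀ hr (fun a ha => (hn a ha).code)
    (OrdMap.add hϑ.one_lt_alpha T₁.o_mem) hR.o_eq (fun a ha => (hn a (hpL a ha)).o_eq)
    (R := fun φ => φ = χ) ?_ ?_ ?_ ?_ ?_ ?_ ?_ ?_ ?_ (hJ₁ h₁.condJ.star) ?_ ?_
  · rintro φ hφ rfl
    exact hprin hφ
  · rintro - φ - rfl hφ
    rw [ht_of_isD0 hφ.1] at hχ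
    exact absurd hχ (by simp)
  · intro φ hφ hne
    simp only [hR.l_eq, Finset.mem_union, Finset.mem_sdiff, Finset.mem_singleton]
    exact .inl ⟨hφ, hne⟩
  · intro a ha φ hφ
    simp only [(hn a (hpL a ha)).l_eq, hR.l_eq, Finset.mem_union, Finset.mem_sdiff,
      Finset.mem_singleton] at hφ ⊢
    tauto
  · intro ψ h
    rw [hR.d_eq]
    exact (h₀.condC.c1 ψ h).trans_le ((le_max_left _ _).trans (le_max_left _ _))
  · intro a ha
    rw [(hn a (hpL a ha)).d_eq, hR.d_eq]
    exact max_le_max_right _ (max_le_max_right _ (h₀.condC.c2 a ha))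
  · rw [hR.h₀_eq]; exact le_tmax_left _ _
  · rw [hR.h₁_eq]; exact le_max_left _ _
  · intro φ hφ
    rw [hR.l_eq, Finset.mem_union, Finset.mem_sdiff, Finset.mem_sdiff] at hφ
    rcases hφ with hφ | hφ
    exacts [.inl hφ.1, .inr (hJ₁ (h₁.condJ.seq φ hφ.1))]
  · intro a ha
    have Ta := hT _ (h₀.n_mem a (hpL a ha))
    rw [(hn a (hpL a ha)).h₀_eq, hR.h₀_eq]
    refine tmax_le ?_ (le_tmax_right T₀.h₀_mem T₁.h₀_mem)
    exact (h₀.condJ.h₀_le a ha).trans Ta.h₀_mem T₀.h₀_mem (tmax_mem T₀.h₀_mem T₁.h₀_mem)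
      (le_tmax_left _ _)
  · intro a ha
    rw [(hn a (hpL a ha)).h₁_eq, hR.h₁_eq]
    exact max_le_max_left _ (le_max_right _ _)

/-- A rule that introduces the cut formula is turned into a cut over the premise formula `δ`, whose
other premise `Q₁` arises from `P₁` by inversion. -/
theorem IsRed.lc_cut (hϑ : B.IsBH α ϑ) (hT : ∀ P, B.IsCode α P → B.Typed α K P)
    (hR : B.IsRed α K χ Q P₀ P₁) (hc₀ : B.IsCode α P₀) (hc₁ : B.IsCode α P₁)
    (h₀ : B.LC α K ϑ P₀) (h₁ : B.LC α K ϑ P₁) {δ : Fml.{v}} (hδ : B.IsF (Ordinal.omega0 ^ α) δ)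
    (hχδ : δ.ht < χ.ht) (hr : B.r α K Q = .cut δ)
    (hprem : ∅ ∈ B.premises (Ordinal.omega0 ^ α) (B.r α K P₀))
    (hδ' : ∀ φ ∈ (B.r α K P₀).prem ∅, φ = δ)
    (hn : ∀ a ∈ B.L (Ordinal.omega0 ^ α), B.IsCode α (B.n α K Q a))
    (hn₀ : B.IsRed α K χ (B.n α K Q ∅) (B.n α K P₀ ∅) P₁)
    {Q₁ : Code.{v}} (hn₁ : B.n α K Q {∅} = Q₁)
    (hl : B.l α K Q₁ = (B.l α K P₁ \ {χ.neg}) ∪ {δ.neg}) (ho : B.o α K Q₁ = B.o α K P₁)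
    (hd : B.d K Q₁ = B.d K P₁) (hh₀ : B.h₀ K Q₁ = B.h₀ K P₁)
    (hkδ : B.kF δ ∈ B.J α ϑ (B.h₀ K P₀) {B.h₁ α K P₀})
    {κ : Ordinal.{v}} (hκ : κ ∈ B.J α ϑ (B.h₀ K P₀) {B.h₁ α K P₀})
    (hh₁ : B.h₁ α K Q₁ ≤ max (B.h₁ α K P₁) κ) : B.LC α K ϑ Q := by
  have T₀ := hT _ hc₀
  have T₁ := hT _ hc₁
  have TQ := hT _ hR.code
  have Tn := hT _ (h₀.n_mem ∅ (by simp))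
  obtain ⟨hJ₀, hJ₁⟩ := hR.J_sub hϑ hT T₀ T₁ (ϑ := ϑ)
  have hlt := h₀.o_lt hϑ hT T₀ hprem
  have hJ₂ : B.J α ϑ (B.h₀ K P₀) {B.h₁ α K P₀, B.rk ∅} ⊆
      B.J α ϑ (B.h₀ K Q) {B.h₁ α K Q, B.rk ∅} := by
    refine T₀.J_sub₂ TQ hϑ ?_ (TQ.mem_J hϑ ?_) (by simp)
    · rw [hR.h₀_eq]; exact le_tmax_left _ _
    · rw [hR.h₁_eq]; exact le_max_left _ _
  refine ⟨by rw [hr]; exact hδ, hn, ?_, ⟨?_, ?_⟩, ?_, ?_, ?_, ?_, ?_, ?_⟩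
  all_goals try rw [hr]
  · refine Step.mk_cut ?_ ?_ ?_ ?_
    · rw [hn₀.o_eq, hR.o_eq]
      exact add_lt_add' hϑ.pos T₁.o_mem Tn.o_mem T₀.o_mem hlt
    · rw [hn₁, ho, hR.o_eq]
      refine lt_add_of_pos hϑ.pos T₁.o_mem T₀.o_mem ?_
      exact Le.trans_lt (zero_mem_Eps α) Tn.o_mem T₀.o_mem (zero_le _) hlt
    · intro φ hφ
      simp only [hn₀.l_eq, hR.l_eq, Finset.mem_union, Finset.mem_sdiff,
        Finset.mem_singleton] at hφ ⊢
      rcases hφ with ⟨h, hne⟩ | h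
      · rcases h₀.step.sub ∅ hprem φ h with h | h
        exacts [.inl (.inl ⟨h, hne⟩), .inr (hδ' φ h)]
      · exact .inl (.inr h)
    · intro φ hφ
      simp only [hn₁, hl, hR.l_eq, Finset.mem_union, Finset.mem_sdiff, Finset.mem_singleton] at hφ ⊢
      tauto
  · rintro φ h
    obtain rfl : δ = φ := by injection h
    rw [hR.d_eq]
    exact hχδ.trans_le (le_max_right _ _)
  · rintro a (rfl | rfl)
    · rw [hn₀.d_eq, hR.d_eq]
      exact max_le_max_right _ (max_le_max_right _ (h₀.condC.c2 ∅ hprem))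
    · rw [hn₁, hd, hR.d_eq]
      exact (le_max_right _ _).trans (le_max_left _ _)
  · rw [hR.o_eq]
    exact TQ.J_le hϑ (max_mem_J (hJ₁ h₁.condJ.star) (hJ₀ h₀.condJ.star))
      (star_add_le T₁.o_mem T₀.o_mem)
  · intro φ hφ
    rw [hR.l_eq, Finset.mem_union, Finset.mem_sdiff, Finset.mem_sdiff] at hφ
    rcases hφ with hφ | hφ
    exacts [hJ₀ (h₀.condJ.seq φ hφ.1), hJ₁ (h₁.condJ.seq φ hφ.1)]
  · exact hJ₀ hkδ
  · rintro a (rfl | rfl)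
    · rw [hn₀.h₀_eq, hR.h₀_eq]
      refine tmax_le ?_ (le_tmax_right T₀.h₀_mem T₁.h₀_mem)
      exact (h₀.condJ.h₀_le ∅ hprem).trans Tn.h₀_mem T₀.h₀_mem (tmax_mem T₀.h₀_mem T₁.h₀_mem)
        (le_tmax_left _ _)
    · rw [hn₁, hh₀, hR.h₀_eq]
      exact le_tmax_right T₀.h₀_mem T₁.h₀_mem
  · rintro a (rfl | rfl)
    · rw [hn₀.h₁_eq]
      exact max_mem_J (hJ₂ (h₀.condJ.h₁_mem ∅ hprem))
        (TQ.J_sub_pair hϑ _ (hJ₁ (T₁.mem_J hϑ le_rfl)))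
    · rw [hn₁]
      exact TQ.J_sub_pair hϑ _ (TQ.J_le hϑ (max_mem_J (hJ₁ (T₁.mem_J hϑ le_rfl)) (hJ₀ hκ)) hh₁)
  · rintro a (rfl | rfl)
    · rw [hn₀.o_eq]
      exact TQ.J_le₂ hϑ (by simp) (max_mem_J (TQ.J_sub_pair hϑ _ (hJ₁ h₁.condJ.star))
        (hJ₂ (h₀.condJ.star_mem ∅ hprem))) (star_add_le T₁.o_mem Tn.o_mem)
    · rw [hn₁, ho]
      exact TQ.J_sub_pair hϑ _ (hJ₁ h₁.condJ.star)

end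

theorem lc_redEx (hϑ : B.IsBH α ϑ) (hT : ∀ P, B.IsCode α P → B.Typed α K P) {x : ℕ}
    {ψ : Fml.{v}} {P₀ P₁ : Code.{v}} (hc : B.IsCode α (.redEx x ψ P₀ P₁))
    (h₀ : B.LC α K ϑ P₀) (h₁ : B.LC α K ϑ P₁) : B.LC α K ϑ (.redEx x ψ P₀ P₁) := by
  obtain ⟨hF, hht, hc₀, hc₁⟩ := id hc
  have hred : ∀ a ∈ B.L (Ordinal.omega0 ^ α), B.IsCode α (.redEx x ψ (B.n α K P₀ a) P₁) :=
    fun a ha => ⟨hF, hht, h₀.n_mem a ha, hc₁⟩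
  by_cases hr : ∃ b, B.r α K P₀ = .ex x b ψ
  · obtain ⟨b, hr⟩ := hr
    have hb : b ∈ B.L (Ordinal.omega0 ^ α) := by
      have := h₀.r_mem
      rw [hr] at this
      exact this.2
    have hkb : B.rk b ∈ B.J α ϑ (B.h₀ K P₀) {B.h₁ α K P₀} := by
      have := h₀.condJ.rule
      rwa [hr] at this
    have hkψ := h₀.condJ.seq (.ex x ψ) (h₀.step.prin _ (by rw [hr]; rfl))
    have hn : ∀ a ≠ {∅}, B.n α K (.redEx x ψ P₀ P₁) a = .redEx x ψ (B.n α K P₀ a) P₁ :=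
      fun a ha => by simp only [n, hr, ha, and_false, if_false]
    have hn₀ := hn ∅ Step.one_ne_empty.symm
    have hn₁ : B.n α K (.redEx x ψ P₀ P₁) {∅} = .invAll x ψ.neg b P₁ := by
      simp only [n, hr, and_self, if_true]
    refine (isRed_redEx hc).lc_cut hϑ hT hc₀ hc₁ h₀ h₁ (hF.ex_subst hb) ?_
      (by simp only [r, hr, if_true]) (by rw [hr]; rfl) (by rw [hr]; exact fun φ h => h) ?_
      (hn₀ ▸ isRed_redEx (hred ∅ (by simp))) hn₁ ?_ rfl rfl rfl ?_ (max_mem_J hkψ hkb) ?_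
    · rw [ht_ex hht]
      exact Nat.lt_succ_of_le (ht_subst_le ψ x b)
    · intro a ha
      by_cases e : a = {∅}
      · rw [e, hn₁]; exact ⟨hF.neg, hb, hc₁⟩
      · rw [hn a e]; exact hred a ha
    · rw [neg_subst]; rfl
    · exact (hT _ hc₀).J_le hϑ (max_mem_J hkψ hkb) (B.kF_subst_le ψ x b)
    · rw [← max_assoc]
      simp [Base.h₁, kF]
  · push Not at hr
    have hrn : B.r α K (.redEx x ψ P₀ P₁) = B.r α K P₀ ∧ ∀ a,
        B.n α K (.redEx x ψ P₀ P₁) a = .redEx x ψ (B.n α K P₀ a) P₁ := by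
      simp only [r, n]
      split
      next y b χ h =>
        have : Fml.ex y χ ≠ .ex x ψ := fun e => by
          injection e with e1 e2
          exact hr b (by rw [h, e1, e2])
        simp [this, h]
      next => exact ⟨rfl, fun a => rfl⟩
    refine (isRed_redEx hc).lc_passive hϑ hT hht hc₀ hc₁ h₀ h₁ hrn.1
      (fun a ha => hrn.2 a ▸ isRed_redEx (hred a ha)) fun h => ?_
    -- a reflection introduces a formula of height one, which is not the cut formula
    rcases prin_ex h with ⟨b, h⟩ | ⟨z, y, a, w, θ, h, e⟩
    · exact hr b h
    · have := h₀.r_mem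
      rw [h] at this
      rw [e] at hht
      exact (ht_refConcl_le_one this).not_gt hht

theorem lc_redOr (hϑ : B.IsBH α ϑ) (hT : ∀ P, B.IsCode α P → B.Typed α K P)
    {ψ₀ ψ₁ : Fml.{v}} {P₀ P₁ : Code.{v}} (hc : B.IsCode α (.redOr ψ₀ ψ₁ P₀ P₁))
    (h₀ : B.LC α K ϑ P₀) (h₁ : B.LC α K ϑ P₁) : B.LC α K ϑ (.redOr ψ₀ ψ₁ P₀ P₁) := by
  obtain ⟨hF, hht, hc₀, hc₁⟩ := id hc
  have hred : ∀ a ∈ B.L (Ordinal.omega0 ^ α), B.IsCode α (.redOr ψ₀ ψ₁ (B.n α K P₀ a) P₁) :=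
    fun a ha => ⟨hF, hht, h₀.n_mem a ha, hc₁⟩
  by_cases hr : ∃ i, B.r α K P₀ = .or i ψ₀ ψ₁
  · obtain ⟨i, hr⟩ := hr
    have hkψ := h₀.condJ.seq (.or ψ₀ ψ₁) (h₀.step.prin _ (by rw [hr]; rfl))
    have hk : B.kF (pick i ψ₀ ψ₁) ≤ B.kF (.or ψ₀ ψ₁) := by
      cases i
      exacts [le_max_left _ _, le_max_right _ _]
    have hn : ∀ a ≠ {∅}, B.n α K (.redOr ψ₀ ψ₁ P₀ P₁) a = .redOr ψ₀ ψ₁ (B.n α K P₀ a) P₁ :=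
      fun a ha => by simp only [n, hr, ha, and_false, if_false]
    have hn₀ := hn ∅ Step.one_ne_empty.symm
    have hn₁ : B.n α K (.redOr ψ₀ ψ₁ P₀ P₁) {∅} = .invAnd ψ₀.neg ψ₁.neg i P₁ := by
      simp only [n, hr, and_self, if_true]
    refine (isRed_redOr hc).lc_cut hϑ hT hc₀ hc₁ h₀ h₁ (pick_mem i (IsF.or.1 hF)) ?_
      (by simp only [r, hr, if_true]) (by rw [hr]; rfl) (by rw [hr]; exact fun φ h => h) ?_
      (hn₀ ▸ isRed_redOr (hred ∅ (by simp))) hn₁ ?_ rfl rfl rfl ?_ hkψ ?_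
    · rw [ht_or hht]
      refine Nat.lt_succ_of_le ?_
      cases i
      exacts [le_max_left _ _, le_max_right _ _]
    · intro a ha
      by_cases e : a = {∅}
      · rw [e, hn₁]; exact ⟨hF.neg, hc₁⟩
      · rw [hn a e]; exact hred a ha
    · rw [← pick_neg]; rfl
    · exact (hT _ hc₀).J_le hϑ hkψ hk
    · simp only [Base.h₁, pick_neg, kF_neg]
      exact max_le_max_left _ hk
  · push Not at hr
    have hrn : B.r α K (.redOr ψ₀ ψ₁ P₀ P₁) = B.r α K P₀ ∧ ∀ a,
        B.n α K (.redOr ψ₀ ψ₁ P₀ P₁) a = .redOr ψ₀ ψ₁ (B.n α K P₀ a) P₁ := by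
      simp only [r, n]
      split
      next i χ₀ χ₁ h =>
        have : Fml.or χ₀ χ₁ ≠ .or ψ₀ ψ₁ := fun e => by
          injection e with e1 e2
          exact hr i (by rw [h, e1, e2])
        simp [this, h]
      next => exact ⟨rfl, fun a => rfl⟩
    refine (isRed_redOr hc).lc_passive hϑ hT hht hc₀ hc₁ h₀ h₁ hrn.1
      (fun a ha => hrn.2 a ▸ isRed_redOr (hred a ha)) fun h => ?_
    obtain ⟨i, h⟩ := prin_or h
    exact hr i h

/-! ### Cut elimination -/

theorem isRed_cutReduce {ψ : Fml.{v}} (hψ : B.IsF (Ordinal.omega0 ^ α) ψ) (hht : 1 < ψ.ht)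
    {Q₀ Q₁ : Code.{v}} (h₀ : B.IsCode α Q₀) (h₁ : B.IsCode α Q₁) :
    B.IsRed α K ψ (cutReduce Q₀ Q₁ ψ) Q₀ Q₁ ∨
      B.IsRed α K ψ.neg (cutReduce Q₀ Q₁ ψ) Q₁ Q₀ := by
  have hn : 1 < ψ.neg.ht := by rwa [ht_neg]
  cases ψ with
  | ex x χ => exact .inl (isRed_redEx ⟨hψ, hht, h₀, h₁⟩)
  | or ψ₀ ψ₁ => exact .inl (isRed_redOr ⟨hψ, hht, h₀, h₁⟩)
  | all x χ => exact .inr (isRed_redEx ⟨hψ.neg, hn, h₁, h₀⟩)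
  | and ψ₀ ψ₁ => exact .inr (isRed_redOr ⟨hψ.neg, hn, h₁, h₀⟩)
  | _ => simp [Fml.ht] at hht

/-- A cut over a formula of height above one becomes a repetition of the reduced cut between the
transformed premises. Its height `Ω ^ o₁ + Ω ^ o₀` is below `Ω ^ o`, as `o₀` and `o₁` are below `o`. -/
theorem lc_cutElim (hϑ : B.IsBH α ϑ) (hT : ∀ P, B.IsCode α P → B.Typed α K P) {P : Code.{v}}
    (hcP : B.IsCode α P) (hP : B.LC α K ϑ P) : B.LC α K ϑ (.cutElim P) := by
  have TP := hT _ hcP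
  have TQ := hT (.cutElim P) hcP
  have hpL := premises_mem_L hP.r_mem
  by_cases hr : ∃ ψ, B.r α K P = .cut ψ ∧ 1 < ψ.ht
  · obtain ⟨ψ, hr, hht⟩ := hr
    have hrQ : B.r α K (.cutElim P) = .rep ∅ := by simp only [r, hr, if_pos hht]
    have hn : ∀ a, B.n α K (.cutElim P) a =
        cutReduce (.cutElim (B.n α K P ∅)) (.cutElim (B.n α K P {∅})) ψ := fun a => by
      simp only [n, hr, if_pos hht]
    have hψ : B.IsF (Ordinal.omega0 ^ α) ψ := by
      have := hP.r_mem
      rwa [hr] at this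
    have m₀ : ∅ ∈ B.premises (Ordinal.omega0 ^ α) (B.r α K P) := by rw [hr]; exact .inl rfl
    have m₁ : {∅} ∈ B.premises (Ordinal.omega0 ^ α) (B.r α K P) := by rw [hr]; exact .inr rfl
    have c₀ := hP.n_mem ∅ (by simp)
    have c₁ := hP.n_mem {∅} (by simp)
    have T₀ := hT _ c₀
    have T₁ := hT _ c₁
    have l₀ := hP.o_lt hϑ hT TP m₀
    have l₁ := hP.o_lt hϑ hT TP m₁
    have hd : ψ.ht ≤ B.d K P - 1 := Nat.le_sub_one_of_lt (hP.condC.c1 ψ hr)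
    have d₀ := hP.condC.c2 _ m₀
    have d₁ := hP.condC.c2 _ m₁
    have e₀ := hP.condJ.h₀_le _ m₀
    have e₁ := hP.condJ.h₀_le _ m₁
    have hk₀ : B.rk ∅ ∈ B.J α ϑ (B.h₀ K P) {B.h₁ α K P} := by rw [rk_empty]; exact zero_mem_J
    have hk₁ : B.rk {∅} ∈ B.J α ϑ (B.h₀ K P) {B.h₁ α K P} := by rw [rk_one]; exact zero_mem_J
    have f₀ := TP.J_pair_eq hϑ (by simp) hk₀ (hP.condJ.h₁_mem _ m₀)
    have f₁ := TP.J_pair_eq hϑ (by simp) hk₁ (hP.condJ.h₁_mem _ m₁)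
    have s₀ := TP.J_pair_eq hϑ (by simp) hk₀ (hP.condJ.star_mem _ m₀)
    have s₁ := TP.J_pair_eq hϑ (by simp) hk₁ (hP.condJ.star_mem _ m₁)
    have x₀ := exp_mem hϑ.pos T₀.o_mem
    have x₁ := exp_mem hϑ.pos T₁.o_mem
    have lt₀ := exp_lt_exp hϑ.pos T₀.o_mem TP.o_mem l₀
    have lt₁ := exp_lt_exp hϑ.pos T₁.o_mem TP.o_mem l₁
    have g₀ := hP.step.sub _ m₀
    have g₁ := hP.step.sub _ m₁
    rw [hr] at g₀ g₁
    have key : B.IsCode α (B.n α K (.cutElim P) ∅) ∧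
        (∀ φ ∈ B.l α K (B.n α K (.cutElim P) ∅), φ ∈ B.l α K P) ∧
        B.Lt (B.o α K (B.n α K (.cutElim P) ∅)) (B.o α K (.cutElim P)) ∧
        B.d K (B.n α K (.cutElim P) ∅) ≤ B.d K (.cutElim P) ∧
        B.Le (B.h₀ K (B.n α K (.cutElim P) ∅)) (B.h₀ K P) ∧
        B.h₁ α K (B.n α K (.cutElim P) ∅) ∈ B.J α ϑ (B.h₀ K P) {B.h₁ α K P} ∧
        B.star (B.o α K (B.n α K (.cutElim P) ∅)) ∈ B.J α ϑ (B.h₀ K P) {B.h₁ α K P} := by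
      have sub : ∀ φ, (φ ∈ B.l α K (B.n α K P ∅) ∧ φ ≠ ψ) ∨
          (φ ∈ B.l α K (B.n α K P {∅}) ∧ φ ≠ ψ.neg) → φ ∈ B.l α K P := by
        rintro φ (⟨h, hne⟩ | ⟨h, hne⟩)
        · simpa [Rule.prem, hne] using g₀ φ h
        · simpa [Rule.prem, hne, Step.one_ne_empty] using g₁ φ h
      have st₀ := TP.J_le hϑ s₀ (star_exp_le T₀.o_mem)
      have st₁ := TP.J_le hϑ s₁ (star_exp_le T₁.o_mem)
      rw [hn]
      rcases isRed_cutReduce (K := K) hψ hht (Q₀ := .cutElim (B.n α K P ∅))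
        (Q₁ := .cutElim (B.n α K P {∅})) c₀ c₁ with h | h
      · refine ⟨h.code, fun φ hφ => sub φ ?_, ?_, ?_, ?_, ?_, ?_⟩
        · simpa [h.l_eq, l] using hφ
        · rw [h.o_eq]; exact exp_add_exp_lt hϑ.pos T₁.o_mem T₀.o_mem TP.o_mem l₁ l₀
        · rw [h.d_eq]; simp only [d]; omega
        · rw [h.h₀_eq]; exact tmax_le e₀ e₁
        · rw [h.h₁_eq]; exact max_mem_J f₀ f₁
        · rw [h.o_eq]; exact TP.J_le hϑ (max_mem_J st₁ st₀) (star_add_le x₁ x₀)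
      · refine ⟨h.code, fun φ hφ => sub φ ?_, ?_, ?_, ?_, ?_, ?_⟩
        · simpa [h.l_eq, l, or_comm] using hφ
        · rw [h.o_eq]; exact exp_add_exp_lt hϑ.pos T₀.o_mem T₁.o_mem TP.o_mem l₀ l₁
        · rw [h.d_eq, ht_neg]; simp only [d]; omega
        · rw [h.h₀_eq]; exact tmax_le e₁ e₀
        · rw [h.h₁_eq]; exact max_mem_J f₁ f₀
        · rw [h.o_eq]; exact TP.J_le hϑ (max_mem_J st₀ st₁) (star_add_le x₀ x₁)
    obtain ⟨k1, k2, k3, k4, k5, k6, k7⟩ := key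
    refine ⟨by rw [hrQ]; simp [IsRule], fun a _ => by rw [hn a, ← hn ∅]; exact k1, ?_, ⟨?_, ?_⟩,
      TQ.J_le hϑ hP.condJ.star (star_exp_le TP.o_mem), hP.condJ.seq, ?_, ?_, ?_, ?_⟩
    all_goals try rw [hrQ]
    · exact Step.mk_rep k3 k2
    · nofun
    · rintro a rfl; exact k4
    · exact hk₀
    · rintro a rfl; exact k5
    · rintro a rfl; exact TQ.J_sub_pair hϑ _ k6
    · rintro a rfl; exact TQ.J_sub_pair hϑ _ k7
  · push Not at hr
    have hrn : B.r α K (.cutElim P) = B.r α K P ∧ ∀ a,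
        B.n α K (.cutElim P) a = .cutElim (B.n α K P a) := by
      simp only [r, n]
      split
      next ψ h =>
        have := (hr ψ h).not_gt
        simp [this, h]
      next => exact ⟨rfl, fun a => rfl⟩
    have hnd : ∀ a, B.d K (B.n α K (.cutElim P) a) = max 2 (B.d K (B.n α K P a) - 1) :=
      fun a => by rw [hrn.2]; rfl
    refine lc_passive hϑ hT TP TQ hP hrn.1 (fun a ha => hrn.2 a ▸ hP.n_mem a ha)
      (OrdMap.exp hϑ.one_lt_alpha) rfl (fun a _ => by rw [hrn.2]; rfl) (R := fun _ => False)
      (fun _ _ h => h) (fun _ _ _ h => h.elim) (fun _ h _ => h) ?_ ?_ ?_ (.refl _) le_rfl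
      (fun _ h => .inl h) zero_mem_J ?_ ?_
    · intro a _ φ hφ
      rw [hrn.2] at hφ
      exact .inl ⟨hφ, id⟩
    · intro ψ h
      exact (hr ψ h).trans_lt (Nat.lt_of_succ_le (le_max_left _ _))
    · intro a ha
      rw [hnd]
      exact max_le_max_left _ (Nat.sub_le_sub_right (hP.condC.c2 a ha) 1)
    · intro a ha
      rw [hrn.2]
      exact hP.condJ.h₀_le a ha
    · intro a _
      rw [hrn.2]
      exact le_max_left _ _

/-! ### Axioms and propositional rules -/

theorem lc_axm (hϑ : B.IsBH α ϑ) (hT : ∀ P, B.IsCode α P → B.Typed α K P) {θ : Fml.{v}}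
    (hc : B.IsCode α (.axm θ)) : B.LC α K ϑ (.axm θ) := by
  have TQ := hT _ hc
  have hn : ∀ a, a ∉ B.premises (Ordinal.omega0 ^ α) (B.r α K (.axm θ)) :=
    fun a => Set.notMem_empty a
  refine ⟨trivial, fun _ _ => hc, Step.mk_ax (Finset.mem_singleton_self _) hc.2,
    ⟨nofun, fun a h => absurd h (hn a)⟩, ?_, ?_, zero_mem_J, fun a h => absurd h (hn a),
    fun a h => absurd h (hn a), fun a h => absurd h (hn a)⟩
  · rw [o, star_zero]; exact zero_mem_J
  · intro φ hφ
    obtain rfl := Finset.mem_singleton.1 hφ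
    exact TQ.mem_J hϑ le_rfl

theorem lc_conj (hϑ : B.IsBH α ϑ) (hT : ∀ P, B.IsCode α P → B.Typed α K P)
    {ψ₀ ψ₁ : Fml.{v}} {P₀ P₁ : Code.{v}} (hc : B.IsCode α (.conj ψ₀ ψ₁ P₀ P₁))
    (h₀ : B.LC α K ϑ P₀) (h₁ : B.LC α K ϑ P₁) : B.LC α K ϑ (.conj ψ₀ ψ₁ P₀ P₁) := by
  obtain ⟨hF, hc₀, hc₁⟩ := id hc
  have T₀ := hT _ hc₀
  have T₁ := hT _ hc₁
  have TQ := hT _ hc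
  have hm := tmax_mem T₀.o_mem T₁.o_mem
  have hm1 := add_mem hϑ.pos hm (one_mem_Eps hϑ.pos)
  have e₀ : B.Le (B.h₀ K P₀) (B.h₀ K (.conj ψ₀ ψ₁ P₀ P₁)) := le_tmax_left _ _
  have e₁ : B.Le (B.h₀ K P₁) (B.h₀ K (.conj ψ₀ ψ₁ P₀ P₁)) := le_tmax_right T₀.h₀_mem T₁.h₀_mem
  have f₀ := TQ.mem_J hϑ ((le_max_left _ _).trans (le_max_left _ _))
  have f₁ := TQ.mem_J hϑ ((le_max_right _ _).trans (le_max_left _ _))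
  have hJ₀ := T₀.J_sub TQ hϑ e₀ f₀
  have hJ₁ := T₁.J_sub TQ hϑ e₁ f₁
  have n₀ : B.n α K (.conj ψ₀ ψ₁ P₀ P₁) ∅ = P₀ := by simp only [n, if_true]
  have n₁ : B.n α K (.conj ψ₀ ψ₁ P₀ P₁) {∅} = P₁ := by simp only [n, if_neg Step.one_ne_empty]
  refine ⟨IsF.and.1 hF, ?_, Step.mk_and (by simp [l]) ?_ ?_ ?_ ?_, ⟨nofun, ?_⟩, ?_, ?_,
    zero_mem_J, ?_, ?_, ?_⟩
  · intro a _
    simp only [n]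
    split_ifs
    exacts [hc₀, hc₁]
  · rw [n₀]
    exact (le_tmax_left _ _).trans_lt T₀.o_mem hm hm1 (lt_add_one hϑ.pos hm)
  · rw [n₁]
    exact (le_tmax_right T₀.o_mem T₁.o_mem).trans_lt T₁.o_mem hm hm1 (lt_add_one hϑ.pos hm)
  · intro φ hφ
    rw [n₀] at hφ
    simp only [l, Finset.mem_union, Finset.mem_sdiff, Finset.mem_singleton]
    tauto
  · intro φ hφ
    rw [n₁] at hφ
    simp only [l, Finset.mem_union, Finset.mem_sdiff, Finset.mem_singleton]
    tauto
  · rintro a (rfl | rfl)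
    · rw [n₀]; exact le_max_left _ _
    · rw [n₁]; exact le_max_right _ _
  · refine TQ.J_le hϑ (max_mem_J (hJ₀ h₀.condJ.star) (hJ₁ h₁.condJ.star))
      ((star_add_le hm (one_mem_Eps hϑ.pos)).trans ?_)
    rw [star_one, max_eq_left _root_.zero_le]
    exact star_tmax_le
  · intro φ hφ
    simp only [l, Finset.mem_union, Finset.mem_sdiff, Finset.mem_singleton] at hφ
    rcases hφ with (⟨hφ, -⟩ | ⟨hφ, -⟩) | rfl
    exacts [hJ₀ (h₀.condJ.seq φ hφ), hJ₁ (h₁.condJ.seq φ hφ), TQ.mem_J hϑ (le_max_right _ _)]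
  · rintro a (rfl | rfl)
    · rw [n₀]; exact e₀
    · rw [n₁]; exact e₁
  · rintro a (rfl | rfl)
    · rw [n₀]; exact TQ.J_sub_pair hϑ _ f₀
    · rw [n₁]; exact TQ.J_sub_pair hϑ _ f₁
  · rintro a (rfl | rfl)
    · rw [n₀]; exact TQ.J_sub_pair hϑ _ (hJ₀ h₀.condJ.star)
    · rw [n₁]; exact TQ.J_sub_pair hϑ _ (hJ₁ h₁.condJ.star)

theorem lc_disj (hϑ : B.IsBH α ϑ) (hT : ∀ P, B.IsCode α P → B.Typed α K P) {i : Bool}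
    {ψ₀ ψ₁ : Fml.{v}} {P : Code.{v}} (hc : B.IsCode α (.disj i ψ₀ ψ₁ P))
    (hP : B.LC α K ϑ P) : B.LC α K ϑ (.disj i ψ₀ ψ₁ P) := by
  obtain ⟨hF, hcP⟩ := id hc
  have TP := hT _ hcP
  have TQ := hT _ hc
  have f := TQ.mem_J hϑ (le_max_left _ _)
  have hJ := TP.J_sub TQ hϑ (.refl _) f
  refine ⟨IsF.or.1 hF, fun _ _ => hcP, Step.mk_or (by simp [l]) (lt_add_one hϑ.pos TP.o_mem) ?_,
    ⟨nofun, ?_⟩, ?_, ?_, zero_mem_J, ?_, ?_, ?_⟩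
  · intro φ (hφ : φ ∈ B.l α K P)
    simp only [l, Finset.mem_union, Finset.mem_sdiff, Finset.mem_singleton]
    tauto
  · exact fun _ _ => le_rfl
  · refine TQ.J_le hϑ (hJ hP.condJ.star) ((star_add_le TP.o_mem (one_mem_Eps hϑ.pos)).trans ?_)
    rw [star_one, max_eq_left _root_.zero_le]
  · intro φ hφ
    simp only [l, Finset.mem_union, Finset.mem_sdiff, Finset.mem_singleton] at hφ
    rcases hφ with ⟨hφ, -⟩ | rfl
    exacts [hJ (hP.condJ.seq φ hφ), TQ.mem_J hϑ (le_max_right _ _)]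
  · exact fun _ _ => .refl _
  · exact fun a _ => TQ.J_sub_pair hϑ _ f
  · exact fun a _ => TQ.J_sub_pair hϑ _ (hJ hP.condJ.star)

end Base

end Collapsing

namespace Collapsing

universe v

open Fml

namespace Base

variable {B : Base.{v}} {α : Ordinal.{v}} {ϑ : Tm.{v} → Ordinal.{v}} {K : CollVal.{v}}

/-! ### Boundedness -/

theorem add_one_add_omega (hα : 1 < α) {s : Tm.{v}} (hs : s ∈ B.Eps α) :
    B.add (B.add s .one) (.hat Ordinal.omega0) = B.add s (.hat Ordinal.omega0) := by
  have hα0 : 0 < α := zero_lt_one.trans hα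
  have hω : Tm.hat Ordinal.omega0 ∈ B.Eps α := hat_mem (by
    have := (Ordinal.opow_lt_opow_iff_right Ordinal.one_lt_omega0).2 hα
    rwa [Ordinal.opow_one] at this)
  rw [add_assoc' hα0 hs (one_mem_Eps hα0) hω, Tm.one, add_hat, Ordinal.one_add_omega0]

/-- A code inherits local correctness from a code `P` with the same height if its last rule is a
modification `q` of the last rule of `P`, with corresponding premises. For quantifier rules, premises
may be higher by one, since heights drop by `ω` and since `1 + ω = ω`. -/
theorem lc_of_premises (hϑ : B.IsBH α ϑ) (hT : ∀ P, B.IsCode α P → B.Typed α K P)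
    {P Q : Code.{v}} (TP : B.Typed α K P) (TQ : B.Typed α K Q) (hP : B.LC α K ϑ P)
    (ho : B.o α K Q = B.o α K P)
    (hl : ∀ φ ∈ B.l α K Q, φ ∈ B.l α K P ∨ B.kF φ ≤ B.h₁ α K Q) (hd : B.d K Q = B.d K P)
    (hh₀ : B.h₀ K Q = B.h₀ K P) (hh₁ : B.h₁ α K P ≤ B.h₁ α K Q) {q : Rule.{v}}
    (hr : B.r α K Q = q) (hq : B.IsRule (Ordinal.omega0 ^ α) q)
    (hcode : ∀ a ∈ B.L (Ordinal.omega0 ^ α), B.IsCode α (B.n α K Q a))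
    (hprem : ∀ a ∈ B.premises (Ordinal.omega0 ^ α) q,
      a ∈ B.premises (Ordinal.omega0 ^ α) (B.r α K P))
    (hk : B.kR q = B.kR (B.r α K P)) (hbig : q.Big ↔ (B.r α K P).Big)
    (hax : q ≠ .ax) (hcut : ∀ φ, q ≠ .cut φ) (href : ∀ z x a y θ, q ≠ .ref z x a y θ)
    (hex : ∀ x b ψ, q = .ex x b ψ → B.Lt (.hat (B.rk b)) (B.o α K P))
    (hprin : ∀ φ ∈ q.prin, φ ∈ B.l α K Q)
    (hln : ∀ a ∈ B.premises (Ordinal.omega0 ^ α) q, ∀ φ ∈ B.l α K (B.n α K Q a),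
      φ ∈ B.l α K Q ∨ φ ∈ q.prem a)
    (hon : ∀ a ∈ B.premises (Ordinal.omega0 ^ α) q,
      B.o α K (B.n α K Q a) = B.o α K (B.n α K P a) ∨
      (q.Big ∧ B.o α K (B.n α K Q a) = B.add (B.o α K (B.n α K P a)) .one))
    (hdn : ∀ a ∈ B.premises (Ordinal.omega0 ^ α) q, B.d K (B.n α K Q a) ≤ B.d K (B.n α K P a))
    (hhn : ∀ a ∈ B.premises (Ordinal.omega0 ^ α) q,
      B.Le (B.h₀ K (B.n α K Q a)) (B.h₀ K (B.n α K P a)))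
    (hh₁n : ∀ a ∈ B.premises (Ordinal.omega0 ^ α) q, B.h₁ α K (B.n α K Q a) ≤
      max (max (B.h₁ α K (B.n α K P a)) (B.h₁ α K Q)) (max (B.rk a) (B.kR (B.r α K P)))) :
    B.LC α K ϑ Q := by
  have e0 : B.Le (B.h₀ K P) (B.h₀ K Q) := hh₀ ▸ .refl _
  have hJ := TP.J_sub TQ hϑ e0 (TQ.mem_J hϑ hh₁)
  have hL := premises_mem_L hq
  have hJ₂ := fun {a} (ha : a ∈ _) => TP.J_sub₂ TQ hϑ e0 (TQ.mem_J hϑ hh₁) (hL a ha)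
  have hTn := fun a ha => hT _ (hP.n_mem a (hL a ha))
  have hTn' := fun a ha => hT _ (hcode a (hL a ha))
  have h1 := one_mem_Eps (B := B) hϑ.pos
  refine ⟨hr ▸ hq, hcode, ⟨?_, ?_, ?_, ?_, ?_, ?_, ?_⟩, ⟨?_, ?_⟩, ?_, ?_, ?_, ?_, ?_, ?_⟩
  all_goals try rw [hr]
  · exact fun h => absurd h hax
  · exact hprin
  · exact hln
  · intro hb a ha
    rw [ho]
    rcases hon a ha with h | ⟨h, -⟩
    · rw [h]
      exact hP.step.lt (fun h => hb (hbig.2 h)) a (hprem a ha)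
    · exact absurd h hb
  · intro hb a ha
    have := hP.step.big (hbig.1 hb) a (hprem a ha)
    rw [ho]
    rcases hon a ha with h | ⟨-, h⟩
    · rwa [h]
    · rwa [h, add_one_add_omega hϑ.one_lt_alpha (hTn a ha).o_mem]
  · exact fun x b ψ h => ho ▸ hex x b ψ h
  · exact fun z x a y θ h => absurd h (href z x a y θ)
  · exact fun ψ h => absurd h (hcut ψ)
  · intro a ha
    rw [hd]
    exact (hdn a ha).trans (hP.condC.c2 a (hprem a ha))
  · rw [ho]; exact hJ hP.condJ.star
  · intro φ hφ
    rcases hl φ hφ with h | h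
    exacts [hJ (hP.condJ.seq φ h), TQ.mem_J hϑ h]
  · rw [hk]; exact hJ hP.condJ.rule
  · intro a ha
    rw [hh₀]
    exact (hhn a ha).trans (hTn' a ha).h₀_mem (hTn a ha).h₀_mem TP.h₀_mem
      (hP.condJ.h₀_le a (hprem a ha))
  · intro a ha
    refine TQ.J_le₂ hϑ (hL a ha) (max_mem_J (max_mem_J (hJ₂ ha (hP.condJ.h₁_mem a (hprem a ha)))
      (base_mem_J (Set.mem_insert _ _))) (max_mem_J (base_mem_J (by simp)) ?_)) (hh₁n a ha)
    exact TQ.J_sub_pair hϑ a (hJ hP.condJ.rule)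
  · intro a ha
    have h2 := hJ₂ ha (hP.condJ.star_mem a (hprem a ha))
    rcases hon a ha with h | ⟨-, h⟩
    · rwa [h]
    · rw [h]
      refine TQ.J_le₂ hϑ (hL a ha) h2 ((star_add_le (hTn a ha).o_mem h1).trans ?_)
      rw [star_one, max_eq_left _root_.zero_le]

theorem lc_congr {P Q : Code.{v}} (hr : B.r α K Q = B.r α K P) (hn : B.n α K Q = B.n α K P)
    (hl : B.l α K Q = B.l α K P) (ho : B.o α K Q = B.o α K P) (hd : B.d K Q = B.d K P)
    (hh₀ : B.h₀ K Q = B.h₀ K P) (hh₁ : B.h₁ α K Q = B.h₁ α K P) (hP : B.LC α K ϑ P) :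
    B.LC α K ϑ Q := by
  obtain ⟨h1, h2, h3, ⟨h4, h5⟩, ⟨a1, a2, a3, a4, a5, a6⟩⟩ := hP
  refine ⟨?_, ?_, ?_, ⟨?_, ?_⟩, ⟨?_, ?_, ?_, ?_, ?_, ?_⟩⟩ <;>
    simp only [hr, hn, hl, ho, hd, hh₀, hh₁] <;> assumption

theorem Typed.lt_hat {P : Code.{v}} (TP : B.Typed α K P) {β : Ordinal.{v}}
    (hβ : β < Ordinal.omega0 ^ α) (hle : B.Le (B.o α K P) (.hat β)) {s : Tm.{v}}
    (hs : s ∈ B.Eps α) (h : B.Lt s (B.o α K P)) : B.Lt s (.hat β) :=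
  h.trans_le hs TP.o_mem (hat_mem hβ) hle

theorem rk_le_kF_rel_ex {x : ℕ} {θ : Fml.{v}} (h : ¬ Fml.BddEx x θ) (c : ZFSet.{v}) :
    B.rk c ≤ B.kF ((Fml.ex x θ).rel c) :=
  rk_le_kF (by simp [Fml.rel, h, Fml.pars, Trm.pars])

open Classical in
/-- In a derivation of height at most `β < Ω`, the witnesses of a `Σ`-formula lie in `L β`, because
a rule for an existential quantifier has height above the rank of its witness. Reflections do not
occur, because they have height at least `Ω`. -/
theorem lc_bddEx (hϑ : B.IsBH α ϑ) (hT : ∀ P, B.IsCode α P → B.Typed α K P) {φ : Fml.{v}}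
    {β : Ordinal.{v}} {P : Code.{v}} (hc : B.IsCode α (.bddEx φ β P)) (hP : B.LC α K ϑ P) :
    B.LC α K ϑ (.bddEx φ β P) := by
  obtain ⟨hF, hS, hβ, hcP⟩ := id hc
  by_cases hle : B.Le (B.o α K P) (.hat β)
  swap
  · refine lc_congr (P := P) ?_ (funext fun a => ?_) ?_ rfl rfl rfl ?_ hP
    all_goals simp only [r, n, l, h₁, if_neg hle]
  have TP := hT _ hcP
  have TQ := hT _ hc
  have hα := hϑ.pos
  set c := B.L β with hcdef
  have hcL : c ∈ B.L (Ordinal.omega0 ^ α) := B.L_mem_L hβ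
  have l_eq : ∀ {χ : Fml.{v}} {R : Code.{v}}, B.Le (B.o α K R) (.hat β) →
      B.l α K (.bddEx χ β R) = (B.l α K R \ {χ}) ∪ {χ.rel c} := fun h => by
    simp only [l, if_pos h, hcdef]
  have h₁_eq : ∀ {χ : Fml.{v}} {R : Code.{v}}, B.Le (B.o α K R) (.hat β) →
      B.h₁ α K (.bddEx χ β R) = max (B.h₁ α K R) (B.kF (χ.rel c)) := fun h => by
    simp only [h₁, if_pos h, hcdef]
  have r_eq : B.r α K (.bddEx φ β P) = bddExRule φ c (B.r α K P) := by
    simp only [r, if_pos hle, hcdef]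
  have hlQ := l_eq hle (χ := φ)
  have hφQ : φ.rel c ∈ B.l α K (.bddEx φ β P) := by rw [hlQ]; simp
  have hkφ : B.kF (φ.rel c) ≤ B.h₁ α K (.bddEx φ β P) := by
    rw [h₁_eq hle]; exact le_max_right _ _
  have hh1 : B.h₁ α K P ≤ B.h₁ α K (.bddEx φ β P) := by rw [h₁_eq hle]; exact le_max_left _ _
  have hseq : ∀ ψ ∈ B.l α K (.bddEx φ β P), ψ ∈ B.l α K P ∨
      B.kF ψ ≤ B.h₁ α K (.bddEx φ β P) := by
    intro ψ hψ
    rw [hlQ, Finset.mem_union, Finset.mem_sdiff, Finset.mem_singleton, Finset.mem_singleton] at hψ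
    rcases hψ with hψ | rfl
    exacts [.inl hψ.1, .inr hkφ]
  have hpL := premises_mem_L hP.r_mem
  have hon : ∀ a ∈ B.premises (Ordinal.omega0 ^ α) (B.r α K P),
      B.Le (B.o α K (B.n α K P a)) (.hat β) := fun a ha =>
    (TP.lt_hat hβ hle (hT _ (hP.n_mem a (hpL a ha))).o_mem (hP.o_lt hϑ hT TP ha)).le
  have hcode : ∀ {χ : Fml.{v}} (a), B.IsF (Ordinal.omega0 ^ α) χ → χ.IsSigma →
      a ∈ B.L (Ordinal.omega0 ^ α) → B.IsCode α (.bddEx χ β (.bddEx φ β (B.n α K P a))) :=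
    fun a h1 h2 ha => ⟨h1, h2, hβ, hF, hS, hβ, hP.n_mem a ha⟩
  have hln : ∀ (χ : Fml.{v}), ∀ a ∈ B.premises (Ordinal.omega0 ^ α) (B.r α K P),
      (∀ ψ ∈ (B.r α K P).prem a, ψ = χ) →
      ∀ ψ ∈ B.l α K (.bddEx χ β (.bddEx φ β (B.n α K P a))),
        ψ ∈ B.l α K (.bddEx φ β P) ∨ ψ = χ.rel c := by
    intro χ a ha hχ ψ hψ
    rw [l_eq (R := .bddEx φ β (B.n α K P a)) (hon a ha), l_eq (hon a ha)] at hψ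
    simp only [Finset.mem_union, Finset.mem_sdiff, Finset.mem_singleton] at hψ
    rcases hψ with ⟨⟨hψ, hne⟩ | rfl, hne'⟩ | rfl
    · rcases hP.step.sub a ha ψ hψ with h | h
      · left
        rw [hlQ]
        simp only [Finset.mem_union, Finset.mem_sdiff, Finset.mem_singleton]
        exact .inl ⟨h, hne⟩
      · exact absurd (hχ ψ h) hne'
    · exact .inl hφQ
    · exact .inr rfl
  have hh1n : ∀ (χ : Fml.{v}), ∀ a ∈ B.premises (Ordinal.omega0 ^ α) (B.r α K P),
      B.kF (χ.rel c) ≤ max (B.h₁ α K (.bddEx φ β P)) (max (B.rk a) (B.kR (B.r α K P))) →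
      B.h₁ α K (.bddEx χ β (.bddEx φ β (B.n α K P a))) ≤
        max (max (B.h₁ α K (B.n α K P a)) (B.h₁ α K (.bddEx φ β P)))
          (max (B.rk a) (B.kR (B.r α K P))) := by
    intro χ a ha h
    rw [h₁_eq (R := .bddEx φ β (B.n α K P a)) (hon a ha), h₁_eq (hon a ha)]
    refine max_le (max_le ?_ ?_) (h.trans (max_le_max_right _ (le_max_right _ _)))
    · exact (le_max_left _ _).trans (le_max_left _ _)
    · exact (hkφ.trans (le_max_right _ _)).trans (le_max_left _ _)
  -- either the last rule does not introduce `φ` and is passed on, or it introduces `φ`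
  have hcases : (φ ∉ (B.r α K P).prin ∧ bddExRule φ c (B.r α K P) = B.r α K P ∧
      (∀ a ∈ B.L (Ordinal.omega0 ^ α), B.IsCode α (B.n α K (.bddEx φ β P) a)) ∧
      ∀ a ∈ B.premises (Ordinal.omega0 ^ α) (B.r α K P),
        B.n α K (.bddEx φ β P) a = .bddEx φ β (B.n α K P a)) ∨
      φ ∈ (B.r α K P).prin := by
    by_cases hp : φ ∈ (B.r α K P).prin
    · exact .inr hp
    refine .inl ⟨hp, ?_, ?_, ?_⟩
    · rcases hr : B.r α K P with
          _ | ⟨ψ₀, ψ₁⟩ | ⟨i, ψ₀, ψ₁⟩ | ⟨x, ψ⟩ | ⟨x, b, ψ⟩ | ψ | ⟨z, x, a, y, θ⟩ | b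
      all_goals
        rw [hr] at hp
        simp only [Rule.prin, Set.mem_singleton_iff, Set.mem_empty_iff_false] at hp
        simp only [bddExRule]
        try rw [if_neg (fun e => hp e.symm)]
    · intro a ha
      have h1 : ∀ a ∈ B.L (Ordinal.omega0 ^ α), B.IsCode α (.bddEx φ β (B.n α K P a)) :=
        fun a ha => ⟨hF, hS, hβ, hP.n_mem a ha⟩
      simp only [n, if_pos hle]
      rcases hr : B.r α K P with
          _ | ⟨ψ₀, ψ₁⟩ | ⟨i, ψ₀, ψ₁⟩ | ⟨x, ψ⟩ | ⟨x, b, ψ⟩ | ψ | ⟨z, x, a, y, θ⟩ | b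
      all_goals
        rw [hr] at hp
        simp only [Rule.prin, Set.mem_singleton_iff, Set.mem_empty_iff_false] at hp
        simp only [bddExNext]
        try rw [if_neg (fun e => hp e.symm)]
        exact h1 _ (by first | exact ha | simp)
    · intro a ha
      simp only [n, if_pos hle]
      rcases hr : B.r α K P with
          _ | ⟨ψ₀, ψ₁⟩ | ⟨i, ψ₀, ψ₁⟩ | ⟨x, ψ⟩ | ⟨x, b, ψ⟩ | ψ | ⟨z, x, a, y, θ⟩ | b
      all_goals
        rw [hr] at hp ha
        simp only [Rule.prin, Set.mem_singleton_iff, Set.mem_empty_iff_false] at hp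
        simp only [bddExNext]
        try rw [if_neg (fun e => hp e.symm)]
      obtain rfl : a = ∅ := ha
      rfl
  rcases hcases with ⟨hp, hr, hcd, hn⟩ | hp
  · refine lc_passive hϑ hT TP TQ hP (r_eq.trans hr) hcd OrdMap.id rfl
      (fun a ha => by rw [hn a ha]; rfl) (R := fun ψ => ψ = φ) ?_ ?_ ?_ ?_ hP.condC.c1 ?_ (.refl _)
      hh1 (fun ψ hψ => (hseq ψ hψ).imp_right fun h => TQ.mem_J hϑ h) zero_mem_J ?_ ?_
    · rintro ψ hψ rfl
      exact hp hψ
    · rintro - ψ - rfl hψ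
      refine ⟨_, hφQ, ?_⟩
      rwa [rel_of_isD0 hψ.1]
    · intro ψ hψ hne
      rw [hlQ]
      simp only [Finset.mem_union, Finset.mem_sdiff, Finset.mem_singleton]
      exact .inl ⟨hψ, hne⟩
    · intro a ha ψ hψ
      rw [hn a ha, l_eq (hon a ha)] at hψ
      rw [hlQ]
      simp only [Finset.mem_union, Finset.mem_sdiff, Finset.mem_singleton] at hψ ⊢
      tauto
    · intro a ha
      rw [hn a ha]
      exact hP.condC.c2 a ha
    · intro a ha
      rw [hn a ha]
      exact hP.condJ.h₀_le a ha
    · intro a ha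
      rw [hn a ha, h₁_eq (hon a ha)]
      exact max_le_max_left _ hkφ
  -- the last rule `q` introduces the relativized formula, with premise formulas relativized as well
  have hmain : ∀ (q : Rule.{v}) (χ : ZFSet.{v} → Fml.{v}), bddExRule φ c (B.r α K P) = q →
      B.IsRule (Ordinal.omega0 ^ α) q →
      (∀ a ∈ B.premises (Ordinal.omega0 ^ α) q, a ∈ B.premises (Ordinal.omega0 ^ α) (B.r α K P)) →
      B.kR q = B.kR (B.r α K P) → (q.Big ↔ (B.r α K P).Big) → q ≠ .ax → (∀ φ, q ≠ .cut φ) →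
      (∀ z x a y θ, q ≠ .ref z x a y θ) →
      (∀ x b ψ, q = .ex x b ψ → B.Lt (.hat (B.rk b)) (B.o α K P)) → q.prin = {φ.rel c} →
      (∀ a ∈ B.premises (Ordinal.omega0 ^ α) q, ∀ ψ ∈ (B.r α K P).prem a, ψ = χ a) →
      (∀ a ∈ B.premises (Ordinal.omega0 ^ α) q, (χ a).rel c ∈ q.prem a) →
      (∀ a ∈ B.L (Ordinal.omega0 ^ α), B.IsF (Ordinal.omega0 ^ α) (χ a) ∧ (χ a).IsSigma) →
      (∀ a ∈ B.L (Ordinal.omega0 ^ α), ∃ a' ∈ B.L (Ordinal.omega0 ^ α),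
        B.n α K (.bddEx φ β P) a = .bddEx (χ a) β (.bddEx φ β (B.n α K P a'))) →
      (∀ a ∈ B.premises (Ordinal.omega0 ^ α) q,
        B.n α K (.bddEx φ β P) a = .bddEx (χ a) β (.bddEx φ β (B.n α K P a))) →
      (∀ a ∈ B.premises (Ordinal.omega0 ^ α) q, B.kF ((χ a).rel c) ≤
        max (B.h₁ α K (.bddEx φ β P)) (max (B.rk a) (B.kR (B.r α K P)))) →
      B.LC α K ϑ (.bddEx φ β P) := by
    intro q χ g1 g2 g3 g4 g5 g6 g7 g8 g9 g10 g11 g12 g13 g14 g15 g16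
    refine lc_of_premises hϑ hT TP TQ hP rfl hseq rfl rfl hh1 (r_eq.trans g1) g2 ?_ g3 g4 g5 g6 g7
      g8 g9 ?_ ?_ ?_ ?_ ?_ ?_
    · intro a ha
      obtain ⟨a', ha', e⟩ := g14 a ha
      rw [e]
      exact hcode a' (g13 a ha).1 (g13 a ha).2 ha'
    · rw [g10]
      rintro ψ rfl
      exact hφQ
    · intro a ha ψ hψ
      rw [g15 a ha] at hψ
      rcases hln (χ a) a (g3 a ha) (g11 a ha) ψ hψ with h | rfl
      exacts [.inl h, .inr (g12 a ha)]
    · exact fun a ha => .inl (by rw [g15 a ha]; rfl)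
    · exact fun a ha => by rw [g15 a ha]; exact le_rfl
    · exact fun a ha => by rw [g15 a ha]; exact .refl _
    · intro a ha
      rw [g15 a ha]
      exact hh1n (χ a) a (g3 a ha) (g16 a ha)
  have hrule := hP.r_mem
  have hFr := hF.rel hcL
  have hone : ({∅} : ZFSet.{v}) ≠ ∅ := Step.one_ne_empty
  rcases hr : B.r α K P with
      _ | ⟨ψ₀, ψ₁⟩ | ⟨i, ψ₀, ψ₁⟩ | ⟨x, ψ⟩ | ⟨x, b, ψ⟩ | ψ | ⟨z, x, a, y, θ⟩ | b
  all_goals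
    rw [hr] at hp hrule
    simp only [Rule.prin, Set.mem_singleton_iff, Set.mem_empty_iff_false] at hp
    try subst hp
  · -- conjunction
    refine hmain (.and (ψ₀.rel c) (ψ₁.rel c)) (fun a => if a = ∅ then ψ₀ else ψ₁) ?_ (IsF.and.1 hFr)
      ?_ ?_ ?_ nofun nofun nofun nofun rfl ?_ ?_ ?_ ?_ ?_ ?_
    · simp only [hr, bddExRule, if_true]
    · rw [hr]; exact fun a h => h
    · rw [hr]; rfl
    · rw [hr]; rfl
    · rw [hr]
      rintro a - ψ (⟨ha, rfl⟩ | ⟨ha, rfl⟩) <;> simp [ha]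
    · rintro a (rfl | rfl) <;> simp [Rule.prem, hone]
    · intro a _
      split_ifs
      exacts [⟨hrule.1, hS.1⟩, ⟨hrule.2, hS.2⟩]
    · exact fun a ha => ⟨a, ha, by simp only [n, if_pos hle, hr, bddExNext, if_true]⟩
    · exact fun a ha => by simp only [n, if_pos hle, hr, bddExNext, if_true]
    · intro a _
      refine le_trans ?_ (hkφ.trans (le_max_left _ _))
      split_ifs
      exacts [le_max_left _ _, le_max_right _ _]
  · -- disjunction
    have hp : (pick i ψ₀ ψ₁).rel c = pick i (ψ₀.rel c) (ψ₁.rel c) := by cases i <;> rfl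
    refine hmain (.or i (ψ₀.rel c) (ψ₁.rel c)) (fun _ => pick i ψ₀ ψ₁) ?_ (IsF.or.1 hFr)
      ?_ ?_ ?_ nofun nofun nofun nofun rfl ?_ ?_ ?_ ?_ ?_ ?_
    · simp only [hr, bddExRule, if_true]
    · rw [hr]; exact fun a h => h
    · rw [hr]; rfl
    · rw [hr]; rfl
    · rw [hr]
      exact fun a _ ψ h => h
    · intro a _
      rw [hp]; rfl
    · refine fun a _ => ⟨pick_mem i hrule, ?_⟩
      cases i
      exacts [hS.1, hS.2]
    · exact fun a ha => ⟨a, ha, by simp only [n, if_pos hle, hr, bddExNext, if_true]⟩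
    · exact fun a ha => by simp only [n, if_pos hle, hr, bddExNext, if_true]
    · intro a _
      refine le_trans ?_ (hkφ.trans (le_max_left _ _))
      cases i
      exacts [le_max_left _ _, le_max_right _ _]
  · -- universal quantifier, which is bounded since it occurs in a `Σ`-formula
    have hrel : (Fml.all x ψ).rel c = .all x (ψ.rel c) := by simp only [Fml.rel, if_pos hS.1]
    refine hmain (.all x (ψ.rel c)) (fun a => ψ.subst x a) ?_ (show B.IsF _ _ from hrel ▸ hFr)
      ?_ ?_ ?_ nofun nofun nofun nofun (by rw [hrel]; rfl) ?_ ?_ ?_ ?_ ?_ ?_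
    · simp only [hr, bddExRule, if_true]
    · rw [hr]; exact fun a h => h
    · rw [hr]; rfl
    · rw [hr]; rfl
    · rw [hr]
      exact fun a _ ψ h => h
    · exact fun a _ => rel_subst ψ x a c
    · exact fun a ha => ⟨hF.all_subst ha, hS.2.subst x a⟩
    · exact fun a ha => ⟨a, ha, by simp only [n, if_pos hle, hr, bddExNext, if_true]⟩
    · exact fun a ha => by simp only [n, if_pos hle, hr, bddExNext, if_true]
    · intro a _
      rw [rel_subst]
      refine (B.kF_subst_le _ x a).trans (max_le ?_ ((le_max_left _ _).trans (le_max_right _ _)))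
      exact (B.kF_rel_all x ψ c).trans (hkφ.trans (le_max_left _ _))
  · have hbL : b ∈ B.L (Ordinal.omega0 ^ α) := hrule.2
    have hb : B.Lt (.hat (B.rk b)) (B.o α K P) := hP.step.ex x b ψ hr
    have hkψ : B.kF ((ψ.subst x b).rel c) ≤ max (B.kF ((Fml.ex x ψ).rel c)) (B.rk b) := by
      rw [rel_subst]
      exact (B.kF_subst_le _ x b).trans (max_le_max_right _ (B.kF_rel_ex x ψ c))
    by_cases hbd : Fml.BddEx x ψ
    · -- bounded existential quantifier
      have hrel : (Fml.ex x ψ).rel c = .ex x (ψ.rel c) := by simp only [Fml.rel, if_pos hbd]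
      refine hmain (.ex x b (ψ.rel c)) (fun _ => ψ.subst x b) ?_ ⟨hrel ▸ hFr, hbL⟩
        ?_ ?_ ?_ nofun nofun nofun ?_ (by rw [hrel]; rfl) ?_ ?_ ?_ ?_ ?_ ?_
      · simp only [hr, bddExRule, if_true, if_pos hbd]
      · rw [hr]; exact fun a h => h
      · rw [hr]; rfl
      · rw [hr]; rfl
      · rintro y b' χ h
        injection h with h1 h2 h3
        exact h2 ▸ hb
      · rw [hr]
        exact fun a _ ψ h => h
      · exact fun a _ => rel_subst ψ x b c
      · exact fun a ha => ⟨hF.ex_subst hbL, IsSigma.subst (φ := ψ) hS x b⟩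
      · exact fun a ha => ⟨∅, by simp, by
          simp only [n, if_pos hle, hr, bddExNext, if_true, if_pos hbd]⟩
      · rintro a rfl
        simp only [n, if_pos hle, hr, bddExNext, if_true, if_pos hbd]
      · intro a _
        refine hkψ.trans (max_le_max hkφ ?_)
        rw [hr]
        exact le_max_right _ _
    · -- unbounded existential quantifier; the witness lies in `L β`
      have hrel : (Fml.ex x ψ).rel c = .ex x (.and (.mem (.var x) (.par c)) (ψ.rel c)) := by
        simp only [Fml.rel, if_neg hbd]
      have hbc : b ∈ c := by
        refine B.mem_L_of_rk_lt hbL ?_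
        rw [← hat_lt_hat (B := B)]
        exact TP.lt_hat hβ hle (hat_mem (rk_lt (opow_pos' α) hbL)) hb
      have hn : ∀ a, B.n α K (.bddEx (.ex x ψ) β P) a = .conj (.mem (.par b) (.par c))
          ((ψ.subst x b).rel c) (.axm (.mem (.par b) (.par c)))
            (.bddEx (ψ.subst x b) β (.bddEx (.ex x ψ) β (B.n α K P ∅))) := fun a => by
        simp only [n, if_pos hle, hr, bddExNext, if_true, if_neg hbd, hcdef]
      have m0 : ∅ ∈ B.premises (Ordinal.omega0 ^ α) (B.r α K P) := by rw [hr]; rfl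
      have hψF := hF.ex_subst hbL
      have hψS : (ψ.subst x b).IsSigma := IsSigma.subst (φ := ψ) hS x b
      have hmF : B.IsF (Ordinal.omega0 ^ α) (.mem (.par b) (.par c)) := IsF.mem_par hbL hcL
      have T0 := hT _ (hP.n_mem ∅ (by simp))
      have hln0 := hln (ψ.subst x b) ∅ m0 (by rw [hr]; exact fun ψ h => h)
      have hh1n0 := hh1n (ψ.subst x b) ∅ m0 (hkψ.trans (max_le_max hkφ (by
        rw [hr]
        exact le_max_right _ _)))
      have hrb : B.kR (B.r α K P) = B.rk b := by rw [hr]; rfl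
      refine lc_of_premises hϑ hT TP TQ hP rfl hseq rfl rfl hh1
        (q := .ex x b (.and (.mem (.var x) (.par c)) (ψ.rel c))) ?_ ⟨hrel ▸ hFr, hbL⟩
        ?_ ?_ ?_ ?_ nofun nofun nofun ?_ ?_ ?_ ?_ ?_ ?_ ?_
      · simp only [r_eq, hr, bddExRule, if_true, if_neg hbd]
      · intro a _
        rw [hn]
        exact ⟨IsF.and.2 ⟨hmF, hψF.rel hcL⟩, ⟨hmF, trueD0_mem hbc⟩,
          hcode ∅ hψF hψS (by simp)⟩
      · rw [hr]; exact fun a h => h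
      · rw [hr]; rfl
      · rw [hr]; rfl
      · rintro y b' χ h
        injection h with h1 h2 h3
        exact h2 ▸ hb
      · rintro φ rfl
        exact hrel ▸ hφQ
      · rintro a rfl φ hφ
        rw [hn] at hφ
        simp only [l.eq_7, l.eq_8, Finset.mem_union, Finset.mem_sdiff, Finset.mem_singleton] at hφ
        rcases hφ with (⟨h, h'⟩ | ⟨h, h'⟩) | rfl
        · exact absurd h h'
        · exact .inl ((hln0 φ h).resolve_right h')
        · right
          simp [Rule.prem, Fml.subst, Trm.subst, rel_subst]
      · -- the conjunction with `b ∈ L β` raises the height of the premise by one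
        rintro a rfl
        refine .inr ⟨trivial, ?_⟩
        rw [hn]
        change B.add (B.tmax .zero (B.o α K (B.n α K P ∅))) .one = _
        congr 1
        rcases zero_le (B := B) (B.o α K (B.n α K P ∅)) with h | h
        · rw [tmax, if_pos h]
        · rw [← h]
          rcases tmax_cases (B := B) .zero .zero with e | e <;> exact e
      · rintro a rfl
        rw [hn]
        exact max_le (Nat.zero_le _) le_rfl
      · rintro a rfl
        rw [hn]
        exact tmax_le T0.Om_le_h₀ (.refl _)
      · rintro a rfl
        rw [hn]
        have k1 : B.rk c ≤ B.h₁ α K (.bddEx (.ex x ψ) β P) := (rk_le_kF_rel_ex hbd c).trans hkφ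
        have k2 : B.kF (ψ.rel c) ≤ B.h₁ α K (.bddEx (.ex x ψ) β P) :=
          (B.kF_rel_ex x ψ c).trans hkφ
        have k3 : max (B.rk b) (B.rk c) ≤
            max (max (B.h₁ α K (B.n α K P ∅)) (B.h₁ α K (.bddEx (.ex x ψ) β P)))
              (max (B.rk ∅) (B.kR (B.r α K P))) := by
          refine max_le ?_ ((k1.trans (le_max_right _ _)).trans (le_max_left _ _))
          rw [hrb]
          exact (le_max_right _ _).trans (le_max_right _ _)
        have k4 : B.kF ((ψ.subst x b).rel c) ≤
            max (max (B.h₁ α K (B.n α K P ∅)) (B.h₁ α K (.bddEx (.ex x ψ) β P)))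
              (max (B.rk ∅) (B.kR (B.r α K P))) := by
          refine hkψ.trans (max_le ((hkφ.trans (le_max_right _ _)).trans (le_max_left _ _)) ?_)
          rw [hrb]
          exact (le_max_right _ _).trans (le_max_right _ _)
        exact max_le (max_le k3 hh1n0) (max_le k3 k4)
  · -- reflection is impossible since the height is below `Ω`
    refine absurd ?_ (Lt.irrefl (B := B) (Om_mem hα))
    exact ((hP.step.ref _ _ _ _ _ hr).trans (Om_mem hα) TP.o_mem (hat_mem hβ) hle).trans_lt
      (Om_mem hα) (hat_mem hβ) (Om_mem hα) (hat_lt_Om β)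

/-- A premise for `∀ x, θ` is turned into a premise for `∀ x ∈ L β, θ` by a disjunction rule. -/
theorem lc_bddAll (hϑ : B.IsBH α ϑ) (hT : ∀ P, B.IsCode α P → B.Typed α K P) {x : ℕ}
    {θ : Fml.{v}} {β : Ordinal.{v}} {P : Code.{v}} (hc : B.IsCode α (.bddAll x θ β P))
    (hP : B.LC α K ϑ P) : B.LC α K ϑ (.bddAll x θ β P) := by
  obtain ⟨hF, hD, hnb, hβ, hcP⟩ := id hc
  have TP := hT _ hcP
  have TQ := hT _ hc
  have hcL : B.L β ∈ B.L (Ordinal.omega0 ^ α) := B.L_mem_L hβ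
  have hrel : (Fml.all x θ).rel (B.L β) = .all x (.or (.nmem (.var x) (.par (B.L β))) θ) := by
    simp only [Fml.rel, if_neg hnb, rel_of_isD0 hD]
  have hcode : ∀ a ∈ B.L (Ordinal.omega0 ^ α), B.IsCode α (.bddAll x θ β (B.n α K P a)) :=
    fun a ha => ⟨hF, hD, hnb, hβ, hP.n_mem a ha⟩
  have hh1 : B.h₁ α K P ≤ B.h₁ α K (.bddAll x θ β P) := le_max_left _ _
  have hk : B.kF ((Fml.all x θ).rel (B.L β)) ≤ B.h₁ α K (.bddAll x θ β P) := le_max_right _ _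
  have hseq : ∀ φ ∈ B.l α K (.bddAll x θ β P), φ ∈ B.l α K P ∨
      B.kF φ ≤ B.h₁ α K (.bddAll x θ β P) := by
    intro φ hφ
    simp only [l, Finset.mem_union, Finset.mem_sdiff, Finset.mem_singleton] at hφ
    rcases hφ with ⟨hφ, -⟩ | rfl
    exacts [.inl hφ, .inr hk]
  by_cases hr : B.r α K P = .all x θ
  · have hn : ∀ a, B.n α K (.bddAll x θ β P) a = .disj true (.nmem (.par a) (.par (B.L β)))
        (θ.subst x a) (.bddAll x θ β (B.n α K P a)) := fun a => by
      simp only [n, if_pos hr]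
    have hFr := hF.rel hcL
    rw [hrel] at hFr
    refine lc_of_premises hϑ hT TP TQ hP rfl hseq rfl rfl hh1
      (q := .all x (.or (.nmem (.var x) (.par (B.L β))) θ)) (by simp only [r, if_pos hr])
      hFr ?_ ?_ ?_ ?_ nofun nofun nofun nofun ?_ ?_ ?_ ?_ ?_ ?_
    · intro a ha
      rw [hn]
      exact ⟨IsF.or.2 ⟨IsF.nmem_par ha hcL, hF.all_subst ha⟩, hcode a ha⟩
    · intro a ha
      rw [hr]
      exact ha
    · rw [hr]; rfl
    · rw [hr]; rfl
    · rintro φ rfl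
      simp [l, hrel]
    · intro a ha φ hφ
      have h2 := hP.step.sub a (by rw [hr]; exact ha) φ
      rw [hr] at h2
      rw [hn] at hφ
      simp only [l, pick, if_true, Finset.mem_union, Finset.mem_sdiff, Finset.mem_singleton,
        Rule.prem, Set.mem_singleton_iff, Fml.subst, Trm.subst] at hφ h2 ⊢
      tauto
    · intro a _
      rw [hn]
      exact .inr ⟨trivial, rfl⟩
    · intro a _
      rw [hn]
      exact le_rfl
    · intro a _
      rw [hn]
      exact .refl _
    · intro a _
      rw [hn]
      rw [hrel] at hk
      have k1 : B.rk (B.L β) ≤ B.h₁ α K (.bddAll x θ β P) :=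
        (rk_le_kF (by simp [Fml.pars, Trm.pars])).trans hk
      have k2 : B.kF θ ≤ B.h₁ α K (.bddAll x θ β P) := (le_max_right _ _).trans hk
      have k3 := B.kF_subst_le θ x a
      have e : B.h₁ α K (.disj true (.nmem (.par a) (.par (B.L β))) (θ.subst x a)
          (.bddAll x θ β (B.n α K P a))) = max (max (B.h₁ α K (B.n α K P a))
            (B.kF ((Fml.all x θ).rel (B.L β)))) (max (max (B.rk a) (B.rk (B.L β)))
              (B.kF (θ.subst x a))) := rfl
      rw [e, hrel]
      refine max_le (max_le ?_ ?_) (max_le (max_le ?_ ?_) (k3.trans (max_le ?_ ?_)))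
      · exact (le_max_left _ _).trans (le_max_left _ _)
      · exact (hk.trans (le_max_right _ _)).trans (le_max_left _ _)
      · exact (le_max_left _ _).trans (le_max_right _ _)
      · exact (k1.trans (le_max_right _ _)).trans (le_max_left _ _)
      · exact (k2.trans (le_max_right _ _)).trans (le_max_left _ _)
      · exact (le_max_left _ _).trans (le_max_right _ _)
  · have hn : ∀ a, B.n α K (.bddAll x θ β P) a = .bddAll x θ β (B.n α K P a) := fun a => by
      simp only [n, if_neg hr]
    refine lc_passive hϑ hT TP TQ hP (by simp only [r, if_neg hr])
      (fun a ha => by rw [hn]; exact hcode a ha) OrdMap.id rfl (fun a _ => by rw [hn]; rfl)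
      (R := fun φ => φ = .all x θ) ?_ ?_ ?_ ?_ hP.condC.c1 ?_ (.refl _) hh1
      (fun ψ hψ => (hseq ψ hψ).imp_right fun h => TQ.mem_J hϑ h) zero_mem_J ?_ ?_
    · rintro φ hφ rfl
      exact hr (prin_all hφ)
    · -- an axiom cannot be lost, since an unbounded quantifier is not a `Δ₀`-formula
      rintro - φ - rfl hφ
      exact absurd hφ.1.1 hnb
    · intro φ hφ hne
      simp only [l, Finset.mem_union, Finset.mem_sdiff, Finset.mem_singleton]
      exact .inl ⟨hφ, hne⟩
    · intro a ha φ hφ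
      rw [hn] at hφ
      simp only [l, Finset.mem_union, Finset.mem_sdiff, Finset.mem_singleton] at hφ ⊢
      tauto
    · intro a ha
      rw [hn]
      exact hP.condC.c2 a ha
    · intro a ha
      rw [hn]
      exact hP.condJ.h₀_le a ha
    · intro a _
      rw [hn]
      exact max_le_max_left _ hk

end Base

end Collapsing

namespace Collapsing

universe v

open Fml

/-- The premise of a reflection, relativized to `c`, is the instance of its conclusion at `c`. As `θ`
is a disjunction, `∃ y, θ` does not have the form of a bounded quantifier, so that it is indeed
relativized. -/
theorem refPrem_rel {z x y : ℕ} {a c : ZFSet.{v}} {θ : Fml.{v}} (hD : θ.IsD0) (hO : θ.IsOr)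
    (hzx : z ≠ x) (hzy : z ≠ y) (hz : z ∉ θ.fv) :
    (refPrem x a y θ).rel c = (Fml.ball x (.par a) (.bex y (.var z) θ)).subst z c := by
  obtain ⟨θ₀, θ₁, rfl⟩ := hO
  have h1 : Fml.BddAll x (.or (.nmem (.var x) (.par a)) (.ex y (.or θ₀ θ₁))) :=
    ⟨.par a, _, by simp, rfl⟩
  have h2 : ¬ Fml.BddEx y (.or θ₀ θ₁) := by rintro ⟨_, _, _, h⟩; cases h
  have h3 := subst_of_notMem (a := c) hz
  simp only [refPrem, ball, bex, Fml.rel, if_pos h1, if_neg h2]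
  have h4 := rel_of_isD0 hD c
  simp only [Fml.rel, Fml.subst] at h3 h4
  simp only [Fml.subst, Trm.subst, if_neg hzx.symm, if_neg hzy.symm, h3, h4, if_true]

theorem isSigma_refPrem {x y : ℕ} {a : ZFSet.{v}} {θ : Fml.{v}} (hD : θ.IsD0) :
    (refPrem x a y θ).IsSigma := ⟨⟨.par a, _, by simp, rfl⟩, trivial, hD.isSigma⟩

namespace Base

variable {B : Base.{v}} {α : Ordinal.{v}} {ϑ : Tm.{v} → Ordinal.{v}} {K : CollVal.{v}}

/-! ### Collapsing -/

theorem IsBH.theta_lt (hϑ : B.IsBH α ϑ) {s : Tm.{v}} (hs : s ∈ B.Eps α) :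
    ϑ s < Ordinal.omega0 ^ α := (hϑ.lt_alpha s hs).trans_le (le_opow α)

/-- The situation of a collapse `C_t P`, where `P` has height `s`. -/
structure CollCtx (B : Base.{v}) (α : Ordinal.{v}) (ϑ : Tm.{v} → Ordinal.{v}) (t s : Tm.{v}) :
    Prop where
  bh : B.IsBH α ϑ
  t_mem : t ∈ B.Eps α
  s_mem : s ∈ B.Eps α
  Om_le : B.Le .Om t
  t_mem_H : t ∈ B.H α ϑ t ∅

namespace CollCtx

variable {t s u : Tm.{v}}

theorem new_mem (h : B.CollCtx α ϑ t s) : B.add t s.exp ∈ B.Eps α :=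
  add_mem h.bh.pos h.t_mem (exp_mem h.bh.pos h.s_mem)

theorem lt_new (h : B.CollCtx α ϑ t s) : B.Lt t (B.add t s.exp) :=
  lt_add_of_pos h.bh.pos h.t_mem (exp_mem h.bh.pos h.s_mem) (exp_pos s)

theorem Om_le_new (h : B.CollCtx α ϑ t s) : B.Le .Om (B.add t s.exp) :=
  h.Om_le.trans (Om_mem h.bh.pos) h.t_mem h.new_mem h.lt_new.le

theorem star_t (h : B.CollCtx α ϑ t s) : B.star t ∈ B.J α ϑ t ∅ :=
  (h.bh.J_Iio (fun _ h => absurd h (Set.notMem_empty _)) t h.t_mem_H).2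

theorem J_sub (h : B.CollCtx α ϑ t s) (X : Set Ordinal.{v}) :
    B.J α ϑ t ∅ ⊆ B.J α ϑ (B.add t s.exp) X :=
  h.bh.J_mono h.t_mem h.new_mem (fun _ h => absurd h (Set.notMem_empty _)) h.lt_new.le
    (Set.empty_subset _)

theorem lt_opow (h : B.CollCtx α ϑ t s) {γ : Ordinal.{v}} (hγ : γ ∈ B.J α ϑ t ∅) :
    γ < Ordinal.omega0 ^ α := h.bh.lt_of_mem_J (fun _ h => absurd h (Set.notMem_empty _)) hγ

theorem J_le (h : B.CollCtx α ϑ t s) {β γ : Ordinal.{v}} (hγ : γ ∈ B.J α ϑ t ∅) (hβ : β ≤ γ) :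
    β ∈ B.J α ϑ t ∅ := h.bh.J_le (fun _ h => absurd h (Set.notMem_empty _)) hγ hβ

theorem lt_theta (h : B.CollCtx α ϑ t s) {γ : Ordinal.{v}} (hγ : γ ∈ B.J α ϑ t ∅) :
    γ < ϑ (B.add t s.exp) := h.bh.lt_theta_of_mem_J h.t_mem h.new_mem h.Om_le h.lt_new hγ

/-- Smaller terms that are controlled by `H t` have smaller collapse, which is controlled by the
new operator. -/
theorem theta (h : B.CollCtx α ϑ t s) (hu : u ∈ B.Eps α) (hlt : B.Lt u (B.add t s.exp))
    (hs : B.star u ∈ B.J α ϑ t ∅) :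
    ϑ u < ϑ (B.add t s.exp) ∧ ∀ X, ϑ u ∈ B.J α ϑ (B.add t s.exp) X :=
  ⟨h.bh.mono u hu _ h.new_mem hlt (h.lt_theta hs),
    fun X => h.bh.theta_mem_J hu h.new_mem hlt.le (h.J_sub X hs)⟩

/-- The terms `t + Ω ^ u` for `u < s`. -/
theorem add_exp (h : B.CollCtx α ϑ t s) (hu : u ∈ B.Eps α) (hlt : B.Lt u s)
    (hs : B.star u ∈ B.J α ϑ t ∅) : B.Lt (B.add t u.exp) (B.add t s.exp) ∧
      B.star (B.add t u.exp) ∈ B.J α ϑ t ∅ :=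
  have he := exp_mem h.bh.pos hu
  ⟨add_lt_add' h.bh.pos h.t_mem he (exp_mem h.bh.pos h.s_mem)
    (exp_lt_exp h.bh.pos hu h.s_mem hlt),
    h.J_le (max_mem_J h.star_t (h.J_le hs (star_exp_le hu))) (star_add_le h.t_mem he)⟩

theorem restrict (h : B.CollCtx α ϑ t s) (hu : u ∈ B.Eps α) : B.CollCtx α ϑ t u :=
  ⟨h.bh, h.t_mem, hu, h.Om_le, h.t_mem_H⟩

/-- The situation for a further collapse after `t` has been increased. -/
theorem step (h : B.CollCtx α ϑ t s) {w : Tm.{v}} (hu : u ∈ B.Eps α) (hw : w ∈ B.Eps α)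
    (hlt : B.Lt u s) (hs : B.star u ∈ B.J α ϑ t ∅) : B.CollCtx α ϑ (B.add t u.exp) w := by
  have h' := h.restrict hu
  exact ⟨h.bh, h'.new_mem, hw, h'.Om_le_new,
    mem_H_of_star h'.new_mem (h'.J_sub ∅ (h.add_exp hu hlt hs).2)⟩

end CollCtx

/-- The code `N` can serve as the premise with index `a` of a rule with premise formulas in `Δ`
that leads to the sequent `Γ`, with height `ϑ(t₁)` and operator `H_{t₁}`. -/
structure CollPrem (B : Base.{v}) (α : Ordinal.{v}) (K : CollVal.{v}) (ϑ : Tm.{v} → Ordinal.{v})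
    (t₁ : Tm.{v}) (Γ : Finset Fml.{v}) (Δ : Set Fml.{v}) (a : ZFSet.{v}) (N : Code.{v}) :
    Prop where
  sub : ∀ φ ∈ B.l α K N, φ ∈ Γ ∨ φ ∈ Δ
  ord : ∃ γ < ϑ t₁, B.o α K N = .hat γ
  d_le : B.d K N ≤ 1
  h₀_le : B.Le (B.h₀ K N) t₁
  h₁_mem : B.h₁ α K N ∈ B.J α ϑ t₁ {0, B.rk a}
  star_mem : B.star (B.o α K N) ∈ B.J α ϑ t₁ {0, B.rk a}

section

variable {t s : Tm.{v}} {Γ : Finset Fml.{v}} {Δ : Set Fml.{v}} {a : ZFSet.{v}} {R R₀ : Code.{v}}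

theorem IsColl.l_eq (hK : B.IsColl α ϑ K) (h : B.Collapsible α K ϑ t R) :
    B.l α K (.coll t R) = B.l α K R := (hK.pos t R h).1

theorem IsColl.o_eq (hK : B.IsColl α ϑ K) (h : B.Collapsible α K ϑ t R) :
    B.o α K (.coll t R) = .hat (ϑ (B.add t (B.o α K R).exp)) := (hK.pos t R h).2.1

theorem IsColl.d_eq (hK : B.IsColl α ϑ K) (h : B.Collapsible α K ϑ t R) :
    B.d K (.coll t R) = 1 := (hK.pos t R h).2.2.1

theorem IsColl.h₀_eq (hK : B.IsColl α ϑ K) (h : B.Collapsible α K ϑ t R) :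
    B.h₀ K (.coll t R) = B.add t (B.o α K R).exp := (hK.pos t R h).2.2.2.1

theorem IsColl.h₁_eq (hK : B.IsColl α ϑ K) (h : B.Collapsible α K ϑ t R) :
    B.h₁ α K (.coll t R) = 0 := (hK.pos t R h).2.2.2.2.1

/-- A collapsible code `R` of smaller and controlled height yields the premise `C_t R`. -/
theorem CollCtx.prem_coll (h : B.CollCtx α ϑ t s) (hK : B.IsColl α ϑ K) (TR : B.Typed α K R)
    (hR : B.Collapsible α K ϑ t R) (hlt : B.Lt (B.o α K R) s)
    (hs : B.star (B.o α K R) ∈ B.J α ϑ t ∅) (hl : ∀ φ ∈ B.l α K R, φ ∈ Γ ∨ φ ∈ Δ) :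
    B.CollPrem α K ϑ (B.add t s.exp) Γ Δ a (.coll t R) := by
  obtain ⟨h1, h2⟩ := h.add_exp TR.o_mem hlt hs
  obtain ⟨h3, h4⟩ := h.theta (h.restrict TR.o_mem).new_mem h1 h2
  refine ⟨by rwa [hK.l_eq hR], ⟨_, h3, hK.o_eq hR⟩, (hK.d_eq hR).le, ?_, ?_, ?_⟩
  · rw [hK.h₀_eq hR]; exact h1.le
  · rw [hK.h₁_eq hR]; exact zero_mem_J
  · rw [hK.o_eq hR]
    exact h.bh.J_down (h.bh.theta_lt (h.restrict TR.o_mem).new_mem) (h4 _) (star_hat_le_self _)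

/-- A collapsible code `R` yields a premise in which the `Σ`-formula `φ` is bounded by the stage at
the height of `C_t R`. -/
theorem CollCtx.prem_bddEx (h : B.CollCtx α ϑ t s) (hK : B.IsColl α ϑ K) (TR : B.Typed α K R)
    (hR : B.Collapsible α K ϑ t R) (hlt : B.Lt (B.o α K R) s)
    (hs : B.star (B.o α K R) ∈ B.J α ϑ t ∅) {φ : Fml.{v}} (hk : B.kF φ ∈ B.J α ϑ t ∅)
    (hl : ∀ ψ ∈ B.l α K R, ψ ∈ Γ ∨ ψ = φ)
    (hφ : φ.rel (B.L (ϑ (B.add t (B.o α K R).exp))) ∈ Δ) :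
    B.CollPrem α K ϑ (B.add t s.exp) Γ Δ a
      (.bddEx φ (ϑ (B.add t (B.o α K R).exp)) (.coll t R)) := by
  obtain ⟨h1, h2⟩ := h.add_exp TR.o_mem hlt hs
  obtain ⟨h3, h4⟩ := h.theta (h.restrict TR.o_mem).new_mem h1 h2
  have hle : B.Le (B.o α K (.coll t R)) (.hat (ϑ (B.add t (B.o α K R).exp))) := by
    rw [hK.o_eq hR]; exact .refl _
  refine ⟨?_, ⟨_, h3, hK.o_eq hR⟩, (hK.d_eq hR).le, ?_, ?_, ?_⟩
  · intro ψ hψ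
    rw [l, if_pos hle, hK.l_eq hR, Finset.mem_union, Finset.mem_sdiff, Finset.mem_singleton,
      Finset.mem_singleton] at hψ
    rcases hψ with ⟨hψ, hne⟩ | rfl
    exacts [.inl ((hl ψ hψ).resolve_right hne), .inr hφ]
  · change B.Le (B.h₀ K (.coll t R)) _
    rw [hK.h₀_eq hR]; exact h1.le
  · rw [Base.h₁, if_pos hle, hK.h₁_eq hR]
    refine h.bh.J_down (max_lt (h.lt_opow hk) (h.bh.theta_lt (h.restrict TR.o_mem).new_mem))
      (max_mem_J (h.J_sub _ hk) (h4 _)) ?_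
    exact max_le _root_.zero_le ((B.kF_rel_le _ _).trans (max_le_max_left _ (B.rk_L_le _)))
  · change B.star (B.o α K (.coll t R)) ∈ _
    rw [hK.o_eq hR]
    exact h.bh.J_down (h.bh.theta_lt (h.restrict TR.o_mem).new_mem) (h4 _) (star_hat_le_self _)

/-- The premise of a bounded cut that is not used for the bound: it is collapsed with respect to the
larger term `t + Ω ^ u`, so that the bound `ϑ(t + Ω ^ u)` is controlled. -/
theorem CollCtx.prem_bddAll (h : B.CollCtx α ϑ t s) (hK : B.IsColl α ϑ K)
    (hT : ∀ P, B.IsCode α P → B.Typed α K P) {u : Tm.{v}} (hu : u ∈ B.Eps α) (hus : B.Lt u s)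
    (hu' : B.star u ∈ B.J α ϑ t ∅) (hR : B.IsCode α R) (hlt : B.Lt (B.o α K R) s)
    (hs : B.star (B.o α K R) ∈ B.J α ϑ t ∅) {x : ℕ} {θ : Fml.{v}}
    (hD : θ.IsD0) (hk : B.kF (.all x θ) ∈ B.J α ϑ t ∅) (hl : ∀ ψ ∈ B.l α K R, ψ ∈ Γ ∨ ψ = .all x θ)
    (hΓ : ∀ ψ ∈ Γ, ψ.IsSigma) (hd : B.d K R ≤ 2) (hh₀ : B.Le (B.h₀ K R) t)
    (hh₁ : B.h₁ α K R ∈ B.J α ϑ t ∅)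
    (hφ : (Fml.all x θ).rel (B.L (ϑ (B.add t u.exp))) ∈ Δ) :
    B.CollPrem α K ϑ (B.add t s.exp) Γ Δ a
      (.coll (B.add t u.exp) (.bddAll x θ (ϑ (B.add t u.exp)) R)) := by
  have hα := h.bh.pos
  have TR := hT _ hR
  have h' := h.restrict hu
  have hβ := h.bh.theta_lt h'.new_mem
  obtain ⟨h1, h2⟩ := h.add_exp hu hus hu'
  obtain ⟨h3, h4⟩ := h.theta h'.new_mem h1 h2
  have c' := h.step hu TR.o_mem hus hu'
  have x₀ := exp_mem hα hu
  have x₁ := exp_mem hα TR.o_mem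
  have hlS : ∀ ψ ∈ B.l α K (.bddAll x θ (ϑ (B.add t u.exp)) R), ψ ∈ Γ ∨
      ψ = (Fml.all x θ).rel (B.L (ϑ (B.add t u.exp))) := by
    intro ψ hψ
    rw [l, Finset.mem_union, Finset.mem_sdiff, Finset.mem_singleton, Finset.mem_singleton] at hψ
    rcases hψ with ⟨hψ, hne⟩ | rfl
    exacts [.inl ((hl ψ hψ).resolve_right hne), .inr rfl]
  have hS : B.Collapsible α K ϑ (B.add t u.exp) (.bddAll x θ (ϑ (B.add t u.exp)) R) := by
    refine ⟨fun ψ hψ => ?_, hd, hh₀.trans TR.h₀_mem h.t_mem h'.new_mem h'.lt_new.le, c'.t_mem_H, ?_⟩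
    · rcases hlS ψ hψ with h | rfl
      exacts [hΓ ψ h, (hD.rel_all _).isSigma]
    · refine max_mem_J (h'.J_sub ∅ hh₁) (h.bh.J_down (max_lt (h.lt_opow hk) hβ)
        (max_mem_J (h'.J_sub ∅ hk) (h.bh.theta_mem_J h'.new_mem h'.new_mem (.refl _)
          (h'.J_sub ∅ h2))) ((B.kF_rel_le _ _).trans (max_le_max_left _ (B.rk_L_le _))))
  have e1 : B.Lt (B.add (B.add t u.exp) (B.o α K R).exp) (B.add t s.exp) := by
    rw [add_assoc' hα h.t_mem x₀ x₁]
    exact add_lt_add' hα h.t_mem (add_mem hα x₀ x₁) (exp_mem hα h.s_mem)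
      (exp_add_exp_lt hα hu TR.o_mem h.s_mem hus hlt)
  have e2 : B.star (B.add (B.add t u.exp) (B.o α K R).exp) ∈ B.J α ϑ t ∅ :=
    h.J_le (max_mem_J h2 (h.J_le hs (star_exp_le TR.o_mem))) (star_add_le h'.new_mem x₁)
  obtain ⟨e3, e4⟩ := h.theta c'.new_mem e1 e2
  have ho : B.o α K (.coll (B.add t u.exp) (.bddAll x θ (ϑ (B.add t u.exp)) R)) =
      .hat (ϑ (B.add (B.add t u.exp) (B.o α K R).exp)) := hK.o_eq hS
  refine ⟨?_, ⟨_, e3, ho⟩, (hK.d_eq hS).le, ?_, ?_, ?_⟩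
  · intro ψ hψ
    rw [hK.l_eq hS] at hψ
    rcases hlS ψ hψ with h | rfl
    exacts [.inl h, .inr hφ]
  · rw [hK.h₀_eq hS]; exact e1.le
  · rw [hK.h₁_eq hS]; exact zero_mem_J
  · rw [ho]
    exact h.bh.J_down (h.bh.theta_lt c'.new_mem) (e4 _) (star_hat_le_self _)

end

/-- Local correctness of a collapsed code, reduced to its premises. Heights are ordinals below
`ϑ(t₁)`, which is closed under addition of `ω`. -/
theorem CollCtx.lc_coll {t : Tm.{v}} {P : Code.{v}} (h : B.CollCtx α ϑ t (B.o α K P))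
    (hK : B.IsColl α ϑ K) (hc : B.Collapsible α K ϑ t P)
    (hJ : B.J α ϑ (B.h₀ K P) {B.h₁ α K P} ⊆ B.J α ϑ t ∅) (hP : B.LC α K ϑ P) {q : Rule.{v}}
    (hr : B.r α K (.coll t P) = q) (hq : B.IsRule (Ordinal.omega0 ^ α) q)
    (hcode : ∀ a ∈ B.L (Ordinal.omega0 ^ α), B.IsCode α (B.n α K (.coll t P) a))
    (hax : q = .ax → ∃ φ ∈ B.l α K P, φ.TrueD0) (hprin : ∀ φ ∈ q.prin, φ ∈ B.l α K P)
    (hcut : ∀ φ, q = .cut φ → φ.IsD0) (href : ∀ z x a y θ, q ≠ .ref z x a y θ)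
    (hex : ∀ x b ψ, q = .ex x b ψ → B.rk b < ϑ (B.add t (B.o α K P).exp))
    (hk : B.kR q ∈ B.J α ϑ (B.add t (B.o α K P).exp) {0})
    (hn : ∀ a ∈ B.premises (Ordinal.omega0 ^ α) q, B.CollPrem α K ϑ (B.add t (B.o α K P).exp)
      (B.l α K P) (q.prem a) a (B.n α K (.coll t P) a)) : B.LC α K ϑ (.coll t P) := by
  have ht₁ := h.new_mem
  have hb : ∀ {γ : Ordinal.{v}}, γ < ϑ (B.add t (B.o α K P).exp) →
      γ + Ordinal.omega0 < ϑ (B.add t (B.o α K P).exp) := h.bh.add_omega_lt ht₁ h.Om_le_new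
  refine ⟨hr ▸ hq, hcode, ?_, ?_, ?_⟩
  · rw [hr, hK.l_eq hc, hK.o_eq hc]
    refine ⟨hax, hprin, fun a ha => (hn a ha).sub, ?_, ?_, ?_, ?_⟩
    · intro _ a ha
      obtain ⟨γ, hγ, e⟩ := (hn a ha).ord
      rw [e]
      simpa using hγ
    · intro _ a ha
      obtain ⟨γ, hγ, e⟩ := (hn a ha).ord
      rw [e, add_hat, hat_le_hat]
      exact (hb hγ).le
    · intro x b ψ e
      simpa using hex x b ψ e
    · exact fun z x a y θ e => absurd e (href z x a y θ)
  · refine ⟨?_, ?_⟩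
    · intro φ hφ
      rw [hK.d_eq hc, ht_of_isD0 (hcut φ (hr ▸ hφ))]
      exact Nat.one_pos
    · rw [hr]
      intro a ha
      rw [hK.d_eq hc]
      exact (hn a ha).d_le
  · refine ⟨?_, ?_, ?_, ?_, ?_, ?_⟩
    all_goals try rw [hr]
    all_goals rw [hK.h₀_eq hc]
    all_goals try rw [hK.h₁_eq hc]
    · rw [hK.o_eq hc]
      refine h.bh.J_down (h.bh.theta_lt ht₁) (h.bh.theta_mem_J ht₁ ht₁ (.refl _) ?_)
        (star_hat_le_self _)
      exact h.J_sub _ (h.J_le (max_mem_J h.star_t (h.J_le (hJ hP.condJ.star)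
        (star_exp_le h.s_mem))) (star_add_le h.t_mem (exp_mem h.bh.pos h.s_mem)))
    · rw [hK.l_eq hc]
      exact fun φ hφ => h.J_sub _ (hJ (hP.condJ.seq φ hφ))
    · exact hk
    · exact fun a ha => (hn a ha).h₀_le
    · exact fun a ha => (hn a ha).h₁_mem
    · exact fun a ha => (hn a ha).star_mem

end Base

end Collapsing

namespace Collapsing

universe v

open Fml

/-- A universally quantified closed `Σ`-formula is a universal quantifier bounded by a set. -/
theorem Fml.BddAll.exists_par {x : ℕ} {ψ : Fml.{v}} (h : Fml.BddAll x ψ)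
    (hv : (Fml.all x ψ).fv = ∅) :
    ∃ b χ, ψ = .or (.nmem (.var x) (.par b)) χ := by
  obtain ⟨s, χ, hs, rfl⟩ := h
  cases s with
  | par b => exact ⟨b, χ, rfl⟩
  | var y =>
    exfalso
    have : y ∈ (Fml.all x (.or (.nmem (.var x) (.var y)) χ)).fv := by
      simp only [Fml.fv, Trm.fv, Finset.mem_erase, Finset.mem_union, Finset.mem_singleton]
      exact ⟨fun e => hs (by rw [e]), by simp⟩
    rw [hv] at this
    exact absurd this (Finset.notMem_empty y)

namespace Base

variable {B : Base.{v}} {α : Ordinal.{v}} {ϑ : Tm.{v} → Ordinal.{v}} {K : CollVal.{v}}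

/-- Where the assumptions of the theorem fail, the code `C_t P` stands for the axiom `0 = 0`. -/
theorem lc_coll_of_not (hK : B.IsColl α ϑ K) {t : Tm.{v}} {P : Code.{v}}
    (hc : ¬ B.Collapsible α K ϑ t P) : B.LC α K ϑ (.coll t P) := by
  obtain ⟨h1, h2, h3, h4, h5, h6, h7⟩ := hK.neg t P hc
  have hr : B.r α K (.coll t P) = .ax := h6
  have hno : ∀ a, a ∉ B.premises (Ordinal.omega0 ^ α) (B.r α K (.coll t P)) := fun a => by
    rw [hr]
    exact Set.notMem_empty a
  have hl : B.l α K (.coll t P) = {triv} := h1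
  have ho : B.o α K (.coll t P) = .zero := h2
  have hF : B.IsF (Ordinal.omega0 ^ α) triv :=
    ⟨rfl, by simp [triv, Fml.pars, Trm.pars]⟩
  refine ⟨by rw [hr]; trivial, fun a _ => ?_, ?_, ⟨?_, fun a h => absurd h (hno a)⟩, ?_, ?_, ?_,
    fun a h => absurd h (hno a), fun a h => absurd h (hno a), fun a h => absurd h (hno a)⟩
  · rw [n, h7]
    exact ⟨hF, triv_trueD0⟩
  · rw [hr, hl]
    exact Step.mk_ax (Finset.mem_singleton_self _) triv_trueD0
  · rw [hr]
    nofun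
  · rw [ho, star_zero]
    exact zero_mem_J
  · rw [hl]
    intro φ hφ
    obtain rfl := Finset.mem_singleton.1 hφ
    rw [show B.kF triv = 0 by simp [triv, kF, kTrm]]
    exact zero_mem_J
  · rw [hr]
    exact zero_mem_J

open Classical in
/-- Collapsing preserves local correctness. Only the last rule of `P` matters: its premises are again
collapsible, once their indices are controlled by `H t`, and their new heights `ϑ(t + Ω ^ o')` lie
below `ϑ(t + Ω ^ o)`. The cases that change are reflections, whose premise is bounded by the stage
at the new height of that premise, and cuts over formulas of height one, where one premise is not a
sequent of `Σ`-formulas. -/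
theorem lc_coll (hϑ : B.IsBH α ϑ) (hT : ∀ P, B.IsCode α P → B.Typed α K P) (hK : B.IsColl α ϑ K)
    {t : Tm.{v}} {P : Code.{v}} (hcd : B.IsCode α (.coll t P)) (hP : B.LC α K ϑ P) :
    B.LC α K ϑ (.coll t P) := by
  by_cases hc : B.Collapsible α K ϑ t P
  swap
  · exact lc_coll_of_not hK hc
  obtain ⟨ht, hΩ, hcP⟩ := hcd
  have TP := hT _ hcP
  have h : B.CollCtx α ϑ t (B.o α K P) := ⟨hϑ, ht, TP.o_mem, hΩ, hc.t_mem⟩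
  have hJ : B.J α ϑ (B.h₀ K P) {B.h₁ α K P} ⊆ B.J α ϑ t ∅ :=
    hϑ.J_mono TP.h₀_mem ht (by simpa using TP.h₁_lt) hc.h₀_le
      (Set.singleton_subset_iff.2 hc.h₁_mem)
  have hpL := premises_mem_L hP.r_mem
  have hJ₂ : ∀ a ∈ B.premises (Ordinal.omega0 ^ α) (B.r α K P), B.rk a ∈ B.J α ϑ t ∅ →
      B.J α ϑ (B.h₀ K P) {B.h₁ α K P, B.rk a} ⊆ B.J α ϑ t ∅ := by
    intro a ha hka
    refine hϑ.J_mono TP.h₀_mem ht (TP.lt_of_mem (hpL a ha)) hc.h₀_le ?_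
    rintro γ (rfl | rfl)
    exacts [hc.h₁_mem, hka]
  have hTn := fun {a} ha => hT _ (hP.n_mem a (hpL a ha))
  have hstar := fun {a} ha hka => hJ₂ a ha hka (hP.condJ.star_mem a ha)
  -- a premise of `P` whose index is controlled by `H t` can be collapsed
  have hcoll : ∀ a ∈ B.premises (Ordinal.omega0 ^ α) (B.r α K P), B.rk a ∈ B.J α ϑ t ∅ →
      (∀ φ ∈ (B.r α K P).prem a, φ.IsSigma) → B.Collapsible α K ϑ t (B.n α K P a) := by
    intro a ha hka hS
    refine ⟨fun φ hφ => ?_, (hP.condC.c2 a ha).trans hc.d_le,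
      (hP.condJ.h₀_le a ha).trans (hTn ha).h₀_mem TP.h₀_mem ht hc.h₀_le, hc.t_mem,
      hJ₂ a ha hka (hP.condJ.h₁_mem a ha)⟩
    rcases hP.step.sub a ha φ hφ with h | h
    exacts [hc.sigma φ h, hS φ h]
  have hprem : ∀ a ∈ B.premises (Ordinal.omega0 ^ α) (B.r α K P), B.rk a ∈ B.J α ϑ t ∅ →
      (∀ φ ∈ (B.r α K P).prem a, φ.IsSigma) → B.CollPrem α K ϑ (B.add t (B.o α K P).exp)
        (B.l α K P) ((B.r α K P).prem a) a (.coll t (B.n α K P a)) := fun a ha hka hS =>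
    h.prem_coll hK (hTn ha) (hcoll a ha hka hS) (hP.o_lt hϑ hT TP ha) (hstar ha hka)
      (hP.step.sub a ha)
  have hcode : ∀ a ∈ B.L (Ordinal.omega0 ^ α), B.IsCode α (.coll t (B.n α K P a)) :=
    fun a ha => ⟨ht, hΩ, hP.n_mem a ha⟩
  have h0 : B.rk ∅ ∈ B.J α ϑ t ∅ := by rw [rk_empty]; exact zero_mem_J
  have h1 : B.rk {∅} ∈ B.J α ϑ t ∅ := by rw [rk_one]; exact zero_mem_J
  have hone : ({∅} : ZFSet.{v}) ≠ ∅ := Step.one_ne_empty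
  have hrule := hP.r_mem
  have hkr := hJ hP.condJ.rule
  have hr0 : B.r α K (.coll t P) = B.collRule ϑ (B.o α K) t (B.n α K P) (B.r α K P) :=
    (hK.pos t P hc).2.2.2.2.2.1
  have hn0 : B.n α K (.coll t P) = collNext ϑ B (B.o α K) t (B.n α K P) (B.r α K P) :=
    funext fun a => by rw [n, (hK.pos t P hc).2.2.2.2.2.2]
  -- the rules that are not changed
  have hsame : B.r α K (.coll t P) = B.r α K P →
      (∀ a ∈ B.L (Ordinal.omega0 ^ α), B.IsCode α (B.n α K (.coll t P) a)) →
      (∀ φ, B.r α K P = .cut φ → φ.IsD0) → (∀ z x a y θ, B.r α K P ≠ .ref z x a y θ) →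
      (∀ a ∈ B.premises (Ordinal.omega0 ^ α) (B.r α K P),
        B.CollPrem α K ϑ (B.add t (B.o α K P).exp) (B.l α K P) ((B.r α K P).prem a) a
          (B.n α K (.coll t P) a)) → B.LC α K ϑ (.coll t P) := fun a1 a2 a3 a4 a5 =>
    h.lc_coll hK hc hJ hP a1 hP.r_mem a2 hP.step.ax hP.step.prin a3 a4
      (fun x b ψ e => h.lt_theta (by rwa [e] at hkr)) (h.J_sub _ hkr) a5
  rcases hr : B.r α K P with
      _ | ⟨ψ₀, ψ₁⟩ | ⟨i, ψ₀, ψ₁⟩ | ⟨x, ψ⟩ | ⟨x, b, ψ⟩ | ψ | ⟨z, x, b, y, θ⟩ | b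
  · -- axiom
    have hn : ∀ a, B.n α K (.coll t P) a = .coll t (B.n α K P a) := fun a => by rw [hn0, hr]; rfl
    refine hsame (by rw [hr0, hr]; rfl) (fun a ha => hn a ▸ hcode a ha) (by rw [hr]; nofun)
      (by rw [hr]; nofun) fun a ha => ?_
    rw [hr] at ha
    exact absurd ha (Set.notMem_empty a)
  · -- conjunction
    have hn : ∀ a, B.n α K (.coll t P) a = .coll t (B.n α K P a) := fun a => by rw [hn0, hr]; rfl
    have hS := hc.sigma _ (hP.step.prin _ (by rw [hr]; rfl))
    refine hsame (by rw [hr0, hr]; rfl) (fun a ha => hn a ▸ hcode a ha) (by rw [hr]; nofun)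
      (by rw [hr]; nofun) fun a ha => ?_
    rw [hn]
    refine hprem a ha ?_ ?_
    · rw [hr] at ha
      rcases ha with rfl | rfl
      exacts [h0, h1]
    · rw [hr]
      rintro φ (⟨-, rfl⟩ | ⟨-, rfl⟩)
      exacts [hS.1, hS.2]
  · -- disjunction
    have hn : ∀ a, B.n α K (.coll t P) a = .coll t (B.n α K P a) := fun a => by rw [hn0, hr]; rfl
    have hS := hc.sigma _ (hP.step.prin _ (by rw [hr]; rfl))
    refine hsame (by rw [hr0, hr]; rfl) (fun a ha => hn a ▸ hcode a ha) (by rw [hr]; nofun)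
      (by rw [hr]; nofun) fun a ha => ?_
    rw [hn]
    refine hprem a ha ?_ ?_
    · rw [hr] at ha
      obtain rfl : a = ∅ := ha
      exact h0
    · rw [hr]
      rintro φ rfl
      cases i
      exacts [hS.1, hS.2]
  · -- bounded universal quantifier
    have hmem := hP.step.prin (.all x ψ) (by rw [hr]; rfl)
    have hS := hc.sigma _ hmem
    have hF := TP.l_mem _ hmem
    have hkψ := hJ (hP.condJ.seq _ hmem)
    obtain ⟨b, χ, rfl⟩ := hS.1.exists_par hF.1
    have hb : b ∈ B.L (Ordinal.omega0 ^ α) := hF.2 b (by simp [Fml.pars, Trm.pars])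
    have hkb : B.rk b ∈ B.J α ϑ t ∅ :=
      h.J_le hkψ (rk_le_kF (by simp [Fml.pars, Trm.pars]))
    -- elements of `b` have rank at most that of `b`, which is controlled by `H t`
    have hn : ∀ a ∈ b, B.n α K (.coll t P) a = .coll t (B.n α K P a) := fun a ha => by
      rw [hn0, hr]
      simp only [collNext, true_and, ha, not_true_eq_false, if_false]
    have hn' : ∀ a ∉ b, B.n α K (.coll t P) a =
        .disj false (.nmem (.par a) (.par b)) (χ.subst x a) (.axm (.nmem (.par a) (.par b))) :=
      fun a ha => by
      rw [hn0, hr]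
      simp only [collNext, true_and, ha, not_false_eq_true, if_true]
    have hFa : ∀ a ∈ B.L (Ordinal.omega0 ^ α), B.IsF (Ordinal.omega0 ^ α)
        (.or (.nmem (.par a) (.par b)) (χ.subst x a)) := fun a ha => by
      simpa only [Fml.subst, Trm.subst, if_true] using hF.all_subst ha
    refine hsame (by rw [hr0, hr]; rfl) (fun a ha => ?_) (by rw [hr]; nofun) (by rw [hr]; nofun)
      fun a ha => ?_
    · by_cases hab : a ∈ b
      · rw [hn a hab]
        exact hcode a ha
      · rw [hn' a hab]
        exact ⟨hFa a ha, IsF.nmem_par ha hb, trueD0_nmem hab⟩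
    · have haL := hpL a ha
      by_cases hab : a ∈ b
      · rw [hn a hab]
        refine hprem a ha (h.J_le hkb (rk_mem_le hb hab)) ?_
        rw [hr]
        rintro φ rfl
        exact hS.2.subst x a
      · rw [hn' a hab]
        have ho : B.o α K (.disj false (.nmem (.par a) (.par b)) (χ.subst x a)
            (.axm (.nmem (.par a) (.par b)))) = .one := zero_add' (one_mem_Eps hϑ.pos)
        have hka : B.rk a ∈ B.J α ϑ (B.add t (B.o α K P).exp) {0, B.rk a} :=
          base_mem_J (by simp)
        have hm := max_mem_J (h.J_sub {0, B.rk a} hkψ) hka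
        have hkF : B.kF (.or (.nmem (.par a) (.par b)) (χ.subst x a)) ≤
            max (B.kF (.all x (.or (.nmem (.var x) (.par b)) χ))) (B.rk a) := by
          have := B.kF_subst_le (.or (.nmem (.var x) (.par b)) χ) x a
          simp only [Fml.subst, Trm.subst, if_true] at this
          exact this
        refine ⟨fun φ hφ => ?_, ⟨1, hϑ.one_lt h.new_mem h.Om_le_new, ho⟩, Nat.zero_le 1,
          h.Om_le_new, ?_, ?_⟩
        · right
          simp only [l, pick, Finset.mem_union, Finset.mem_sdiff, Finset.mem_singleton] at hφ
          rw [hr]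
          simpa [Rule.prem, Fml.subst, Trm.subst] using hφ
        · exact hϑ.J_down (max_lt (h.lt_opow hkψ) (rk_lt (opow_pos' α) haL)) hm
            (max_le ((le_max_left _ _).trans hkF) hkF)
        · rw [ho, star_one]
          exact zero_mem_J
  · -- existential quantifier
    have hn : ∀ a, B.n α K (.coll t P) a = .coll t (B.n α K P a) := fun a => by rw [hn0, hr]; rfl
    have hS := hc.sigma _ (hP.step.prin _ (by rw [hr]; rfl))
    refine hsame (by rw [hr0, hr]; rfl) (fun a ha => hn a ▸ hcode a ha) (by rw [hr]; nofun)
      (by rw [hr]; nofun) fun a ha => ?_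
    rw [hn]
    refine hprem a ha ?_ ?_
    · rw [hr] at ha
      obtain rfl : a = ∅ := ha
      exact h0
    · rw [hr]
      rintro φ rfl
      exact IsSigma.subst (φ := ψ) hS x b
  · -- cut
    have m₀ : ∅ ∈ B.premises (Ordinal.omega0 ^ α) (B.r α K P) := by rw [hr]; exact .inl rfl
    have m₁ : {∅} ∈ B.premises (Ordinal.omega0 ^ α) (B.r α K P) := by rw [hr]; exact .inr rfl
    have c₀ := hP.n_mem _ (hpL _ m₀)
    have c₁ := hP.n_mem _ (hpL _ m₁)
    have l₀ := hP.o_lt hϑ hT TP m₀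
    have l₁ := hP.o_lt hϑ hT TP m₁
    have g₀ : ∀ φ ∈ B.l α K (B.n α K P ∅), φ ∈ B.l α K P ∨ φ = ψ := fun φ hφ => by
      have := hP.step.sub _ m₀ φ hφ
      rw [hr] at this
      simpa [Rule.prem] using this
    have g₁ : ∀ φ ∈ B.l α K (B.n α K P {∅}), φ ∈ B.l α K P ∨ φ = ψ.neg := fun φ hφ => by
      have := hP.step.sub _ m₁ φ hφ
      rw [hr] at this
      simpa [Rule.prem, hone] using this
    have d₀ := (hP.condC.c2 _ m₀).trans hc.d_le
    have d₁ := (hP.condC.c2 _ m₁).trans hc.d_le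
    have e₀ := (hP.condJ.h₀_le _ m₀).trans (hTn m₀).h₀_mem TP.h₀_mem ht hc.h₀_le
    have e₁ := (hP.condJ.h₀_le _ m₁).trans (hTn m₁).h₀_mem TP.h₀_mem ht hc.h₀_le
    have f₀ := hJ₂ _ m₀ h0 (hP.condJ.h₁_mem _ m₀)
    have f₁ := hJ₂ _ m₁ h1 (hP.condJ.h₁_mem _ m₁)
    rw [hr] at hrule hkr
    have hF : B.IsF (Ordinal.omega0 ^ α) ψ := hrule
    have hkψ : B.kF ψ ∈ B.J α ϑ t ∅ := hkr
    have hβ := fun {a} ha => hϑ.theta_lt (h.restrict (hTn (a := a) ha).o_mem).new_mem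
    have hkrel : ∀ {a}, (ha : a ∈ B.premises (Ordinal.omega0 ^ α) (B.r α K P)) →
        B.rk a ∈ B.J α ϑ t ∅ → B.kF (ψ.rel (B.L (ϑ (B.add t (B.o α K (B.n α K P a)).exp)))) ∈
          B.J α ϑ (B.add t (B.o α K P).exp) {0} := by
      intro a ha hka
      obtain ⟨s1, s2⟩ := h.add_exp (hTn ha).o_mem (hP.o_lt hϑ hT TP ha) (hstar ha hka)
      obtain ⟨-, s4⟩ := h.theta (h.restrict (hTn ha).o_mem).new_mem s1 s2
      exact hϑ.J_down (max_lt (h.lt_opow hkψ) (hβ ha)) (max_mem_J (h.J_sub _ hkψ) (s4 _))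
        ((B.kF_rel_le _ _).trans (max_le_max_left _ (B.rk_L_le _)))
    have hht : ψ.ht ≤ 1 := Nat.le_of_lt_succ ((hP.condC.c1 ψ hr).trans_le hc.d_le)
    -- a cut over a bounded formula remains; otherwise the premise with the existential quantifier is
    -- collapsed first and determines the bound
    rcases ht_le_one hht with hD | ⟨x, θ, hD, ⟨rfl, hnb⟩ | ⟨rfl, hnb⟩⟩
    · have hD' : ψ.neg.IsD0 := (isD0_neg ψ).2 hD
      have hrn : B.r α K (.coll t P) = B.r α K P ∧
          ∀ a, B.n α K (.coll t P) a = .coll t (B.n α K P a) := by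
        rw [hr0, hn0, hr]
        cases ψ with
        | ex x θ => simp [collRule, collNext, hD.1]
        | all x θ => simp [collRule, collNext, hD.1]
        | _ => exact ⟨rfl, fun a => rfl⟩
      refine hsame hrn.1 (fun a ha => hrn.2 a ▸ hcode a ha) ?_ (by rw [hr]; nofun) fun a ha => ?_
      · rw [hr]
        intro φ e
        obtain rfl : ψ = φ := by injection e
        exact hD
      · rw [hrn.2]
        refine hprem a ha ?_ ?_
        · rw [hr] at ha
          rcases ha with rfl | rfl
          exacts [h0, h1]
        · rw [hr]
          rintro φ (⟨-, rfl⟩ | ⟨-, rfl⟩)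
          exacts [hD.isSigma, hD'.isSigma]
    · -- the second premise is used for the bound
      have hDn : θ.neg.IsD0 := (isD0_neg θ).2 hD
      have hS₁ : B.Collapsible α K ϑ t (B.n α K P {∅}) := by
        refine hcoll _ m₁ h1 ?_
        rw [hr]
        rintro φ (⟨h, -⟩ | ⟨-, rfl⟩)
        exacts [absurd h hone, hDn.isSigma]
      have hrQ : B.r α K (.coll t P) = .cut ((Fml.all x θ).rel
          (B.L (ϑ (B.add t (B.o α K (B.n α K P {∅})).exp)))) := by
        rw [hr0, hr]
        simp only [collRule, hD, hnb, not_false_eq_true, and_self, if_true]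
      have hn₀ : B.n α K (.coll t P) ∅ = .coll (B.add t (B.o α K (B.n α K P {∅})).exp)
          (.bddAll x θ (ϑ (B.add t (B.o α K (B.n α K P {∅})).exp)) (B.n α K P ∅)) := by
        rw [hn0, hr]
        simp only [collNext, hD, hnb, not_false_eq_true, and_self, if_true]
      have hn₁ : ∀ a ≠ ∅, B.n α K (.coll t P) a = .bddEx (.ex x θ.neg)
          (ϑ (B.add t (B.o α K (B.n α K P {∅})).exp)) (.coll t (B.n α K P {∅})) := fun a ha => by
        rw [hn0, hr]
        simp only [collNext, hD, hnb, not_false_eq_true, and_self, if_true, ha, if_false]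
      refine h.lc_coll hK hc hJ hP hrQ (hF.rel (B.L_mem_L (hβ m₁))) ?_ nofun nofun ?_ nofun nofun
        (hkrel m₁ h1) ?_
      · intro a _
        by_cases ha : a = ∅
        · have hctx := h.restrict (hTn m₁).o_mem
          rw [ha, hn₀]
          exact ⟨hctx.new_mem, hctx.Om_le_new, hF, hD, hnb, hβ m₁, c₀⟩
        · rw [hn₁ a ha]
          exact ⟨hF.neg, hDn.isSigma, hβ m₁, ht, hΩ, c₁⟩
      · rintro φ e
        injection e with e
        exact e ▸ hD.rel_all _
      · rintro a (rfl | rfl)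
        · rw [hn₀]
          exact h.prem_bddAll hK hT (hTn m₁).o_mem l₁ (hstar m₁ h1) c₀ l₀ (hstar m₀ h0) hD hkψ g₀
            hc.sigma d₀ e₀ f₀ (.inl ⟨rfl, rfl⟩)
        · rw [hn₁ _ hone]
          refine h.prem_bddEx hK (hTn m₁) hS₁ l₁ (hstar m₁ h1) ?_ g₁ (.inr ⟨hone, ?_⟩)
          · rw [← kF_neg] at hkψ
            exact hkψ
          · rw [neg_rel]
            rfl
    · -- the first premise is used for the bound
      have hDn : θ.neg.IsD0 := (isD0_neg θ).2 hD
      have hnb' : ¬ Fml.BddAll x θ.neg := fun h => hnb (by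
        rw [← bddEx_neg, neg_neg] at h
        exact h)
      have hS₀ : B.Collapsible α K ϑ t (B.n α K P ∅) := by
        refine hcoll _ m₀ h0 ?_
        rw [hr]
        rintro φ (⟨-, rfl⟩ | ⟨h, -⟩)
        exacts [hD.isSigma, absurd rfl h]
      have hrQ : B.r α K (.coll t P) = .cut ((Fml.ex x θ).rel
          (B.L (ϑ (B.add t (B.o α K (B.n α K P ∅)).exp)))) := by
        rw [hr0, hr]
        simp only [collRule, hD, hnb, not_false_eq_true, and_self, if_true]
      have hn₀ : B.n α K (.coll t P) ∅ = .bddEx (.ex x θ)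
          (ϑ (B.add t (B.o α K (B.n α K P ∅)).exp)) (.coll t (B.n α K P ∅)) := by
        rw [hn0, hr]
        simp only [collNext, hD, hnb, not_false_eq_true, and_self, if_true]
      have hn₁ : ∀ a ≠ ∅, B.n α K (.coll t P) a = .coll (B.add t (B.o α K (B.n α K P ∅)).exp)
          (.bddAll x θ.neg (ϑ (B.add t (B.o α K (B.n α K P ∅)).exp)) (B.n α K P {∅})) :=
        fun a ha => by
        rw [hn0, hr]
        simp only [collNext, hD, hnb, not_false_eq_true, and_self, if_true, ha, if_false]
      refine h.lc_coll hK hc hJ hP hrQ (hF.rel (B.L_mem_L (hβ m₀))) ?_ nofun nofun ?_ nofun nofun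
        (hkrel m₀ h0) ?_
      · intro a _
        by_cases ha : a = ∅
        · rw [ha, hn₀]
          exact ⟨hF, hD.isSigma, hβ m₀, ht, hΩ, c₀⟩
        · have hctx := h.restrict (hTn m₀).o_mem
          rw [hn₁ a ha]
          exact ⟨hctx.new_mem, hctx.Om_le_new, hF.neg, hDn, hnb', hβ m₀, c₁⟩
      · rintro φ e
        injection e with e
        exact e ▸ hD.rel_ex _
      · rintro a (rfl | rfl)
        · rw [hn₀]
          exact h.prem_bddEx hK (hTn m₀) hS₀ l₀ (hstar m₀ h0) hkψ g₀ (.inl ⟨rfl, rfl⟩)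
        · rw [hn₁ _ hone]
          refine h.prem_bddAll hK hT (hTn m₀).o_mem l₀ (hstar m₀ h0) c₁ l₁ (hstar m₁ h1) hDn ?_ g₁
            hc.sigma d₁ e₁ f₁ (.inr ⟨hone, ?_⟩)
          · rw [← kF_neg] at hkψ
            exact hkψ
          · rw [neg_rel]
            rfl
  · -- reflection becomes an existential quantifier
    have m₀ : ∅ ∈ B.premises (Ordinal.omega0 ^ α) (B.r α K P) := by rw [hr]; rfl
    have hmem := hP.step.prin (refConcl z x b y θ) (by rw [hr]; rfl)
    have hk₀ := hJ (hP.condJ.seq _ hmem)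
    rw [hr] at hrule
    obtain ⟨hF, hD, hO, hzx, hzy, hxy, hz⟩ := hrule
    have hk₁ : B.kF (refPrem x b y θ) ∈ B.J α ϑ t ∅ := by
      simpa [refPrem, refConcl, Fml.ball, Fml.bex, kF, kTrm] using hk₀
    have hFp : B.IsF (Ordinal.omega0 ^ α) (refPrem x b y θ) := by
      refine ⟨Finset.eq_empty_iff_forall_notMem.2 fun w hw => ?_, fun a ha => hF.2 a ?_⟩
      · have hw' := Finset.eq_empty_iff_forall_notMem.1 hF.1 w
        have hwz : w ∈ θ.fv → w ≠ z := fun h e => hz (e ▸ h)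
        simp only [refPrem, refConcl, Fml.ball, Fml.bex, Fml.fv, Trm.fv, Finset.mem_erase,
          Finset.mem_union, Finset.mem_singleton, Finset.notMem_empty] at hw hw'
        tauto
      · simpa [refPrem, refConcl, Fml.ball, Fml.bex, Fml.pars, Trm.pars] using ha
    have hβ := hϑ.theta_lt (h.restrict (hTn m₀).o_mem).new_mem
    have hS : B.Collapsible α K ϑ t (B.n α K P ∅) := by
      refine hcoll _ m₀ h0 ?_
      rw [hr]
      rintro φ rfl
      exact isSigma_refPrem hD
    have l₀ := hP.o_lt hϑ hT TP m₀
    obtain ⟨s1, s2⟩ := h.add_exp (hTn m₀).o_mem l₀ (hstar m₀ h0)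
    obtain ⟨s3, s4⟩ := h.theta (h.restrict (hTn m₀).o_mem).new_mem s1 s2
    have hn : ∀ a, B.n α K (.coll t P) a = .bddEx (refPrem x b y θ)
        (ϑ (B.add t (B.o α K (B.n α K P ∅)).exp)) (.coll t (B.n α K P ∅)) := fun a => by
      rw [hn0, hr]
      rfl
    have hrQ : B.r α K (.coll t P) =
        .ex z (B.L (ϑ (B.add t (B.o α K (B.n α K P ∅)).exp)))
          (.ball x (.par b) (.bex y (.var z) θ)) := by
      rw [hr0, hr]
      rfl
    refine h.lc_coll hK hc hJ hP hrQ ⟨hF, B.L_mem_L hβ⟩ ?_ nofun ?_ nofun nofun ?_ ?_ ?_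
    · intro a _
      rw [hn]
      exact ⟨hFp, isSigma_refPrem hD, hβ, ht, hΩ, hP.n_mem _ (hpL _ m₀)⟩
    · rintro φ rfl
      exact hmem
    · intro x' b' ψ' e
      injection e with e1 e2 e3
      rw [← e2]
      exact (B.rk_L_le _).trans_lt s3
    · exact hϑ.J_down hβ (s4 _) (B.rk_L_le _)
    · rintro a rfl
      rw [hn]
      refine h.prem_bddEx hK (hTn m₀) hS l₀ (hstar m₀ h0) hk₁ ?_ ?_
      · have := hP.step.sub _ m₀
        rwa [hr] at this
      · exact refPrem_rel hD hO hzx hzy hz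
  · -- repetition
    have hn : ∀ a, B.n α K (.coll t P) a = .coll t (B.n α K P a) := fun a => by rw [hn0, hr]; rfl
    refine hsame (by rw [hr0, hr]; rfl) (fun a ha => hn a ▸ hcode a ha) (by rw [hr]; nofun)
      (by rw [hr]; nofun) fun a ha => ?_
    rw [hn]
    refine hprem a ha ?_ ?_
    · rw [hr] at ha hkr
      obtain rfl : a = b := ha
      exact hkr
    · rw [hr]
      nofun

/-- All codes are locally correct, by induction on their build-up. -/
theorem lc (hϑ : B.IsBH α ϑ) (hT : ∀ P, B.IsCode α P → B.Typed α K P) (hK : B.IsColl α ϑ K) :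
    ∀ P, B.IsCode α P → B.LC α K ϑ P := by
  intro P
  induction P with
  | basic σ => exact lc_basic hϑ
  | invAll x ψ b P ih => exact fun h => lc_invAll hϑ hT h (ih h.2.2)
  | invAnd ψ₀ ψ₁ i P ih => exact fun h => lc_invAnd hϑ hT h (ih h.2)
  | redEx x ψ P₀ P₁ ih₀ ih₁ => exact fun h => lc_redEx hϑ hT h (ih₀ h.2.2.1) (ih₁ h.2.2.2)
  | redOr ψ₀ ψ₁ P₀ P₁ ih₀ ih₁ => exact fun h => lc_redOr hϑ hT h (ih₀ h.2.2.1) (ih₁ h.2.2.2)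
  | cutElim P ih => exact fun h => lc_cutElim hϑ hT h (ih h)
  | axm θ => exact fun h => lc_axm hϑ hT h
  | conj ψ₀ ψ₁ P₀ P₁ ih₀ ih₁ => exact fun h => lc_conj hϑ hT h (ih₀ h.2.1) (ih₁ h.2.2)
  | disj i ψ₀ ψ₁ P ih => exact fun h => lc_disj hϑ hT h (ih h.2)
  | bddEx φ β P ih => exact fun h => lc_bddEx hϑ hT h (ih h.2.2.2)
  | bddAll x θ β P ih => exact fun h => lc_bddAll hϑ hT h (ih h.2.2.2.2)
  | coll t P ih => exact fun h => lc_coll hϑ hT hK h (ih h.2.2)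

end Base

end Collapsing

theorem mainTheorem4 (B : Collapsing.Base) (α : Ordinal) (ϑ : Collapsing.Tm → Ordinal)
    (hϑ : B.IsBH α ϑ) :
    ∃ K : Collapsing.CollVal, B.LocallyCorrect α K ϑ ∧
      ∀ t P, t ∈ B.Eps α → B.Le .Om t → B.IsCode α P →
        (∀ φ ∈ B.l α K P, φ.IsSigma) → B.d K P ≤ 2 →
        B.Le (B.h₀ K P) t → t ∈ B.H α ϑ t ∅ → .hat (B.h₁ α K P) ∈ B.H α ϑ t ∅ →
        B.l α K (.coll t P) = B.l α K P ∧
        B.o α K (.coll t P) = .hat (ϑ (B.add t (B.o α K P).exp)) ∧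
        B.Lt (B.o α K (.coll t P)) .Om ∧
        B.d K (.coll t P) = 1 ∧
        B.h₀ K (.coll t P) = B.add t (B.o α K P).exp ∧
        B.h₁ α K (.coll t P) = 0 := by
  obtain ⟨K, hK⟩ := Collapsing.Base.exists_isColl B α ϑ
  have hT := Collapsing.Base.typed hϑ hK
  refine ⟨K, Collapsing.Base.locallyCorrect_of_LC hT (Collapsing.Base.lc hϑ hT hK),
    fun t P ht hΩ hP h1 h2 h3 h4 h5 => ?_⟩
  have hc : B.Collapsible α K ϑ t P := ⟨h1, h2, h3, h4, h5⟩
  refine ⟨hK.l_eq hc, hK.o_eq hc, ?_, hK.d_eq hc, hK.h₀_eq hc, hK.h₁_eq hc⟩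
  rw [hK.o_eq hc]
  exact Collapsing.Base.hat_lt_Om _
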